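/- **Setting.** Write $\langle\xi\rangle=(1+|\xi|^2)^{1/2}$, $\hat f(\xi)=\int_{\mathbb R^3} e^{-ix\cdot\xi}f(x)\,dx$, and let $e^{it\langle D\rangle}$ be the Fourier multiplier with symbol $e^{it\langle\xi\rangle}$. Fix an even $\rho\in C_c^\infty(-2,2)$ with $0\le\rho\le1$ and $\rho=1$ on $[-1,1]$, and put $\chi_k(y)=\rho(2^{-k}|y|)-\rho(2^{-k+1}|y|)$, $\tilde\chi_k=\chi_{k-1}+\chi_k+\chi_{k+1}$, $\chi_{\le m}(y)=\rho(2^{-m}|y|)$. For $l\in\mathbb N=\{0,1,2,\dots\}$ let $\mathcal K_l$ be a symmetric collection of spherical caps of (angular) diameter $2^{-l}$ covering $\mathbb S^2$ with overlap bounded uniformly in $l$; let $\omega(\kappa)$ be the center of $\kappa$, $\Gamma_\kappa$ the cone over $\kappa$, and $a\Gamma_\kappa$ the concentric cone of $a$ times the opening angle. Let $(\eta_\kappa)_{\kappa\in\mathcal K_l}$ be a partition of unity on $\mathbb R^3\setminus\{0\}$ by nonnegative smooth functions, homogeneous of degree $0$, with $\operatorname{supp}\eta_\kappa\subset 2\Gamma_\kappa$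 and, uniformly in $l,\kappa$, $$|\partial^\beta\eta_\kappa(\xi)|\le C_\beta 2^{l|\beta|}|\xi|^{-|\beta|},\qquad |(\omega(\kappa)\cdot\nabla)^N\eta_\kappa(\xi)|\le C_N|\xi|^{-N}.$$ Let $\tilde\eta_\kappa\ge0$ be smooth, homogeneous of degree $0$, satisfy the same kind of bounds, be supported in $4\Gamma_\kappa$, and satisfy $\tilde\eta_\kappa\eta_\kappa=\eta_\kappa$. Set $$A_{k,\kappa}=\operatorname{supp}(\eta_\kappa\chi_k),\quad \tilde A_{k,\kappa}=\operatorname{supp}(\tilde\eta_\kappa\tilde\chi_k),\quad B_{k,\kappa}=\operatorname{supp}\bigl(\chi_{\le k-2l-c}(\tau-\langle\xi\rangle)\,\eta_\kappa(\xi)\chi_k(\xi)\bigr)\subset\mathbb R\times\mathbb R^3,$$ where $c$ is a fixed integer. For $\lambda\in\mathbb R$, $\omega\in\mathbb S^2$ let $\Theta_{\lambda,\omega}=\frac{1}{\sqrt{1+\lambda^2}}(\lambda,\omega)$, $\Theta^\perp_{\lambda,\omega}=\frac{1}{\sqrt{1+\lambda^2}}(-1,\lambda\omega)$, and complete them by $(0,\omega_2),(0,\omega_3)$,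 with $(\omega,\omega_2,\omega_3)$ orthonormal, to an orthonormal basis of $\mathbb R^4$. Let $t_{\lambda,\omega}=(t,x)\cdot\Theta_{\lambda,\omega}$ and let $x_{\lambda,\omega}\in\mathbb R^3$ be the other three coordinates. The norms $L^p_{t_{\lambda,\omega}}L^2_{x_{\lambda,\omega}}$ are taken in these coordinates. **Theorem.** For $\rho$ and the caps and cutoffs fixed as above there is $c_0$ such that for every integer $c\ge c_0$ there is a constant $C$, depending only on these choices, for which the following holds. Let $k,j\ge100$ and $0\le l\le\min(j,k)-10$ be integers, $\kappa\in\mathcal K_l$, $\lambda=\lambda(j)=(1+2^{-2j})^{-1/2}$, $\omega\in\mathbb S^2$, and suppose that $\alpha=\operatorname{dist}(\omega,\kappa)$ satisfies $2^{-3-l}\le\alpha\le2^{3-l}$ and that $|\xi-\omega|\ge\alpha/2$ for all $\xi\in\mathbb S^2\cap\operatorname{supp}\eta_\kappa$ (the last condition is automatic if $\alpha\ge2^{-l}$). i) If $f\in L^2(\mathbb R^3)$ and $\hat f$ is supported in $A_{k,\kappa}$, then $$\alpha\,\|e^{it\langle D\rangle}f\|_{L^\infty_{t_{\lambda,\omega}}L^2_{x_{\lambda,\omega}}}\le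 C\|f\|_{L^2}.$$ ii) Let $g\in L^1_{t_{\lambda,\omega}}L^2_{x_{\lambda,\omega}}$ have space-time Fourier transform supported in $B_{k,\kappa}$. Then the problem $(i\partial_t+\langle D\rangle)u=g$, $u(0)=0$, has a solution $u\in C(\mathbb R;L^2(\mathbb R^3))$, and the solution satisfies $$\alpha\,\|u\|_{L^\infty_{t_{\lambda,\omega}}L^2_{x_{\lambda,\omega}}}\le C\alpha^{-1}\|g\|_{L^1_{t_{\lambda,\omega}}L^2_{x_{\lambda,\omega}}}.$$ iii) Under the hypotheses of ii) there are $\tilde v_0\in L^2(\mathbb R^3)$ and $(v_s)_{s\in\mathbb R}\in L^1(\mathbb R;L^2(\mathbb R^3))$, with $\hat{\tilde v}_0$ and all $\hat v_s$ supported in $\tilde A_{k,\kappa}$, such that $$u(t)=e^{it\langle D\rangle}\tilde v_0+\int_{-\infty}^\infty \bigl(e^{it\langle D\rangle}v_s\bigr)\,\mathbf 1_{\{t_{\lambda,\omega}>s\}}\,ds,\qquad \|\tilde v_0\|_{L^2}+\int_{-\infty}^\infty\|v_s\|_{L^2}\,ds\le C\alpha^{-1}\|g\|_{L^1_{t_{\lambda,\omega}}L^2_{x_{\lambda,\omega}}},$$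 where the first identity holds almost everywhere in $\mathbb R\times\mathbb R^3$, with an absolutely convergent integral. -/

import Mathlib

noncomputable section

namespace TiltedFrames

open MeasureTheory Set
open scoped FourierTransform ENNReal RealInnerProductSpace

/-- Physical space `ℝ³`; space-time is `ℝ × E3`, with points `(t, x)`. -/
abbrev E3 : Type := EuclideanSpace ℝ (Fin 3)

/-- The space `L²(ℝ³; ℂ)`. -/
abbrev L2 : Type := Lp (α := E3) ℂ 2 volume

/-- The Japanese bracket `⟨ξ⟩ = (1 + |ξ|²)^{1/2}`. -/
def jap (ξ : E3) : ℝ := √(1 + ‖ξ‖ ^ 2)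

/-- The Fourier transform of `f ∈ L²(ℝ³)` in the convention `∫ e^{-i x·ξ} f(x) dx`
(Mathlib's transform uses `e^{-2πi x·ζ}`, so `ξ = 2πζ`). -/
def hat (f : L2) (ξ : E3) : ℂ := (𝓕 f : L2) ((2 * Real.pi)⁻¹ • ξ)

/-- `f̂` is supported in the closed set `A` (almost everywhere sense). -/
def FreqSupportedIn (f : L2) (A : Set E3) : Prop := ∀ᵐ ξ : E3, ξ ∉ A → hat f ξ = 0

/-- The free wave `(t, x) ↦ (e^{it⟨D⟩} f)(x) = (2π)⁻³ ∫ e^{i(x·ξ + t⟨ξ⟩)} f̂(ξ) dξ`.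
It is only used for `f ∈ L²` with compactly supported `f̂`, for which the integral converges
absolutely. -/
def freeWave (f : L2) (z : ℝ × E3) : ℂ :=
  (((2 * Real.pi) ^ 3 : ℝ) : ℂ)⁻¹ *
    ∫ ξ : E3, Complex.exp (Complex.I * ((⟪z.2, ξ⟫ + z.1 * jap ξ : ℝ) : ℂ)) * hat f ξ

/-! ### Tilted frames -/

/-- The slope `λ(j) = (1 + 2^{-2j})^{-1/2}`. -/
def lam (j : ℤ) : ℝ := 1 / √(1 + (2 : ℝ) ^ (-2 * j))

/-- The direction `Θ_{λ,ω} = (1 + λ²)^{-1/2} (λ, ω)`. -/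
def Theta (lm : ℝ) (ω : E3) : ℝ × E3 := (1 / √(1 + lm ^ 2)) • ((lm, ω) : ℝ × E3)

/-- The orthogonal direction `Θ^⊥_{λ,ω} = (1 + λ²)^{-1/2} (-1, λω)`. -/
def ThetaPerp (lm : ℝ) (ω : E3) : ℝ × E3 := (1 / √(1 + lm ^ 2)) • ((-1, lm • ω) : ℝ × E3)

/-- The time coordinate `t_{λ,ω} = (t, x) · Θ_{λ,ω}`. -/
def tTheta (lm : ℝ) (ω : E3) (z : ℝ × E3) : ℝ :=
  z.1 * (Theta lm ω).1 + ⟪z.2, (Theta lm ω).2⟫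

/-- The point of space-time with frame coordinates `t_{λ,ω} = s`, `x_{λ,ω} = y`. The orthonormal
basis `b = (ω, ω₂, ω₃)` of `ℝ³` gives `ω` and the two remaining spatial directions. -/
def framePoint (lm : ℝ) (b : OrthonormalBasis (Fin 3) ℝ E3) (s : ℝ) (y : E3) : ℝ × E3 :=
  s • Theta lm (b 0) + y 0 • ThetaPerp lm (b 0) + y 1 • ((0, b 1) : ℝ × E3)
    + y 2 • ((0, b 2) : ℝ × E3)

/-- The `L²_{x_{λ,ω}}` norm of `u` on the hyperplane `t_{λ,ω} = s`. -/
def sliceNorm (lm : ℝ) (b : OrthonormalBasis (Fin 3) ℝ E3) (u : ℝ × E3 → ℂ) (s : ℝ) : ℝ≥0∞ :=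
  eLpNorm (fun y : E3 => u (framePoint lm b s y)) 2 volume

/-- The norm of `L^∞_{t_{λ,ω}} L²_{x_{λ,ω}}`. -/
def normLinfL2 (lm : ℝ) (b : OrthonormalBasis (Fin 3) ℝ E3) (u : ℝ × E3 → ℂ) : ℝ≥0∞ :=
  essSup (sliceNorm lm b u) volume

/-- The norm of `L¹_{t_{λ,ω}} L²_{x_{λ,ω}}`. -/
def normL1L2 (lm : ℝ) (b : OrthonormalBasis (Fin 3) ℝ E3) (u : ℝ × E3 → ℂ) : ℝ≥0∞ :=
  ∫⁻ s, sliceNorm lm b u s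

open scoped ContDiff

/-! ### Space-time Fourier support and the inhomogeneous equation -/

/-- The space-time Fourier transform `∫∫ e^{-i(tτ + x·ξ)} φ(τ, ξ) dτ dξ` of a test function. -/
def hatST (φ : ℝ × E3 → ℂ) (z : ℝ × E3) : ℂ :=
  ∫ ζ : ℝ × E3, Complex.exp (-Complex.I * ((z.1 * ζ.1 + ⟪z.2, ζ.2⟫ : ℝ) : ℂ)) * φ ζ

/-- The distribution `ĝ`, given by `⟨ĝ, φ⟩ = ⟨g, φ̂⟩`, is supported in the closed set `B`. -/
def STFreqSupportedIn (g : ℝ × E3 → ℂ) (B : Set (ℝ × E3)) : Prop :=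
  ∀ φ : ℝ × E3 → ℂ, ContDiff ℝ ∞ φ → HasCompactSupport φ → Disjoint (tsupport φ) B →
    ∫ z : ℝ × E3, g z * hatST φ z = 0

/-- `u` is a solution of `(i∂_t + ⟨D⟩) u = g`, `u(0) = 0`: the function `u` on space-time is
represented by a curve `U ∈ C(ℝ; L²(ℝ³))` with `U 0 = 0`, the forcing is represented by a
`G ∈ L¹_loc(ℝ; L²(ℝ³))`, and the equation holds after integration over `[0, t]`, for every `t`, i.e.
`i U(t) + ⟨D⟩ ∫₀ᵗ U(s) ds = ∫₀ᵗ G(s) ds` (read on the spatial Fourier side). -/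
def IsSolution (g u : ℝ × E3 → ℂ) : Prop :=
  AEStronglyMeasurable u volume ∧
  ∃ U G : ℝ → L2,
    Continuous U ∧ U 0 = 0 ∧
    (∀ᵐ t : ℝ, ∀ᵐ x : E3, U t x = u (t, x)) ∧
    (∀ᵐ t : ℝ, ∀ᵐ x : E3, G t x = g (t, x)) ∧
    (∀ a b : ℝ, IntervalIntegrable G volume a b) ∧
    ∀ t : ℝ, ∀ᵐ ξ : E3,
      Complex.I * hat (U t) ξ + (jap ξ : ℂ) * hat (∫ s in (0 : ℝ)..t, U s) ξ
        = hat (∫ s in (0 : ℝ)..t, G s) ξ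

/-! ### Frequency localization -/

/-- The fixed cutoff: `ρ ∈ C_c^∞(-2, 2)` even, `0 ≤ ρ ≤ 1`, `ρ = 1` on `[-1, 1]`. -/
structure IsCutoff (ρ : ℝ → ℝ) : Prop where
  smooth : ContDiff ℝ ∞ ρ
  support : tsupport ρ ⊆ Ioo (-2) 2
  even : ∀ s, ρ (-s) = ρ s
  one : ∀ s, |s| ≤ 1 → ρ s = 1
  nonneg : ∀ s, 0 ≤ ρ s
  le_one : ∀ s, ρ s ≤ 1

/-- `χ_k` as a function of `r = |y|`: `ρ(2^{-k} r) - ρ(2^{-k+1} r)`. -/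
def chi (ρ : ℝ → ℝ) (k : ℤ) (r : ℝ) : ℝ := ρ ((2 : ℝ) ^ (-k) * r) - ρ ((2 : ℝ) ^ (-k + 1) * r)

/-- `χ̃_k = χ_{k-1} + χ_k + χ_{k+1}`. -/
def chiT (ρ : ℝ → ℝ) (k : ℤ) (r : ℝ) : ℝ := chi ρ (k - 1) r + chi ρ k r + chi ρ (k + 1) r

/-- `χ_{≤ m}`; the sum of the `χ_i`, `i ≤ m`, telescopes to `ρ(2^{-m} r)` for `r ≠ 0`. -/
def chiLe (ρ : ℝ → ℝ) (m : ℤ) (r : ℝ) : ℝ := ρ ((2 : ℝ) ^ (-m) * r)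

/-- The cone of opening angle `θ` around the half-line through `e`. -/
def cone (e : E3) (θ : ℝ) : Set E3 := {ξ | ξ ≠ 0 ∧ InnerProductGeometry.angle e ξ ≤ θ}

/-- The spherical cap of (angular) diameter `2^{-l}` with center `e`. -/
def cap (l : ℕ) (e : E3) : Set E3 := cone e ((2 : ℝ) ^ (-(l : ℤ)) / 2) ∩ Metric.sphere 0 1

/-- The caps `𝒦_l`, `l ∈ ℕ`, with the partitions of unity `η_κ` and the fattened cutoffs `η̃_κ`.
A cap `κ ∈ 𝒦_l` is given by `l` and its center `e = ω(κ)`. The constants in the derivative bounds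
do not depend on `l` and `κ`. -/
structure CapSystem where
  /-- the centers of the caps in `𝒦_l` -/
  centers : ℕ → Set E3
  /-- `η l e` is `η_κ` -/
  η : ℕ → E3 → E3 → ℝ
  /-- `ηT l e` is `η̃_κ` -/
  ηT : ℕ → E3 → E3 → ℝ
  unit : ∀ l, ∀ e ∈ centers l, ‖e‖ = 1
  symmetric : ∀ l, ∀ e ∈ centers l, -e ∈ centers l
  cover : ∀ l, ∀ x : E3, ‖x‖ = 1 → ∃ e ∈ centers l, x ∈ cap l e
  overlap : ∃ M : ℕ, ∀ l, ∀ x : E3, {e ∈ centers l | x ∈ cap l e}.encard ≤ M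
  η_smooth : ∀ l, ∀ e ∈ centers l, ContDiffOn ℝ ∞ (η l e) {0}ᶜ
  η_nonneg : ∀ l, ∀ e ∈ centers l, ∀ ξ, 0 ≤ η l e ξ
  η_homogeneous : ∀ l, ∀ e ∈ centers l, ∀ r : ℝ, 0 < r → ∀ ξ, η l e (r • ξ) = η l e ξ
  /-- `η_κ` is supported in `2Γ_κ` -/
  η_support : ∀ l, ∀ e ∈ centers l, ∀ ξ, ξ ≠ 0 → η l e ξ ≠ 0 → ξ ∈ cone e ((2 : ℝ) ^ (-(l : ℤ)))
  η_sum : ∀ l, ∀ ξ : E3, ξ ≠ 0 → ∑ᶠ e ∈ centers l, η l e ξ = 1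
  η_deriv : ∀ N : ℕ, ∃ C : ℝ, ∀ l, ∀ e ∈ centers l, ∀ ξ, ξ ≠ 0 →
    ‖iteratedFDeriv ℝ N (η l e) ξ‖ ≤ C * (2 ^ l / ‖ξ‖) ^ N
  η_deriv_center : ∀ N : ℕ, ∃ C : ℝ, ∀ l, ∀ e ∈ centers l, ∀ ξ, ξ ≠ 0 →
    |iteratedFDeriv ℝ N (η l e) ξ (fun _ => e)| ≤ C * (1 / ‖ξ‖) ^ N
  ηT_smooth : ∀ l, ∀ e ∈ centers l, ContDiffOn ℝ ∞ (ηT l e) {0}ᶜ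
  ηT_nonneg : ∀ l, ∀ e ∈ centers l, ∀ ξ, 0 ≤ ηT l e ξ
  ηT_homogeneous : ∀ l, ∀ e ∈ centers l, ∀ r : ℝ, 0 < r → ∀ ξ, ηT l e (r • ξ) = ηT l e ξ
  /-- `η̃_κ` has a slightly bigger support -/
  ηT_support : ∀ l, ∀ e ∈ centers l, ∀ ξ, ξ ≠ 0 → ηT l e ξ ≠ 0 →
    ξ ∈ cone e (4 * (2 : ℝ) ^ (-(l : ℤ)))
  /-- `η̃_κ η_κ = η_κ` -/
  ηT_mul : ∀ l, ∀ e ∈ centers l, ∀ ξ, ξ ≠ 0 → ηT l e ξ * η l e ξ = η l e ξ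
  ηT_deriv : ∀ N : ℕ, ∃ C : ℝ, ∀ l, ∀ e ∈ centers l, ∀ ξ, ξ ≠ 0 →
    ‖iteratedFDeriv ℝ N (ηT l e) ξ‖ ≤ C * (2 ^ l / ‖ξ‖) ^ N
  ηT_deriv_center : ∀ N : ℕ, ∃ C : ℝ, ∀ l, ∀ e ∈ centers l, ∀ ξ, ξ ≠ 0 →
    |iteratedFDeriv ℝ N (ηT l e) ξ (fun _ => e)| ≤ C * (1 / ‖ξ‖) ^ N

/-- `A_{k,κ} = supp (η_κ χ_k)`. -/
def freqSet (ρ : ℝ → ℝ) (K : CapSystem) (k : ℤ) (l : ℕ) (e : E3) : Set E3 :=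
  tsupport fun ξ : E3 => K.η l e ξ * chi ρ k ‖ξ‖

/-- `Ã_{k,κ} = supp (η̃_κ χ̃_k)`. -/
def freqSetT (ρ : ℝ → ℝ) (K : CapSystem) (k : ℤ) (l : ℕ) (e : E3) : Set E3 :=
  tsupport fun ξ : E3 => K.ηT l e ξ * chiT ρ k ‖ξ‖

/-- `B_{k,κ}`, the Fourier support of `Q⁺_{≺ k-2l} P_{k,κ}`, i.e. the support of the symbol
`χ_{≤ k-2l-c}(τ - ⟨ξ⟩) η_κ(ξ) χ_k(ξ)`, where `c` is the large integer in the definition of `≺`. -/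
def modSet (ρ : ℝ → ℝ) (K : CapSystem) (c : ℕ) (k : ℤ) (l : ℕ) (e : E3) : Set (ℝ × E3) :=
  tsupport fun ζ : ℝ × E3 =>
    chiLe ρ (k - 2 * l - c) |ζ.1 - jap ζ.2| * (K.η l e ζ.2 * chi ρ k ‖ζ.2‖)

end TiltedFrames

end

open TiltedFrames MeasureTheory
open scoped ENNReal

/-!
The linear estimates in tilted frames rest on one quantity, the transversality factor
`D(ξ) = λ - ω·ξ/⟨ξ⟩`, which is up to normalization the derivative of `τ - ⟨ξ⟩` in the direction
`Θ_{λ,ω}`. If the direction of `ξ` has distance about `α` to `ω`, and `|ξ|⁻²` and `1 - λ` are small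
compared to `α²`, then `D(ξ) ≈ α²` (`transv_bounds`). The characteristic surface is then a graph
over the frequencies of the hyperplanes `t_{λ,ω} = s`, with `D` as Jacobian, and Plancherel's
theorem on a hyperplane gives the bound for free waves, with the loss `D^{-1/2} ≈ α⁻¹`
(`eLpNorm_freeWave_slice_le`).

For the inhomogeneous problem, the forcing is first shown to be the inverse Fourier integral of a
function `F ∈ L¹ ∩ L²` supported in the compact set `B_{k,κ}` (`exists_forcing_eq_stSynth`). If the
modulation `|τ - ⟨ξ⟩|` is at most a small multiple of `2^{k-2l} ≈ α² 2^k`, every point of `B_{k,κ}`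
is of the form `(⟨ξ⟩ + λh, ξ + hω)` with `|h| ≪ 2^k` and `D(ξ) ≈ α²` (`exists_isTransverse`); these
are coordinates with Jacobian `D`. In them the symbol of the equation is `⟨ξ⟩ + λh - ⟨ξ + hω⟩`,
which for such `h` vanishes at `h = 0` only. The quotient of `h` by this symbol is the Fourier
transform, in the variable `h`, of a kernel whose `L¹` norm is at most a multiple of `1/D`
(`exists_isParametrix`).

In Duhamel's formula the exponential of `t_{λ,ω} h` splits as `1` plus an integral over
`0 < s < t_{λ,ω}`. The integral is a superposition of free waves with data `v_s` cut off at
`t_{λ,ω} = s`; since the parametrix acts by convolution in `s`, the data are controlled by the norms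
of the forcing on the hyperplanes (`exists_sources`), with the factor `√D · D⁻¹ ≈ α⁻¹`. What remains
involves only exponentials of characteristic frequencies (`duhamel_sub_sources`), hence is a free
wave (`residual_ae_eq_freeWave`), and its data, read off at time `0` where the solution vanishes, is
bounded by the data `v_s`. The resulting decomposition (`exists_decomposition`) implies the
`L^∞ L²` bound through the estimate for free waves. Solutions are unique by Grönwall's inequality on
bounded frequency sets (`IsSolution.ae_eq`), so the decomposition holds for every solution.
-/

noncomputable section

namespace TiltedFrames

open MeasureTheory Set Filter Topology
open scoped ENNReal FourierTransform RealInnerProductSpace SchwartzMap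

section

open scoped ContDiff

/-! ### The Fourier transform on `L²(ℝ³)` in the convention without `2π` -/

lemma contDiff_ofReal_comp {W : Type*} [NormedAddCommGroup W] [NormedSpace ℝ W] {g : W → ℝ}
    (hg : ContDiff ℝ ∞ g) : ContDiff ℝ ∞ fun x => (g x : ℂ) :=
  Complex.ofRealCLM.contDiff.comp hg

lemma hasCompactSupport_ofReal_comp {W : Type*} [TopologicalSpace W] {g : W → ℝ}
    (hg : HasCompactSupport g) : HasCompactSupport fun x => (g x : ℂ) :=
  HasCompactSupport.comp_left (g := fun r : ℝ => (r : ℂ)) hg Complex.ofReal_zero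

lemma exists_schwartz_of_hasCompactSupport {W : Type*} [NormedAddCommGroup W] [NormedSpace ℝ W]
    {g : W → ℂ} (hg : ContDiff ℝ ∞ g) (hc : HasCompactSupport g) :
    ∃ G : 𝓢(W, ℂ), ∀ x, G x = g x :=
  ⟨hc.toSchwartzMap hg, fun _ => rfl⟩

section Fourier

variable {V : Type*} [NormedAddCommGroup V] [InnerProductSpace ℝ V] [FiniteDimensional ℝ V]
  [MeasurableSpace V] [BorelSpace V]

/-- The unnormalized synthesis integral `x ↦ ∫ e^{i x·ξ} φ(ξ) dξ`. -/
def synth (φ : V → ℂ) (x : V) : ℂ :=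
  ∫ ξ, Complex.exp (Complex.I * ((⟪x, ξ⟫ : ℝ) : ℂ)) * φ ξ

lemma synth_eq_fourierInv (φ : V → ℂ) (x : V) :
    synth φ x = 𝓕⁻ φ ((2 * Real.pi)⁻¹ • x) := by
  rw [Real.fourierInv_eq']
  refine integral_congr_ae (Eventually.of_forall fun ξ => ?_)
  have : (2 * Real.pi * ⟪ξ, (2 * Real.pi)⁻¹ • x⟫ : ℝ) = ⟪x, ξ⟫ := by
    rw [inner_smul_right, real_inner_comm]; field_simp
  simp only [this, smul_eq_mul, mul_comm Complex.I]

lemma synth_congr_ae {φ ψ : V → ℂ} (h : φ =ᵐ[volume] ψ) (x : V) : synth φ x = synth ψ x := by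
  refine integral_congr_ae ?_
  filter_upwards [h] with ξ hξ
  rw [hξ]

lemma continuous_synth {φ : V → ℂ} (hφ : Integrable φ) : Continuous (synth φ) := by
  have h : Continuous (𝓕⁻ φ) := by
    rw [Real.fourierInv_eq_fourier_comp_neg]
    exact VectorFourier.fourierIntegral_continuous Real.continuous_fourierChar
      (by simpa using continuous_inner) hφ.comp_neg
  have := h.comp (continuous_const_smul ((2 * Real.pi)⁻¹) : Continuous fun x : V => _)
  exact this.congr fun x => (synth_eq_fourierInv φ x).symm

/-- On `L¹ ∩ L²` the inverse Fourier transform of `L²` is given by the integral. -/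
lemma fourierInv_toLp_ae {φ : V → ℂ} (h1 : Integrable φ) (h2 : MemLp φ 2) :
    ((𝓕⁻ (h2.toLp φ) : Lp (α := V) ℂ 2 volume) : V → ℂ) =ᵐ[volume] 𝓕⁻ φ := by
  have hc : Continuous (𝓕⁻ φ) := by
    have := (continuous_synth h1).comp 
      (continuous_const_smul ((2 * Real.pi)) : Continuous fun x : V => _)
    refine this.congr fun x => ?_
    simp only [Function.comp_apply, synth_eq_fourierInv, smul_smul]
    rw [inv_mul_cancel₀ (by positivity), one_smul]
  obtain ⟨P, hP⟩ : ∃ P : Lp (α := V) ℂ 2 volume, P = 𝓕⁻ (h2.toLp φ) := ⟨_, rfl⟩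
  rw [← hP]
  have hl : LocallyIntegrable (P : V → ℂ) volume := (Lp.memLp P).locallyIntegrable (by norm_num)
  obtain ⟨Q, hQ⟩ : ∃ Q : V → ℂ, Q = 𝓕⁻ φ := ⟨_, rfl⟩
  rw [← hQ] at hc ⊢
  refine ae_eq_of_integral_contDiff_smul_eq (f' := Q) hl hc.locallyIntegrable fun g hg hgc => ?_
  rw [hQ]
  have hgs := contDiff_ofReal_comp hg
  have hgcs := hasCompactSupport_ofReal_comp hgc
  obtain ⟨G, hG⟩ := exists_schwartz_of_hasCompactSupport hgs hgcs
  have e1 := congrArg (fun T => T G) (Lp.fourierInv_toTemperedDistribution_eq (h2.toLp φ))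
  rw [← hP] at e1
  simp only [TemperedDistribution.fourierInv_apply, Lp.toTemperedDistribution_apply] at e1
  have e2 : ∫ x, g x • P x
      = ∫ x, (𝓕⁻ G) x • φ x := by
    have e0 : ∫ x, (𝓕⁻ G) x • φ x = ∫ x, (𝓕⁻ G) x • (h2.toLp φ) x :=
      integral_congr_ae (by filter_upwards [h2.coeFn_toLp] with x hx; rw [hx])
    rw [e0, e1]
    refine integral_congr_ae (Eventually.of_forall fun x => ?_)
    simp only [hG, smul_eq_mul, Complex.real_smul]
  rw [e2]
  have e3 := VectorFourier.integral_fourierIntegral_smul_eq_flip (𝕜 := ℝ) (e := Real.fourierChar)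
    (μ := (volume : Measure V)) (ν := (volume : Measure V)) (L := -innerₗ V)
    (f := (fun x => (g x : ℂ))) (g := φ) Real.continuous_fourierChar
    (by simp only [LinearMap.neg_apply, innerₗ_apply_apply]; fun_prop)
    (hgs.continuous.integrable_of_hasCompactSupport hgcs) h1
  have e4 : ∀ f : V → ℂ, VectorFourier.fourierIntegral Real.fourierChar (volume : Measure V)
      (-innerₗ V) f = 𝓕⁻ f := by
    intro f; ext x
    simp [VectorFourier.fourierIntegral, Real.fourierInv_eq]
  have e5 : ∀ f : V → ℂ, VectorFourier.fourierIntegral Real.fourierChar (volume : Measure V)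
      (-innerₗ V).flip f = 𝓕⁻ f := by
    intro f; ext x
    simp [VectorFourier.fourierIntegral, Real.fourierInv_eq, real_inner_comm]
  rw [e4, e5] at e3
  have hGf : (G : V → ℂ) = fun x => (g x : ℂ) := funext hG
  rw [SchwartzMap.fourierInv_coe, hGf, e3]
  simp only [Complex.real_smul, smul_eq_mul]

end Fourier

lemma ae_dilate {P : E3 → Prop} (h : ∀ᵐ v, P v) {r : ℝ} (hr : r ≠ 0) : ∀ᵐ ξ : E3, P (r • ξ) := by
  have hq : Measure.QuasiMeasurePreserving (fun x : E3 => r • x) volume volume := by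
    refine ⟨measurable_const_smul r, ?_⟩
    rw [Measure.map_addHaar_smul _ hr]
    exact Measure.smul_absolutelyContinuous
  exact hq.ae h

lemma eLpNorm_dilate {f : E3 → ℂ} (hf : AEStronglyMeasurable f) {r : ℝ} (hr : 0 < r) :
    eLpNorm (fun x => f (r⁻¹ • x)) 2 = ENNReal.ofReal (√(r ^ 3)) * eLpNorm f 2 := by
  have hm := Measure.map_addHaar_smul (volume : Measure E3) (inv_ne_zero hr.ne')
  have h1 : AEStronglyMeasurable f (Measure.map (fun x : E3 => r⁻¹ • x) volume) := by
    rw [hm]; exact hf.smul_measure _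
  have := eLpNorm_map_measure (p := 2) h1 (measurable_const_smul r⁻¹).aemeasurable
  rw [hm, eLpNorm_smul_measure_of_ne_top (by norm_num)] at this
  rw [show (fun x => f (r⁻¹ • x)) = f ∘ (fun x => r⁻¹ • x) from rfl, ← this, smul_eq_mul]
  congr 1
  rw [ENNReal.ofReal_rpow_of_nonneg (abs_nonneg _) (by simp), Real.sqrt_eq_rpow]
  congr 2
  · simp [abs_of_pos hr]
  · simp

/-- The factor `(2π)^{3/2}` of Plancherel's theorem. -/
def planch : ℝ := √((2 * Real.pi) ^ 3)

lemma planch_pos : 0 < planch := Real.sqrt_pos.2 (by positivity)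

lemma planch_sq : planch ^ 2 = (2 * Real.pi) ^ 3 := Real.sq_sqrt (by positivity)

lemma aestronglyMeasurable_hat (f : L2) : AEStronglyMeasurable (hat f) := by
  have hq : Measure.QuasiMeasurePreserving (fun x : E3 => (2 * Real.pi)⁻¹ • x) volume volume := by
    refine ⟨measurable_const_smul _, ?_⟩
    rw [Measure.map_addHaar_smul _ (by positivity)]
    exact Measure.smul_absolutelyContinuous
  exact (Lp.aestronglyMeasurable (𝓕 f : L2)).comp_quasiMeasurePreserving hq

lemma eLpNorm_hat (f : L2) : eLpNorm (hat f) 2 = ENNReal.ofReal planch * ‖f‖ₑ := by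
  have := eLpNorm_dilate (Lp.aestronglyMeasurable (𝓕 f : L2)) (r := 2 * Real.pi) (by positivity)
  rw [show hat f = fun x => (𝓕 f : L2) ((2 * Real.pi)⁻¹ • x) from rfl, this, ← Lp.enorm_def]
  congr 1
  rw [enorm_eq_iff_norm_eq]
  exact Lp.norm_fourier_eq f

lemma memLp_hat (f : L2) : MemLp (hat f) 2 :=
  ⟨aestronglyMeasurable_hat f, by
    rw [eLpNorm_hat]; exact ENNReal.mul_lt_top ENNReal.ofReal_lt_top enorm_lt_top⟩

lemma hat_eq_of_fourier {f : L2} {φ : E3 → ℂ}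
    (h : ((𝓕 f : L2) : E3 → ℂ) =ᵐ[volume] fun v => φ ((2 * Real.pi) • v)) :
    hat f =ᵐ[volume] φ := by
  have := ae_dilate h (r := (2 * Real.pi)⁻¹) (by positivity)
  filter_upwards [this] with ξ hξ
  simp only [hat]
  rw [hξ, smul_smul, mul_inv_cancel₀ (by positivity), one_smul]

lemma fourier_eq_of_hat {f : L2} {φ : E3 → ℂ} (h : hat f =ᵐ[volume] φ) :
    ((𝓕 f : L2) : E3 → ℂ) =ᵐ[volume] fun v => φ ((2 * Real.pi) • v) := by
  filter_upwards [ae_dilate h (r := (2 * Real.pi)) (by positivity)] with ξ hξ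
  rw [← hξ, hat, smul_smul, inv_mul_cancel₀ (by positivity), one_smul]

/-- An element of `L²` is determined by its Fourier transform. -/
lemma eq_of_hat_eq {f g : L2} (h : hat f =ᵐ[volume] hat g) : f = g := by
  have h1 : (𝓕 f : L2) = 𝓕 g := by
    refine Lp.ext ((fourier_eq_of_hat h).trans ?_)
    exact (fourier_eq_of_hat (Filter.EventuallyEq.refl _ (hat g))).symm
  exact (Lp.fourierTransformₗᵢ E3 ℂ).injective h1

lemma hat_sub (f g : L2) : hat (f - g) =ᵐ[volume] fun ξ => hat f ξ - hat g ξ := by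
  have h : (𝓕 (f - g) : L2) = 𝓕 f - 𝓕 g := (Lp.fourierTransformₗᵢ E3 ℂ).map_sub f g
  refine hat_eq_of_fourier ?_
  rw [h]
  filter_upwards [Lp.coeFn_sub (𝓕 f : L2) (𝓕 g)] with v hv
  simp only [hat, hv, smul_smul, Pi.sub_apply]
  rw [inv_mul_cancel₀ (by positivity), one_smul]

lemma memLp_dilate {φ : E3 → ℂ} (h2 : MemLp φ 2) :
    MemLp (fun v => φ ((2 * Real.pi) • v)) 2 := by
  have hq : Measure.QuasiMeasurePreserving (fun x : E3 => (2 * Real.pi) • x) volume volume := by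
    refine ⟨measurable_const_smul _, ?_⟩
    rw [Measure.map_addHaar_smul _ (by positivity)]
    exact Measure.smul_absolutelyContinuous
  refine ⟨h2.1.comp_quasiMeasurePreserving hq, ?_⟩
  have := eLpNorm_dilate h2.1 (r := (2 * Real.pi)⁻¹) (by positivity)
  rw [inv_inv] at this
  rw [this]
  exact ENNReal.mul_lt_top ENNReal.ofReal_lt_top h2.2

/-- Every `φ ∈ L¹ ∩ L²` is the Fourier transform of an `f ∈ L²`, and `f` is the absolutely
convergent synthesis integral of `φ`. -/
lemma exists_hat_eq {φ : E3 → ℂ} (h1 : Integrable φ) (h2 : MemLp φ 2) :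
    ∃ f : L2, hat f =ᵐ[volume] φ ∧
      (f : E3 → ℂ) =ᵐ[volume] fun x => (((2 * Real.pi) ^ 3 : ℝ) : ℂ)⁻¹ * synth φ x := by
  have h2' := memLp_dilate h2
  have h1' : Integrable (fun v => φ ((2 * Real.pi) • v)) := h1.comp_smul (by positivity)
  refine ⟨𝓕⁻ (h2'.toLp _), hat_eq_of_fourier ?_, (fourierInv_toLp_ae h1' h2').trans ?_⟩
  · rw [FourierTransform.fourier_fourierInv_eq]
    exact h2'.coeFn_toLp
  · refine Eventually.of_forall fun x => ?_
    have := Measure.integral_comp_smul (volume : Measure E3)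
      (fun ξ => Complex.exp (Complex.I * ((⟪x, ξ⟫ : ℝ) : ℂ)) * φ ξ) (2 * Real.pi)
    simp only [finrank_euclideanSpace, Fintype.card_fin] at this
    change _ = (((2 * Real.pi) ^ 3 : ℝ) : ℂ)⁻¹ * synth φ x
    rw [show synth φ x = ∫ ξ, Complex.exp (Complex.I * ((⟪x, ξ⟫ : ℝ) : ℂ)) * φ ξ from rfl,
      ← Complex.ofReal_inv, ← Complex.real_smul, ← abs_of_pos (a := ((2 * Real.pi) ^ 3)⁻¹)
      (by positivity), ← this, Real.fourierInv_eq']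
    refine integral_congr_ae (Eventually.of_forall fun v => ?_)
    simp only [inner_smul_right, smul_eq_mul, real_inner_comm, mul_comm Complex.I]

lemma exists_hat_eq_norm {φ : E3 → ℂ} {f : L2} (h : hat f =ᵐ[volume] φ) :
    eLpNorm φ 2 = ENNReal.ofReal planch * ‖f‖ₑ := by
  rw [← eLpNorm_congr_ae h, eLpNorm_hat]

/-- Plancherel's theorem for the synthesis integral. -/
lemma eLpNorm_synth {φ : E3 → ℂ} (h1 : Integrable φ) (h2 : MemLp φ 2) :
    eLpNorm (synth φ) 2 = ENNReal.ofReal planch * eLpNorm φ 2 := by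
  obtain ⟨f, hf1, hf2⟩ := exists_hat_eq h1 h2
  rw [exists_hat_eq_norm hf1, ← mul_assoc, ← ENNReal.ofReal_mul planch_pos.le, ← sq, planch_sq]
  have : synth φ =ᵐ[volume] ((((2 * Real.pi) ^ 3 : ℝ) : ℂ)) • (f : E3 → ℂ) := by
    filter_upwards [hf2] with x hx
    rw [Pi.smul_apply, hx, smul_eq_mul, ← mul_assoc, mul_inv_cancel₀, one_mul]
    exact_mod_cast (by positivity : ((2 * Real.pi) ^ 3 : ℝ) ≠ 0)
  rw [eLpNorm_congr_ae this, eLpNorm_const_smul, ← Lp.enorm_def]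
  congr 1
  rw [← ofReal_norm, Complex.norm_real, Real.norm_of_nonneg (by positivity)]

/-- `f ∈ L²` with integrable Fourier transform is the synthesis integral of `f̂`. -/
lemma ae_eq_synth_hat {f : L2} (h : Integrable (hat f)) :
    (f : E3 → ℂ) =ᵐ[volume] fun x => (((2 * Real.pi) ^ 3 : ℝ) : ℂ)⁻¹ * synth (hat f) x := by
  obtain ⟨g, hg1, hg2⟩ := exists_hat_eq h (memLp_hat f)
  rwa [eq_of_hat_eq hg1] at hg2

/-- Parseval's formula against Schwartz functions. -/
lemma integral_mul_schwartz (f : L2) (θ : 𝓢(E3, ℂ)) :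
    ∫ x, f x * θ x = (((2 * Real.pi) ^ 3 : ℝ) : ℂ)⁻¹ * ∫ ξ, hat f ξ * synth θ ξ := by
  have e1 := congrArg (fun T => T (𝓕⁻ θ)) (Lp.fourier_toTemperedDistribution_eq f)
  simp only [TemperedDistribution.fourier_apply, Lp.toTemperedDistribution_apply,
    FourierTransform.fourier_fourierInv_eq] at e1
  have := Measure.integral_comp_smul (volume : Measure E3)
      (fun v => (𝓕⁻ θ) v • (𝓕 f : L2) v) ((2 * Real.pi)⁻¹)
  rw [← e1] at this
  simp only [finrank_euclideanSpace, Fintype.card_fin] at this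
  have h2 : ∫ ξ, hat f ξ * synth θ ξ
      = ((2 * Real.pi) ^ 3 : ℝ) • ∫ x, θ x • (f : E3 → ℂ) x := by
    rw [show ((2 * Real.pi) ^ 3 : ℝ) = |(((2 * Real.pi)⁻¹) ^ 3)⁻¹| by
      rw [inv_pow, inv_inv, abs_of_pos (by positivity)], ← this]
    refine integral_congr_ae (Eventually.of_forall fun ξ => ?_)
    simp only [synth_eq_fourierInv, hat, SchwartzMap.fourierInv_coe, smul_eq_mul, mul_comm]
  rw [h2, Complex.real_smul, ← mul_assoc, inv_mul_cancel₀, one_mul]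
  · simp only [smul_eq_mul, mul_comm]
  · exact_mod_cast (by positivity : ((2 * Real.pi) ^ 3 : ℝ) ≠ 0)

end

section

open scoped ContDiff

/-! ### Minkowski's integral inequality in `L²` -/

section Minkowski

variable {α β : Type*} [MeasurableSpace α] [MeasurableSpace β]

lemma eLpNorm_two_sq {E : Type*} [NormedAddCommGroup E] (f : α → E) (μ : Measure α) :
    eLpNorm f 2 μ ^ 2 = ∫⁻ x, ‖f x‖ₑ ^ 2 ∂μ := by
  rw [eLpNorm_eq_lintegral_rpow_enorm_toReal (by norm_num) (by norm_num), ← ENNReal.rpow_natCast,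
    ← ENNReal.rpow_mul]
  simp

lemma eLpNorm_two_le_of_sq {E : Type*} [NormedAddCommGroup E] {f : α → E} {μ : Measure α} {C : ℝ≥0∞}
    (h : ∫⁻ x, ‖f x‖ₑ ^ 2 ∂μ ≤ C ^ 2) : eLpNorm f 2 μ ≤ C := by
  rw [← eLpNorm_two_sq] at h
  exact (ENNReal.pow_le_pow_left_iff (by norm_num)).1 h

lemma lintegral_mul_sq_le {μ : Measure α} {f g : α → ℝ≥0∞} (hf : AEMeasurable f μ)
    (hg : AEMeasurable g μ) :
    (∫⁻ x, f x * g x ∂μ) ^ 2 ≤ (∫⁻ x, f x ^ 2 ∂μ) * ∫⁻ x, g x ^ 2 ∂μ := by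
  have h := ENNReal.lintegral_mul_le_Lp_mul_Lq μ (p := 2) (q := 2)
    (Real.holderConjugate_iff.2 ⟨by norm_num, by norm_num⟩) hf hg
  simp only [Pi.mul_apply, ENNReal.rpow_two] at h
  calc _ ≤ _ := pow_le_pow_left₀ (by positivity) h 2
    _ = _ := by
      rw [mul_pow, ← ENNReal.rpow_natCast, ← ENNReal.rpow_natCast, ← ENNReal.rpow_mul,
        ← ENNReal.rpow_mul]
      norm_num

/-- Minkowski's integral inequality for nonnegative functions: expand the square of the inner
integral as a double integral and apply the Cauchy–Schwarz inequality. -/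
lemma lintegral_lintegral_sq_le {μ : Measure α} {ν : Measure β} [SFinite μ] [SFinite ν]
    {f : α → β → ℝ≥0∞} (hf : Measurable (Function.uncurry f)) :
    ∫⁻ y, (∫⁻ x, f x y ∂μ) ^ 2 ∂ν ≤ (∫⁻ x, (∫⁻ y, f x y ^ 2 ∂ν) ^ (1 / 2 : ℝ) ∂μ) ^ 2 := by
  have hx : ∀ x, Measurable (f x) := fun x => hf.comp (measurable_const.prodMk measurable_id)
  have hy : ∀ y, Measurable fun x => f x y := fun y =>
    hf.comp (measurable_id.prodMk measurable_const)
  set n : α → ℝ≥0∞ := fun x => (∫⁻ y, f x y ^ 2 ∂ν) ^ (1 / 2 : ℝ) with hn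
  have hnm : Measurable n := by
    refine Measurable.pow_const ?_ _
    exact Measurable.lintegral_prod_right (hf.pow_const 2)
  have hcs : ∀ x x', ∫⁻ y, f x y * f x' y ∂ν ≤ n x * n x' := by
    intro x x'
    have h := lintegral_mul_sq_le (μ := ν) (hx x).aemeasurable (hx x').aemeasurable
    rw [← ENNReal.pow_le_pow_left_iff (n := 2) (by norm_num)]
    refine h.trans (le_of_eq ?_)
    rw [mul_pow, hn]
    simp only
    rw [← ENNReal.rpow_natCast, ← ENNReal.rpow_natCast, ← ENNReal.rpow_mul, ← ENNReal.rpow_mul]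
    norm_num
  calc ∫⁻ y, (∫⁻ x, f x y ∂μ) ^ 2 ∂ν
      = ∫⁻ y, ∫⁻ x, ∫⁻ x', f x y * f x' y ∂μ ∂μ ∂ν := by
        refine lintegral_congr fun y => ?_
        rw [sq, ← lintegral_mul_const _ (hy y)]
        refine lintegral_congr fun x => ?_
        rw [lintegral_const_mul _ (hy y)]
    _ = ∫⁻ x, ∫⁻ y, ∫⁻ x', f x y * f x' y ∂μ ∂ν ∂μ := by
        refine lintegral_lintegral_swap (Measurable.aemeasurable ?_)
        refine Measurable.lintegral_prod_right
          (f := fun (p : (β × α)) x' => f p.2 p.1 * f x' p.1) ?_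
        exact (hf.comp (by fun_prop : Measurable fun p : (β × α) × α => (p.1.2, p.1.1))).mul
          (hf.comp (by fun_prop : Measurable fun p : (β × α) × α => (p.2, p.1.1)))
    _ = ∫⁻ x, ∫⁻ x', ∫⁻ y, f x y * f x' y ∂ν ∂μ ∂μ := by
        refine lintegral_congr fun x => ?_
        refine lintegral_lintegral_swap (Measurable.aemeasurable ?_)
        exact ((hx x).comp measurable_fst).mul (hf.comp measurable_swap)
    _ ≤ ∫⁻ x, ∫⁻ x', n x * n x' ∂μ ∂μ := by
        gcongr with x x'
        exact hcs x x'
    _ = (∫⁻ x, n x ∂μ) ^ 2 := by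
        rw [sq, ← lintegral_mul_const _ hnm]
        refine lintegral_congr fun x => ?_
        rw [lintegral_const_mul _ hnm]

/-- Minkowski's integral inequality: the `L²` norm of an integral is at most the integral of the
`L²` norms. -/
lemma eLpNorm_integral_le {μ : Measure α} {ν : Measure β} [SFinite μ] [SFinite ν]
    {F : α → β → ℂ} (hF : StronglyMeasurable (Function.uncurry F)) :
    eLpNorm (fun y => ∫ x, F x y ∂μ) 2 ν ≤ ∫⁻ x, eLpNorm (F x) 2 ν ∂μ := by
  have hm : Measurable (Function.uncurry fun x y => ‖F x y‖ₑ) := hF.measurable.enorm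
  refine eLpNorm_two_le_of_sq ?_
  calc ∫⁻ y, ‖∫ x, F x y ∂μ‖ₑ ^ 2 ∂ν ≤ ∫⁻ y, (∫⁻ x, ‖F x y‖ₑ ∂μ) ^ 2 ∂ν := by
        gcongr with y
        exact enorm_integral_le_lintegral_enorm _
    _ ≤ _ := lintegral_lintegral_sq_le hm
    _ = _ := by
        congr 1
        refine lintegral_congr fun x => ?_
        rw [← eLpNorm_two_sq, ← ENNReal.rpow_natCast, ← ENNReal.rpow_mul]
        norm_num

lemma measurable_eLpNorm_two {ν : Measure β} [SFinite ν] {F : α → β → ℂ}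
    (hF : Measurable (Function.uncurry F)) : Measurable fun x => eLpNorm (F x) 2 ν := by
  have : (fun x => eLpNorm (F x) 2 ν) = fun x => (∫⁻ y, ‖F x y‖ₑ ^ 2 ∂ν) ^ (1 / 2 : ℝ) := by
    ext x
    rw [← eLpNorm_two_sq, ← ENNReal.rpow_natCast, ← ENNReal.rpow_mul]
    norm_num
  rw [this]
  refine Measurable.pow_const ?_ _
  exact Measurable.lintegral_prod_right (hF.enorm.pow_const 2)

end Minkowski

/-! ### Tilted frames -/

/-- The normalizing factor `(1 + λ²)^{1/2}`. -/
def frameNorm (lm : ℝ) : ℝ := √(1 + lm ^ 2)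

lemma frameNorm_pos (lm : ℝ) : 0 < frameNorm lm := Real.sqrt_pos.2 (by positivity)

lemma frameNorm_sq (lm : ℝ) : frameNorm lm ^ 2 = 1 + lm ^ 2 := Real.sq_sqrt (by positivity)

/-- The duality pairing `tτ + x·ξ` of space-time. -/
def pair (z ζ : ℝ × E3) : ℝ := z.1 * ζ.1 + ⟪z.2, ζ.2⟫

lemma continuous_pair : Continuous fun p : (ℝ × E3) × (ℝ × E3) => pair p.1 p.2 := by
  unfold pair; fun_prop

/-- The change of coordinates `(s, Y) ↦ s Θ + (Y·ω) Θ^⊥ + (0, Y - (Y·ω) ω)`. The three coordinates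
`x_{λ,ω}` are kept together in the vector `Y`, so that no basis of `ω^⊥` enters. -/
def frameMap (lm : ℝ) (w : E3) : (ℝ × E3) →ₗ[ℝ] (ℝ × E3) where
  toFun p := ((lm * p.1 - ⟪w, p.2⟫) / frameNorm lm,
    p.2 + ((p.1 + lm * ⟪w, p.2⟫) / frameNorm lm - ⟪w, p.2⟫) • w)
  map_add' p q := by
    ext1
    · simp only [Prod.fst_add, Prod.snd_add, inner_add_right]; ring
    · simp only [Prod.fst_add, Prod.snd_add, inner_add_right]; module
  map_smul' c p := by
    ext1
    · simp only [Prod.smul_fst, Prod.smul_snd, inner_smul_right, smul_eq_mul, RingHom.id_apply]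
      ring
    · simp only [Prod.smul_fst, Prod.smul_snd, inner_smul_right, smul_eq_mul, RingHom.id_apply]
      module

lemma frameMap_apply (lm : ℝ) (w : E3) (p : ℝ × E3) :
    frameMap lm w p = ((lm * p.1 - ⟪w, p.2⟫) / frameNorm lm,
      p.2 + ((p.1 + lm * ⟪w, p.2⟫) / frameNorm lm - ⟪w, p.2⟫) • w) := rfl

lemma continuous_frameMap (lm : ℝ) (w : E3) : Continuous (frameMap lm w) :=
  LinearMap.continuous_of_finiteDimensional _

lemma pair_frameMap {lm : ℝ} {w : E3} (hw : ‖w‖ = 1) (p q : ℝ × E3) :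
    pair (frameMap lm w p) (frameMap lm w q) = pair p q := by
  have hN := frameNorm_pos lm
  have hN2 := frameNorm_sq lm
  have hww : ⟪w, w⟫ = 1 := by rw [real_inner_self_eq_norm_sq, hw]; norm_num
  simp only [pair, frameMap_apply, inner_add_left, inner_add_right, inner_smul_left,
    inner_smul_right, hww, RCLike.conj_to_real, real_inner_comm w p.2]
  generalize ⟪w, p.2⟫ = a at *
  generalize ⟪w, q.2⟫ = b at *
  field_simp
  linear_combination (a * b + p.1 * q.1) * (-hN2)

/-- The linear map `frameMap` is a product of two transvections with determinants
`λ (1 + λ²)^{-1/2}` and `(1 + λ²)^{1/2} λ⁻¹`. -/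
lemma det_frameMap {lm : ℝ} {w : E3} (hw : ‖w‖ = 1) (hlm : lm ≠ 0) :
    LinearMap.det (frameMap lm w) = 1 := by
  have hN := frameNorm_pos lm
  have hN2 := frameNorm_sq lm
  have hww : ⟪w, w⟫ = 1 := by rw [real_inner_self_eq_norm_sq, hw]; norm_num
  set N := frameNorm lm with hNdef
  set f₁ : (ℝ × E3) →ₗ[ℝ] ℝ := (lm / N - 1) • LinearMap.fst ℝ ℝ E3
    - (1 / N) • (innerₗ E3 w ∘ₗ LinearMap.snd ℝ ℝ E3) with hf₁
  set f₂ : (ℝ × E3) →ₗ[ℝ] ℝ := (1 / lm) • LinearMap.fst ℝ ℝ E3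
    + (N / lm - 1) • (innerₗ E3 w ∘ₗ LinearMap.snd ℝ ℝ E3) with hf₂
  have h : frameMap lm w = LinearMap.transvection f₂ ((0, w) : ℝ × E3)
      ∘ₗ LinearMap.transvection f₁ ((1, 0) : ℝ × E3) := by
    apply LinearMap.ext
    intro p
    rw [LinearMap.comp_apply, LinearMap.transvection.apply, LinearMap.transvection.apply,
      frameMap_apply, ← hNdef]
    simp only [hf₁, hf₂, LinearMap.sub_apply, LinearMap.add_apply, LinearMap.smul_apply,
      LinearMap.fst_apply, LinearMap.comp_apply, LinearMap.snd_apply, innerₗ_apply_apply,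
      smul_eq_mul]
    ext1
    · simp only [Prod.fst_add, Prod.smul_fst, smul_eq_mul]; field_simp; ring
    · simp only [Prod.snd_add, Prod.smul_snd, Prod.smul_fst, Prod.fst_add, smul_zero, add_zero,
        smul_eq_mul, mul_one]
      congr 2
      field_simp
      linear_combination (-⟪w, p.2⟫) * hN2
  rw [h, LinearMap.det_comp, LinearMap.transvection.det, LinearMap.transvection.det]
  simp only [hf₁, hf₂, LinearMap.sub_apply, LinearMap.add_apply, LinearMap.smul_apply,
      LinearMap.fst_apply, LinearMap.comp_apply, LinearMap.snd_apply, innerₗ_apply_apply,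
      smul_eq_mul, hww, inner_zero_right]
  field_simp
  ring

instance isAddHaarMeasure_spaceTime : (volume : Measure (ℝ × E3)).IsAddHaarMeasure :=
  inferInstanceAs ((volume : Measure ℝ).prod (volume : Measure E3)).IsAddHaarMeasure

lemma measurePreserving_frameMap {lm : ℝ} {w : E3} (hw : ‖w‖ = 1) (hlm : lm ≠ 0) :
    MeasurePreserving (frameMap lm w) volume volume := by
  refine ⟨(continuous_frameMap lm w).measurable, ?_⟩
  have hd := det_frameMap hw hlm
  rw [Measure.map_linearMap_addHaar_eq_smul_addHaar _ (by rw [hd]; exact one_ne_zero), hd]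
  simp

lemma measurableEmbedding_frameMap {lm : ℝ} {w : E3} (hw : ‖w‖ = 1) (hlm : lm ≠ 0) :
    MeasurableEmbedding (frameMap lm w) := by
  have hd := det_frameMap hw hlm
  have hinj : Function.Injective (frameMap lm w) :=
    (LinearMap.equivOfDetNeZero (frameMap lm w) (by rw [hd]; exact one_ne_zero)).injective
  exact (continuous_frameMap lm w).measurableEmbedding hinj

lemma tTheta_eq (lm : ℝ) (w : E3) (z : ℝ × E3) :
    tTheta lm w z = (lm * z.1 + ⟪w, z.2⟫) / frameNorm lm := by
  simp only [tTheta, Theta, Prod.smul_mk, smul_eq_mul, inner_smul_right, frameNorm,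
    real_inner_comm w z.2]
  ring

lemma tTheta_frameMap {lm : ℝ} {w : E3} (hw : ‖w‖ = 1) (p : ℝ × E3) :
    tTheta lm w (frameMap lm w p) = p.1 := by
  have hN := frameNorm_pos lm
  have hN2 := frameNorm_sq lm
  have hww : ⟪w, w⟫ = 1 := by rw [real_inner_self_eq_norm_sq, hw]; norm_num
  simp only [tTheta_eq, frameMap_apply, inner_add_right, inner_smul_right, hww]
  field_simp
  linear_combination (-p.1) * hN2

lemma framePoint_eq (lm : ℝ) (b : OrthonormalBasis (Fin 3) ℝ E3) (s : ℝ) (y : E3) :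
    framePoint lm b s y = frameMap lm (b 0) (s, b.repr.symm y) := by
  have h0 : ⟪b 0, b.repr.symm y⟫ = y 0 := by
    rw [← OrthonormalBasis.repr_apply_apply, LinearIsometryEquiv.apply_symm_apply]
  have hs : b.repr.symm y = y 0 • b 0 + y 1 • b 1 + y 2 • b 2 := by
    rw [← OrthonormalBasis.sum_repr b (b.repr.symm y)]
    simp [Fin.sum_univ_three]
  rw [frameMap_apply]
  simp only [h0]
  rw [hs]
  simp only [framePoint, Theta, ThetaPerp, frameNorm]
  ext1
  · simp only [Prod.fst_add, Prod.smul_fst, smul_eq_mul]; ring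
  · simp only [Prod.snd_add, Prod.smul_snd]
    module

/-- The `L²_{x_{λ,ω}}` norm on a hyperplane, in the coordinates of `frameMap`. -/
lemma sliceNorm_eq (lm : ℝ) (b : OrthonormalBasis (Fin 3) ℝ E3) (u : ℝ × E3 → ℂ) (s : ℝ) :
    sliceNorm lm b u s = eLpNorm (fun Y : E3 => u (frameMap lm (b 0) (s, Y))) 2 volume := by
  have hm := b.repr.symm.measurePreserving
  have he : MeasurableEmbedding b.repr.symm := b.repr.symm.toMeasurableEquiv.measurableEmbedding
  have := he.eLpNorm_map_measure (p := 2) (μ := volume)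
    (g := fun Y : E3 => u (frameMap lm (b 0) (s, Y)))
  rw [hm.map_eq] at this
  rw [this, sliceNorm]
  simp only [framePoint_eq]
  rfl

lemma ae_slice {lm : ℝ} {w : E3} (hw : ‖w‖ = 1) (hlm : lm ≠ 0) {P : ℝ × E3 → Prop}
    (h : ∀ᵐ z, P z) : ∀ᵐ s : ℝ, ∀ᵐ Y : E3, P (frameMap lm w (s, Y)) :=
  Measure.ae_ae_of_ae_prod ((measurePreserving_frameMap hw hlm).quasiMeasurePreserving.ae h)

end

/-! ### The characteristic hypersurface in tilted coordinates -/

lemma jap_pos (ξ : E3) : 0 < jap ξ := Real.sqrt_pos.2 (by positivity)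

lemma jap_sq (ξ : E3) : jap ξ ^ 2 = 1 + ‖ξ‖ ^ 2 := Real.sq_sqrt (by positivity)

lemma continuous_jap : Continuous jap := by unfold jap; fun_prop

lemma hasFDerivAt_jap (ξ : E3) : HasFDerivAt jap ((jap ξ)⁻¹ • innerSL ℝ ξ) ξ := by
  have h := ((hasStrictFDerivAt_norm_sq ξ).hasFDerivAt.const_add 1).sqrt
    (by positivity : (1 + ‖ξ‖ ^ 2 : ℝ) ≠ 0)
  refine h.congr_fderiv ?_
  ext v
  simp only [jap, one_div, _root_.smul_apply, smul_eq_mul, mul_inv, innerSL_apply_apply]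
  simp
  ring

/-- The transversality factor `λ - ω·ξ/⟨ξ⟩`. Up to normalization it is the derivative of the symbol
`τ - ⟨ξ⟩` in the direction `Θ_{λ,ω}`. -/
def transv (lm : ℝ) (w ξ : E3) : ℝ := lm - ⟪w, ξ⟫ / jap ξ

lemma continuous_transv (lm : ℝ) (w : E3) : Continuous (transv lm w) := by
  unfold transv
  exact continuous_const.sub ((by fun_prop : Continuous fun ξ : E3 => ⟪w, ξ⟫).div continuous_jap
    fun ξ => (jap_pos ξ).ne')

/-- The point `(⟨ξ⟩, ξ)` of the characteristic hypersurface. -/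
def charPt (ξ : E3) : ℝ × E3 := (jap ξ, ξ)

lemma continuous_charPt : Continuous charPt := continuous_jap.prodMk continuous_id

/-- The last three frame coordinates of the characteristic point over `ξ`. -/
def charProj (lm : ℝ) (w ξ : E3) : E3 :=
  ξ + ((lm * ⟪w, ξ⟫ - jap ξ) / frameNorm lm - ⟪w, ξ⟫) • w

/-- The first frame coordinate of the characteristic point over `ξ`. -/
def charTime (lm : ℝ) (w ξ : E3) : ℝ := (lm * jap ξ + ⟪w, ξ⟫) / frameNorm lm

/-- The line through the characteristic point over `ξ` in the direction `(λ, ω)`. -/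
def charLine (lm : ℝ) (w : E3) (p : ℝ × E3) : ℝ × E3 := (jap p.2 + lm * p.1, p.2 + p.1 • w)

lemma continuous_charProj (lm : ℝ) (w : E3) : Continuous (charProj lm w) := by
  unfold charProj
  have := continuous_jap
  fun_prop

lemma continuous_charTime (lm : ℝ) (w : E3) : Continuous (charTime lm w) := by
  unfold charTime
  have := continuous_jap
  fun_prop

lemma continuous_charLine (lm : ℝ) (w : E3) : Continuous (charLine lm w) := by
  unfold charLine
  have := continuous_jap
  fun_prop

/-- The direction `(λ, ω)` is the first frame direction: moving along it changes only the first
frame coordinate. -/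
lemma frameMap_char {lm : ℝ} {w : E3} (hw : ‖w‖ = 1) (h : ℝ) (ξ : E3) :
    frameMap lm w (charTime lm w ξ + frameNorm lm * h, charProj lm w ξ)
      = charLine lm w (h, ξ) := by
  have hN := frameNorm_pos lm
  have hN2 := frameNorm_sq lm
  have hww : ⟪w, w⟫ = 1 := by rw [real_inner_self_eq_norm_sq, hw]; norm_num
  have hp : ⟪w, charProj lm w ξ⟫ = (lm * ⟪w, ξ⟫ - jap ξ) / frameNorm lm := by
    simp only [charProj, inner_add_right, inner_smul_right, hww]; ring
  rw [frameMap_apply]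
  ext1
  · simp only [hp, charTime, charLine]
    field_simp
    linear_combination (-jap ξ) * hN2
  · simp only [hp]
    simp only [charProj, charTime, charLine]
    rw [add_assoc, ← add_smul]
    congr 2
    field_simp
    linear_combination (-⟪w, ξ⟫) * hN2

lemma frameMap_charPt {lm : ℝ} {w : E3} (hw : ‖w‖ = 1) (ξ : E3) :
    frameMap lm w (charTime lm w ξ, charProj lm w ξ) = charPt ξ := by
  have := frameMap_char hw (lm := lm) 0 ξ
  simpa [charLine, charPt] using this

/-- Two characteristic points at which the transversality factor is positive and which differ by a
multiple of `(λ, ω)` coincide: `⟨ξ⟩` is convex along the line. -/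
lemma eq_of_jap_add {lm : ℝ} {w ξ : E3} (hw : ‖w‖ = 1) {c : ℝ} (h1 : 0 < transv lm w ξ)
    (h2 : 0 < transv lm w (ξ + c • w)) (h : jap (ξ + c • w) = jap ξ + lm * c) : c = 0 := by
  have hww : ⟪w, w⟫ = 1 := by rw [real_inner_self_eq_norm_sq, hw]; norm_num
  have j1 := jap_pos ξ
  have j2 := jap_pos (ξ + c • w)
  have s1 := jap_sq ξ
  have s2 := jap_sq (ξ + c • w)
  simp only [transv, sub_pos, div_lt_iff₀ j1, div_lt_iff₀ j2, inner_add_right, inner_smul_right,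
    hww] at h1 h2
  have hn : ‖ξ + c • w‖ ^ 2 = ‖ξ‖ ^ 2 + 2 * c * ⟪w, ξ⟫ + c ^ 2 := by
    rw [norm_add_sq_real, inner_smul_right, norm_smul, hw, real_inner_comm, mul_one,
      Real.norm_eq_abs, sq_abs]
    ring
  rw [hn] at s2
  by_contra hc
  have key : c * (2 * ⟪w, ξ⟫ + c) = c * (lm * (jap (ξ + c • w) + jap ξ)) := by
    have : jap (ξ + c • w) ^ 2 - jap ξ ^ 2 = lm * c * (jap (ξ + c • w) + jap ξ) := by
      rw [sq_sub_sq, h]; ring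
    linarith
  have := mul_left_cancel₀ hc key
  linarith

lemma injOn_charProj {lm : ℝ} {w : E3} (hw : ‖w‖ = 1) {R : Set E3}
    (hR : ∀ ξ ∈ R, 0 < transv lm w ξ) : InjOn (charProj lm w) R := by
  intro ξ hξ η hη he
  have hN := frameNorm_pos lm
  have hww : ⟪w, w⟫ = 1 := by rw [real_inner_self_eq_norm_sq, hw]; norm_num
  obtain ⟨c, hc⟩ : ∃ c : ℝ, η = ξ + c • w := by
    refine ⟨((lm * ⟪w, ξ⟫ - jap ξ) / frameNorm lm - ⟪w, ξ⟫)
      - ((lm * ⟪w, η⟫ - jap η) / frameNorm lm - ⟪w, η⟫), ?_⟩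
    rw [sub_smul, add_sub, eq_sub_iff_add_eq]
    exact he.symm
  have h1 : ⟪w, charProj lm w ξ⟫ = ⟪w, charProj lm w η⟫ := by rw [he]
  simp only [charProj, inner_add_right, inner_smul_right, hww] at h1
  have h2 : lm * ⟪w, ξ⟫ - jap ξ = lm * ⟪w, η⟫ - jap η := by
    field_simp at h1; linarith
  have h3 : jap (ξ + c • w) = jap ξ + lm * c := by
    rw [hc] at h2
    simp only [inner_add_right, inner_smul_right, hww] at h2
    linarith
  have := eq_of_jap_add hw (hR ξ hξ) (hc ▸ hR η hη) h3
  rw [hc, this, zero_smul, add_zero]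

lemma injOn_charLine {lm : ℝ} {w : E3} (hw : ‖w‖ = 1) {R : Set E3}
    (hR : ∀ ξ ∈ R, 0 < transv lm w ξ) : InjOn (charLine lm w) (univ ×ˢ R) := by
  rintro ⟨h, ξ⟩ ⟨-, hξ⟩ ⟨h', η⟩ ⟨-, hη⟩ he
  simp only [charLine, Prod.mk.injEq] at he
  obtain ⟨e1, e2⟩ := he
  have hc : η = ξ + (h - h') • w := by
    rw [sub_smul, add_sub, eq_sub_iff_add_eq]; exact e2.symm
  have h3 : jap (ξ + (h - h') • w) = jap ξ + lm * (h - h') := by rw [← hc]; linarith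
  have := eq_of_jap_add hw (hR ξ hξ) (hc ▸ hR η hη) h3
  have hh : h = h' := by linarith
  rw [hc, hh]; simp

/-- The derivative of `charProj`. -/
def charProjDeriv (lm : ℝ) (w ξ : E3) : E3 →L[ℝ] E3 :=
  ContinuousLinearMap.id ℝ E3 +
    ((frameNorm lm)⁻¹ • (lm • innerSL ℝ w - (jap ξ)⁻¹ • innerSL ℝ ξ) - innerSL ℝ w).smulRight w

lemma hasFDerivAt_charProj (lm : ℝ) (w ξ : E3) :
    HasFDerivAt (charProj lm w) (charProjDeriv lm w ξ) ξ := by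
  have h1 : HasFDerivAt (fun ξ : E3 => ⟪w, ξ⟫) (innerSL ℝ w) ξ := (innerSL ℝ w).hasFDerivAt
  have h2 : HasFDerivAt (fun ξ : E3 => (lm * ⟪w, ξ⟫ - jap ξ) / frameNorm lm - ⟪w, ξ⟫)
      ((frameNorm lm)⁻¹ • (lm • innerSL ℝ w - (jap ξ)⁻¹ • innerSL ℝ ξ) - innerSL ℝ w) ξ := by
    have := (((h1.const_mul lm).sub (hasFDerivAt_jap ξ)).const_mul ((frameNorm lm)⁻¹)).sub h1
    refine this.congr_of_eventuallyEq (Eventually.of_forall fun η => ?_)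
    simp only [Pi.sub_apply]
    ring
  exact (hasFDerivAt_id ξ).add (h2.smul_const w)

lemma det_charProjDeriv {lm : ℝ} {w : E3} (hw : ‖w‖ = 1) (ξ : E3) :
    (charProjDeriv lm w ξ).det = transv lm w ξ / frameNorm lm := by
  have hN := frameNorm_pos lm
  have hJ := jap_pos ξ
  have hww : ⟪w, w⟫ = 1 := by rw [real_inner_self_eq_norm_sq, hw]; norm_num
  have h : ((charProjDeriv lm w ξ : E3 →L[ℝ] E3) : E3 →ₗ[ℝ] E3)
      = LinearMap.transvection (((frameNorm lm)⁻¹ • (lm • innerSL ℝ w - (jap ξ)⁻¹ • innerSL ℝ ξ)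
        - innerSL ℝ w : E3 →L[ℝ] ℝ) : E3 →ₗ[ℝ] ℝ) w := by
    apply LinearMap.ext
    intro v
    rw [LinearMap.transvection.apply]
    rfl
  rw [ContinuousLinearMap.det, h, LinearMap.transvection.det]
  simp only [ContinuousLinearMap.coe_coe, _root_.sub_apply,
    _root_.smul_apply, innerSL_apply_apply, hww, smul_eq_mul, transv,
    real_inner_comm w ξ]
  field_simp
  ring

/-- The derivative of `charLine`. -/
def charLineDeriv (lm : ℝ) (w : E3) (p : ℝ × E3) : (ℝ × E3) →L[ℝ] (ℝ × E3) :=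
  (((jap p.2)⁻¹ • innerSL ℝ p.2) ∘L ContinuousLinearMap.snd ℝ ℝ E3
    + lm • ContinuousLinearMap.fst ℝ ℝ E3).prod
  (ContinuousLinearMap.snd ℝ ℝ E3 + (ContinuousLinearMap.fst ℝ ℝ E3).smulRight w)

lemma hasFDerivAt_charLine (lm : ℝ) (w : E3) (p : ℝ × E3) :
    HasFDerivAt (charLine lm w) (charLineDeriv lm w p) p := by
  have h1 : HasFDerivAt (fun p : ℝ × E3 => jap p.2)
      (((jap p.2)⁻¹ • innerSL ℝ p.2) ∘L ContinuousLinearMap.snd ℝ ℝ E3) p :=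
    (hasFDerivAt_jap p.2).comp p hasFDerivAt_snd
  have h2 : HasFDerivAt (fun p : ℝ × E3 => p.1) (ContinuousLinearMap.fst ℝ ℝ E3) p :=
    hasFDerivAt_fst
  have h3 : HasFDerivAt (fun p : ℝ × E3 => p.2) (ContinuousLinearMap.snd ℝ ℝ E3) p :=
    hasFDerivAt_snd
  exact (h1.add (h2.const_mul lm)).prodMk (h3.add (h2.smul_const w))

lemma det_charLineDeriv (lm : ℝ) (w : E3) (p : ℝ × E3) :
    (charLineDeriv lm w p).det = transv lm w p.2 := by
  set f₁ : (ℝ × E3) →ₗ[ℝ] ℝ := LinearMap.fst ℝ ℝ E3 with hf₁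
  set f₂ : (ℝ × E3) →ₗ[ℝ] ℝ := (transv lm w p.2 - 1) • LinearMap.fst ℝ ℝ E3
    + (jap p.2)⁻¹ • (innerₗ E3 p.2 ∘ₗ LinearMap.snd ℝ ℝ E3) with hf₂
  have hJ := jap_pos p.2
  have h : ((charLineDeriv lm w p : (ℝ × E3) →L[ℝ] (ℝ × E3)) : (ℝ × E3) →ₗ[ℝ] (ℝ × E3))
      = LinearMap.transvection f₂ ((1, 0) : ℝ × E3)
        ∘ₗ LinearMap.transvection f₁ ((0, w) : ℝ × E3) := by
    apply LinearMap.ext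
    rintro ⟨a, v⟩
    rw [LinearMap.comp_apply, LinearMap.transvection.apply, LinearMap.transvection.apply]
    ext1
    · simp [charLineDeriv, hf₁, hf₂, transv, inner_add_right, inner_smul_right,
        real_inner_comm w p.2]
      ring
    · simp [charLineDeriv, hf₁]
  rw [ContinuousLinearMap.det, h, LinearMap.det_comp, LinearMap.transvection.det,
    LinearMap.transvection.det]
  simp [hf₁, hf₂]

/-! ### Changes of variables -/

section ChangeOfVariables

variable {lm : ℝ} {w : E3} {R : Set E3}

/-- The change of variables `η = charProj ξ`, whose Jacobian is the transversality factor up to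
normalization. -/
lemma lintegral_charProj (hw : ‖w‖ = 1) (hR : MeasurableSet R)
    (hpos : ∀ ξ ∈ R, 0 < transv lm w ξ) (f : E3 → ℝ≥0∞) :
    ∫⁻ η in charProj lm w '' R, f η
      = ∫⁻ ξ in R, ENNReal.ofReal (transv lm w ξ / frameNorm lm) * f (charProj lm w ξ) := by
  rw [lintegral_image_eq_lintegral_abs_det_fderiv_mul volume hR
    (fun ξ _ => (hasFDerivAt_charProj lm w ξ).hasFDerivWithinAt) (injOn_charProj hw hpos)]
  refine setLIntegral_congr_fun hR fun ξ hξ => ?_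
  rw [det_charProjDeriv hw, abs_of_pos (div_pos (hpos ξ hξ) (frameNorm_pos lm))]

lemma integral_charProj (hw : ‖w‖ = 1) (hR : MeasurableSet R)
    (hpos : ∀ ξ ∈ R, 0 < transv lm w ξ) (f : E3 → ℂ) :
    ∫ η in charProj lm w '' R, f η
      = ∫ ξ in R, ((transv lm w ξ / frameNorm lm : ℝ) : ℂ) * f (charProj lm w ξ) := by
  rw [integral_image_eq_integral_abs_det_fderiv_smul volume hR
    (fun ξ _ => (hasFDerivAt_charProj lm w ξ).hasFDerivWithinAt) (injOn_charProj hw hpos)]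
  refine setIntegral_congr_fun hR fun ξ hξ => ?_
  rw [det_charProjDeriv hw, abs_of_pos (div_pos (hpos ξ hξ) (frameNorm_pos lm)), Complex.real_smul]

/-- The change of variables `ζ = charLine (h, ξ)`, whose Jacobian is the transversality factor. -/
lemma lintegral_charLine (hw : ‖w‖ = 1) (hR : MeasurableSet R)
    (hpos : ∀ ξ ∈ R, 0 < transv lm w ξ) {f : ℝ × E3 → ℝ≥0∞} (hf : Measurable f)
    (hsupp : ∀ ζ, f ζ ≠ 0 → ζ ∈ charLine lm w '' (univ ×ˢ R)) :
    ∫⁻ ζ, f ζ = ∫⁻ ξ in R, ENNReal.ofReal (transv lm w ξ) * ∫⁻ h, f (charLine lm w (h, ξ)) := by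
  have hm : MeasurableSet (univ ×ˢ R : Set (ℝ × E3)) := MeasurableSet.univ.prod hR
  have h1 : ∫⁻ ζ, f ζ = ∫⁻ ζ in charLine lm w '' (univ ×ˢ R), f ζ :=
    (setLIntegral_eq_of_support_subset fun ζ hζ => hsupp ζ hζ).symm
  rw [h1, lintegral_image_eq_lintegral_abs_det_fderiv_mul volume hm
    (fun ξ _ => (hasFDerivAt_charLine lm w ξ).hasFDerivWithinAt) (injOn_charLine hw hpos)]
  have hfm : Measurable fun p : ℝ × E3 => f (charLine lm w p) :=
    hf.comp (continuous_charLine lm w).measurable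
  have htm : Measurable fun p : ℝ × E3 => ENNReal.ofReal (transv lm w p.2) :=
    ((continuous_transv lm w).measurable.comp measurable_snd).ennreal_ofReal
  have h2 : ∫⁻ p in univ ×ˢ R, ENNReal.ofReal |(charLineDeriv lm w p).det| * f (charLine lm w p)
      = ∫⁻ p in univ ×ˢ R, ENNReal.ofReal (transv lm w p.2) * f (charLine lm w p) := by
    refine setLIntegral_congr_fun hm fun p hp => ?_
    rw [det_charLineDeriv, abs_of_pos (hpos p.2 hp.2)]
  rw [h2, Measure.volume_eq_prod, ← Measure.prod_restrict, Measure.restrict_univ,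
    lintegral_prod_symm' (fun p : ℝ × E3 => ENNReal.ofReal (transv lm w p.2) * f (charLine lm w p))
      (htm.mul hfm)]
  refine lintegral_congr fun ξ => ?_
  have hfm' : Measurable fun h : ℝ => f (charLine lm w (h, ξ)) :=
    hfm.comp (measurable_id.prodMk measurable_const)
  exact lintegral_const_mul (ENNReal.ofReal (transv lm w ξ)) hfm'

lemma integral_charLine (hw : ‖w‖ = 1) (hR : MeasurableSet R)
    (hpos : ∀ ξ ∈ R, 0 < transv lm w ξ) {f : ℝ × E3 → ℂ} (hf : Integrable f)
    (hsupp : ∀ ζ, f ζ ≠ 0 → ζ ∈ charLine lm w '' (univ ×ˢ R)) :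
    ∫ ζ, f ζ = ∫ ξ in R, (transv lm w ξ : ℂ) * ∫ h, f (charLine lm w (h, ξ)) := by
  have hm : MeasurableSet (univ ×ˢ R : Set (ℝ × E3)) := MeasurableSet.univ.prod hR
  have h1 : ∫ ζ, f ζ = ∫ ζ in charLine lm w '' (univ ×ˢ R), f ζ :=
    (setIntegral_eq_integral_of_forall_compl_eq_zero fun ζ hζ => by
      by_contra h; exact hζ (hsupp ζ h)).symm
  have hd := fun (p : ℝ × E3) (_ : p ∈ (univ ×ˢ R : Set (ℝ × E3))) =>
    (hasFDerivAt_charLine lm w p).hasFDerivWithinAt (s := univ ×ˢ R)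
  have hI := (integrableOn_image_iff_integrableOn_abs_det_fderiv_smul volume hm hd
    (injOn_charLine hw hpos) f).1 hf.integrableOn
  rw [h1, integral_image_eq_integral_abs_det_fderiv_smul volume hm hd (injOn_charLine hw hpos)]
  have hc : EqOn (fun p : ℝ × E3 => |(charLineDeriv lm w p).det| • f (charLine lm w p))
      (fun p => (transv lm w p.2 : ℂ) * f (charLine lm w p)) (univ ×ˢ R) := by
    intro p hp
    simp only
    rw [det_charLineDeriv, abs_of_pos (hpos p.2 hp.2), Complex.real_smul]
  rw [setIntegral_congr_fun hm hc]
  have hI' := hI.congr_fun hc hm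
  rw [IntegrableOn, Measure.volume_eq_prod, ← Measure.prod_restrict, Measure.restrict_univ] at hI'
  rw [Measure.volume_eq_prod, ← Measure.prod_restrict, Measure.restrict_univ,
    integral_prod_symm _ hI']
  refine integral_congr_ae (Eventually.of_forall fun ξ => ?_)
  simp only
  rw [integral_const_mul]

lemma isFiniteMeasure_of_isCompact (hR : IsCompact R) :
    volume (charProj lm w '' R) < ⊤ :=
  (hR.image (continuous_charProj lm w)).measure_lt_top

end ChangeOfVariables

/-! ### Free waves on tilted hyperplanes -/

lemma pair_frameMap_charPt {lm : ℝ} {w : E3} (hw : ‖w‖ = 1) (s : ℝ) (Y ξ : E3) :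
    pair (frameMap lm w (s, Y)) (charPt ξ) = s * charTime lm w ξ + ⟪Y, charProj lm w ξ⟫ := by
  rw [← frameMap_charPt hw (lm := lm), pair_frameMap hw]
  rfl

lemma freeWave_eq (f : L2) (z : ℝ × E3) :
    freeWave f z = (((2 * Real.pi) ^ 3 : ℝ) : ℂ)⁻¹ *
      ∫ ξ : E3, Complex.exp (Complex.I * (pair z (charPt ξ) : ℂ)) * hat f ξ := by
  simp only [freeWave, pair, charPt, add_comm]

/-- The energy estimate on hyperplanes `t_{λ,ω} = s`: in the frequency coordinates of the
hyperplane the transversality factor is the Jacobian. -/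
lemma eLpNorm_freeWave_slice_le {lm : ℝ} {w : E3} (hw : ‖w‖ = 1) {R : Set E3} (hR : IsCompact R)
    {d₀ : ℝ} (hd₀ : 0 < d₀) (hd : ∀ ξ ∈ R, d₀ ≤ transv lm w ξ) {f : L2} (hf : FreqSupportedIn f R)
    (s : ℝ) : eLpNorm (fun Y : E3 => freeWave f (frameMap lm w (s, Y))) 2
      ≤ ENNReal.ofReal (√(frameNorm lm / d₀)) * ‖f‖ₑ := by
  have hN := frameNorm_pos lm
  have hRm : MeasurableSet R := hR.measurableSet
  have hpos : ∀ ξ ∈ R, 0 < transv lm w ξ := fun ξ hξ => hd₀.trans_le (hd ξ hξ)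
  set a : E3 → ℂ := (aestronglyMeasurable_hat f).mk (hat f) with ha
  have ham : Measurable a := (aestronglyMeasurable_hat f).stronglyMeasurable_mk.measurable
  have hae : hat f =ᵐ[volume] a := (aestronglyMeasurable_hat f).ae_eq_mk
  -- the Fourier transform of the restriction to the hyperplane, as a function on the image of `R`
  have hemb : MeasurableEmbedding (R.domRestrict (charProj lm w)) :=
    ContinuousOn.measurableEmbedding hRm (continuous_charProj lm w).continuousOn
      (injOn_charProj hw hpos)
  obtain ⟨ψ, hψm, hψ⟩ := hemb.exists_measurable_extend
    (g := fun ξ : R => Complex.exp (Complex.I * ((s * charTime lm w ξ : ℝ) : ℂ)) * a ξ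
      * ((frameNorm lm / transv lm w ξ : ℝ) : ℂ))
    (by
      have h1 : Measurable (charTime lm w) := (continuous_charTime lm w).measurable
      have h2 : Measurable (transv lm w) := (continuous_transv lm w).measurable
      fun_prop) (fun _ => ⟨0⟩)
  have hψ' : ∀ ξ ∈ R, ψ (charProj lm w ξ)
      = Complex.exp (Complex.I * ((s * charTime lm w ξ : ℝ) : ℂ)) * a ξ
      * ((frameNorm lm / transv lm w ξ : ℝ) : ℂ) := fun ξ hξ => congrFun hψ ⟨ξ, hξ⟩
  have hTm : MeasurableSet (charProj lm w '' R) :=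
    (hR.image (continuous_charProj lm w)).measurableSet
  set φ : E3 → ℂ := (charProj lm w '' R).indicator ψ with hφ
  have hwave : ∀ Y, freeWave f (frameMap lm w (s, Y))
      = (((2 * Real.pi) ^ 3 : ℝ) : ℂ)⁻¹ * synth φ Y := by
    intro Y
    rw [freeWave_eq]
    congr 1
    have e1 : synth φ Y = ∫ η in charProj lm w '' R,
        Complex.exp (Complex.I * ((⟪Y, η⟫ : ℝ) : ℂ)) * ψ η := by
      rw [← integral_indicator hTm]
      refine integral_congr_ae (Eventually.of_forall fun η => ?_)
      by_cases h : η ∈ charProj lm w '' R <;> simp [hφ, h]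
    rw [e1, integral_charProj hw hRm hpos]
    rw [← integral_indicator hRm]
    refine integral_congr_ae ?_
    filter_upwards [hae, hf] with ξ h1 h2
    by_cases h : ξ ∈ R
    · rw [indicator_of_mem h, hψ' ξ h, pair_frameMap_charPt hw, h1, Complex.ofReal_add, mul_add,
        Complex.exp_add]
      have hne : (transv lm w ξ : ℂ) ≠ 0 := by exact_mod_cast (hpos ξ h).ne'
      have hne' : (frameNorm lm : ℂ) ≠ 0 := by exact_mod_cast hN.ne'
      push_cast
      field_simp
    · rw [indicator_of_notMem h, h2 h, mul_zero]
  have hsq : ∫⁻ η, ‖φ η‖ₑ ^ 2 ≤ (ENNReal.ofReal (√(frameNorm lm / d₀)) *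
      (ENNReal.ofReal planch * ‖f‖ₑ)) ^ 2 := by
    have e1 : ∫⁻ η, ‖φ η‖ₑ ^ 2 = ∫⁻ η in charProj lm w '' R, ‖ψ η‖ₑ ^ 2 := by
      rw [← lintegral_indicator hTm]
      refine lintegral_congr fun η => ?_
      by_cases h : η ∈ charProj lm w '' R <;> simp [hφ, h]
    rw [e1, lintegral_charProj hw hRm hpos, ← eLpNorm_hat, mul_pow, eLpNorm_two_sq,
      ← ENNReal.ofReal_pow (Real.sqrt_nonneg _), Real.sq_sqrt (by positivity)]
    calc _ ≤ ∫⁻ ξ in R, ENNReal.ofReal (frameNorm lm / d₀) * ‖a ξ‖ₑ ^ 2 := by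
          refine setLIntegral_mono' hRm fun ξ hξ => ?_
          have hD := hpos ξ hξ
          rw [hψ' ξ hξ, enorm_mul, enorm_mul]
          have e2 : ‖Complex.exp (Complex.I * ((s * charTime lm w ξ : ℝ) : ℂ))‖ₑ = 1 := by
            rw [← ofReal_norm, mul_comm, Complex.norm_exp_ofReal_mul_I, ENNReal.ofReal_one]
          have e3 : ‖((frameNorm lm / transv lm w ξ : ℝ) : ℂ)‖ₑ
              = ENNReal.ofReal (frameNorm lm / transv lm w ξ) := by
            rw [← ofReal_norm, Complex.norm_real, Real.norm_of_nonneg (by positivity)]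
          rw [e2, e3, one_mul, mul_pow, mul_left_comm, ← ENNReal.ofReal_pow (by positivity),
            ← ENNReal.ofReal_mul (by positivity), mul_comm]
          gcongr
          rw [show transv lm w ξ / frameNorm lm * (frameNorm lm / transv lm w ξ) ^ 2
            = frameNorm lm / transv lm w ξ by field_simp]
          exact div_le_div_of_nonneg_left hN.le hd₀ (hd ξ hξ)
      _ ≤ ∫⁻ ξ, ENNReal.ofReal (frameNorm lm / d₀) * ‖a ξ‖ₑ ^ 2 := setLIntegral_le_lintegral _ _
      _ = _ := by
          rw [lintegral_const_mul _ (ham.enorm.pow_const 2)]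
          congr 1
          refine lintegral_congr_ae ?_
          filter_upwards [hae] with ξ h
          rw [h]
  have hle := eLpNorm_two_le_of_sq hsq
  have hm : MemLp φ 2 := ⟨(hψm.indicator hTm).aestronglyMeasurable, hle.trans_lt
    (ENNReal.mul_lt_top ENNReal.ofReal_lt_top (ENNReal.mul_lt_top ENNReal.ofReal_lt_top
      enorm_lt_top))⟩
  have hm1 : Integrable φ := by
    have : IsFiniteMeasure (volume.restrict (charProj lm w '' R)) :=
      ⟨by simpa using isFiniteMeasure_of_isCompact hR⟩
    have h1 : MemLp φ 2 (volume.restrict (charProj lm w '' R)) := hm.restrict _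
    have h2 : IntegrableOn φ (charProj lm w '' R) := h1.integrable (by norm_num)
    exact (integrableOn_iff_integrable_of_support_subset (support_indicator_subset)).1 h2
  simp only [hwave]
  have e4 : eLpNorm (fun Y => (((2 * Real.pi) ^ 3 : ℝ) : ℂ)⁻¹ * synth φ Y) 2 volume
      = ‖(((2 * Real.pi) ^ 3 : ℝ) : ℂ)⁻¹‖ₑ * eLpNorm (synth φ) 2 :=
    eLpNorm_const_smul ((((2 * Real.pi) ^ 3 : ℝ) : ℂ)⁻¹) (synth φ) 2 volume
  rw [e4, eLpNorm_synth hm1 hm]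
  have e5 : ‖(((2 * Real.pi) ^ 3 : ℝ) : ℂ)⁻¹‖ₑ * (ENNReal.ofReal planch * ENNReal.ofReal planch)
      = 1 := by
    rw [← ENNReal.ofReal_mul planch_pos.le, ← sq, planch_sq, ← ofReal_norm, norm_inv,
      Complex.norm_real, Real.norm_of_nonneg (by positivity), ← ENNReal.ofReal_mul (by positivity),
      inv_mul_cancel₀ (by positivity), ENNReal.ofReal_one]
  calc _ ≤ ‖(((2 * Real.pi) ^ 3 : ℝ) : ℂ)⁻¹‖ₑ * (ENNReal.ofReal planch *
        (ENNReal.ofReal (√(frameNorm lm / d₀)) * (ENNReal.ofReal planch * ‖f‖ₑ))) := by gcongr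
    _ = (‖(((2 * Real.pi) ^ 3 : ℝ) : ℂ)⁻¹‖ₑ * (ENNReal.ofReal planch * ENNReal.ofReal planch))
        * (ENNReal.ofReal (√(frameNorm lm / d₀)) * ‖f‖ₑ) := by ring
    _ = _ := by rw [e5, one_mul]

/-! ### Fibre integrals and pairings in mixed norms -/

lemma lintegral_inv_one_add_sq :
    ∫⁻ σ : ℝ, ENNReal.ofReal ((1 + σ ^ 2)⁻¹) = ENNReal.ofReal Real.pi := by
  rw [← integral_univ_inv_one_add_sq, ofReal_integral_eq_lintegral_ofReal integrable_inv_one_add_sq]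
  exact Eventually.of_forall fun σ => by positivity

/-- Cauchy–Schwarz in the fibres with the weight `1 + σ²`. -/
lemma lintegral_fiber_sq_le {f : ℝ × E3 → ℝ≥0∞} (hf : Measurable f) :
    ∫⁻ η : E3, (∫⁻ σ : ℝ, f (σ, η)) ^ 2
      ≤ ENNReal.ofReal Real.pi * ∫⁻ p : ℝ × E3, ENNReal.ofReal (1 + p.1 ^ 2) * f p ^ 2 := by
  have hm : Measurable fun p : ℝ × E3 => ENNReal.ofReal (1 + p.1 ^ 2) * f p ^ 2 := by fun_prop
  rw [Measure.volume_eq_prod, lintegral_prod_symm' _ hm,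
    ← lintegral_const_mul _ (Measurable.lintegral_prod_left hm)]
  gcongr with η
  have h := lintegral_mul_sq_le (μ := (volume : Measure ℝ))
    (f := fun σ : ℝ => ENNReal.ofReal (√((1 + σ ^ 2)⁻¹)))
    (g := fun σ : ℝ => ENNReal.ofReal (√(1 + σ ^ 2)) * f (σ, η))
    (by fun_prop) (by fun_prop)
  have e1 : ∀ σ : ℝ, ENNReal.ofReal (√((1 + σ ^ 2)⁻¹)) * (ENNReal.ofReal (√(1 + σ ^ 2)) * f (σ, η))
      = f (σ, η) := by
    intro σ
    rw [← mul_assoc, ← ENNReal.ofReal_mul (by positivity), ← Real.sqrt_mul (by positivity),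
      inv_mul_cancel₀ (by positivity), Real.sqrt_one, ENNReal.ofReal_one, one_mul]
  have e2 : ∀ σ : ℝ, ENNReal.ofReal (√((1 + σ ^ 2)⁻¹)) ^ 2 = ENNReal.ofReal ((1 + σ ^ 2)⁻¹) := by
    intro σ
    rw [← ENNReal.ofReal_pow (by positivity), Real.sq_sqrt (by positivity)]
  have e3 : ∀ σ : ℝ, (ENNReal.ofReal (√(1 + σ ^ 2)) * f (σ, η)) ^ 2
      = ENNReal.ofReal (1 + σ ^ 2) * f (σ, η) ^ 2 := by
    intro σ
    rw [mul_pow, ← ENNReal.ofReal_pow (by positivity), Real.sq_sqrt (by positivity)]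
  simp only [e1, e2, e3, lintegral_inv_one_add_sq] at h
  exact h

lemma pair_self_nonneg (z : ℝ × E3) : 0 ≤ pair z z := by
  rw [pair, real_inner_self_eq_norm_sq]; nlinarith [sq_nonneg z.1, sq_nonneg ‖z.2‖]

lemma measurable_pair_self : Measurable fun z : ℝ × E3 => pair z z :=
  (continuous_pair.comp (continuous_id.prodMk continuous_id)).measurable

lemma norm_phase (r : ℝ) : ‖Complex.exp (Complex.I * (r : ℂ))‖ = 1 := by
  rw [mul_comm, Complex.norm_exp_ofReal_mul_I]

lemma enorm_phase (r : ℝ) : ‖Complex.exp (Complex.I * (r : ℂ))‖ₑ = 1 := by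
  rw [← ofReal_norm, norm_phase, ENNReal.ofReal_one]

lemma integrable_phase_mul {α : Type*} [MeasurableSpace α] {μ : Measure α} {f : α → ℂ}
    (hf : Integrable f μ) {a : α → ℝ} (ha : AEStronglyMeasurable a μ) :
    Integrable (fun x => Complex.exp (Complex.I * (a x : ℂ)) * f x) μ := by
  refine hf.bdd_mul (c := 1) ?_ (Eventually.of_forall fun x => (norm_phase _).le)
  exact Complex.continuous_exp.comp_aestronglyMeasurable
    ((Complex.continuous_ofReal.comp_aestronglyMeasurable ha).const_mul _)

lemma hatST_eq (φ : ℝ × E3 → ℂ) (z : ℝ × E3) :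
    hatST φ z = ∫ ζ : ℝ × E3, Complex.exp (Complex.I * (pair (-z) ζ : ℂ)) * φ ζ := by
  refine integral_congr_ae (Eventually.of_forall fun ζ => ?_)
  simp only [pair, Prod.fst_neg, Prod.snd_neg, inner_neg_left]
  congr 2
  push_cast
  ring

section Frame

variable {lm : ℝ} {w : E3}

lemma integral_frameMap (hw : ‖w‖ = 1) (hlm : lm ≠ 0) (f : ℝ × E3 → ℂ) :
    ∫ p, f (frameMap lm w p) = ∫ ζ, f ζ :=
  (measurePreserving_frameMap hw hlm).integral_comp (measurableEmbedding_frameMap hw hlm) f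

lemma lintegral_frameMap (hw : ‖w‖ = 1) (hlm : lm ≠ 0) (f : ℝ × E3 → ℝ≥0∞) :
    ∫⁻ p, f (frameMap lm w p) = ∫⁻ ζ, f ζ :=
  (measurePreserving_frameMap hw hlm).lintegral_comp_emb (measurableEmbedding_frameMap hw hlm) f

lemma integrable_frameMap (hw : ‖w‖ = 1) (hlm : lm ≠ 0) {f : ℝ × E3 → ℂ} (hf : Integrable f) :
    Integrable fun p => f (frameMap lm w p) :=
  ((measurePreserving_frameMap hw hlm).integrable_comp_emb
    (measurableEmbedding_frameMap hw hlm)).2 hf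

/-- Restricting a space-time synthesis integral to a hyperplane amounts to integrating out the dual
variable of `t_{λ,ω}`. -/
lemma integral_phase_frameMap (hw : ‖w‖ = 1) (hlm : lm ≠ 0) {F : ℝ × E3 → ℂ} (hF : Integrable F)
    (s : ℝ) (Y : E3) :
    ∫ ζ, Complex.exp (Complex.I * (pair (frameMap lm w (s, Y)) ζ : ℂ)) * F ζ
      = synth (fun η => ∫ σ : ℝ, Complex.exp (Complex.I * ((s * σ : ℝ) : ℂ))
          * F (frameMap lm w (σ, η))) Y := by
  rw [← integral_frameMap hw hlm, Measure.volume_eq_prod, integral_prod_symm]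
  · refine integral_congr_ae (Eventually.of_forall fun η => ?_)
    simp only
    rw [← integral_const_mul]
    refine integral_congr_ae (Eventually.of_forall fun σ => ?_)
    simp only [pair_frameMap hw]
    rw [← mul_assoc, ← Complex.exp_add, ← mul_add, ← Complex.ofReal_add]
    simp only [pair, add_comm]
  · exact integrable_frameMap hw hlm (f := fun ζ =>
      Complex.exp (Complex.I * (pair (frameMap lm w (s, Y)) ζ : ℂ)) * F ζ)
      (integrable_phase_mul hF (continuous_pair.comp
        (continuous_const.prodMk continuous_id)).aestronglyMeasurable)

/-- The square of the `L²` norm with the weight `(1 + |ζ|²)^{1/2}`. -/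
def wsq (φ : ℝ × E3 → ℂ) : ℝ≥0∞ := ∫⁻ ζ, ENNReal.ofReal (1 + pair ζ ζ) * ‖φ ζ‖ₑ ^ 2

lemma lintegral_fiber_frameMap_sq_le (hw : ‖w‖ = 1) (hlm : lm ≠ 0) {F : ℝ × E3 → ℂ}
    (hF : Measurable F) :
    ∫⁻ η : E3, (∫⁻ σ : ℝ, ‖F (frameMap lm w (σ, η))‖ₑ) ^ 2
      ≤ ENNReal.ofReal Real.pi * wsq F := by
  have hm := (continuous_frameMap lm w).measurable
  refine (lintegral_fiber_sq_le (f := fun p => ‖F (frameMap lm w p)‖ₑ) (by fun_prop)).trans ?_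
  gcongr
  rw [wsq, ← lintegral_frameMap hw hlm (fun ζ => ENNReal.ofReal (1 + pair ζ ζ) * ‖F ζ‖ₑ ^ 2)]
  gcongr with p
  rw [pair_frameMap hw, pair, real_inner_self_eq_norm_sq]
  nlinarith [sq_nonneg ‖p.2‖]

/-- Weighted `L²` functions with integrable values have space-time synthesis integrals whose
restrictions to hyperplanes are bounded in `L²`. -/
lemma eLpNorm_synth_slice_le (hw : ‖w‖ = 1) (hlm : lm ≠ 0) {F : ℝ × E3 → ℂ} (hF : Measurable F)
    (hFi : Integrable F) (hFw : wsq F < ⊤) (s : ℝ) :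
    MemLp (fun η => ∫ σ : ℝ, Complex.exp (Complex.I * ((s * σ : ℝ) : ℂ))
          * F (frameMap lm w (σ, η))) 2 ∧
    Integrable (fun η => ∫ σ : ℝ, Complex.exp (Complex.I * ((s * σ : ℝ) : ℂ))
          * F (frameMap lm w (σ, η))) ∧
    eLpNorm (fun η => ∫ σ : ℝ, Complex.exp (Complex.I * ((s * σ : ℝ) : ℂ))
          * F (frameMap lm w (σ, η))) 2
      ≤ ENNReal.ofReal (√Real.pi) * wsq F ^ (1 / 2 : ℝ) := by
  set H : E3 → ℂ := fun η => ∫ σ : ℝ, Complex.exp (Complex.I * ((s * σ : ℝ) : ℂ))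
          * F (frameMap lm w (σ, η)) with hH
  have hI : Integrable (fun p : ℝ × E3 => Complex.exp (Complex.I * ((s * p.1 : ℝ) : ℂ))
          * F (frameMap lm w p)) :=
    integrable_phase_mul (integrable_frameMap hw hlm hFi) (by fun_prop)
  have hHi : Integrable H := hI.integral_prod_right
  have hle : eLpNorm H 2 ≤ ENNReal.ofReal (√Real.pi) * wsq F ^ (1 / 2 : ℝ) := by
    refine eLpNorm_two_le_of_sq ?_
    rw [mul_pow, ← ENNReal.ofReal_pow (by positivity), Real.sq_sqrt (by positivity),
      ← ENNReal.rpow_natCast (wsq F ^ (1 / 2 : ℝ)), ← ENNReal.rpow_mul]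
    norm_num
    refine le_trans ?_ (lintegral_fiber_frameMap_sq_le hw hlm hF)
    gcongr with η
    refine (enorm_integral_le_lintegral_enorm _).trans (le_of_eq ?_)
    refine lintegral_congr fun σ => ?_
    rw [enorm_mul, enorm_phase, one_mul]
  refine ⟨⟨hHi.1, hle.trans_lt (ENNReal.mul_lt_top ENNReal.ofReal_lt_top
    (ENNReal.rpow_lt_top_of_nonneg (by norm_num) hFw.ne))⟩, hHi, hle⟩

/-- The constant in the `L^∞ L²` bound for Fourier transforms of weighted `L²` functions. -/
def sliceConst : ℝ≥0∞ := ENNReal.ofReal planch * ENNReal.ofReal (√Real.pi)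

lemma eLpNorm_hatST_slice_le (hw : ‖w‖ = 1) (hlm : lm ≠ 0) {φ : ℝ × E3 → ℂ} (hφ : Measurable φ)
    (hφi : Integrable φ) (hφw : wsq φ < ⊤) (s : ℝ) :
    eLpNorm (fun Y => hatST φ (frameMap lm w (s, Y))) 2
      ≤ sliceConst * wsq φ ^ (1 / 2 : ℝ) := by
  obtain ⟨h1, h2, h3⟩ := eLpNorm_synth_slice_le hw hlm hφ hφi hφw (-s)
  have e : (fun Y => hatST φ (frameMap lm w (s, Y)))
      = (synth fun η => ∫ σ : ℝ, Complex.exp (Complex.I * ((-s * σ : ℝ) : ℂ))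
          * φ (frameMap lm w (σ, η))) ∘ fun Y => -Y := by
    ext Y
    rw [hatST_eq, ← map_neg, Prod.neg_mk, integral_phase_frameMap hw hlm hφi]
    rfl
  rw [e, eLpNorm_comp_measurePreserving (continuous_synth h2).aestronglyMeasurable
    (Measure.measurePreserving_neg volume), eLpNorm_synth h2 h1, sliceConst, mul_assoc]
  gcongr

/-- Pairing of `L¹_{t_{λ,ω}} L²_{x_{λ,ω}}` with `L^∞_{t_{λ,ω}} L²_{x_{λ,ω}}`. -/
lemma lintegral_mul_le_mixed (hw : ‖w‖ = 1) (hlm : lm ≠ 0) {g θ : ℝ × E3 → ℂ}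
    (hg : Measurable g) (hθ : Measurable θ) {S : ℝ≥0∞}
    (hS : ∀ s, eLpNorm (fun Y => θ (frameMap lm w (s, Y))) 2 ≤ S) :
    ∫⁻ z, ‖g z * θ z‖ₑ ≤ (∫⁻ s, eLpNorm (fun Y => g (frameMap lm w (s, Y))) 2) * S := by
  have hm := (continuous_frameMap lm w).measurable
  rw [← lintegral_frameMap hw hlm, Measure.volume_eq_prod, lintegral_prod]
  · have hgm : Measurable fun s => eLpNorm (fun Y => g (frameMap lm w (s, Y))) 2 volume :=
      measurable_eLpNorm_two (F := fun s Y => g (frameMap lm w (s, Y))) (hg.comp hm)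
    rw [← lintegral_mul_const _ hgm]
    gcongr with s
    refine le_trans ?_ (mul_le_mul_right (hS s) _)
    rw [← ENNReal.pow_le_pow_left_iff (n := 2) (by norm_num), mul_pow, eLpNorm_two_sq,
      eLpNorm_two_sq]
    simp only [enorm_mul]
    exact lintegral_mul_sq_le (by fun_prop) (by fun_prop)
  · exact ((hg.comp hm).mul (hθ.comp hm)).enorm.aemeasurable

end Frame

/-! ### The space-time Fourier transform of the forcing -/

/-- The Riesz representation theorem in `L²` for functionals given on functions. -/
lemma exists_memLp_of_bounded_functional {α : Type*} [MeasurableSpace α] {μ : Measure α}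
    {T : (α → ℂ) → ℂ} (hcongr : ∀ φ ψ, φ =ᵐ[μ] ψ → T φ = T ψ)
    (hadd : ∀ φ ψ, Measurable φ → Measurable ψ → MemLp φ 2 μ → MemLp ψ 2 μ →
      T (fun x => φ x + ψ x) = T φ + T ψ)
    (hsmul : ∀ (c : ℂ) φ, T (fun x => c * φ x) = c * T φ) {C : ℝ≥0∞} (hC : C < ⊤)
    (hbd : ∀ φ, Measurable φ → MemLp φ 2 μ → ‖T φ‖ₑ ≤ C * eLpNorm φ 2 μ) :
    ∃ F : α → ℂ, Measurable F ∧ MemLp F 2 μ ∧ ∀ φ : α → ℂ, Measurable φ → MemLp φ 2 μ →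
      T φ = ∫ x, F x * φ x ∂μ := by
  have hm : ∀ φ : Lp ℂ 2 μ, Measurable φ := fun φ => (Lp.stronglyMeasurable φ).measurable
  have hadd' : ∀ φ ψ : Lp ℂ 2 μ, T (φ + ψ : Lp ℂ 2 μ) = T φ + T ψ := by
    intro φ ψ
    rw [← hadd φ ψ (hm φ) (hm ψ) (Lp.memLp φ) (Lp.memLp ψ)]
    exact hcongr _ _ (Lp.coeFn_add φ ψ)
  have hsmul' : ∀ (c : ℂ) (φ : Lp ℂ 2 μ), T (c • φ : Lp ℂ 2 μ) = c * T φ := by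
    intro c φ
    rw [← hsmul]
    exact hcongr _ _ (Lp.coeFn_smul c φ)
  have hbd' : ∀ φ : Lp ℂ 2 μ, ‖T φ‖ ≤ C.toReal * ‖φ‖ := by
    intro φ
    have h1 := hbd φ (hm φ) (Lp.memLp φ)
    rw [← Lp.enorm_def] at h1
    have h2 := ENNReal.toReal_mono (ENNReal.mul_lt_top hC enorm_lt_top).ne h1
    rwa [ENNReal.toReal_mul, toReal_enorm, toReal_enorm] at h2
  obtain ⟨ℓ, hℓ⟩ : ∃ ℓ : StrongDual ℂ (Lp ℂ 2 μ), ∀ φ : Lp ℂ 2 μ, ℓ φ = T φ :=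
    ⟨LinearMap.mkContinuous ⟨⟨fun φ => T φ, hadd'⟩, hsmul'⟩ C.toReal hbd', fun φ => rfl⟩
  obtain ⟨y, hy⟩ : ∃ y : Lp ℂ 2 μ, ∀ φ, inner ℂ y φ = ℓ φ :=
    ⟨(InnerProductSpace.toDual ℂ _).symm ℓ, fun φ => InnerProductSpace.toDual_symm_apply⟩
  refine ⟨fun x => (starRingEnd ℂ) (y x), Complex.continuous_conj.measurable.comp (hm y),
    (Lp.memLp y).star, fun φ hφ h2 => ?_⟩
  rw [hcongr φ (h2.toLp φ) h2.coeFn_toLp.symm, ← hℓ, ← hy, L2.inner_def]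
  refine integral_congr_ae ?_
  filter_upwards [h2.coeFn_toLp] with ζ hζ
  rw [hζ, RCLike.inner_apply, mul_comm]

lemma continuous_integral_phase {F : ℝ × E3 → ℂ} (hF : Integrable F) :
    Continuous fun z => ∫ ζ, Complex.exp (Complex.I * (pair z ζ : ℂ)) * F ζ := by
  refine continuous_of_dominated (bound := fun ζ => ‖F ζ‖) (fun z => ?_) (fun z => ?_) hF.norm ?_
  · exact (integrable_phase_mul hF (continuous_pair.comp
        (continuous_const.prodMk continuous_id)).aestronglyMeasurable).1
  · exact Eventually.of_forall fun ζ => by rw [norm_mul, norm_phase, one_mul]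
  · refine Eventually.of_forall fun ζ => ?_
    unfold pair
    fun_prop

lemma continuous_hatST {φ : ℝ × E3 → ℂ} (hφ : Integrable φ) : Continuous (hatST φ) :=
  ((continuous_integral_phase hφ).comp continuous_neg).congr fun z => (hatST_eq φ z).symm

lemma hatST_add {φ ψ : ℝ × E3 → ℂ} (hφ : Integrable φ) (hψ : Integrable ψ) (z : ℝ × E3) :
    hatST (fun ζ => φ ζ + ψ ζ) z = hatST φ z + hatST ψ z := by
  simp only [hatST_eq, mul_add]
  have hm : AEStronglyMeasurable (fun ζ => pair (-z) ζ) volume :=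
    (continuous_pair.comp (continuous_const.prodMk continuous_id)).aestronglyMeasurable
  exact integral_add (integrable_phase_mul hφ hm) (integrable_phase_mul hψ hm)

lemma hatST_smul (c : ℂ) (φ : ℝ × E3 → ℂ) (z : ℝ × E3) :
    hatST (fun ζ => c * φ ζ) z = c * hatST φ z := by
  simp only [hatST_eq, ← integral_const_mul]
  congr 1; ext ζ; ring

lemma hatST_congr {φ ψ : ℝ × E3 → ℂ} (h : φ =ᵐ[volume] ψ) : hatST φ = hatST ψ := by
  ext z
  refine integral_congr_ae ?_
  filter_upwards [h] with ζ hζ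
  rw [hζ]

lemma wsq_indicator_le (r : ℝ) (φ : ℝ × E3 → ℂ) :
    wsq ((Metric.closedBall 0 r).indicator φ)
      ≤ ENNReal.ofReal (1 + 2 * r ^ 2) * eLpNorm φ 2 ^ 2 := by
  rw [eLpNorm_two_sq, wsq, ← lintegral_const_mul' _ _ ENNReal.ofReal_ne_top]
  refine lintegral_mono fun ζ => ?_
  by_cases h : ζ ∈ Metric.closedBall (0 : ℝ × E3) r
  · rw [indicator_of_mem h]
    gcongr
    rw [mem_closedBall_zero_iff, Prod.norm_def, max_le_iff] at h
    rw [pair, real_inner_self_eq_norm_sq, ← sq]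
    have h1 : ζ.1 ^ 2 ≤ r ^ 2 := sq_le_sq' (by linarith [neg_abs_le ζ.1, h.1, Real.norm_eq_abs ζ.1])
      (by linarith [le_abs_self ζ.1, h.1, Real.norm_eq_abs ζ.1])
    have h2 : ‖ζ.2‖ ^ 2 ≤ r ^ 2 := by gcongr; exact h.2
    linarith
  · rw [indicator_of_notMem h]; simp

lemma integrable_indicator_closedBall {φ : ℝ × E3 → ℂ} (hφ : MemLp φ 2) (r : ℝ) :
    Integrable ((Metric.closedBall 0 r).indicator φ) := by
  rw [integrable_indicator_iff measurableSet_closedBall]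
  have : IsFiniteMeasure (volume.restrict (Metric.closedBall (0 : ℝ × E3) r)) :=
    ⟨by simpa using measure_closedBall_lt_top⟩
  exact (hφ.restrict _).integrable (by norm_num)

section Forcing

variable {lm : ℝ} {w : E3} {g : ℝ × E3 → ℂ}

/-- The norm of `L¹_{t_{λ,ω}} L²_{x_{λ,ω}}` in the coordinates of `frameMap`. -/
def mixedNorm (lm : ℝ) (w : E3) (g : ℝ × E3 → ℂ) : ℝ≥0∞ :=
  ∫⁻ s, eLpNorm (fun Y => g (frameMap lm w (s, Y))) 2

lemma integrable_mul_hatST (hw : ‖w‖ = 1) (hlm : lm ≠ 0) (hg : Measurable g)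
    (hgN : mixedNorm lm w g < ⊤) {φ : ℝ × E3 → ℂ} (hφ : Measurable φ)
    (hφi : Integrable φ) (hφw : wsq φ < ⊤) :
    Integrable (fun z => g z * hatST φ z) ∧
    ‖∫ z, g z * hatST φ z‖ₑ ≤ mixedNorm lm w g * (sliceConst * wsq φ ^ (1 / 2 : ℝ)) := by
  have h := lintegral_mul_le_mixed hw hlm hg (continuous_hatST hφi).measurable
    (eLpNorm_hatST_slice_le hw hlm hφ hφi hφw)
  have hfin : sliceConst * wsq φ ^ (1 / 2 : ℝ) < ⊤ :=
    ENNReal.mul_lt_top (ENNReal.mul_lt_top ENNReal.ofReal_lt_top ENNReal.ofReal_lt_top)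
      (ENNReal.rpow_lt_top_of_nonneg (by norm_num) hφw.ne)
  refine ⟨⟨(hg.mul (continuous_hatST hφi).measurable).aestronglyMeasurable,
    h.trans_lt (ENNReal.mul_lt_top hgN hfin)⟩, (enorm_integral_le_lintegral_enorm _).trans h⟩

/-- The Fourier transform of the forcing on a ball, as an element of `L²`, by the Riesz
representation theorem. -/
lemma exists_riesz (hw : ‖w‖ = 1) (hlm : lm ≠ 0) (hg : Measurable g)
    (hgN : mixedNorm lm w g < ⊤) (r : ℝ) :
    ∃ F : ℝ × E3 → ℂ, Measurable F ∧ MemLp F 2 ∧ ∀ φ : ℝ × E3 → ℂ, Measurable φ → MemLp φ 2 →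
      ∫ z, g z * hatST ((Metric.closedBall 0 r).indicator φ) z = ∫ ζ, F ζ * φ ζ := by
  set Q := Metric.closedBall (0 : ℝ × E3) r with hQ
  have hQm : MeasurableSet Q := measurableSet_closedBall
  have hmain : ∀ φ : ℝ × E3 → ℂ, Measurable φ → MemLp φ 2 →
      Integrable (fun z => g z * hatST (Q.indicator φ) z) ∧
      ‖∫ z, g z * hatST (Q.indicator φ) z‖ₑ
        ≤ mixedNorm lm w g * (sliceConst * wsq (Q.indicator φ) ^ (1 / 2 : ℝ)) := fun φ hφ h2 =>
    integrable_mul_hatST hw hlm hg hgN (hφ.indicator hQm) (integrable_indicator_closedBall h2 r)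
      ((wsq_indicator_le r φ).trans_lt
        (ENNReal.mul_lt_top ENNReal.ofReal_lt_top (ENNReal.pow_lt_top h2.2)))
  obtain ⟨C, hCf, hb⟩ : ∃ C : ℝ≥0∞, C < ⊤ ∧ ∀ φ : ℝ × E3 → ℂ, Measurable φ → MemLp φ 2 →
      ‖∫ z, g z * hatST (Q.indicator φ) z‖ₑ ≤ C * eLpNorm φ 2 := by
    have hK : ENNReal.ofReal (1 + 2 * r ^ 2) ≠ ⊤ := ENNReal.ofReal_ne_top
    refine ⟨mixedNorm lm w g * (sliceConst * ENNReal.ofReal (1 + 2 * r ^ 2) ^ (1 / 2 : ℝ)),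
      ENNReal.mul_lt_top hgN (ENNReal.mul_lt_top (ENNReal.mul_lt_top
      ENNReal.ofReal_lt_top ENNReal.ofReal_lt_top)
      (ENNReal.rpow_lt_top_of_nonneg (by norm_num) hK)), fun φ hφ h2 => ?_⟩
    refine (hmain φ hφ h2).2.trans ?_
    have h3 : wsq (Q.indicator φ) ^ (1 / 2 : ℝ)
        ≤ ENNReal.ofReal (1 + 2 * r ^ 2) ^ (1 / 2 : ℝ) * eLpNorm φ 2 := by
      refine (ENNReal.rpow_le_rpow (wsq_indicator_le r φ) (by norm_num)).trans (le_of_eq ?_)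
      rw [ENNReal.mul_rpow_of_nonneg _ _ (by norm_num), ← ENNReal.rpow_natCast,
        ← ENNReal.rpow_mul]
      norm_num
    rw [mul_assoc, mul_assoc]
    exact mul_le_mul_right (mul_le_mul_right h3 _) _
  refine exists_memLp_of_bounded_functional
    (T := fun φ => ∫ z, g z * hatST (Q.indicator φ) z) ?_ ?_ ?_ hCf hb
  · intro φ ψ h
    rw [hatST_congr (φ := Q.indicator φ) (ψ := Q.indicator ψ) (by
      filter_upwards [h] with ζ hζ
      by_cases hQ : ζ ∈ Q <;> simp [hQ, hζ])]
  · intro φ ψ hφ hψ hφ2 hψ2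
    rw [← integral_add (hmain φ hφ hφ2).1 (hmain ψ hψ hψ2).1]
    refine integral_congr_ae (Eventually.of_forall fun z => ?_)
    have : Q.indicator (fun ζ => φ ζ + ψ ζ) = fun ζ => Q.indicator φ ζ + Q.indicator ψ ζ :=
      indicator_add Q φ ψ
    simp only
    rw [this, hatST_add (integrable_indicator_closedBall hφ2 r)
      (integrable_indicator_closedBall hψ2 r), mul_add]
  · intro c φ
    rw [← integral_const_mul]
    refine integral_congr_ae (Eventually.of_forall fun z => ?_)
    have : Q.indicator (fun ζ => c * φ ζ) = fun ζ => c * Q.indicator φ ζ :=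
      indicator_const_smul Q c φ
    simp only
    rw [this, hatST_smul]
    ring
end Forcing

lemma pair_self_le (ζ : ℝ × E3) : pair ζ ζ ≤ 2 * ‖ζ‖ ^ 2 := by
  rw [pair, real_inner_self_eq_norm_sq, ← sq, ← sq_abs, ← Real.norm_eq_abs]
  have h1 : ‖ζ.1‖ ^ 2 ≤ ‖ζ‖ ^ 2 := by gcongr; exact norm_fst_le ζ
  have h2 : ‖ζ.2‖ ^ 2 ≤ ‖ζ‖ ^ 2 := by gcongr; exact norm_snd_le ζ
  linarith

section Forcing

variable {lm : ℝ} {w : E3} {g : ℝ × E3 → ℂ}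

lemma wsq_lt_top_of_hasCompactSupport {φ : ℝ × E3 → ℂ} (hφ : Continuous φ)
    (hc : HasCompactSupport φ) : wsq φ < ⊤ := by
  obtain ⟨r, hr⟩ := hc.isCompact.isBounded.subset_closedBall 0
  have h2 : MemLp φ 2 := hφ.memLp_of_hasCompactSupport hc
  have h := wsq_indicator_le r φ
  rw [indicator_eq_self.2 ((subset_tsupport φ).trans hr)] at h
  exact h.trans_lt (ENNReal.mul_lt_top ENNReal.ofReal_lt_top (ENNReal.pow_lt_top h2.2))

lemma tsupport_ofReal_comp {W : Type*} [TopologicalSpace W] (h : W → ℝ) :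
    tsupport (fun x => (h x : ℂ)) = tsupport h := by
  rw [tsupport, tsupport]
  congr 1
  ext x
  simp

/-- If the space-time Fourier transform of `g ∈ L¹_{t_{λ,ω}} L²_{x_{λ,ω}}` is supported in a compact
set `B`, then it is a square integrable function supported in `B`. -/
lemma exists_spaceTime_fourier (hw : ‖w‖ = 1) (hlm : lm ≠ 0) (hg : Measurable g)
    (hgN : mixedNorm lm w g < ⊤) {B : Set (ℝ × E3)} (hBc : IsCompact B)
    (hB : STFreqSupportedIn g B) :
    ∃ F : ℝ × E3 → ℂ, Measurable F ∧ MemLp F 2 ∧ (∀ ζ, ζ ∉ B → F ζ = 0) ∧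
      ∀ φ : ℝ × E3 → ℂ, ContDiff ℝ (⊤ : ℕ∞) φ → HasCompactSupport φ →
        ∫ z, g z * hatST φ z = ∫ ζ, F ζ * φ ζ := by
  obtain ⟨r, hr0, hr⟩ := hBc.isBounded.subset_closedBall_lt 0 0
  obtain ⟨F₀, hF₀m, hF₀, hF₀T⟩ := exists_riesz hw hlm hg hgN (r + 2)
  obtain ⟨ψ, hψ⟩ : ∃ ψ : ContDiffBump (0 : ℝ × E3), ψ.rIn = r + 1 ∧ ψ.rOut = r + 2 :=
    ⟨⟨r + 1, r + 2, by linarith, by linarith⟩, rfl, rfl⟩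
  have hψs : ContDiff ℝ (⊤ : ℕ∞) (fun ζ => (ψ ζ : ℂ)) := contDiff_ofReal_comp ψ.contDiff
  have hψ1 : ∀ ζ ∈ B, ψ ζ = 1 := fun ζ hζ => ψ.one_of_mem_closedBall
    (Metric.closedBall_subset_closedBall (by rw [hψ.1]; linarith) (hr hζ))
  -- the part of the test function away from `B` does not contribute, by the support assumption
  have claim1 : ∀ φ : ℝ × E3 → ℂ, ContDiff ℝ (⊤ : ℕ∞) φ → HasCompactSupport φ →
      ∫ z, g z * hatST φ z = ∫ ζ, F₀ ζ * ((ψ ζ : ℂ) * φ ζ) := by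
    intro φ hφ hc
    set φ₁ : ℝ × E3 → ℂ := fun ζ => (ψ ζ : ℂ) * φ ζ with hφ₁
    set φ₂ : ℝ × E3 → ℂ := fun ζ => (1 - (ψ ζ : ℂ)) * φ ζ with hφ₂
    have s1 : ContDiff ℝ (⊤ : ℕ∞) φ₁ := hψs.mul hφ
    have s2 : ContDiff ℝ (⊤ : ℕ∞) φ₂ := (contDiff_const.sub hψs).mul hφ
    have c1 : HasCompactSupport φ₁ := hc.mul_left
    have c2 : HasCompactSupport φ₂ := hc.mul_left
    have i1 := s1.continuous.integrable_of_hasCompactSupport (μ := volume) c1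
    have i2 := s2.continuous.integrable_of_hasCompactSupport (μ := volume) c2
    have m1 := (integrable_mul_hatST hw hlm hg hgN s1.continuous.measurable i1
      (wsq_lt_top_of_hasCompactSupport s1.continuous c1)).1
    have m2 := (integrable_mul_hatST hw hlm hg hgN s2.continuous.measurable i2
      (wsq_lt_top_of_hasCompactSupport s2.continuous c2)).1
    have e : φ = fun ζ => φ₁ ζ + φ₂ ζ := by ext ζ; simp only [hφ₁, hφ₂]; ring
    have hz : ∫ z, g z * hatST φ₂ z = 0 := by
      refine hB φ₂ s2 c2 (Set.disjoint_left.2 fun ζ h1 h2 => ?_)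
      have h3 : ζ ∈ Metric.ball (0 : ℝ × E3) (r + 1) :=
        Metric.closedBall_subset_ball (by linarith) (hr h2)
      obtain ⟨ζ', h4, h5⟩ := mem_closure_iff.1 h1 _ Metric.isOpen_ball h3
      refine h5 ?_
      have : ψ ζ' = 1 := ψ.one_of_mem_closedBall (by
        rw [hψ.1]; exact Metric.ball_subset_closedBall h4)
      simp [hφ₂, this]
    have hind : (Metric.closedBall 0 (r + 2)).indicator φ₁ = φ₁ := by
      refine indicator_eq_self.2 fun ζ hζ => ?_
      have h6 : ψ ζ ≠ 0 := fun h => hζ (by simp [hφ₁, h])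
      have h7 : ζ ∈ Function.support ψ := h6
      rw [ψ.support_eq, hψ.2] at h7
      exact Metric.ball_subset_closedBall h7
    have h8 := hF₀T φ₁ s1.continuous.measurable (s1.continuous.memLp_of_hasCompactSupport c1)
    rw [hind] at h8
    rw [← h8]
    have e2 : ∀ z, g z * hatST φ z = g z * hatST φ₁ z + g z * hatST φ₂ z := by
      intro z
      rw [← mul_add, ← hatST_add i1 i2, ← e]
    simp only [e2]
    rw [integral_add m1 m2, hz, add_zero]
  have hloc : LocallyIntegrable (fun ζ => F₀ ζ * (ψ ζ : ℂ)) volume := by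
    have : LocallyIntegrable F₀ volume := hF₀.locallyIntegrable (by norm_num)
    have h := this.smul_continuous (f := F₀) (g := fun ζ => (ψ ζ : ℂ)) hψs.continuous
    exact h
  -- so `F₀ ψ` represents `ĝ`; it vanishes off `B` because `ĝ` does
  have claim2 : ∀ᵐ ζ, ζ ∈ Bᶜ → F₀ ζ * (ψ ζ : ℂ) = 0 := by
    refine hBc.isClosed.isOpen_compl.ae_eq_zero_of_integral_contDiff_smul_eq_zero
      (hloc.locallyIntegrableOn _) fun h hh hc hsub => ?_
    have e1 := claim1 (fun x => (h x : ℂ)) (contDiff_ofReal_comp hh)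
      (hasCompactSupport_ofReal_comp hc)
    have e2 := hB (fun x => (h x : ℂ)) (contDiff_ofReal_comp hh)
      (hasCompactSupport_ofReal_comp hc) (by
        rw [tsupport_ofReal_comp]; exact Set.disjoint_left.2 fun ζ h1 => hsub h1)
    rw [e2] at e1
    rw [e1]
    refine integral_congr_ae (Eventually.of_forall fun ζ => ?_)
    simp only [Complex.real_smul]
    ring
  refine ⟨B.indicator F₀, hF₀m.indicator hBc.measurableSet, hF₀.indicator hBc.measurableSet,
    fun ζ hζ => indicator_of_notMem hζ _, fun φ hφ hc => ?_⟩
  rw [claim1 φ hφ hc]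
  refine integral_congr_ae ?_
  filter_upwards [claim2] with ζ hζ
  by_cases h : ζ ∈ B
  · rw [indicator_of_mem h, hψ1 ζ h]; simp
  · rw [indicator_of_notMem h, ← mul_assoc, hζ h, zero_mul]

/-- Every test function is the space-time Fourier transform of a Schwartz function. -/
lemma exists_schwartz_hatST_eq {θ : ℝ × E3 → ℂ} (hθ : ContDiff ℝ (⊤ : ℕ∞) θ)
    (hc : HasCompactSupport θ) :
    ∃ φ : 𝓢(ℝ × E3, ℂ), hatST φ = θ ∧ ∀ ζ, φ ζ = (((2 * Real.pi) ^ 4 : ℝ) : ℂ)⁻¹ *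
      ∫ z, Complex.exp (Complex.I * (pair z ζ : ℂ)) * θ z := by
  set V := WithLp 2 (ℝ × E3) with hV
  set e : V ≃L[ℝ] (ℝ × E3) := WithLp.prodContinuousLinearEquiv 2 ℝ ℝ E3 with he
  have hin : ∀ u v : V, ⟪u, v⟫ = pair (e u) (e v) := by
    intro u v
    rw [WithLp.prod_inner_apply]
    simp [pair, he, mul_comm]
    rfl
  have hvol : ∀ f : (ℝ × E3) → ℂ, ∫ v : V, f (e v) = ∫ z, f z := by
    intro f
    have h1 := WithLp.volume_preserving_symm_measurableEquiv_toLp_prod ℝ E3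
    exact h1.integral_comp (MeasurableEquiv.measurableEmbedding _) f
  have hπ : (0 : ℝ) < 2 * Real.pi := by positivity
  obtain ⟨Θ, hΘ⟩ : ∃ Θ : 𝓢(V, ℂ), ∀ v, Θ v = θ (e v) :=
    exists_schwartz_of_hasCompactSupport (g := fun v => θ (e v)) (hθ.comp e.contDiff)
      (hc.comp_homeomorph e.toHomeomorph)
  set L : (ℝ × E3) ≃L[ℝ] V := (ContinuousLinearEquiv.smulLeft (Units.mk0 ((2 * Real.pi)⁻¹)
    (by positivity) : ℝˣ)).trans e.symm with hL
  have hLa : ∀ ζ, L ζ = (2 * Real.pi)⁻¹ • e.symm ζ := by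
    intro ζ
    rw [hL, ContinuousLinearEquiv.trans_apply]
    exact map_smul e.symm ((2 * Real.pi)⁻¹) ζ
  set c : ℂ := (((2 * Real.pi) ^ 4 : ℝ) : ℂ)⁻¹ with hcdef
  set φ : 𝓢(ℝ × E3, ℂ) := c • SchwartzMap.compCLMOfContinuousLinearEquiv ℂ L (𝓕⁻ Θ) with hφ
  have hφa : ∀ ζ, φ ζ = c * 𝓕⁻ (Θ : V → ℂ) ((2 * Real.pi)⁻¹ • e.symm ζ) := by
    intro ζ
    rw [hφ, _root_.smul_apply, SchwartzMap.compCLMOfContinuousLinearEquiv_apply,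
      Function.comp_apply, hLa, SchwartzMap.fourierInv_coe, smul_eq_mul]
  refine ⟨φ, ?_, ?_⟩
  · ext z
    have h1 : 𝓕 (𝓕⁻ Θ : 𝓢(V, ℂ)) (e.symm z) = θ z := by
      rw [FourierTransform.fourier_fourierInv_eq, hΘ, ContinuousLinearEquiv.apply_symm_apply]
    rw [SchwartzMap.fourier_coe, Real.fourier_eq', SchwartzMap.fourierInv_coe] at h1
    rw [← h1, hatST_eq]
    have h2 := Measure.integral_comp_smul (volume : Measure (ℝ × E3))
      (fun ζ => Complex.exp (Complex.I * (pair (-z) ζ : ℂ)) * φ ζ) (2 * Real.pi)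
    have h3 : Module.finrank ℝ (ℝ × E3) = 4 := by simp
    rw [h3, abs_of_pos (by positivity)] at h2
    have h4 : ∫ ζ, Complex.exp (Complex.I * (pair (-z) ζ : ℂ)) * φ ζ
        = (((2 * Real.pi) ^ 4 : ℝ) : ℂ) * ∫ ζ, Complex.exp (Complex.I *
          (pair (-z) ((2 * Real.pi) • ζ) : ℂ)) * φ ((2 * Real.pi) • ζ) := by
      rw [h2, Complex.real_smul, ← mul_assoc, ← Complex.ofReal_mul,
        mul_inv_cancel₀ (by positivity), Complex.ofReal_one, one_mul]
    rw [h4, ← hvol, ← integral_const_mul]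
    refine integral_congr_ae (Eventually.of_forall fun v => ?_)
    simp only
    rw [hφa, map_smul, ContinuousLinearEquiv.symm_apply_apply, smul_smul,
      inv_mul_cancel₀ hπ.ne', one_smul, hin, ContinuousLinearEquiv.apply_symm_apply]
    have h5 : (((2 * Real.pi) ^ 4 : ℝ) : ℂ) * c = 1 :=
      mul_inv_cancel₀ (by exact_mod_cast (by positivity : ((2 * Real.pi) ^ 4 : ℝ) ≠ 0))
    have h6 : pair (-z) ((2 * Real.pi) • e v) = -2 * Real.pi * pair (e v) z := by
      simp only [pair, Prod.fst_neg, Prod.snd_neg, Prod.smul_fst, Prod.smul_snd, smul_eq_mul,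
        inner_neg_left, inner_smul_right, real_inner_comm]
      ring
    rw [h6, smul_eq_mul, mul_comm Complex.I]
    linear_combination (Complex.exp (((-2 * Real.pi * pair (e v) z : ℝ) : ℂ) * Complex.I) *
      𝓕⁻ (Θ : V → ℂ) v) * h5
  · intro ζ
    rw [hφa, Real.fourierInv_eq', ← hvol]
    congr 1
    refine integral_congr_ae (Eventually.of_forall fun v => ?_)
    simp only [hΘ, smul_eq_mul]
    congr 2
    rw [hin, map_smul, ContinuousLinearEquiv.apply_symm_apply]
    have h6 : pair (e v) ((2 * Real.pi)⁻¹ • ζ) = (2 * Real.pi)⁻¹ * pair (e v) ζ := by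
      simp only [pair, Prod.smul_fst, Prod.smul_snd, smul_eq_mul, inner_smul_right]
      ring
    rw [h6, ← mul_assoc, mul_inv_cancel₀ hπ.ne', one_mul, mul_comm]

lemma wsq_schwartz_lt_top (φ : 𝓢(ℝ × E3, ℂ)) : wsq φ < ⊤ := by
  obtain ⟨C, hC0, hC⟩ : ∃ C : ℝ, 0 < C ∧ ∀ ζ, ‖φ ζ‖ ≤ C := by
    obtain ⟨C, hC0, hC⟩ := φ.decay 0 0
    exact ⟨C, hC0, fun ζ => by simpa using hC ζ⟩
  have hi : Integrable (fun ζ => C * (‖ζ‖ ^ 0 * ‖φ ζ‖) + 2 * C * (‖ζ‖ ^ 2 * ‖φ ζ‖)) :=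
    ((φ.integrable_pow_mul volume 0).const_mul C).add
      ((φ.integrable_pow_mul volume 2).const_mul (2 * C))
  refine lt_of_le_of_lt ?_ hi.lintegral_lt_top
  refine lintegral_mono fun ζ => ?_
  rw [← ofReal_norm, ← ENNReal.ofReal_pow (norm_nonneg _),
    ← ENNReal.ofReal_mul (by linarith [pair_self_nonneg ζ])]
  refine ENNReal.ofReal_le_ofReal ?_
  have h1 := pair_self_le ζ
  have h2 := hC ζ
  have h3 := norm_nonneg (φ ζ)
  calc (1 + pair ζ ζ) * ‖φ ζ‖ ^ 2 ≤ (1 + 2 * ‖ζ‖ ^ 2) * (C * ‖φ ζ‖) := by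
        rw [sq]; gcongr
    _ = _ := by ring

/-- The inverse space-time Fourier transform `(2π)⁻⁴ ∫ e^{i(tτ + x·ξ)} F(τ, ξ) dτ dξ`. -/
def stSynth (F : ℝ × E3 → ℂ) (z : ℝ × E3) : ℂ :=
  (((2 * Real.pi) ^ 4 : ℝ) : ℂ)⁻¹ * ∫ ζ, Complex.exp (Complex.I * (pair z ζ : ℂ)) * F ζ

/-- Hölder's inequality on the hyperplanes, against the indicator function of a compact set. -/
lemma locallyIntegrable_of_mixedNorm (hw : ‖w‖ = 1) (hlm : lm ≠ 0) (hg : Measurable g)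
    (hgN : mixedNorm lm w g < ⊤) : LocallyIntegrable g volume := by
  refine (locallyIntegrable_iff).2 fun K hK => ?_
  obtain ⟨r, hr⟩ := hK.isBounded.subset_closedBall 0
  have hS : ∀ s, eLpNorm (fun Y => K.indicator (fun _ => (1 : ℂ)) (frameMap lm w (s, Y))) 2
      ≤ eLpNorm ((Metric.closedBall (0 : E3) (√(2 * r ^ 2))).indicator fun _ => (1 : ℂ)) 2 := by
    intro s
    refine eLpNorm_mono fun Y => ?_
    by_cases h : frameMap lm w (s, Y) ∈ K
    · have h1 : Y ∈ Metric.closedBall (0 : E3) (√(2 * r ^ 2)) := by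
        rw [mem_closedBall_zero_iff]
        refine Real.le_sqrt_of_sq_le ?_
        have h2 := pair_self_le (frameMap lm w (s, Y))
        rw [pair_frameMap hw, pair, real_inner_self_eq_norm_sq] at h2
        have h3 := hr h
        rw [mem_closedBall_zero_iff] at h3
        have h4 : ‖frameMap lm w (s, Y)‖ ^ 2 ≤ r ^ 2 := by gcongr
        nlinarith [sq_nonneg s]
      rw [indicator_of_mem h, indicator_of_mem h1]
    · rw [indicator_of_notMem h, norm_zero]; positivity
  have hfin : eLpNorm ((Metric.closedBall (0 : E3) (√(2 * r ^ 2))).indicator fun _ => (1 : ℂ)) 2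
      volume < ⊤ := (memLp_indicator_const 2 measurableSet_closedBall (1 : ℂ)
        (Or.inr measure_closedBall_lt_top.ne)).2
  have h := lintegral_mul_le_mixed hw hlm hg
    (measurable_const.indicator hK.measurableSet : Measurable (K.indicator fun _ => (1 : ℂ))) hS
  have h2 := h.trans_lt (ENNReal.mul_lt_top hgN hfin)
  rw [← integrable_indicator_iff hK.measurableSet]
  refine ⟨(hg.indicator hK.measurableSet).aestronglyMeasurable, lt_of_le_of_lt (le_of_eq ?_) h2⟩
  refine lintegral_congr fun z => ?_
  by_cases h : z ∈ K <;> simp [h]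

/-- The forcing is the absolutely convergent inverse Fourier integral of its Fourier transform. -/
lemma exists_forcing_eq_stSynth (hw : ‖w‖ = 1) (hlm : lm ≠ 0) (hg : Measurable g)
    (hgN : mixedNorm lm w g < ⊤) {B : Set (ℝ × E3)} (hBc : IsCompact B)
    (hB : STFreqSupportedIn g B) :
    ∃ F : ℝ × E3 → ℂ, Measurable F ∧ MemLp F 2 ∧ Integrable F ∧ (∀ ζ, ζ ∉ B → F ζ = 0) ∧
      g =ᵐ[volume] stSynth F := by
  obtain ⟨F, hFm, hF2, hFB, hFT⟩ := exists_spaceTime_fourier hw hlm hg hgN hBc hB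
  obtain ⟨r, hr0, hr⟩ := hBc.isBounded.subset_closedBall_lt 0 0
  have hFi : Integrable F := by
    have := integrable_indicator_closedBall hF2 r
    rwa [indicator_eq_self.2] at this
    intro ζ hζ
    by_contra h
    exact hζ (hFB ζ fun h' => h (hr h'))
  refine ⟨F, hFm, hF2, hFi, hFB, ?_⟩
  have hcont : Continuous (stSynth F) := continuous_const.mul (continuous_integral_phase hFi)
  refine ae_eq_of_integral_contDiff_smul_eq (locallyIntegrable_of_mixedNorm hw hlm hg hgN)
    hcont.locallyIntegrable fun θ hθ hθc => ?_
  obtain ⟨φ, hφ1, hφ2⟩ := exists_schwartz_hatST_eq (contDiff_ofReal_comp hθ)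
    (hasCompactSupport_ofReal_comp hθc)
  have key : ∫ z, g z * hatST φ z = ∫ ζ, F ζ * φ ζ := by
    -- truncate `φ` and pass to the limit
    have hφm : Measurable φ := φ.continuous.measurable
    set χ : ℕ → ContDiffBump (0 : ℝ × E3) := fun n =>
      ⟨n + 1, n + 2, by positivity, by linarith⟩ with hχ
    set φ' : ℕ → ℝ × E3 → ℂ := fun n ζ => (1 - (χ n ζ : ℂ)) * φ ζ with hφ'
    have hχs : ∀ n, ContDiff ℝ (⊤ : ℕ∞) (fun ζ => (χ n ζ : ℂ)) := fun n =>
      contDiff_ofReal_comp (χ n).contDiff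
    have hχ1 : ∀ n : ℕ, ∀ ζ : ℝ × E3, ‖ζ‖ ≤ n + 1 → χ n ζ = 1 := fun n ζ h =>
      (χ n).one_of_mem_closedBall (by simpa [hχ] using h)
    have hnorm : ∀ n ζ, ‖φ' n ζ‖ ≤ ‖φ ζ‖ := by
      intro n ζ
      rw [hφ', norm_mul, ← Complex.ofReal_one, ← Complex.ofReal_sub, Complex.norm_real,
        Real.norm_of_nonneg (by linarith [(χ n).le_one (x := ζ)])]
      exact mul_le_of_le_one_left (norm_nonneg _) (by linarith [(χ n).nonneg (x := ζ)])
    have hm' : ∀ n, Measurable (φ' n) := fun n =>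
      (measurable_const.sub (hχs n).continuous.measurable).mul hφm
    have hi' : ∀ n, Integrable (φ' n) := fun n =>
      φ.integrable.mono (hm' n).aestronglyMeasurable (Eventually.of_forall (hnorm n))
    have hwle : ∀ n, wsq (φ' n) ≤ wsq φ := by
      intro n
      refine lintegral_mono fun ζ => ?_
      gcongr
      exact enorm_le_iff_norm_le.2 (hnorm n ζ)
    have hwt : Tendsto (fun n => wsq (φ' n)) atTop (𝓝 0) := by
      have := tendsto_lintegral_of_dominated_convergence
        (μ := (volume : Measure (ℝ × E3)))
        (F := fun n ζ => ENNReal.ofReal (1 + pair ζ ζ) * ‖φ' n ζ‖ₑ ^ 2) (f := fun _ => 0)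
        (fun ζ => ENNReal.ofReal (1 + pair ζ ζ) * ‖φ ζ‖ₑ ^ 2)
        (fun n =>
          ((measurable_pair_self.const_add 1).ennreal_ofReal).mul ((hm' n).enorm.pow_const 2))
        (fun n => Eventually.of_forall fun ζ => by
          refine mul_le_mul_right (pow_le_pow_left₀ (by positivity) ?_ 2) _
          exact enorm_le_iff_norm_le.2 (hnorm n ζ)) (wsq_schwartz_lt_top φ).ne
        (Eventually.of_forall fun ζ => by
          refine tendsto_const_nhds.congr' ?_
          filter_upwards [eventually_ge_atTop ⌈‖ζ‖⌉₊] with n hn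
          have : χ n ζ = 1 := hχ1 n ζ ((Nat.ceil_le.1 hn).trans (by linarith))
          simp [hφ', this])
      simpa only [wsq, lintegral_zero] using this
    have hdiff : ∀ n : ℕ, r ≤ n →
        ‖(∫ z, g z * hatST φ z) - ∫ ζ, F ζ * φ ζ‖ₑ
          ≤ mixedNorm lm w g * (sliceConst * wsq (φ' n) ^ (1 / 2 : ℝ)) := by
      intro n hn
      set φ₁ : ℝ × E3 → ℂ := fun ζ => (χ n ζ : ℂ) * φ ζ with hφ₁
      have s1 : ContDiff ℝ (⊤ : ℕ∞) φ₁ := (hχs n).mul (φ.smooth _)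
      have c1 : HasCompactSupport φ₁ :=
        (hasCompactSupport_ofReal_comp (χ n).hasCompactSupport).mul_right
      have i1 := s1.continuous.integrable_of_hasCompactSupport (μ := volume) c1
      have m1 := (integrable_mul_hatST hw hlm hg hgN s1.continuous.measurable i1
        (wsq_lt_top_of_hasCompactSupport s1.continuous c1)).1
      have m2 := integrable_mul_hatST hw hlm hg hgN (hm' n) (hi' n)
        ((hwle n).trans_lt (wsq_schwartz_lt_top φ))
      have e : (φ : ℝ × E3 → ℂ) = fun ζ => φ₁ ζ + φ' n ζ := by
        ext ζ; simp only [hφ₁, hφ']; ring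
      have e2 : ∀ z, g z * hatST φ z = g z * hatST φ₁ z + g z * hatST (φ' n) z := by
        intro z
        rw [← mul_add, ← hatST_add i1 (hi' n), ← e]
      have e3 : ∫ ζ, F ζ * φ ζ = ∫ ζ, F ζ * φ₁ ζ := by
        refine integral_congr_ae (Eventually.of_forall fun ζ => ?_)
        by_cases h : ζ ∈ B
        · have h1 := hr h
          rw [mem_closedBall_zero_iff] at h1
          simp [hφ₁, hχ1 n ζ (by linarith)]
        · simp [hFB ζ h]
      rw [e3, ← hFT φ₁ s1 c1]
      simp only [e2]
      rw [integral_add m1 m2.1, add_sub_cancel_left]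
      exact m2.2
    have hlim : Tendsto (fun n => mixedNorm lm w g * (sliceConst * wsq (φ' n) ^ (1 / 2 : ℝ)))
        atTop (𝓝 0) := by
      have h1 : Tendsto (fun n => wsq (φ' n) ^ (1 / 2 : ℝ)) atTop (𝓝 0) := by
        have := (ENNReal.continuous_rpow_const (y := (1 / 2 : ℝ))).tendsto 0 |>.comp hwt
        rw [ENNReal.zero_rpow_of_pos (by norm_num)] at this
        exact this
      have hs : sliceConst ≠ ⊤ :=
        (ENNReal.mul_lt_top ENNReal.ofReal_lt_top ENNReal.ofReal_lt_top).ne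
      have h2 := ENNReal.Tendsto.const_mul (a := sliceConst) h1 (Or.inr hs)
      have h3 := ENNReal.Tendsto.const_mul (a := mixedNorm lm w g) h2 (Or.inr hgN.ne)
      simpa using h3
    have h0 : ‖(∫ z, g z * hatST φ z) - ∫ ζ, F ζ * φ ζ‖ₑ ≤ 0 := by
      refine ge_of_tendsto hlim ?_
      filter_upwards [eventually_ge_atTop ⌈r⌉₊] with n hn
      exact hdiff n (Nat.ceil_le.1 hn)
    rw [nonpos_iff_eq_zero, enorm_eq_zero, sub_eq_zero] at h0
    exact h0
  rw [hφ1] at key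
  -- Fubini: `∫ F φ = ∫ (stSynth F) θ`
  have hfub : ∫ ζ, F ζ * φ ζ = ∫ z, stSynth F z * (θ z : ℂ) := by
    have hθi : Integrable fun z => (θ z : ℂ) :=
      (contDiff_ofReal_comp hθ).continuous.integrable_of_hasCompactSupport
        (hasCompactSupport_ofReal_comp hθc)
    have hI : Integrable (Function.uncurry fun (ζ z : ℝ × E3) =>
        Complex.exp (Complex.I * (pair z ζ : ℂ)) * (F ζ * (θ z : ℂ)))
        ((volume : Measure (ℝ × E3)).prod volume) :=
      integrable_phase_mul (hFi.mul_prod hθi)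
        (continuous_pair.comp continuous_swap).aestronglyMeasurable
    calc ∫ ζ, F ζ * φ ζ = (((2 * Real.pi) ^ 4 : ℝ) : ℂ)⁻¹ *
          ∫ ζ, ∫ z, Complex.exp (Complex.I * (pair z ζ : ℂ)) * (F ζ * (θ z : ℂ)) := by
          rw [← integral_const_mul]
          refine integral_congr_ae (Eventually.of_forall fun ζ => ?_)
          simp only
          rw [hφ2, mul_left_comm, ← integral_const_mul]
          congr 2
          ext z; ring
      _ = (((2 * Real.pi) ^ 4 : ℝ) : ℂ)⁻¹ *
          ∫ z, ∫ ζ, Complex.exp (Complex.I * (pair z ζ : ℂ)) * (F ζ * (θ z : ℂ)) := by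
          rw [integral_integral_swap hI]
      _ = _ := by
          rw [← integral_const_mul]
          refine integral_congr_ae (Eventually.of_forall fun z => ?_)
          simp only [stSynth]
          rw [mul_assoc, ← integral_mul_const]
          congr 2
          ext ζ; ring
  rw [hfub] at key
  simpa only [Complex.real_smul, mul_comm] using key

end Forcing

/-! ### Curves in `L²` given on the Fourier side -/

/-- A family of functions on the Fourier side that is locally Lipschitz in the parameter, relative
to a fixed `M ∈ L¹ ∩ L²`, is the Fourier transform of a continuous curve in `L²`. -/
lemma exists_continuous_curve {a : ℝ → E3 → ℂ} {M : E3 → ℝ} (hM1 : Integrable M)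
    (hM2 : MemLp M 2) (ha : ∀ s, AEStronglyMeasurable (a s) volume)
    (h0 : ∃ C : ℝ, ∀ᵐ ξ, ‖a 0 ξ‖ ≤ C * M ξ)
    (hL : ∀ T : ℝ, ∃ C : ℝ, ∀ s s' : ℝ, |s| ≤ T → |s'| ≤ T →
      ∀ᵐ ξ, ‖a s ξ - a s' ξ‖ ≤ C * |s - s'| * M ξ) :
    (∀ s, Integrable (a s)) ∧ (∀ s, MemLp (a s) 2) ∧
    ∃ A : ℝ → L2, Continuous A ∧ ∀ s, hat (A s) =ᵐ[volume] a s := by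
  have hb : ∀ s, ∃ C : ℝ, ∀ᵐ ξ, ‖a s ξ‖ ≤ C * M ξ := by
    intro s
    obtain ⟨C, hC⟩ := h0
    obtain ⟨C', hC'⟩ := hL |s|
    refine ⟨C' * |s - 0| + C, ?_⟩
    filter_upwards [hC, hC' s 0 le_rfl (by simp)] with ξ h1 h2
    calc ‖a s ξ‖ = ‖(a s ξ - a 0 ξ) + a 0 ξ‖ := by rw [sub_add_cancel]
      _ ≤ _ := norm_add_le _ _
      _ ≤ _ := by linarith
  have h1 : ∀ s, Integrable (a s) := fun s => by
    obtain ⟨C, hC⟩ := hb s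
    exact (hM1.const_mul C).mono' (ha s) hC
  have h2 : ∀ s, MemLp (a s) 2 := fun s => by
    obtain ⟨C, hC⟩ := hb s
    refine MemLp.mono (hM2.const_mul C) (ha s) ?_
    filter_upwards [hC] with ξ h
    exact h.trans (le_abs_self _)
  choose A hA _ using fun s => exists_hat_eq (h1 s) (h2 s)
  refine ⟨h1, h2, A, ?_, hA⟩
  rw [continuous_iff_continuousAt]
  intro s₀
  obtain ⟨C, hC⟩ := hL (|s₀| + 1)
  set K : ℝ := |C| * (eLpNorm M 2 volume).toReal / planch with hK
  have hd : ∀ s, |s - s₀| ≤ 1 → ‖A s - A s₀‖ ≤ K * |s - s₀| := by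
    intro s hs
    have hs1 : |s| ≤ |s₀| + 1 := by
      have := abs_add_le s₀ (s - s₀)
      rw [add_sub_cancel] at this
      linarith
    have e1 : ENNReal.ofReal planch * ‖A s - A s₀‖ₑ
        ≤ ENNReal.ofReal (|C| * |s - s₀|) * eLpNorm M 2 volume := by
      rw [← eLpNorm_hat]
      refine eLpNorm_le_mul_eLpNorm_of_ae_le_mul ?_ 2
      filter_upwards [hat_sub (A s) (A s₀), hA s, hA s₀, hC s s₀ hs1 (by linarith)]
        with ξ e2 e3 e4 e5
      rw [e2, e3, e4]
      refine e5.trans ((le_abs_self _).trans ?_)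
      rw [abs_mul, abs_mul, abs_abs, Real.norm_eq_abs]
    have e2 := ENNReal.toReal_mono (ENNReal.mul_lt_top ENNReal.ofReal_lt_top hM2.2).ne e1
    rw [ENNReal.toReal_mul, ENNReal.toReal_mul, toReal_enorm, ENNReal.toReal_ofReal planch_pos.le,
      ENNReal.toReal_ofReal (by positivity)] at e2
    rw [hK, div_mul_eq_mul_div, le_div_iff₀ planch_pos]
    linarith
  rw [ContinuousAt, tendsto_iff_norm_sub_tendsto_zero]
  have ht : Tendsto (fun s => K * |s - s₀|) (𝓝 s₀) (𝓝 0) := by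
    have : Continuous fun s => K * |s - s₀| := by fun_prop
    simpa using this.tendsto s₀
  refine squeeze_zero' (Eventually.of_forall fun s => norm_nonneg _) ?_ ht
  filter_upwards [Metric.closedBall_mem_nhds s₀ one_pos] with s hs
  exact hd s (by simpa [Real.dist_eq] using hs)

/-! ### The geometric setting -/

/-- The relation between a compact set `R` of spatial frequencies on which the transversality
factor is bounded below and above, and a compact set `B` of space-time frequencies: the spatial
parts of points of `B` lie in `R`, and every point of `B` can be moved in the direction `(λ, ω)`
to a characteristic point over `R`. -/
structure IsTransverse (lm : ℝ) (w : E3) (R : Set E3) (B : Set (ℝ × E3)) (d₀ d₁ : ℝ) : Prop where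
  unit : ‖w‖ = 1
  ne_zero : lm ≠ 0
  isCompact_freq : IsCompact R
  isCompact_st : IsCompact B
  pos : 0 < d₀
  lower : ∀ ξ ∈ R, d₀ ≤ transv lm w ξ
  upper : ∀ ξ ∈ R, transv lm w ξ ≤ d₁
  freq_mem : ∀ ζ ∈ B, ζ.2 ∈ R
  exists_char : ∀ ζ ∈ B, ζ ∈ charLine lm w '' (univ ×ˢ R)

/-- A square integrable function supported in `B`: the Fourier transform of the forcing. -/
structure IsSymbolOn (F : ℝ × E3 → ℂ) (B : Set (ℝ × E3)) : Prop where
  measurable : Measurable F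
  memLp : MemLp F 2
  integrable : Integrable F
  eq_zero : ∀ ζ, ζ ∉ B → F ζ = 0

namespace IsTransverse

variable {lm : ℝ} {w : E3} {R : Set E3} {B : Set (ℝ × E3)} {d₀ d₁ : ℝ}

lemma transv_pos (hG : IsTransverse lm w R B d₀ d₁) : ∀ ξ ∈ R, 0 < transv lm w ξ :=
  fun ξ hξ => hG.pos.trans_le (hG.lower ξ hξ)

lemma measurableSet (hG : IsTransverse lm w R B d₀ d₁) : MeasurableSet R :=
  hG.isCompact_freq.measurableSet

lemma exists_bound (hG : IsTransverse lm w R B d₀ d₁) :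
    ∃ H : ℝ, 0 ≤ H ∧ ∀ ξ ∈ R, ∀ h : ℝ, charLine lm w (h, ξ) ∈ B → |h| ≤ H := by
  obtain ⟨r, hr0, hr⟩ := hG.isCompact_freq.isBounded.subset_closedBall_lt 0 0
  refine ⟨2 * r, by positivity, fun ξ hξ h hB => ?_⟩
  have h1 := hr hξ
  have h2 := hr (hG.freq_mem _ hB)
  rw [mem_closedBall_zero_iff] at h1 h2
  have h3 : |h| = ‖(ξ + h • w) - ξ‖ := by
    rw [add_sub_cancel_left, norm_smul, hG.unit, mul_one, Real.norm_eq_abs]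
  rw [h3]
  have := norm_sub_le (ξ + h • w) ξ
  simp only [charLine] at h2
  linarith

end IsTransverse

section Lines

variable {lm : ℝ} {w : E3} {R : Set E3} {B : Set (ℝ × E3)} {d₀ d₁ : ℝ} {F : ℝ × E3 → ℂ}

/-- The Fourier transform of `F` along the lines in the direction `(λ, ω)`. -/
def lineFT (lm : ℝ) (w : E3) (F : ℝ × E3 → ℂ) (r : ℝ) (ξ : E3) : ℂ :=
  ∫ h : ℝ, Complex.exp (Complex.I * ((r * h : ℝ) : ℂ)) * F (charLine lm w (h, ξ))

lemma IsSymbolOn.measurable_line (hF : IsSymbolOn F B) (lm : ℝ) (w : E3) :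
    Measurable fun p : ℝ × E3 => F (charLine lm w p) :=
  hF.measurable.comp (continuous_charLine lm w).measurable

lemma measurable_lineFT (hF : IsSymbolOn F B) (lm : ℝ) (w : E3) :
    Measurable (Function.uncurry (lineFT lm w F)) := by
  have hm : StronglyMeasurable (Function.uncurry fun (p : ℝ × E3) (h : ℝ) =>
      Complex.exp (Complex.I * ((p.1 * h : ℝ) : ℂ)) * F (charLine lm w (h, p.2))) := by
    have h1 := (hF.measurable_line lm w).comp
      (by fun_prop : Measurable fun x : (ℝ × E3) × ℝ => (x.2, x.1.2))
    exact (Measurable.mul (by fun_prop) h1).stronglyMeasurable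
  exact hm.integral_prod_right.measurable

/-- On a hyperplane the `L²` norm of the forcing controls the line transforms; the transversality
factor is the Jacobian. -/
lemma lintegral_lineFT_sq_le (hG : IsTransverse lm w R B d₀ d₁) (hF : IsSymbolOn F B) (s : ℝ) :
    ∫⁻ ξ in R, ENNReal.ofReal (transv lm w ξ) * ‖lineFT lm w F (frameNorm lm * s) ξ‖ₑ ^ 2
      ≤ ENNReal.ofReal ((2 * Real.pi) ^ 5) *
        eLpNorm (fun Y => stSynth F (frameMap lm w (s, Y))) 2 ^ 2 := by
  have hw := hG.unit
  have hN := frameNorm_pos lm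
  have hN1 : 1 ≤ frameNorm lm := Real.one_le_sqrt.2 (by nlinarith [sq_nonneg lm])
  have hFw : wsq F < ⊤ := by
    obtain ⟨r, hr⟩ := hG.isCompact_st.isBounded.subset_closedBall 0
    have h := wsq_indicator_le r F
    rw [indicator_eq_self.2] at h
    · exact h.trans_lt (ENNReal.mul_lt_top ENNReal.ofReal_lt_top (ENNReal.pow_lt_top hF.memLp.2))
    · intro ζ hζ
      by_contra h'
      exact hζ (hF.eq_zero ζ fun h'' => h' (hr h''))
  set γ : E3 → ℂ := fun η => ∫ σ : ℝ, Complex.exp (Complex.I * ((s * σ : ℝ) : ℂ))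
          * F (frameMap lm w (σ, η)) with hγ
  obtain ⟨g1, g2, -⟩ := eLpNorm_synth_slice_le hw hG.ne_zero hF.measurable hF.integrable hFw s
  have e1 : eLpNorm (fun Y => stSynth F (frameMap lm w (s, Y))) 2
      = ENNReal.ofReal (((2 * Real.pi) ^ 4)⁻¹) * (ENNReal.ofReal planch * eLpNorm γ 2) := by
    rw [← eLpNorm_synth g2 g1]
    have : (fun Y => stSynth F (frameMap lm w (s, Y)))
        = ((((2 * Real.pi) ^ 4 : ℝ) : ℂ)⁻¹) • synth γ := by
      ext Y
      rw [stSynth, integral_phase_frameMap hw hG.ne_zero hF.integrable]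
      rfl
    rw [this, eLpNorm_const_smul, ← ofReal_norm, norm_inv, Complex.norm_real,
      Real.norm_of_nonneg (by positivity)]
  have e2 : ENNReal.ofReal ((2 * Real.pi) ^ 5) *
        eLpNorm (fun Y => stSynth F (frameMap lm w (s, Y))) 2 ^ 2 = ∫⁻ η, ‖γ η‖ₑ ^ 2 := by
    rw [e1, ← eLpNorm_two_sq, mul_pow _ (ENNReal.ofReal planch * eLpNorm γ 2 volume),
      mul_pow _ (eLpNorm γ 2 volume), ← mul_assoc, ← mul_assoc,
      ← ENNReal.ofReal_pow (by positivity), ← ENNReal.ofReal_pow planch_pos.le, planch_sq,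
      ← ENNReal.ofReal_mul (by positivity), ← ENNReal.ofReal_mul (by positivity)]
    have : (2 * Real.pi) ^ 5 * (((2 * Real.pi) ^ 4)⁻¹) ^ 2 * (2 * Real.pi) ^ 3 = 1 := by
      field_simp
    rw [this, ENNReal.ofReal_one, one_mul]
  rw [e2]
  calc ∫⁻ ξ in R, ENNReal.ofReal (transv lm w ξ) * ‖lineFT lm w F (frameNorm lm * s) ξ‖ₑ ^ 2
      ≤ ∫⁻ ξ in R, ENNReal.ofReal (transv lm w ξ / frameNorm lm) *
          ‖γ (charProj lm w ξ)‖ₑ ^ 2 := by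
        refine setLIntegral_mono' hG.measurableSet fun ξ hξ => ?_
        have hD := hG.transv_pos ξ hξ
        have e3 : γ (charProj lm w ξ) = (frameNorm lm : ℂ) *
            (Complex.exp (Complex.I * ((s * charTime lm w ξ : ℝ) : ℂ)) *
              lineFT lm w F (frameNorm lm * s) ξ) := by
          have h1 : γ (charProj lm w ξ) = ∫ σ : ℝ, Complex.exp (Complex.I *
              ((s * (charTime lm w ξ + σ) : ℝ) : ℂ)) *
              F (frameMap lm w (charTime lm w ξ + σ, charProj lm w ξ)) :=
            (integral_add_left_eq_self (μ := (volume : Measure ℝ)) (fun σ =>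
              Complex.exp (Complex.I * ((s * σ : ℝ) : ℂ)) *
              F (frameMap lm w (σ, charProj lm w ξ))) (charTime lm w ξ)).symm
          have h2 := Measure.integral_comp_mul_left (fun σ : ℝ => Complex.exp (Complex.I *
              ((s * (charTime lm w ξ + σ) : ℝ) : ℂ)) *
              F (frameMap lm w (charTime lm w ξ + σ, charProj lm w ξ))) (frameNorm lm)
          rw [← h1, abs_of_pos (inv_pos.2 hN), Complex.real_smul] at h2
          have h3 : γ (charProj lm w ξ) = (frameNorm lm : ℂ) * (((frameNorm lm)⁻¹ : ℝ) *
              γ (charProj lm w ξ)) := by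
            rw [← mul_assoc, ← Complex.ofReal_mul, mul_inv_cancel₀ hN.ne', Complex.ofReal_one,
              one_mul]
          rw [h3, ← h2, lineFT]
          congr 1
          rw [← integral_const_mul]
          refine integral_congr_ae (Eventually.of_forall fun h => ?_)
          beta_reduce
          rw [frameMap_char hw, ← mul_assoc, ← Complex.exp_add, ← mul_add, ← Complex.ofReal_add]
          congr 5
          ring
        rw [e3, enorm_mul, enorm_mul, enorm_phase, one_mul, mul_pow, ← mul_assoc]
        gcongr
        have e4 : ‖(frameNorm lm : ℂ)‖ₑ = ENNReal.ofReal (frameNorm lm) := by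
          rw [← ofReal_norm, Complex.norm_real, Real.norm_of_nonneg hN.le]
        rw [e4, ← ENNReal.ofReal_pow hN.le, ← ENNReal.ofReal_mul (by positivity)]
        refine ENNReal.ofReal_le_ofReal ?_
        rw [show transv lm w ξ / frameNorm lm * frameNorm lm ^ 2 = transv lm w ξ * frameNorm lm by
          field_simp]
        nlinarith
    _ = ∫⁻ η in charProj lm w '' R, ‖γ η‖ₑ ^ 2 :=
        (lintegral_charProj hw hG.measurableSet hG.transv_pos (fun η => ‖γ η‖ₑ ^ 2)).symm
    _ ≤ ∫⁻ η, ‖γ η‖ₑ ^ 2 := setLIntegral_le_lintegral _ _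

lemma IsSymbolOn.mem_of_ne_zero (hF : IsSymbolOn F B) {ζ : ℝ × E3} (h : F ζ ≠ 0) : ζ ∈ B := by
  by_contra h'
  exact h (hF.eq_zero ζ h')

/-- The integral of `|F|` along the line through the characteristic point over `ξ`, with the
Jacobian weight. -/
def lineMajorant (lm : ℝ) (w : E3) (R : Set E3) (F : ℝ × E3 → ℂ) : E3 → ℝ :=
  R.indicator fun ξ => transv lm w ξ * ∫ h : ℝ, ‖F (charLine lm w (h, ξ))‖

lemma measurable_lineMajorant (hG : IsTransverse lm w R B d₀ d₁) (hF : IsSymbolOn F B) :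
    Measurable (lineMajorant lm w R F) := by
  refine Measurable.indicator ?_ hG.measurableSet
  refine (continuous_transv lm w).measurable.mul ?_
  have hm : StronglyMeasurable (Function.uncurry fun (ξ : E3) (h : ℝ) =>
      ‖F (charLine lm w (h, ξ))‖) :=
    ((hF.measurable_line lm w).comp measurable_swap).norm.stronglyMeasurable
  exact hm.integral_prod_right.measurable

lemma lintegral_line_lt_top (hG : IsTransverse lm w R B d₀ d₁) (hF : IsSymbolOn F B) :
    ∫⁻ ξ in R, ENNReal.ofReal (transv lm w ξ) * ∫⁻ h, ‖F (charLine lm w (h, ξ))‖ₑ < ⊤ := by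
  rw [← lintegral_charLine hG.unit hG.measurableSet hG.transv_pos hF.measurable.enorm]
  · exact hF.integrable.2
  · exact fun ζ hζ => hG.exists_char ζ (hF.mem_of_ne_zero (by simpa using hζ))

lemma ae_integrable_line (hG : IsTransverse lm w R B d₀ d₁) (hF : IsSymbolOn F B) :
    ∀ᵐ ξ, ξ ∈ R → Integrable fun h : ℝ => F (charLine lm w (h, ξ)) := by
  have hm : Measurable fun ξ => ENNReal.ofReal (transv lm w ξ) *
      ∫⁻ h, ‖F (charLine lm w (h, ξ))‖ₑ :=
    (continuous_transv lm w).measurable.ennreal_ofReal.mul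
      (Measurable.lintegral_prod_left (hF.measurable_line lm w).enorm)
  have h := ae_lt_top hm (lintegral_line_lt_top hG hF).ne
  rw [ae_restrict_iff' hG.measurableSet] at h
  filter_upwards [h] with ξ h1 h2
  refine ⟨((hF.measurable_line lm w).comp
    (measurable_id.prodMk measurable_const)).aestronglyMeasurable, ?_⟩
  by_contra h3
  rw [hasFiniteIntegral_iff_enorm, not_lt, top_le_iff] at h3
  have h4 := h1 h2
  rw [h3, ENNReal.mul_top] at h4
  · exact lt_irrefl _ h4
  · simpa using hG.transv_pos ξ h2

lemma enorm_lineMajorant_le (hG : IsTransverse lm w R B d₀ d₁) (ξ : E3) :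
    ‖lineMajorant lm w R F ξ‖ₑ ≤ R.indicator (fun ξ => ENNReal.ofReal (transv lm w ξ) *
      ∫⁻ h, ‖F (charLine lm w (h, ξ))‖ₑ) ξ := by
  by_cases h : ξ ∈ R
  · rw [lineMajorant, indicator_of_mem h, indicator_of_mem h, enorm_mul,
      Real.enorm_of_nonneg (hG.transv_pos ξ h).le]
    gcongr
    refine (enorm_integral_le_lintegral_enorm _).trans (le_of_eq ?_)
    simp only [enorm_norm]
  · simp [lineMajorant, h]

lemma integrable_lineMajorant (hG : IsTransverse lm w R B d₀ d₁) (hF : IsSymbolOn F B) :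
    Integrable (lineMajorant lm w R F) := by
  refine ⟨(measurable_lineMajorant hG hF).aestronglyMeasurable, ?_⟩
  refine (lintegral_mono (enorm_lineMajorant_le hG)).trans_lt ?_
  rw [lintegral_indicator hG.measurableSet]
  exact lintegral_line_lt_top hG hF

/-- The displacements occurring in `B` are bounded, so that the weighted Cauchy–Schwarz inequality
on the lines bounds the line integrals of `|F|` in `L²`. -/
lemma memLp_lineMajorant (hG : IsTransverse lm w R B d₀ d₁) (hF : IsSymbolOn F B) :
    MemLp (lineMajorant lm w R F) 2 := by
  refine ⟨(measurable_lineMajorant hG hF).aestronglyMeasurable, ?_⟩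
  obtain ⟨H, hH0, hH⟩ := hG.exists_bound
  have hline := hF.measurable_line lm w
  have htr := (continuous_transv lm w).measurable
  set f : ℝ × E3 → ℝ≥0∞ := fun p => R.indicator (fun ξ => ENNReal.ofReal (√(transv lm w ξ))) p.2 *
    ‖F (charLine lm w p)‖ₑ with hf
  have hfm : Measurable f := by
    have : Measurable (R.indicator fun ξ => ENNReal.ofReal (√(transv lm w ξ))) :=
      Measurable.indicator (by fun_prop) hG.measurableSet
    exact (this.comp measurable_snd).mul hline.enorm
  have h1 := lintegral_fiber_sq_le hfm
  have h2 : ∫⁻ p : ℝ × E3, ENNReal.ofReal (1 + p.1 ^ 2) * f p ^ 2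
      ≤ ENNReal.ofReal (1 + H ^ 2) * eLpNorm F 2 ^ 2 := by
    have h3 : ∀ p : ℝ × E3, ENNReal.ofReal (1 + p.1 ^ 2) * f p ^ 2 ≤
        R.indicator (fun ξ => ENNReal.ofReal (transv lm w ξ)) p.2 *
        (ENNReal.ofReal (1 + H ^ 2) * ‖F (charLine lm w p)‖ₑ ^ 2) := by
      rintro ⟨h, ξ⟩
      by_cases hξ : ξ ∈ R
      · by_cases hz : F (charLine lm w (h, ξ)) = 0
        · simp [hf, hz]
        · have h4 := hH ξ hξ h (hF.mem_of_ne_zero hz)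
          simp only [hf, indicator_of_mem hξ]
          rw [mul_pow, ← ENNReal.ofReal_pow (by positivity),
            Real.sq_sqrt (hG.transv_pos ξ hξ).le, mul_left_comm]
          refine mul_le_mul_right (mul_le_mul_left (ENNReal.ofReal_le_ofReal ?_) _) _
          have : h ^ 2 ≤ H ^ 2 :=
            sq_le_sq' (by linarith [neg_abs_le h]) (by linarith [le_abs_self h])
          linarith
      · simp [hf, hξ]
    refine (lintegral_mono h3).trans (le_of_eq ?_)
    have hm4 : Measurable fun p : ℝ × E3 =>
        R.indicator (fun ξ => ENNReal.ofReal (transv lm w ξ)) p.2 *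
        (ENNReal.ofReal (1 + H ^ 2) * ‖F (charLine lm w p)‖ₑ ^ 2) :=
      ((htr.ennreal_ofReal.indicator hG.measurableSet).comp measurable_snd).mul
        ((hline.enorm.pow_const 2).const_mul _)
    rw [eLpNorm_two_sq, Measure.volume_eq_prod, lintegral_prod_symm' _ hm4,
      ← Measure.volume_eq_prod,
      lintegral_charLine hG.unit hG.measurableSet hG.transv_pos (hF.measurable.enorm.pow_const 2)
        (fun ζ hζ => hG.exists_char ζ (hF.mem_of_ne_zero (by simpa using hζ))),
      ← lintegral_const_mul' _ _ ENNReal.ofReal_ne_top, ← lintegral_indicator hG.measurableSet]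
    refine lintegral_congr fun ξ => ?_
    by_cases hξ : ξ ∈ R
    · simp only [indicator_of_mem hξ]
      rw [lintegral_const_mul' _ _ ENNReal.ofReal_ne_top,
        lintegral_const_mul' _ _ ENNReal.ofReal_ne_top, mul_left_comm]
    · simp [hξ]
  have h5 : ∀ ξ, ‖lineMajorant lm w R F ξ‖ₑ ≤ ENNReal.ofReal (√d₁) * ∫⁻ h, f (h, ξ) := by
    intro ξ
    refine (enorm_lineMajorant_le hG ξ).trans ?_
    by_cases hξ : ξ ∈ R
    · simp only [hf, indicator_of_mem hξ]
      rw [lintegral_const_mul' _ _ ENNReal.ofReal_ne_top, ← mul_assoc,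
        ← ENNReal.ofReal_mul (by positivity)]
      gcongr
      calc transv lm w ξ = √(transv lm w ξ) * √(transv lm w ξ) :=
            (Real.mul_self_sqrt (hG.transv_pos ξ hξ).le).symm
        _ ≤ _ := by gcongr; exact hG.upper ξ hξ
    · simp [hξ]
  have h6 : eLpNorm (lineMajorant lm w R F) 2 ^ 2 < ⊤ := by
    rw [eLpNorm_two_sq]
    calc _ ≤ ∫⁻ ξ, (ENNReal.ofReal (√d₁) * ∫⁻ h, f (h, ξ)) ^ 2 := by
          gcongr with ξ; exact h5 ξ
      _ = ENNReal.ofReal (√d₁) ^ 2 * ∫⁻ ξ, (∫⁻ h, f (h, ξ)) ^ 2 := by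
          simp only [mul_pow]
          rw [lintegral_const_mul' _ _ (ENNReal.pow_lt_top ENNReal.ofReal_lt_top).ne]
      _ < ⊤ := by
          refine ENNReal.mul_lt_top (ENNReal.pow_lt_top ENNReal.ofReal_lt_top) ?_
          refine h1.trans_lt (ENNReal.mul_lt_top ENNReal.ofReal_lt_top (h2.trans_lt ?_))
          exact ENNReal.mul_lt_top ENNReal.ofReal_lt_top (ENNReal.pow_lt_top hF.memLp.2)
  by_contra h7
  rw [not_lt, top_le_iff] at h7
  rw [h7] at h6
  simp at h6

end Lines

section Sources

variable {lm : ℝ} {w : E3} {R : Set E3} {B : Set (ℝ × E3)} {d₀ d₁ : ℝ} {F : ℝ × E3 → ℂ}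
  {κ : ℝ → E3 → ℂ} {μ : ℝ} {k₀ : ℝ → ℝ}

/-- The multiplier with kernel `κ`, as a function of the displacement `h` in the direction
`(λ, ω)`. -/
def kerMult (lm : ℝ) (κ : ℝ → E3 → ℂ) (μ h : ℝ) (ξ : E3) : ℂ :=
  ∫ y : ℝ, Complex.exp (Complex.I * ((frameNorm lm * (μ * y) * h : ℝ) : ℂ)) * κ y ξ

/-- A kernel `κ`, dominated by an integrable function uniformly over `R`, whose multiplier divides
the displacement `h` by the symbol `⟨ξ⟩ + λh - ⟨ξ + hω⟩` of the equation. -/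
structure IsParametrix (lm : ℝ) (w : E3) (R : Set E3) (B : Set (ℝ × E3)) (κ : ℝ → E3 → ℂ) (μ : ℝ)
    (k₀ : ℝ → ℝ) : Prop where
  measurable : Measurable (Function.uncurry κ)
  bound : ∀ ξ ∈ R, ∀ y, ‖κ y ξ‖ ≤ k₀ y
  nonneg : ∀ y, 0 ≤ k₀ y
  integrable : Integrable k₀
  eq : ∀ ξ ∈ R, ∀ h : ℝ, charLine lm w (h, ξ) ∈ B →
    kerMult lm κ μ h ξ * ((jap ξ + lm * h - jap (ξ + h • w) : ℝ) : ℂ) = h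

lemma measurable_kerMult (hκ : IsParametrix lm w R B κ μ k₀) :
    Measurable fun p : ℝ × E3 => kerMult lm κ μ p.1 p.2 := by
  have hm : StronglyMeasurable (Function.uncurry fun (p : ℝ × E3) (y : ℝ) =>
      Complex.exp (Complex.I * ((frameNorm lm * (μ * y) * p.1 : ℝ) : ℂ)) * κ y p.2) := by
    have h1 := hκ.measurable.comp (by fun_prop : Measurable fun x : (ℝ × E3) × ℝ => (x.2, x.1.2))
    exact (Measurable.mul (by fun_prop) h1).stronglyMeasurable
  exact hm.integral_prod_right.measurable

lemma IsParametrix.measurable_left (hκ : IsParametrix lm w R B κ μ k₀) (ξ : E3) :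
    Measurable fun y => κ y ξ :=
  hκ.measurable.comp (measurable_id.prodMk measurable_const)

lemma IsParametrix.integrable_left (hκ : IsParametrix lm w R B κ μ k₀) {ξ : E3} (hξ : ξ ∈ R) :
    Integrable fun y => κ y ξ :=
  hκ.integrable.mono' (hκ.measurable_left ξ).aestronglyMeasurable
    (Eventually.of_forall (hκ.bound ξ hξ))

lemma norm_kerMult_le (hκ : IsParametrix lm w R B κ μ k₀) {ξ : E3} (hξ : ξ ∈ R) (h : ℝ) :
    ‖kerMult lm κ μ h ξ‖ ≤ ∫ y, k₀ y := by
  refine norm_integral_le_of_norm_le hκ.integrable (Eventually.of_forall fun y => ?_)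
  rw [norm_mul, norm_phase, one_mul]
  exact hκ.bound ξ hξ y

/-- The normalizing constant of the source symbols. -/
def sourceConst (lm : ℝ) : ℂ := -Complex.I * ((frameNorm lm / (2 * Real.pi) : ℝ) : ℂ)

lemma norm_sourceConst (lm : ℝ) : ‖sourceConst lm‖ = frameNorm lm / (2 * Real.pi) := by
  rw [sourceConst, norm_mul, norm_neg, Complex.norm_I, one_mul, Complex.norm_real,
    Real.norm_of_nonneg (div_nonneg (frameNorm_pos lm).le (by positivity))]

/-- The Fourier transform of the data `v_s` of the free waves whose superposition over `s` carries
the forcing on the hyperplane `t_{λ,ω} = s`. -/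
def sourceSymbol (lm : ℝ) (w : E3) (R : Set E3) (κ : ℝ → E3 → ℂ) (μ : ℝ) (F : ℝ × E3 → ℂ)
    (s : ℝ) : E3 → ℂ :=
  R.indicator fun ξ => sourceConst lm * (transv lm w ξ : ℂ) *
    ∫ h : ℝ, Complex.exp (Complex.I * ((frameNorm lm * s * h : ℝ) : ℂ)) *
      (kerMult lm κ μ h ξ * F (charLine lm w (h, ξ)))

lemma measurable_kerMult_mul (hF : IsSymbolOn F B) (hκ : IsParametrix lm w R B κ μ k₀) :
    Measurable fun p : ℝ × E3 => kerMult lm κ μ p.1 p.2 * F (charLine lm w p) :=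
  (measurable_kerMult hκ).mul (hF.measurable_line lm w)

lemma integrable_kerMult_mul (hF : IsSymbolOn F B) (hκ : IsParametrix lm w R B κ μ k₀) {ξ : E3}
    (hξ : ξ ∈ R) (hi : Integrable fun h : ℝ => F (charLine lm w (h, ξ))) :
    Integrable fun h : ℝ => kerMult lm κ μ h ξ * F (charLine lm w (h, ξ)) := by
  refine (hi.norm.const_mul (∫ y, k₀ y)).mono'
    ((measurable_kerMult_mul hF hκ).comp
      (measurable_id.prodMk measurable_const)).aestronglyMeasurable
    (Eventually.of_forall fun h => ?_)
  rw [norm_mul]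
  gcongr
  exact norm_kerMult_le hκ hξ h

lemma measurable_sourceSymbol (hG : IsTransverse lm w R B d₀ d₁) (hF : IsSymbolOn F B)
    (hκ : IsParametrix lm w R B κ μ k₀) :
    Measurable (Function.uncurry (sourceSymbol lm w R κ μ F)) := by
  have hm : StronglyMeasurable (Function.uncurry fun (p : ℝ × E3) (h : ℝ) =>
      Complex.exp (Complex.I * ((frameNorm lm * p.1 * h : ℝ) : ℂ)) *
        (kerMult lm κ μ h p.2 * F (charLine lm w (h, p.2)))) := by
    have h1 := (measurable_kerMult_mul hF hκ).comp
      (by fun_prop : Measurable fun x : (ℝ × E3) × ℝ => (x.2, x.1.2))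
    exact (Measurable.mul (by fun_prop) h1).stronglyMeasurable
  have h2 : Function.uncurry (sourceSymbol lm w R κ μ F) = (Prod.snd ⁻¹' R).indicator
      fun p : ℝ × E3 => sourceConst lm * (transv lm w p.2 : ℂ) * ∫ h : ℝ,
        Complex.exp (Complex.I * ((frameNorm lm * p.1 * h : ℝ) : ℂ)) *
        (kerMult lm κ μ h p.2 * F (charLine lm w (h, p.2))) := by
    ext ⟨s, ξ⟩
    rfl
  rw [h2]
  refine Measurable.indicator (Measurable.mul ?_ hm.integral_prod_right.measurable)
    (measurable_snd hG.measurableSet)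
  exact (Complex.continuous_ofReal.comp
    ((continuous_transv lm w).comp continuous_snd)).measurable.const_mul _

lemma norm_sourceSymbol_le (hG : IsTransverse lm w R B d₀ d₁)
    (hκ : IsParametrix lm w R B κ μ k₀) {ξ : E3}
    (hi : ξ ∈ R → Integrable fun h : ℝ => F (charLine lm w (h, ξ))) (s : ℝ) :
    ‖sourceSymbol lm w R κ μ F s ξ‖
      ≤ (frameNorm lm / (2 * Real.pi) * ∫ y, k₀ y) * lineMajorant lm w R F ξ := by
  by_cases hξ : ξ ∈ R
  · rw [sourceSymbol, lineMajorant, indicator_of_mem hξ, indicator_of_mem hξ, norm_mul, norm_mul,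
      norm_sourceConst, Complex.norm_real, Real.norm_of_nonneg (hG.transv_pos ξ hξ).le]
    have h1 : ‖∫ h : ℝ, Complex.exp (Complex.I * ((frameNorm lm * s * h : ℝ) : ℂ)) *
      (kerMult lm κ μ h ξ * F (charLine lm w (h, ξ)))‖
      ≤ (∫ y, k₀ y) * ∫ h : ℝ, ‖F (charLine lm w (h, ξ))‖ := by
      rw [← integral_const_mul]
      refine norm_integral_le_of_norm_le ((hi hξ).norm.const_mul _)
        (Eventually.of_forall fun h => ?_)
      rw [norm_mul, norm_phase, one_mul, norm_mul]
      gcongr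
      exact norm_kerMult_le hκ hξ h
    have h2 : 0 ≤ frameNorm lm / (2 * Real.pi) * transv lm w ξ :=
      mul_nonneg (div_nonneg (frameNorm_pos lm).le (by positivity)) (hG.transv_pos ξ hξ).le
    calc _ ≤ frameNorm lm / (2 * Real.pi) * transv lm w ξ *
          ((∫ y, k₀ y) * ∫ h : ℝ, ‖F (charLine lm w (h, ξ))‖) := by gcongr
      _ = _ := by ring
  · simp [sourceSymbol, lineMajorant, hξ]

lemma norm_exp_sub_exp_le (a b : ℝ) :
    ‖Complex.exp (Complex.I * (a : ℂ)) - Complex.exp (Complex.I * (b : ℂ))‖ ≤ |a - b| := by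
  have h : Complex.exp (Complex.I * (a : ℂ)) - Complex.exp (Complex.I * (b : ℂ))
      = Complex.exp (Complex.I * (b : ℂ)) * (Complex.exp (Complex.I * ((a - b : ℝ) : ℂ)) - 1) := by
    rw [mul_sub, ← Complex.exp_add, mul_one]
    congr 2
    push_cast
    ring
  rw [h, norm_mul, norm_phase, one_mul]
  exact Real.norm_exp_I_mul_ofReal_sub_one_le

lemma norm_sourceSymbol_sub_le (hG : IsTransverse lm w R B d₀ d₁) (hF : IsSymbolOn F B)
    (hκ : IsParametrix lm w R B κ μ k₀) {H : ℝ}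
    (hH : ∀ ξ ∈ R, ∀ h : ℝ, charLine lm w (h, ξ) ∈ B → |h| ≤ H) {ξ : E3}
    (hi : ξ ∈ R → Integrable fun h : ℝ => F (charLine lm w (h, ξ))) (s s' : ℝ) :
    ‖sourceSymbol lm w R κ μ F s ξ - sourceSymbol lm w R κ μ F s' ξ‖
      ≤ (frameNorm lm / (2 * Real.pi) * (frameNorm lm * H * ∫ y, k₀ y)) * |s - s'| *
        lineMajorant lm w R F ξ := by
  by_cases hξ : ξ ∈ R
  · simp only [sourceSymbol, lineMajorant, indicator_of_mem hξ]
    have hk := integrable_kerMult_mul hF hκ hξ (hi hξ)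
    rw [← mul_sub, ← integral_sub (integrable_phase_mul hk (by fun_prop))
      (integrable_phase_mul hk (by fun_prop)), norm_mul, norm_mul,
      norm_sourceConst, Complex.norm_real, Real.norm_of_nonneg (hG.transv_pos ξ hξ).le]
    have hN := frameNorm_pos lm
    have h1 : ‖∫ h : ℝ, (Complex.exp (Complex.I * ((frameNorm lm * s * h : ℝ) : ℂ)) *
      (kerMult lm κ μ h ξ * F (charLine lm w (h, ξ))) -
      Complex.exp (Complex.I * ((frameNorm lm * s' * h : ℝ) : ℂ)) *
      (kerMult lm κ μ h ξ * F (charLine lm w (h, ξ))))‖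
      ≤ (frameNorm lm * H * |s - s'| * (∫ y, k₀ y)) *
        ∫ h : ℝ, ‖F (charLine lm w (h, ξ))‖ := by
      rw [← integral_const_mul]
      refine norm_integral_le_of_norm_le ((hi hξ).norm.const_mul _)
        (Eventually.of_forall fun h => ?_)
      rw [← sub_mul, norm_mul, norm_mul, ← mul_assoc]
      by_cases hz : F (charLine lm w (h, ξ)) = 0
      · simp [hz]
      have h2 := hH ξ hξ h (hF.mem_of_ne_zero hz)
      have h3 : ‖Complex.exp (Complex.I * ((frameNorm lm * s * h : ℝ) : ℂ)) -
          Complex.exp (Complex.I * ((frameNorm lm * s' * h : ℝ) : ℂ))‖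
          ≤ frameNorm lm * H * |s - s'| := by
        refine (norm_exp_sub_exp_le _ _).trans ?_
        rw [show frameNorm lm * s * h - frameNorm lm * s' * h = frameNorm lm * h * (s - s') by ring,
          abs_mul, abs_mul, abs_of_pos hN]
        gcongr
      have h4 := norm_kerMult_le hκ hξ h
      gcongr
      exact (norm_nonneg _).trans h3
    have h2 : 0 ≤ frameNorm lm / (2 * Real.pi) * transv lm w ξ :=
      mul_nonneg (div_nonneg (frameNorm_pos lm).le (by positivity)) (hG.transv_pos ξ hξ).le
    calc _ ≤ frameNorm lm / (2 * Real.pi) * transv lm w ξ *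
          ((frameNorm lm * H * |s - s'| * (∫ y, k₀ y)) *
        ∫ h : ℝ, ‖F (charLine lm w (h, ξ))‖) := by gcongr
      _ = _ := by ring
  · simp [sourceSymbol, lineMajorant, hξ]

/-- The source symbol is a superposition, over the kernel variable `y`, of the line transforms at
the times `s + μy`. -/
lemma sourceSymbol_eq_integral
    (hκ : IsParametrix lm w R B κ μ k₀) {ξ : E3}
    (hi : ξ ∈ R → Integrable fun h : ℝ => F (charLine lm w (h, ξ))) (s : ℝ) :
    sourceSymbol lm w R κ μ F s ξ = ∫ y : ℝ, R.indicator (fun ξ => sourceConst lm *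
      (transv lm w ξ : ℂ) * (κ y ξ * lineFT lm w F (frameNorm lm * (s + μ * y)) ξ)) ξ := by
  by_cases hξ : ξ ∈ R
  · simp only [sourceSymbol, indicator_of_mem hξ]
    rw [integral_const_mul]
    congr 1
    simp only [kerMult, lineFT, ← integral_const_mul, ← integral_mul_const]
    rw [integral_integral_swap]
    · refine integral_congr_ae (Eventually.of_forall fun y => ?_)
      refine integral_congr_ae (Eventually.of_forall fun h => ?_)
      beta_reduce
      rw [show frameNorm lm * (s + μ * y) * h
        = frameNorm lm * s * h + frameNorm lm * (μ * y) * h by ring, Complex.ofReal_add, mul_add,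
        Complex.exp_add]
      ring
    · have h1 : Integrable (fun p : ℝ × ℝ => F (charLine lm w (p.1, ξ)) * κ p.2 ξ) :=
        (hi hξ).mul_prod (hκ.integrable_left hξ)
      refine (integrable_phase_mul h1 (a := fun p : ℝ × ℝ =>
        frameNorm lm * s * p.1 + frameNorm lm * (μ * p.2) * p.1) (by fun_prop)).congr
        (Eventually.of_forall fun p => ?_)
      simp only [Function.uncurry]
      rw [Complex.ofReal_add, mul_add, Complex.exp_add]
      ring
  · simp [sourceSymbol, hξ]

/-- Minkowski's inequality in the kernel variable reduces the source symbol to the line transforms,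
which the forcing controls hyperplane by hyperplane. -/
lemma eLpNorm_sourceSymbol_le (hG : IsTransverse lm w R B d₀ d₁) (hF : IsSymbolOn F B)
    (hκ : IsParametrix lm w R B κ μ k₀) (s : ℝ) :
    eLpNorm (sourceSymbol lm w R κ μ F s) 2
      ≤ ENNReal.ofReal (frameNorm lm * √d₁ * planch) * ∫⁻ y, ENNReal.ofReal (k₀ y) *
        eLpNorm (fun Y => stSynth F (frameMap lm w (s + μ * y, Y))) 2 := by
  set S : ℝ → ℝ≥0∞ := fun s => eLpNorm (fun Y => stSynth F (frameMap lm w (s, Y))) 2 with hS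
  set G : ℝ → E3 → ℂ := fun y => R.indicator (fun ξ => sourceConst lm *
      (transv lm w ξ : ℂ) * (κ y ξ * lineFT lm w F (frameNorm lm * (s + μ * y)) ξ)) with hGdef
  have hGm : Measurable (Function.uncurry G) := by
    have h2 : Function.uncurry G = (Prod.snd ⁻¹' R).indicator fun p : ℝ × E3 => sourceConst lm *
      (transv lm w p.2 : ℂ) * (κ p.1 p.2 * lineFT lm w F (frameNorm lm * (s + μ * p.1)) p.2) := by
      ext ⟨y, ξ⟩
      rfl
    rw [h2]
    refine Measurable.indicator (Measurable.mul ?_ (hκ.measurable.mul ?_))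
      (measurable_snd hG.measurableSet)
    · exact (Complex.continuous_ofReal.comp
        ((continuous_transv lm w).comp continuous_snd)).measurable.const_mul _
    · exact (measurable_lineFT hF lm w).comp
        (by fun_prop : Measurable fun p : ℝ × E3 => (frameNorm lm * (s + μ * p.1), p.2))
  have h1 : eLpNorm (sourceSymbol lm w R κ μ F s) 2 = eLpNorm (fun ξ => ∫ y, G y ξ) 2 := by
    refine eLpNorm_congr_ae ?_
    filter_upwards [ae_integrable_line hG hF] with ξ hi
    exact sourceSymbol_eq_integral hκ hi s
  rw [h1]
  refine (eLpNorm_integral_le hGm.stronglyMeasurable).trans ?_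
  rw [← lintegral_const_mul' _ _ ENNReal.ofReal_ne_top]
  refine lintegral_mono fun y => ?_
  refine eLpNorm_two_le_of_sq ?_
  have h2 := lintegral_lineFT_sq_le hG hF (s + μ * y)
  have hN := frameNorm_pos lm
  calc ∫⁻ ξ, ‖G y ξ‖ₑ ^ 2
      ≤ ∫⁻ ξ in R, ENNReal.ofReal ((frameNorm lm / (2 * Real.pi)) ^ 2 * d₁ * k₀ y ^ 2) *
        (ENNReal.ofReal (transv lm w ξ) *
          ‖lineFT lm w F (frameNorm lm * (s + μ * y)) ξ‖ₑ ^ 2) := by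
        rw [← lintegral_indicator hG.measurableSet]
        refine lintegral_mono fun ξ => ?_
        by_cases hξ : ξ ∈ R
        · simp only [hGdef, indicator_of_mem hξ]
          have hD := hG.transv_pos ξ hξ
          rw [enorm_mul, enorm_mul, enorm_mul, ← ofReal_norm (sourceConst lm), norm_sourceConst,
            ← ofReal_norm ((transv lm w ξ : ℝ) : ℂ), Complex.norm_real, Real.norm_of_nonneg hD.le,
            ← ofReal_norm (κ y ξ), ← mul_assoc, mul_pow, ← mul_assoc,
            ← ENNReal.ofReal_mul (by positivity), ← ENNReal.ofReal_mul (by positivity),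
            ← ENNReal.ofReal_pow (by positivity), ← ENNReal.ofReal_mul' hD.le]
          gcongr
          have h3 := hκ.bound ξ hξ y
          have h4 := hG.upper ξ hξ
          calc (frameNorm lm / (2 * Real.pi) * transv lm w ξ * ‖κ y ξ‖) ^ 2
              = (frameNorm lm / (2 * Real.pi)) ^ 2 * transv lm w ξ * ‖κ y ξ‖ ^ 2 *
                transv lm w ξ := by ring
            _ ≤ _ := by
              have h5 : 0 ≤ (frameNorm lm / (2 * Real.pi)) ^ 2 * d₁ :=
                mul_nonneg (by positivity) (hD.le.trans h4)
              gcongr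
        · simp [hGdef, hξ]
    _ = ENNReal.ofReal ((frameNorm lm / (2 * Real.pi)) ^ 2 * d₁ * k₀ y ^ 2) *
        ∫⁻ ξ in R, (ENNReal.ofReal (transv lm w ξ) *
          ‖lineFT lm w F (frameNorm lm * (s + μ * y)) ξ‖ₑ ^ 2) :=
        lintegral_const_mul' _ _ ENNReal.ofReal_ne_top
    _ ≤ ENNReal.ofReal ((frameNorm lm / (2 * Real.pi)) ^ 2 * d₁ * k₀ y ^ 2) *
        (ENNReal.ofReal ((2 * Real.pi) ^ 5) * S (s + μ * y) ^ 2) := by gcongr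
    _ = _ := by
        change _ = (_ * (_ * S (s + μ * y))) ^ 2
        rw [mul_pow (ENNReal.ofReal (frameNorm lm * √d₁ * planch)), mul_pow (ENNReal.ofReal (k₀ y)),
          ← mul_assoc, ← mul_assoc, ← ENNReal.ofReal_pow (hκ.nonneg y),
          ← ENNReal.ofReal_pow (mul_nonneg (mul_nonneg hN.le (Real.sqrt_nonneg _)) planch_pos.le)]
        rcases le_or_gt 0 d₁ with hd | hd
        · rw [← ENNReal.ofReal_mul (by positivity), ← ENNReal.ofReal_mul (by positivity),
            mul_pow _ planch, mul_pow _ (√d₁), planch_sq, Real.sq_sqrt hd]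
          congr 2
          field_simp
        · have hz : (frameNorm lm / (2 * Real.pi)) ^ 2 * d₁ * k₀ y ^ 2 ≤ 0 :=
            mul_nonpos_of_nonpos_of_nonneg (mul_nonpos_of_nonneg_of_nonpos (by positivity) hd.le)
              (by positivity)
          rw [ENNReal.ofReal_of_nonpos hz, Real.sqrt_eq_zero_of_nonpos hd.le]
          simp

/-- The data `v_s`: a continuous curve in `L²` whose total norm is controlled by the mixed norm of
the forcing. -/
lemma exists_sources (hG : IsTransverse lm w R B d₀ d₁) (hF : IsSymbolOn F B)
    (hκ : IsParametrix lm w R B κ μ k₀) :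
    ∃ v : ℝ → L2, Continuous v ∧ (∀ s, hat (v s) =ᵐ[volume] sourceSymbol lm w R κ μ F s) ∧
      ∫⁻ s, ‖v s‖ₑ ≤ ENNReal.ofReal (frameNorm lm * √d₁ * ∫ y, k₀ y) *
        mixedNorm lm w (stSynth F) := by
  obtain ⟨H, hH0, hH⟩ := hG.exists_bound
  have hline := ae_integrable_line hG hF
  obtain ⟨-, -, v, hv, hvs⟩ := exists_continuous_curve (a := sourceSymbol lm w R κ μ F)
    (integrable_lineMajorant hG hF) (memLp_lineMajorant hG hF)
    (fun s => ((measurable_sourceSymbol hG hF hκ).comp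
      (measurable_const.prodMk measurable_id)).aestronglyMeasurable)
    ⟨_, by filter_upwards [hline] with ξ hi; exact norm_sourceSymbol_le hG hκ hi 0⟩
    (fun T => ⟨_, fun s s' _ _ => by
      filter_upwards [hline] with ξ hi; exact norm_sourceSymbol_sub_le hG hF hκ hH hi s s'⟩)
  refine ⟨v, hv, hvs, ?_⟩
  set S : ℝ → ℝ≥0∞ := fun s => eLpNorm (fun Y => stSynth F (frameMap lm w (s, Y))) 2 with hS
  have hSm : Measurable S := by
    refine measurable_eLpNorm_two (F := fun s Y => stSynth F (frameMap lm w (s, Y))) ?_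
    have h1 : Continuous (stSynth F) :=
      continuous_const.mul (continuous_integral_phase hF.integrable)
    exact (h1.comp (continuous_frameMap lm w)).measurable
  have hp : ENNReal.ofReal planch ≠ 0 := by simpa using planch_pos
  have h1 : ∀ s, ‖v s‖ₑ ≤ ENNReal.ofReal (frameNorm lm * √d₁) *
      ∫⁻ y, ENNReal.ofReal (k₀ y) * S (s + μ * y) := by
    intro s
    have h2 := eLpNorm_sourceSymbol_le hG hF hκ s
    rw [exists_hat_eq_norm (hvs s), mul_comm _ planch, ENNReal.ofReal_mul planch_pos.le,
      mul_assoc] at h2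
    exact (ENNReal.mul_le_mul_iff_right hp ENNReal.ofReal_ne_top).1 h2
  calc ∫⁻ s, ‖v s‖ₑ ≤ ∫⁻ s, ENNReal.ofReal (frameNorm lm * √d₁) *
      ∫⁻ y, ENNReal.ofReal (k₀ y) * S (s + μ * y) := lintegral_mono h1
    _ = ENNReal.ofReal (frameNorm lm * √d₁) *
        ∫⁻ s, ∫⁻ y, ENNReal.ofReal (k₀ y) * S (s + μ * y) :=
        lintegral_const_mul' _ _ ENNReal.ofReal_ne_top
    _ = ENNReal.ofReal (frameNorm lm * √d₁) *
        ∫⁻ y, ∫⁻ s, ENNReal.ofReal (k₀ y) * S (s + μ * y) := by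
        rw [lintegral_lintegral_swap]
        refine AEMeasurable.mul ?_ (hSm.comp (by fun_prop)).aemeasurable
        exact (hκ.integrable.aemeasurable.ennreal_ofReal).comp_snd
    _ = ENNReal.ofReal (frameNorm lm * √d₁) *
        ∫⁻ y, ENNReal.ofReal (k₀ y) * mixedNorm lm w (stSynth F) := by
        congr 1
        refine lintegral_congr fun y => ?_
        rw [lintegral_const_mul' _ _ ENNReal.ofReal_ne_top,
          lintegral_add_right_eq_self (fun s => S s)]
        rfl
    _ = _ := by
        rw [lintegral_mul_const'' _ hκ.integrable.aemeasurable.ennreal_ofReal, ← mul_assoc,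
          ← ofReal_integral_eq_lintegral_ofReal hκ.integrable (Eventually.of_forall hκ.nonneg),
          ← ENNReal.ofReal_mul (mul_nonneg (frameNorm_pos lm).le (Real.sqrt_nonneg _))]

end Sources

/-! ### Linear functionals and integrals on the Fourier side -/

lemma hat_add (f g : L2) : hat (f + g) =ᵐ[volume] fun ξ => hat f ξ + hat g ξ := by
  have h : (𝓕 (f + g) : L2) = 𝓕 f + 𝓕 g := (Lp.fourierTransformₗᵢ E3 ℂ).map_add f g
  refine hat_eq_of_fourier ?_
  rw [h]
  filter_upwards [Lp.coeFn_add (𝓕 f : L2) (𝓕 g)] with v hv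
  simp only [hat, hv, smul_smul, Pi.add_apply]
  rw [inv_mul_cancel₀ (by positivity), one_smul]

lemma hat_smul (c : ℂ) (f : L2) : hat (c • f) =ᵐ[volume] fun ξ => c * hat f ξ := by
  have h : (𝓕 (c • f) : L2) = c • 𝓕 f := (Lp.fourierTransformₗᵢ E3 ℂ).map_smul c f
  refine hat_eq_of_fourier ?_
  rw [h]
  filter_upwards [Lp.coeFn_smul c (𝓕 f : L2)] with v hv
  simp only [hat, hv, smul_smul, Pi.smul_apply, smul_eq_mul]
  rw [inv_mul_cancel₀ (by positivity), one_smul]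

lemma integrable_mul_hat {ψ : E3 → ℂ} (hψ : MemLp ψ 2) (f : L2) :
    Integrable fun ξ => ψ ξ * hat f ξ :=
  hψ.integrable_mul (memLp_hat f)

/-- The bounded functional `f ↦ ∫ ψ f̂` on `L²`. -/
def hatFunctional (ψ : E3 → ℂ) (hψ : MemLp ψ 2) : L2 →L[ℂ] ℂ :=
  LinearMap.mkContinuous
    { toFun := fun f => ∫ ξ, ψ ξ * hat f ξ
      map_add' := fun f g => by
        rw [← integral_add (integrable_mul_hat hψ f) (integrable_mul_hat hψ g)]
        refine integral_congr_ae ?_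
        filter_upwards [hat_add f g] with ξ h
        rw [h, mul_add]
      map_smul' := fun c f => by
        rw [RingHom.id_apply, smul_eq_mul, ← integral_const_mul]
        refine integral_congr_ae ?_
        filter_upwards [hat_smul c f] with ξ h
        rw [h, mul_left_comm] }
    ((eLpNorm ψ 2).toReal * planch) (fun f => by
      have h : ‖∫ ξ, ψ ξ * hat f ξ‖ₑ ≤ eLpNorm ψ 2 * (ENNReal.ofReal planch * ‖f‖ₑ) := by
        rw [← eLpNorm_hat]
        refine (enorm_integral_le_lintegral_enorm _).trans ?_
        have h1 := eLpNorm_smul_le_mul_eLpNorm (p := 2) (q := 2) (r := 1)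
          (memLp_hat f).1 hψ.1
        rw [eLpNorm_one_eq_lintegral_enorm] at h1
        exact h1
      have h2 := ENNReal.toReal_mono (ENNReal.mul_lt_top hψ.2
        (ENNReal.mul_lt_top ENNReal.ofReal_lt_top enorm_lt_top)).ne h
      rw [toReal_enorm, ENNReal.toReal_mul, ENNReal.toReal_mul, toReal_enorm,
        ENNReal.toReal_ofReal planch_pos.le, ← mul_assoc] at h2
      exact h2)

lemma hatFunctional_apply {ψ : E3 → ℂ} (hψ : MemLp ψ 2) (f : L2) :
    hatFunctional ψ hψ f = ∫ ξ, ψ ξ * hat f ξ := rfl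

/-- Integrability on a product, from a bound that holds almost everywhere on each slice. -/
lemma integrable_uncurry_of_ae_le {a : ℝ → E3 → ℂ} (ha : Measurable (Function.uncurry a))
    {M : E3 → ℝ} (hM : Integrable M) {T : Set ℝ} (hT : MeasurableSet T) (hT' : volume T < ⊤)
    {C : ℝ} (hb : ∀ s ∈ T, ∀ᵐ ξ, ‖a s ξ‖ ≤ C * M ξ) :
    Integrable (Function.uncurry a) ((volume.restrict T).prod volume) := by
  refine ⟨ha.aestronglyMeasurable, ?_⟩
  rw [hasFiniteIntegral_iff_enorm, lintegral_prod _ ha.enorm.aemeasurable]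
  have h : ∀ s ∈ T, ∫⁻ ξ, ‖Function.uncurry a (s, ξ)‖ₑ ≤ ∫⁻ ξ, ‖C * M ξ‖ₑ := by
    intro s hs
    refine lintegral_mono_ae ?_
    filter_upwards [hb s hs] with ξ h
    refine enorm_le_iff_norm_le.2 (h.trans ?_)
    exact le_abs_self _
  calc _ ≤ ∫⁻ _ in T, ∫⁻ ξ, ‖C * M ξ‖ₑ := setLIntegral_mono' hT h
    _ = (∫⁻ ξ, ‖C * M ξ‖ₑ) * volume T := by simp
    _ < ⊤ := ENNReal.mul_lt_top (hM.const_mul C).2 hT'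

/-- The Fourier transform of the integral of a continuous curve in `L²` is the pointwise integral of
the Fourier transforms. -/
lemma hat_intervalIntegral {A : ℝ → L2} (hA : Continuous A) {a : ℝ → E3 → ℂ}
    (ha : Measurable (Function.uncurry a)) (hAa : ∀ s, hat (A s) =ᵐ[volume] a s)
    {M : E3 → ℝ} (hM : Integrable M) (t : ℝ) {C : ℝ}
    (hb : ∀ s ∈ uIoc 0 t, ∀ᵐ ξ, ‖a s ξ‖ ≤ C * M ξ) :
    hat (∫ s in (0 : ℝ)..t, A s) =ᵐ[volume] fun ξ => ∫ s in (0 : ℝ)..t, a s ξ := by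
  have hvol : volume (uIoc 0 t) < ⊤ := by
    rw [uIoc]; exact measure_Ioc_lt_top
  have hint := integrable_uncurry_of_ae_le ha hM measurableSet_uIoc hvol hb
  refine ae_eq_of_forall_setIntegral_eq_of_sigmaFinite (fun S hS hfin => ?_)
    (fun S hS hfin => ?_) (fun S hS hfin => ?_)
  · have : IsFiniteMeasure (volume.restrict S) := ⟨by simpa using hfin⟩
    exact ((memLp_hat _).restrict S).integrable (by norm_num)
  · simp only [intervalIntegral.intervalIntegral_eq_integral_uIoc]
    exact (hint.integral_prod_right.smul _).integrableOn
  · have hψ : MemLp (S.indicator fun _ => (1 : ℂ)) 2 :=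
      memLp_indicator_const 2 hS 1 (Or.inr hfin.ne)
    have key : ∀ f : L2, ∫ ξ in S, hat f ξ = hatFunctional _ hψ f := by
      intro f
      rw [hatFunctional_apply, ← integral_indicator hS]
      refine integral_congr_ae (Eventually.of_forall fun ξ => ?_)
      by_cases h : ξ ∈ S <;> simp [h]
    rw [key, ← ContinuousLinearMap.intervalIntegral_comp_comm _ (hA.intervalIntegrable 0 t)]
    have h1 : ∀ s, hatFunctional _ hψ (A s) = ∫ ξ in S, a s ξ := fun s => by
      rw [← key]
      exact integral_congr_ae (ae_restrict_of_ae (hAa s))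
    simp only [h1]
    refine intervalIntegral_integral_swap (hint.mono_measure ?_)
    exact Measure.prod_mono le_rfl Measure.restrict_le_self

/-! ### The solution of the inhomogeneous equation -/

section Duhamel

variable {F : ℝ × E3 → ℂ} {B : Set (ℝ × E3)}

/-- `(2π)⁻¹ ∫ θ(τ, ξ) F(τ, ξ) dτ`: the spatial Fourier transform of the inverse space-time Fourier
transform of `F`, with the time exponential replaced by `θ`. -/
def fiberSymbol (F θ : ℝ × E3 → ℂ) (ξ : E3) : ℂ :=
  ((2 * Real.pi : ℝ) : ℂ)⁻¹ * ∫ τ : ℝ, θ (τ, ξ) * F (τ, ξ)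

/-- `∫ |F(τ, ξ)| dτ`. -/
def fiberMajorant (F : ℝ × E3 → ℂ) (ξ : E3) : ℝ := ∫ τ : ℝ, ‖F (τ, ξ)‖

lemma IsSymbolOn.measurable_left (hF : IsSymbolOn F B) (ξ : E3) :
    Measurable fun τ : ℝ => F (τ, ξ) :=
  hF.measurable.comp (measurable_id.prodMk measurable_const)

lemma integrable_fiberMajorant (hF : IsSymbolOn F B) : Integrable (fiberMajorant F) :=
  (Measure.volume_eq_prod ℝ E3 ▸ hF.integrable.norm :
    Integrable (fun ζ => ‖F ζ‖)
      ((volume : Measure ℝ).prod (volume : Measure E3))).integral_prod_right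

lemma ae_integrable_fiber (hF : IsSymbolOn F B) : ∀ᵐ ξ : E3, Integrable fun τ : ℝ => F (τ, ξ) :=
  (Measure.volume_eq_prod ℝ E3 ▸ hF.integrable :
    Integrable F ((volume : Measure ℝ).prod (volume : Measure E3))).prod_left_ae

lemma memLp_fiberMajorant (hF : IsSymbolOn F B) (hB : IsCompact B) :
    MemLp (fiberMajorant F) 2 := by
  refine ⟨(integrable_fiberMajorant hF).1, ?_⟩
  obtain ⟨r, hr⟩ := hB.isBounded.subset_closedBall 0
  have h2 : ∫⁻ p : ℝ × E3, ENNReal.ofReal (1 + p.1 ^ 2) * ‖F p‖ₑ ^ 2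
      ≤ ENNReal.ofReal (1 + r ^ 2) * eLpNorm F 2 ^ 2 := by
    rw [eLpNorm_two_sq, ← lintegral_const_mul' _ _ ENNReal.ofReal_ne_top]
    refine lintegral_mono fun p => ?_
    by_cases hz : F p = 0
    · simp [hz]
    · refine mul_le_mul_left (ENNReal.ofReal_le_ofReal ?_) _
      have h := hr (hF.mem_of_ne_zero hz)
      rw [mem_closedBall_zero_iff] at h
      have h1 : |p.1| ≤ r := (norm_fst_le p).trans h
      have : p.1 ^ 2 ≤ r ^ 2 := sq_le_sq' (by linarith [neg_abs_le p.1]) ((le_abs_self _).trans h1)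
      linarith
  have h6 : eLpNorm (fiberMajorant F) 2 ^ 2 < ⊤ := by
    rw [eLpNorm_two_sq]
    calc _ ≤ ∫⁻ ξ : E3, (∫⁻ τ : ℝ, ‖F (τ, ξ)‖ₑ) ^ 2 := by
          gcongr with ξ
          refine (enorm_integral_le_lintegral_enorm _).trans (le_of_eq ?_)
          simp only [enorm_norm]
      _ ≤ _ := lintegral_fiber_sq_le hF.measurable.enorm
      _ < ⊤ := by
          refine ENNReal.mul_lt_top ENNReal.ofReal_lt_top (h2.trans_lt ?_)
          exact ENNReal.mul_lt_top ENNReal.ofReal_lt_top (ENNReal.pow_lt_top hF.memLp.2)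
  by_contra h7
  rw [not_lt, top_le_iff] at h7
  rw [h7] at h6
  simp at h6

lemma norm_fiberSymbol_le {θ : ℝ × E3 → ℂ} {C : ℝ} (hF : IsSymbolOn F B)
    (hC : ∀ ζ ∈ B, ‖θ ζ‖ ≤ C) {ξ : E3} (hi : Integrable fun τ : ℝ => F (τ, ξ)) :
    ‖fiberSymbol F θ ξ‖ ≤ ((2 * Real.pi)⁻¹ * C) * fiberMajorant F ξ := by
  rw [fiberSymbol, norm_mul, norm_inv, Complex.norm_real, Real.norm_of_nonneg (by positivity),
    mul_assoc, fiberMajorant, ← integral_const_mul]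
  gcongr
  refine norm_integral_le_of_norm_le (hi.norm.const_mul _) (Eventually.of_forall fun τ => ?_)
  rw [norm_mul]
  by_cases hz : F (τ, ξ) = 0
  · simp [hz]
  · gcongr
    exact hC _ (hF.mem_of_ne_zero hz)

lemma integrable_mul_symbol {θ : ℝ × E3 → ℂ} (hθ : Measurable θ) {C : ℝ} (hF : IsSymbolOn F B)
    (hC : ∀ ζ ∈ B, ‖θ ζ‖ ≤ C) : Integrable fun ζ => θ ζ * F ζ := by
  refine (hF.integrable.norm.const_mul C).mono' (hθ.mul hF.measurable).aestronglyMeasurable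
    (Eventually.of_forall fun ζ => ?_)
  rw [norm_mul]
  by_cases hz : F ζ = 0
  · simp [hz]
  · gcongr
    exact hC _ (hF.mem_of_ne_zero hz)

lemma integrable_mul_symbol_fiber {θ : ℝ × E3 → ℂ} (hθ : Measurable θ) {C : ℝ}
    (hF : IsSymbolOn F B) (hC : ∀ ζ ∈ B, ‖θ ζ‖ ≤ C) {ξ : E3}
    (hi : Integrable fun τ : ℝ => F (τ, ξ)) : Integrable fun τ : ℝ => θ (τ, ξ) * F (τ, ξ) := by
  refine (hi.norm.const_mul C).mono' ((hθ.comp (measurable_id.prodMk measurable_const)).mul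
    (hF.measurable_left ξ)).aestronglyMeasurable (Eventually.of_forall fun τ => ?_)
  rw [norm_mul]
  by_cases hz : F (τ, ξ) = 0
  · simp [hz]
  · gcongr
    exact hC _ (hF.mem_of_ne_zero hz)

lemma measurable_fiberSymbol {θ : ℝ → ℝ × E3 → ℂ} (hθ : Measurable (Function.uncurry θ))
    (hF : IsSymbolOn F B) : Measurable (Function.uncurry fun s => fiberSymbol F (θ s)) := by
  have hm : StronglyMeasurable (Function.uncurry fun (p : ℝ × E3) (τ : ℝ) =>
      θ p.1 (τ, p.2) * F (τ, p.2)) := by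
    have h1 := hF.measurable.comp (by fun_prop : Measurable fun x : (ℝ × E3) × ℝ => (x.2, x.1.2))
    have h2 := hθ.comp
      (by fun_prop : Measurable fun x : (ℝ × E3) × ℝ => (x.1.1, (x.2, x.1.2)))
    exact (h2.mul h1).stronglyMeasurable
  exact (hm.integral_prod_right.measurable).const_mul _

lemma synth_fiberSymbol {θ : ℝ × E3 → ℂ} (hθ : Measurable θ) {C : ℝ} (hF : IsSymbolOn F B)
    (hC : ∀ ζ ∈ B, ‖θ ζ‖ ≤ C) (x : E3) :
    (((2 * Real.pi) ^ 3 : ℝ) : ℂ)⁻¹ * synth (fiberSymbol F θ) x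
      = (((2 * Real.pi) ^ 4 : ℝ) : ℂ)⁻¹ *
        ∫ ζ : ℝ × E3, Complex.exp (Complex.I * (⟪x, ζ.2⟫ : ℂ)) * (θ ζ * F ζ) := by
  have hi : Integrable (fun ζ : ℝ × E3 => Complex.exp (Complex.I * (⟪x, ζ.2⟫ : ℂ)) * (θ ζ * F ζ))
      ((volume : Measure ℝ).prod (volume : Measure E3)) := by
    rw [← Measure.volume_eq_prod]
    exact integrable_phase_mul (integrable_mul_symbol hθ hF hC) (by fun_prop)
  rw [Measure.volume_eq_prod, integral_prod_symm _ hi, synth]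
  have : ∀ ξ, Complex.exp (Complex.I * (⟪x, ξ⟫ : ℂ)) * fiberSymbol F θ ξ
      = ((2 * Real.pi : ℝ) : ℂ)⁻¹ *
        ∫ τ : ℝ, Complex.exp (Complex.I * (⟪x, ξ⟫ : ℂ)) * (θ (τ, ξ) * F (τ, ξ)) := by
    intro ξ
    rw [integral_const_mul, fiberSymbol]
    ring
  simp only [this]
  rw [integral_const_mul, ← mul_assoc, ← mul_inv, ← Complex.ofReal_mul]
  congr 3

/-- A time dependent multiplier, locally Lipschitz in time, applied to `F` gives a continuous curve
in `L²`. -/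
lemma exists_curve_of_multiplier (hF : IsSymbolOn F B) (hB : IsCompact B)
    {θ : ℝ → ℝ × E3 → ℂ} (hθ : Measurable (Function.uncurry θ))
    (hb : ∀ s, ∃ C : ℝ, ∀ ζ ∈ B, ‖θ s ζ‖ ≤ C)
    (hL : ∀ T : ℝ, ∃ C : ℝ, ∀ s s' : ℝ, |s| ≤ T → |s'| ≤ T → ∀ ζ ∈ B,
      ‖θ s ζ - θ s' ζ‖ ≤ C * |s - s'|) :
    ∃ A : ℝ → L2, Continuous A ∧ (∀ s, hat (A s) =ᵐ[volume] fiberSymbol F (θ s)) ∧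
      ∀ s, (A s : E3 → ℂ) =ᵐ[volume] fun x => (((2 * Real.pi) ^ 4 : ℝ) : ℂ)⁻¹ *
        ∫ ζ : ℝ × E3, Complex.exp (Complex.I * (⟪x, ζ.2⟫ : ℂ)) * (θ s ζ * F ζ) := by
  have hθs : ∀ s, Measurable (θ s) := fun s => hθ.comp measurable_prodMk_left
  have hfib := ae_integrable_fiber hF
  obtain ⟨h1, -, A, hA, hAs⟩ := exists_continuous_curve (a := fun s => fiberSymbol F (θ s))
    (integrable_fiberMajorant hF) (memLp_fiberMajorant hF hB)
    (fun s => ((measurable_fiberSymbol hθ hF).comp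
      (measurable_const.prodMk measurable_id)).aestronglyMeasurable)
    (by
      obtain ⟨C, hC⟩ := hb 0
      refine ⟨(2 * Real.pi)⁻¹ * C, ?_⟩
      filter_upwards [hfib] with ξ hi
      exact norm_fiberSymbol_le hF hC hi)
    (fun T => by
      obtain ⟨C, hC⟩ := hL T
      refine ⟨(2 * Real.pi)⁻¹ * C, fun s s' hs hs' => ?_⟩
      obtain ⟨C1, hC1⟩ := hb s
      obtain ⟨C2, hC2⟩ := hb s'
      filter_upwards [hfib] with ξ hi
      have h : fiberSymbol F (θ s) ξ - fiberSymbol F (θ s') ξ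
          = fiberSymbol F (fun ζ => θ s ζ - θ s' ζ) ξ := by
        rw [fiberSymbol, fiberSymbol, fiberSymbol, ← mul_sub, ← integral_sub
          (integrable_mul_symbol_fiber (hθs s) hF hC1 hi)
          (integrable_mul_symbol_fiber (hθs s') hF hC2 hi)]
        simp only [sub_mul]
      rw [h]
      refine (norm_fiberSymbol_le hF (hC s s' hs hs') hi).trans (le_of_eq ?_)
      ring)
  refine ⟨A, hA, hAs, fun s => ?_⟩
  obtain ⟨C, hC⟩ := hb s
  filter_upwards [ae_eq_synth_hat ((h1 s).congr (hAs s).symm)] with x hx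
  rw [hx, synth_congr_ae (hAs s), synth_fiberSymbol (hθs s) hF hC]

/-- The divided difference `(e^{itτ} - e^{itj})/(j - τ)`, which solves `iy' + jy = e^{itτ}`,
`y(0) = 0`. On the diagonal `τ = j`, where Lean's division gives `0`, the values are irrelevant:
the diagonal is negligible in all integrals below. -/
def expDiff (t τ j : ℝ) : ℂ :=
  (Complex.exp (Complex.I * ((t * τ : ℝ) : ℂ)) - Complex.exp (Complex.I * ((t * j : ℝ) : ℂ))) /
    ((j - τ : ℝ) : ℂ)

@[fun_prop]
lemma measurable_jap : Measurable jap := continuous_jap.measurable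

@[fun_prop]
lemma measurable_expDiff {X : Type*} [MeasurableSpace X] {a b c : X → ℝ} (ha : Measurable a)
    (hb : Measurable b) (hc : Measurable c) : Measurable fun x => expDiff (a x) (b x) (c x) := by
  unfold expDiff
  fun_prop

lemma norm_expDiff_le (t τ j : ℝ) : ‖expDiff t τ j‖ ≤ |t| := by
  rcases eq_or_ne τ j with rfl | h
  · simp [expDiff]
  rw [expDiff, norm_div, Complex.norm_real, Real.norm_eq_abs,
    div_le_iff₀ (abs_pos.2 (sub_ne_zero.2 h.symm))]
  refine (norm_exp_sub_exp_le _ _).trans (le_of_eq ?_)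
  rw [← mul_sub, abs_mul, abs_sub_comm τ j]

lemma hasDerivAt_exp_phase (t τ : ℝ) :
    HasDerivAt (fun t : ℝ => Complex.exp (Complex.I * ((t * τ : ℝ) : ℂ)))
      (Complex.I * τ * Complex.exp (Complex.I * ((t * τ : ℝ) : ℂ))) t := by
  have h1 : HasDerivAt (fun t : ℝ => Complex.I * ((t * τ : ℝ) : ℂ)) (Complex.I * τ) t := by
    have h2 : HasDerivAt (fun t : ℝ => t * τ) τ t := by
      simpa using (hasDerivAt_id t).mul_const τ
    exact h2.ofReal_comp.const_mul Complex.I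
  convert h1.cexp using 1
  ring

lemma hasDerivAt_expDiff {τ j : ℝ} (h : τ ≠ j) (t : ℝ) :
    HasDerivAt (fun t => expDiff t τ j)
      (-Complex.I * (Complex.exp (Complex.I * ((t * τ : ℝ) : ℂ)) - j * expDiff t τ j)) t := by
  have hne : ((j - τ : ℝ) : ℂ) ≠ 0 := by
    exact_mod_cast sub_ne_zero.2 h.symm
  have h1 := ((hasDerivAt_exp_phase t τ).sub (hasDerivAt_exp_phase t j)).div_const
    ((j - τ : ℝ) : ℂ)
  refine h1.congr_deriv ?_
  rw [expDiff, div_eq_iff hne, mul_assoc (-Complex.I), sub_mul, mul_assoc (j : ℂ),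
    div_mul_cancel₀ _ hne]
  push_cast
  ring

lemma expDiff_zero (τ j : ℝ) : expDiff 0 τ j = 0 := by simp [expDiff]

lemma expDiff_equation {τ j : ℝ} (h : τ ≠ j) (t : ℝ) :
    Complex.I * expDiff t τ j + j * ∫ s in (0 : ℝ)..t, expDiff s τ j
      = ∫ s in (0 : ℝ)..t, Complex.exp (Complex.I * ((s * τ : ℝ) : ℂ)) := by
  have hc : Continuous fun s => expDiff s τ j := by unfold expDiff; fun_prop
  have hc' : Continuous fun s : ℝ => Complex.exp (Complex.I * ((s * τ : ℝ) : ℂ)) := by fun_prop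
  have h1 := intervalIntegral.integral_eq_sub_of_hasDerivAt (a := 0) (b := t)
    (fun s _ => (hasDerivAt_expDiff h s))
    ((continuous_const.mul (hc'.sub (continuous_const.mul hc))).intervalIntegrable 0 t)
  rw [intervalIntegral.integral_const_mul, intervalIntegral.integral_sub
    (hc'.intervalIntegrable _ _) ((hc.const_mul (j : ℂ)).intervalIntegrable _ _),
    intervalIntegral.integral_const_mul, expDiff_zero, sub_zero] at h1
  rw [← h1]
  linear_combination (-(∫ s in (0 : ℝ)..t, Complex.exp (Complex.I * ((s * τ : ℝ) : ℂ)))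
    + j * ∫ s in (0 : ℝ)..t, expDiff s τ j) * Complex.I_sq

lemma norm_expDiff_sub_le {T τ j : ℝ} {s s' : ℝ} (hs : |s| ≤ T) (hs' : |s'| ≤ T) :
    ‖expDiff s τ j - expDiff s' τ j‖ ≤ (1 + |j| * T) * |s - s'| := by
  rcases eq_or_ne τ j with rfl | h
  · have hT : 0 ≤ T := (abs_nonneg s).trans hs
    simp only [expDiff, sub_self, Complex.ofReal_zero, div_zero, norm_zero]
    positivity
  · refine Convex.norm_image_sub_le_of_norm_hasDerivWithin_le (s := Icc (-T) T)
      (fun t _ => (hasDerivAt_expDiff h t).hasDerivWithinAt) (fun t ht => ?_)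
      (convex_Icc _ _) (abs_le.1 hs') (abs_le.1 hs)
    rw [norm_mul, norm_neg, Complex.norm_I, one_mul]
    refine (norm_sub_le _ _).trans ?_
    rw [norm_phase, norm_mul, Complex.norm_real, Real.norm_eq_abs]
    gcongr
    exact (norm_expDiff_le t τ j).trans (abs_le.2 ht)

/-- The solution of `(i∂_t + ⟨D⟩)u = g`, `u(0) = 0`, where `F` is the space-time Fourier transform
of `g`. -/
def duhamel (F : ℝ × E3 → ℂ) (z : ℝ × E3) : ℂ :=
  (((2 * Real.pi) ^ 4 : ℝ) : ℂ)⁻¹ * ∫ ζ : ℝ × E3,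
    Complex.exp (Complex.I * (⟪z.2, ζ.2⟫ : ℂ)) * (expDiff z.1 ζ.1 (jap ζ.2) * F ζ)

lemma stSynth_eq (F : ℝ × E3 → ℂ) (t : ℝ) (x : E3) :
    stSynth F (t, x) = (((2 * Real.pi) ^ 4 : ℝ) : ℂ)⁻¹ * ∫ ζ : ℝ × E3,
      Complex.exp (Complex.I * (⟪x, ζ.2⟫ : ℂ)) *
        (Complex.exp (Complex.I * ((t * ζ.1 : ℝ) : ℂ)) * F ζ) := by
  rw [stSynth]
  congr 1
  refine integral_congr_ae (Eventually.of_forall fun ζ => ?_)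
  simp only [pair]
  rw [← mul_assoc, ← Complex.exp_add, Complex.ofReal_add, mul_add, add_comm]

lemma measurable_duhamel (hF : IsSymbolOn F B) : Measurable (duhamel F) := by
  have hm : StronglyMeasurable (Function.uncurry fun (z ζ : ℝ × E3) =>
      Complex.exp (Complex.I * (⟪z.2, ζ.2⟫ : ℂ)) * (expDiff z.1 ζ.1 (jap ζ.2) * F ζ)) := by
    have h1 := hF.measurable.comp (by fun_prop : Measurable fun x : (ℝ × E3) × (ℝ × E3) => x.2)
    have h2 : Measurable fun x : (ℝ × E3) × (ℝ × E3) => expDiff x.1.1 x.2.1 (jap x.2.2) := by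
      fun_prop
    exact (Measurable.mul (by fun_prop) (h2.mul h1)).stronglyMeasurable
  exact hm.integral_prod_right.measurable.const_mul _

lemma intervalIntegral_fiberSymbol (hF : IsSymbolOn F B) {θ : ℝ → ℝ × E3 → ℂ}
    (hθ : Measurable (Function.uncurry θ)) {ξ : E3} (hi : Integrable fun τ : ℝ => F (τ, ξ))
    {t C : ℝ} (hC : ∀ s ∈ uIoc 0 t, ∀ τ, ‖θ s (τ, ξ)‖ ≤ C) :
    ∫ s in (0 : ℝ)..t, fiberSymbol F (θ s) ξ
      = ((2 * Real.pi : ℝ) : ℂ)⁻¹ * ∫ τ, (∫ s in (0 : ℝ)..t, θ s (τ, ξ)) * F (τ, ξ) := by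
  simp only [fiberSymbol]
  rw [intervalIntegral.integral_const_mul, intervalIntegral_integral_swap]
  · simp only [intervalIntegral.integral_mul_const]
  · have : IsFiniteMeasure (volume.restrict (uIoc 0 t)) :=
      ⟨by rw [Measure.restrict_apply_univ, uIoc]; exact measure_Ioc_lt_top⟩
    have h1 : Integrable (fun p : ℝ × ℝ => (1 : ℂ) * F (p.2, ξ))
        ((volume.restrict (uIoc 0 t)).prod volume) :=
      (integrable_const (1 : ℂ)).mul_prod hi
    refine (h1.norm.const_mul C).mono' ?_ ?_
    · have h2 : Measurable fun p : ℝ × ℝ => θ p.1 (p.2, ξ) :=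
        hθ.comp (by fun_prop : Measurable fun p : ℝ × ℝ => (p.1, (p.2, ξ)))
      have h3 : Measurable fun p : ℝ × ℝ => F (p.2, ξ) :=
        hF.measurable.comp (by fun_prop : Measurable fun p : ℝ × ℝ => (p.2, ξ))
      exact (h2.mul h3).aestronglyMeasurable
    · have h2 : ∀ᵐ p : ℝ × ℝ ∂(volume.restrict (uIoc 0 t)).prod volume, p.1 ∈ uIoc 0 t :=
        Measure.quasiMeasurePreserving_fst.ae (ae_restrict_mem measurableSet_uIoc)
      filter_upwards [h2] with p hp
      simp only [Function.uncurry, norm_mul, one_mul]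
      gcongr
      exact hC _ hp _

lemma abs_le_of_mem_uIoc {s t : ℝ} (hs : s ∈ uIoc 0 t) : |s| ≤ |t| := by
  simpa using abs_sub_left_of_mem_uIcc (uIoc_subset_uIcc hs)

lemma measurable_expDiff_symbol :
    Measurable (Function.uncurry fun (t : ℝ) (ζ : ℝ × E3) => expDiff t ζ.1 (jap ζ.2)) := by
  simp only [Function.uncurry_def]
  fun_prop

lemma measurable_exp_symbol : Measurable (Function.uncurry fun (t : ℝ) (ζ : ℝ × E3) =>
    Complex.exp (Complex.I * ((t * ζ.1 : ℝ) : ℂ))) := by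
  simp only [Function.uncurry_def]
  fun_prop

/-- The integrated equation at a fixed spatial frequency. -/
lemma fiberSymbol_equation (hF : IsSymbolOn F B) {ξ : E3} (hi : Integrable fun τ : ℝ => F (τ, ξ))
    (t : ℝ) :
    Complex.I * fiberSymbol F (fun ζ => expDiff t ζ.1 (jap ζ.2)) ξ + (jap ξ : ℂ) *
      (∫ s in (0 : ℝ)..t, fiberSymbol F (fun ζ => expDiff s ζ.1 (jap ζ.2)) ξ)
      = ∫ s in (0 : ℝ)..t, fiberSymbol F
        (fun ζ => Complex.exp (Complex.I * ((s * ζ.1 : ℝ) : ℂ))) ξ := by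
  have hUb : ∀ s, ∀ ζ ∈ B, ‖expDiff s ζ.1 (jap ζ.2)‖ ≤ |s| := fun s ζ _ => norm_expDiff_le _ _ _
  rw [intervalIntegral_fiberSymbol hF measurable_expDiff_symbol hi (C := |t|)
      (fun s hs τ => (norm_expDiff_le _ _ _).trans (abs_le_of_mem_uIoc hs)),
    intervalIntegral_fiberSymbol hF measurable_exp_symbol hi (C := 1)
      (fun s hs τ => (norm_phase _).le), fiberSymbol]
  have hne : ∀ᵐ τ : ℝ, τ ≠ jap ξ := by
    rw [ae_iff]
    simp
  have hi1 := integrable_mul_symbol_fiber (by fun_prop :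
    Measurable fun ζ : ℝ × E3 => expDiff t ζ.1 (jap ζ.2)) hF (hUb t) hi
  have hmI : Measurable fun ζ : ℝ × E3 => ∫ s in (0 : ℝ)..t, expDiff s ζ.1 (jap ζ.2) := by
    have hm : StronglyMeasurable (Function.uncurry fun (ζ : ℝ × E3) (s : ℝ) =>
        expDiff s ζ.1 (jap ζ.2)) := by
      simp only [Function.uncurry_def]
      exact Measurable.stronglyMeasurable (by fun_prop)
    simp only [intervalIntegral.intervalIntegral_eq_integral_uIoc]
    exact (hm.integral_prod_right (ν := volume.restrict (uIoc 0 t))).measurable.const_smul _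
  have hi2 := integrable_mul_symbol_fiber hmI hF (C := |t| * |t - 0|) (fun ζ _ =>
    intervalIntegral.norm_integral_le_of_norm_le_const
      fun s hs => (norm_expDiff_le _ _ _).trans (abs_le_of_mem_uIoc hs)) hi
  rw [mul_left_comm, ← integral_const_mul, mul_left_comm (jap ξ : ℂ),
    ← integral_const_mul (jap ξ : ℂ), ← mul_add, ← integral_add (hi1.const_mul _)
    (hi2.const_mul _)]
  congr 1
  refine integral_congr_ae ?_
  filter_upwards [hne] with τ hτ'
  have := expDiff_equation hτ' t
  rw [← this]
  ring

/-- The spatial Fourier transforms of the curves `U` and `G` required of a solution are integrals of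
`F` over `τ` against `expDiff` and the exponential; the equation holds at each spatial frequency. -/
lemma isSolution_duhamel (hF : IsSymbolOn F B) (hB : IsCompact B) {g : ℝ × E3 → ℂ}
    (hg : g =ᵐ[volume] stSynth F) : IsSolution g (duhamel F) := by
  obtain ⟨r, hr0, hr⟩ := hB.isBounded.subset_closedBall_lt 0 0
  have hJ : ∃ J : ℝ, ∀ ζ ∈ B, |jap ζ.2| ≤ J := by
    obtain ⟨J, hJ⟩ := hB.exists_bound_of_continuousOn
      (f := fun ζ : ℝ × E3 => jap ζ.2) (continuous_jap.comp continuous_snd).continuousOn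
    exact ⟨J, hJ⟩
  obtain ⟨J, hJ⟩ := hJ
  have hτ : ∀ ζ ∈ B, |ζ.1| ≤ r := fun ζ hζ =>
    (norm_fst_le ζ).trans (mem_closedBall_zero_iff.1 (hr hζ))
  set θU : ℝ → ℝ × E3 → ℂ := fun t ζ => expDiff t ζ.1 (jap ζ.2) with hθU
  set θG : ℝ → ℝ × E3 → ℂ := fun t ζ => Complex.exp (Complex.I * ((t * ζ.1 : ℝ) : ℂ)) with hθG
  have hmU : Measurable (Function.uncurry θU) := measurable_expDiff_symbol
  have hmG : Measurable (Function.uncurry θG) := measurable_exp_symbol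
  have hUb : ∀ s, ∀ ζ ∈ B, ‖θU s ζ‖ ≤ |s| := fun s ζ _ => norm_expDiff_le _ _ _
  have hGb : ∀ s, ∀ ζ ∈ B, ‖θG s ζ‖ ≤ 1 := fun s ζ _ => (norm_phase _).le
  obtain ⟨U, hU, hUhat, hUx⟩ := exists_curve_of_multiplier hF hB hmU
    (fun s => ⟨_, hUb s⟩) (fun T => ⟨1 + J * T, fun s s' hs hs' ζ hζ => by
      refine (norm_expDiff_sub_le hs hs').trans ?_
      have hT : 0 ≤ T := (abs_nonneg s).trans hs
      gcongr
      exact hJ ζ hζ⟩)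
  obtain ⟨G, hG, hGhat, hGx⟩ := exists_curve_of_multiplier hF hB hmG
    (fun s => ⟨_, hGb s⟩) (fun T => ⟨r, fun s s' hs hs' ζ hζ => by
      refine (norm_exp_sub_exp_le _ _).trans ?_
      rw [← sub_mul, abs_mul, mul_comm]
      gcongr
      exact hτ ζ hζ⟩)
  have hfib := ae_integrable_fiber hF
  refine ⟨(measurable_duhamel hF).aestronglyMeasurable, U, G, hU, ?_, ?_, ?_,
    fun a b => hG.intervalIntegrable a b, fun t => ?_⟩
  · have h1 : hat (U 0) =ᵐ[volume] hat 0 := by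
      have h0 := hat_sub (0 : L2) 0
      rw [sub_zero] at h0
      filter_upwards [hUhat 0, h0] with ξ e1 e2
      rw [e1, e2, sub_self]
      simp [fiberSymbol, hθU, expDiff_zero]
    exact eq_of_hat_eq h1
  · exact Eventually.of_forall fun t => hUx t
  · have h1 : ∀ᵐ t : ℝ, ∀ᵐ x : E3, g (t, x) = stSynth F (t, x) := by
      rw [Measure.volume_eq_prod] at hg
      exact Measure.ae_ae_of_ae_prod hg
    filter_upwards [h1] with t ht
    filter_upwards [ht, hGx t] with x e1 e2
    rw [e1, e2, stSynth_eq]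
  · have hUI := hat_intervalIntegral hU (measurable_fiberSymbol hmU hF) hUhat
      (integrable_fiberMajorant hF) t (C := (2 * Real.pi)⁻¹ * |t|) (fun s hs => by
        filter_upwards [hfib] with ξ hi
        exact norm_fiberSymbol_le hF (fun ζ hζ => (hUb s ζ hζ).trans (abs_le_of_mem_uIoc hs)) hi)
    have hGI := hat_intervalIntegral hG (measurable_fiberSymbol hmG hF) hGhat
      (integrable_fiberMajorant hF) t (C := (2 * Real.pi)⁻¹ * 1) (fun s hs => by
        filter_upwards [hfib] with ξ hi
        exact norm_fiberSymbol_le hF (hGb s) hi)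
    filter_upwards [hUhat t, hUI, hGI, hfib] with ξ e1 e2 e3 hi
    rw [e1, e2, e3]
    exact fiberSymbol_equation hF hi t

end Duhamel

/-! ### Uniqueness of solutions -/

/-- The Fourier transform on `L²`, restricted to the set `S`. -/
def fourierRestrict (S : Set E3) : L2 →L[ℂ] Lp (α := E3) ℂ 2 (volume.restrict S) :=
  (LpToLpRestrictCLM E3 ℂ ℂ volume 2 S).comp
    (Lp.fourierTransformₗᵢ E3 ℂ).toContinuousLinearEquiv.toContinuousLinearMap

lemma fourierRestrict_ae (S : Set E3) (f : L2) :
    (fourierRestrict S f : E3 → ℂ) =ᵐ[volume.restrict S] (𝓕 f : L2) :=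
  LpToLpRestrictCLM_coeFn ℂ _ _

lemma fourierRestrict_eq_zero_iff {S : Set E3} (hS : MeasurableSet S) (f : L2) :
    fourierRestrict S f = 0 ↔ ∀ᵐ v : E3, v ∈ S → (𝓕 f : L2) v = 0 := by
  rw [← ae_restrict_iff' hS]
  constructor
  · intro h
    have h2 := fourierRestrict_ae S f
    rw [h] at h2
    filter_upwards [h2, Lp.coeFn_zero ℂ 2 (volume.restrict S)] with v e1 e2
    rw [← e1, e2, Pi.zero_apply]
  · intro h
    refine Lp.ext ?_
    filter_upwards [h, fourierRestrict_ae S f, Lp.coeFn_zero ℂ 2 (volume.restrict S)]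
      with v e1 e2 e3
    rw [e2, e1, e3, Pi.zero_apply]

lemma eq_zero_of_fourierRestrict {f : L2}
    (h : ∀ n : ℕ, fourierRestrict (Metric.closedBall 0 n) f = 0) : f = 0 := by
  have h1 : ∀ᵐ v : E3, ∀ n : ℕ, v ∈ Metric.closedBall (0 : E3) n → (𝓕 f : L2) v = 0 := by
    rw [ae_all_iff]
    intro n
    exact (fourierRestrict_eq_zero_iff Metric.isClosed_closedBall.measurableSet f).1 (h n)
  have h3 : (𝓕 f : L2) = 0 := by
    refine Lp.ext ?_
    filter_upwards [h1, Lp.coeFn_zero ℂ 2 (volume : Measure E3)] with v e1 e2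
    obtain ⟨n, hn⟩ := exists_nat_ge ‖v‖
    rw [e2, e1 n (mem_closedBall_zero_iff.2 hn), Pi.zero_apply]
  have h4 : ‖f‖ = 0 := by rw [← Lp.norm_fourier_eq f, h3, norm_zero]
  exact norm_eq_zero.1 h4

/-- The homogeneous equation in integrated form has only the zero solution: on bounded sets of
frequencies `⟨D⟩` is bounded, and Grönwall's inequality applies. -/
lemma eq_zero_of_homogeneous {W : ℝ → L2} (hW : Continuous W)
    (h : ∀ t : ℝ, ∀ᵐ ξ : E3,
      Complex.I * hat (W t) ξ + (jap ξ : ℂ) * hat (∫ s in (0 : ℝ)..t, W s) ξ = 0) (t : ℝ) :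
    W t = 0 := by
  refine eq_zero_of_fourierRestrict fun n => ?_
  set Z : ℝ → L2 := fun t => ∫ s in (0 : ℝ)..t, W s with hZ
  set P := fourierRestrict (Metric.closedBall 0 (n : ℝ)) with hP
  have hP' : ∀ t, HasDerivAt (fun t => P (Z t)) (P (W t)) t := fun t =>
    P.hasFDerivAt.restrictScalars ℝ |>.comp_hasDerivAt t
      (intervalIntegral.integral_hasDerivAt_right (hW.intervalIntegrable 0 t)
        (hW.stronglyMeasurableAtFilter _ _) hW.continuousAt)
  set J : ℝ := √(1 + (2 * Real.pi * n) ^ 2) with hJ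
  have hbound : ∀ t, ‖P (W t)‖ ≤ J * ‖P (Z t)‖ := by
    intro t
    refine Lp.norm_le_mul_norm_of_ae_le_mul ?_
    have h1 := ae_dilate (h t) (r := 2 * Real.pi) (by positivity)
    filter_upwards [fourierRestrict_ae _ (W t), fourierRestrict_ae _ (Z t),
      ae_restrict_of_ae h1, ae_restrict_mem Metric.isClosed_closedBall.measurableSet]
      with v e1 e2 e3 e4
    rw [hP, e1, e2]
    rw [mem_closedBall_zero_iff] at e4
    simp only [hat, smul_smul] at e3
    rw [inv_mul_cancel₀ (by positivity), one_smul] at e3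
    have e5 : ‖(𝓕 (W t) : L2) v‖ = jap ((2 * Real.pi) • v) * ‖(𝓕 (Z t) : L2) v‖ := by
      have e6 : Complex.I * (𝓕 (W t) : L2) v
          = -((jap ((2 * Real.pi) • v) : ℂ) * (𝓕 (Z t) : L2) v) := eq_neg_of_add_eq_zero_left e3
      have e7 := congrArg norm e6
      rwa [norm_mul, Complex.norm_I, one_mul, norm_neg, norm_mul, Complex.norm_real,
        Real.norm_of_nonneg (jap_pos _).le] at e7
    rw [e5]
    gcongr
    rw [jap, hJ]
    refine Real.sqrt_le_sqrt ?_
    rw [norm_smul, Real.norm_of_nonneg (by positivity)]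
    gcongr
  have hZ0 : P (Z 0) = 0 := by simp [hZ]
  -- Grönwall's inequality for `‖P Z'‖ ≤ J ‖P Z‖`, forward and backward in time
  have hpos : ∀ t, 0 ≤ t → P (Z t) = 0 := fun t ht =>
    eq_zero_of_abs_deriv_le_mul_abs_self_of_eq_zero_right (a := 0) (b := t)
      (f := fun t => P (Z t)) (f' := fun t => P (W t)) (K := J)
      (fun x _ => (hP' x).continuousAt.continuousWithinAt) (fun x _ => (hP' x).hasDerivWithinAt)
      hZ0 (fun x _ => hbound x) t ⟨ht, le_rfl⟩
  have hneg : ∀ t, 0 ≤ t → P (Z (-t)) = 0 := by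
    have h2 : ∀ t, HasDerivAt (fun t => P (Z (-t))) (-P (W (-t))) t := fun t => by
      have := (hP' (-t)).scomp t (hasDerivAt_neg t)
      rw [neg_one_smul] at this
      exact this
    intro t ht
    exact eq_zero_of_abs_deriv_le_mul_abs_self_of_eq_zero_right (a := 0) (b := t)
      (f := fun t => P (Z (-t))) (f' := fun t => -P (W (-t))) (K := J)
      (fun x _ => (h2 x).continuousAt.continuousWithinAt) (fun x _ => (h2 x).hasDerivWithinAt)
      (by simpa using hZ0) (fun x _ => by rw [norm_neg]; exact hbound (-x)) t ⟨ht, le_rfl⟩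
  have hz : P (Z t) = 0 := by
    rcases le_total 0 t with ht | ht
    · exact hpos t ht
    · simpa using hneg (-t) (neg_nonneg.2 ht)
  have := hbound t
  rw [hz, norm_zero, mul_zero] at this
  exact norm_le_zero_iff.1 this

lemma ae_eq_of_ae_ae_eq {u u' : ℝ × E3 → ℂ} (hu : AEStronglyMeasurable u volume)
    (hu' : AEStronglyMeasurable u' volume) (h : ∀ᵐ t : ℝ, ∀ᵐ x : E3, u (t, x) = u' (t, x)) :
    u =ᵐ[volume] u' := by
  have h1 : ∀ {u : ℝ × E3 → ℂ} (hu : AEStronglyMeasurable u volume),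
      ∀ᵐ t : ℝ, ∀ᵐ x : E3, u (t, x) = hu.mk u (t, x) := fun hu =>
    Measure.ae_ae_of_ae_prod hu.ae_eq_mk
  have h2 : MeasurableSet {z | hu.mk u z = hu'.mk u' z} :=
    measurableSet_eq_fun hu.stronglyMeasurable_mk.measurable hu'.stronglyMeasurable_mk.measurable
  have h3 : hu.mk u =ᵐ[volume] hu'.mk u' := by
    refine (Measure.ae_prod_iff_ae_ae h2).2 ?_
    filter_upwards [h, h1 hu, h1 hu'] with t e1 e2 e3
    filter_upwards [e1, e2, e3] with x e4 e5 e6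
    rw [← e5, e4, e6]
  exact hu.ae_eq_mk.trans (h3.trans hu'.ae_eq_mk.symm)

/-- The forcing curve is determined almost everywhere by `g`, so the difference of two solution
curves solves the homogeneous equation. -/
lemma IsSolution.ae_eq {g u u' : ℝ × E3 → ℂ} (h : IsSolution g u) (h' : IsSolution g u') :
    u =ᵐ[volume] u' := by
  obtain ⟨hu, U, G, hU, -, hUu, hGg, -, heq⟩ := h
  obtain ⟨hu', U', G', hU', -, hUu', hGg', -, heq'⟩ := h'
  have hGG : ∀ᵐ t, G t = G' t := by
    filter_upwards [hGg, hGg'] with t e1 e2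
    refine Lp.ext ?_
    filter_upwards [e1, e2] with x e3 e4
    rw [e3, e4]
  have hI : ∀ t, ∫ s in (0 : ℝ)..t, G s = ∫ s in (0 : ℝ)..t, G' s := fun t =>
    intervalIntegral.integral_congr_ae (hGG.mono fun s hs _ => hs)
  have hz : ∀ t, U t - U' t = 0 := by
    refine eq_zero_of_homogeneous (hU.sub hU') fun t => ?_
    rw [intervalIntegral.integral_sub (hU.intervalIntegrable _ _) (hU'.intervalIntegrable _ _)]
    filter_upwards [heq t, heq' t, hat_sub (U t) (U' t),
      hat_sub (∫ s in (0 : ℝ)..t, U s) (∫ s in (0 : ℝ)..t, U' s)] with ξ e1 e2 e3 e4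
    rw [e3, e4]
    rw [hI] at e1
    linear_combination e1 - e2
  refine ae_eq_of_ae_ae_eq hu hu' ?_
  filter_upwards [hUu, hUu'] with t e1 e2
  filter_upwards [e1, e2] with x e3 e4
  rw [← e3, ← e4, sub_eq_zero.1 (hz t)]

section LineIntegrals

variable {lm : ℝ} {w : E3} {R : Set E3} {B : Set (ℝ × E3)} {d₀ d₁ : ℝ} {F : ℝ × E3 → ℂ}
  {κ : ℝ → E3 → ℂ} {μ : ℝ} {k₀ : ℝ → ℝ} {v : ℝ → L2}

/-- `F` in the coordinates `(h, ξ)` of `charLine`, multiplied by the Jacobian. -/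
def lineWeight (lm : ℝ) (w : E3) (R : Set E3) (F : ℝ × E3 → ℂ) (p : ℝ × E3) : ℂ :=
  R.indicator (fun ξ => (transv lm w ξ : ℂ)) p.2 * F (charLine lm w p)

lemma measurable_lineWeight (hG : IsTransverse lm w R B d₀ d₁) (hF : IsSymbolOn F B) :
    Measurable (lineWeight lm w R F) := by
  have h1 : Measurable fun ξ => (transv lm w ξ : ℂ) :=
    (Complex.continuous_ofReal.comp (continuous_transv lm w)).measurable
  exact ((h1.indicator hG.measurableSet).comp measurable_snd).mul (hF.measurable_line lm w)

lemma lineWeight_ne_zero (hF : IsSymbolOn F B) {p : ℝ × E3} (h : lineWeight lm w R F p ≠ 0) :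
    p.2 ∈ R ∧ charLine lm w p ∈ B := by
  have h1 := left_ne_zero_of_mul h
  exact ⟨mem_of_indicator_ne_zero h1, hF.mem_of_ne_zero (right_ne_zero_of_mul h)⟩

lemma integrable_lineWeight (hG : IsTransverse lm w R B d₀ d₁) (hF : IsSymbolOn F B) :
    Integrable (lineWeight lm w R F) := by
  have hm := measurable_lineWeight hG hF
  refine ⟨hm.aestronglyMeasurable, ?_⟩
  rw [hasFiniteIntegral_iff_enorm, Measure.volume_eq_prod, lintegral_prod_symm' _ hm.enorm]
  refine lt_of_eq_of_lt ?_ (lintegral_line_lt_top hG hF)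
  rw [← lintegral_indicator hG.measurableSet]
  refine lintegral_congr fun ξ => ?_
  by_cases hξ : ξ ∈ R
  · simp only [lineWeight, indicator_of_mem hξ, enorm_mul]
    rw [lintegral_const_mul' _ _ enorm_ne_top, ← ofReal_norm, Complex.norm_real,
      Real.norm_of_nonneg (hG.transv_pos ξ hξ).le]
  · simp [lineWeight, hξ]

lemma integrable_mul_lineWeight (hG : IsTransverse lm w R B d₀ d₁) (hF : IsSymbolOn F B)
    {φ : ℝ × E3 → ℂ} (hφ : Measurable φ) {C : ℝ}
    (hC : ∀ p : ℝ × E3, p.2 ∈ R → charLine lm w p ∈ B → ‖φ p‖ ≤ C) :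
    Integrable fun p => φ p * lineWeight lm w R F p := by
  refine ((integrable_lineWeight hG hF).norm.const_mul C).mono'
    (hφ.mul (measurable_lineWeight hG hF)).aestronglyMeasurable
    (Eventually.of_forall fun p => ?_)
  rw [norm_mul]
  by_cases hz : lineWeight lm w R F p = 0
  · simp [hz]
  · obtain ⟨h1, h2⟩ := lineWeight_ne_zero hF hz
    gcongr
    exact hC p h1 h2

/-- The change of variables `ζ = charLine (h, ξ)`. -/
lemma integral_symbol_eq (hG : IsTransverse lm w R B d₀ d₁) (hF : IsSymbolOn F B)
    {φ : ℝ × E3 → ℂ} (hφ : Measurable φ) {C : ℝ} (hC : ∀ ζ, ‖φ ζ‖ ≤ C) :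
    ∫ ζ, φ ζ * F ζ = ∫ p, φ (charLine lm w p) * lineWeight lm w R F p := by
  rw [integral_charLine hG.unit hG.measurableSet hG.transv_pos
    (integrable_mul_symbol hφ hF fun ζ _ => hC ζ)
    (fun ζ hζ => hG.exists_char ζ (hF.mem_of_ne_zero (right_ne_zero_of_mul hζ)))]
  have hi : Integrable (fun p => φ (charLine lm w p) * lineWeight lm w R F p)
      ((volume : Measure ℝ).prod (volume : Measure E3)) :=
    integrable_mul_lineWeight hG hF (hφ.comp (continuous_charLine lm w).measurable)
      fun p _ _ => hC _
  rw [Measure.volume_eq_prod, integral_prod_symm _ hi, ← integral_indicator hG.measurableSet]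
  refine integral_congr_ae (Eventually.of_forall fun ξ => ?_)
  by_cases hξ : ξ ∈ R
  · simp only [lineWeight, indicator_of_mem hξ]
    rw [← integral_const_mul]
    refine integral_congr_ae (Eventually.of_forall fun h => ?_)
    ring
  · simp [lineWeight, hξ]

lemma integral_mul_sourceSymbol (hG : IsTransverse lm w R B d₀ d₁) (hF : IsSymbolOn F B)
    (hκ : IsParametrix lm w R B κ μ k₀) {φ : E3 → ℂ} (hφ : Measurable φ) (hC : ∀ ξ, ‖φ ξ‖ ≤ 1)
    (s : ℝ) :
    ∫ ξ, φ ξ * sourceSymbol lm w R κ μ F s ξ = sourceConst lm *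
      ∫ p : ℝ × E3, (Complex.exp (Complex.I * ((frameNorm lm * s * p.1 : ℝ) : ℂ)) *
        (φ p.2 * kerMult lm κ μ p.1 p.2)) * lineWeight lm w R F p := by
  have hi : Integrable (fun p : ℝ × E3 =>
      (Complex.exp (Complex.I * ((frameNorm lm * s * p.1 : ℝ) : ℂ)) *
        (φ p.2 * kerMult lm κ μ p.1 p.2)) * lineWeight lm w R F p)
      ((volume : Measure ℝ).prod (volume : Measure E3)) := by
    refine integrable_mul_lineWeight hG hF (Measurable.mul (by fun_prop)
      ((hφ.comp measurable_snd).mul (measurable_kerMult hκ))) (C := 1 * ∫ y, k₀ y)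
      fun p hp _ => ?_
    rw [norm_mul, norm_phase, one_mul, norm_mul]
    have := norm_kerMult_le hκ hp p.1
    gcongr
    exact hC _
  rw [Measure.volume_eq_prod, integral_prod_symm _ hi, ← integral_const_mul]
  refine integral_congr_ae (Eventually.of_forall fun ξ => ?_)
  by_cases hξ : ξ ∈ R
  · simp only [lineWeight, sourceSymbol, indicator_of_mem hξ]
    simp only [← integral_const_mul]
    refine integral_congr_ae (Eventually.of_forall fun h => ?_)
    ring
  · simp [lineWeight, sourceSymbol, hξ]

lemma freeWave_eq_of_hat {f : L2} {a : E3 → ℂ} (h : hat f =ᵐ[volume] a) (z : ℝ × E3) :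
    freeWave f z = (((2 * Real.pi) ^ 3 : ℝ) : ℂ)⁻¹ *
      ∫ ξ : E3, Complex.exp (Complex.I * (pair z (charPt ξ) : ℂ)) * a ξ := by
  rw [freeWave_eq]
  congr 1
  refine integral_congr_ae ?_
  filter_upwards [h] with ξ e
  rw [e]

@[fun_prop]
lemma measurable_charPt : Measurable charPt := continuous_charPt.measurable

@[fun_prop]
lemma measurable_pair {X : Type*} [MeasurableSpace X] {a b : X → ℝ × E3} (ha : Measurable a)
    (hb : Measurable b) : Measurable fun x => pair (a x) (b x) := by
  unfold pair
  fun_prop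

lemma freeWave_source (hG : IsTransverse lm w R B d₀ d₁) (hF : IsSymbolOn F B)
    (hκ : IsParametrix lm w R B κ μ k₀)
    (hv : ∀ s, hat (v s) =ᵐ[volume] sourceSymbol lm w R κ μ F s) (s : ℝ) (z : ℝ × E3) :
    freeWave (v s) z = (((2 * Real.pi) ^ 3 : ℝ) : ℂ)⁻¹ * (sourceConst lm *
      ∫ p : ℝ × E3, (Complex.exp (Complex.I * ((frameNorm lm * s * p.1 : ℝ) : ℂ)) *
        (Complex.exp (Complex.I * (pair z (charPt p.2) : ℂ)) * kerMult lm κ μ p.1 p.2)) *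
          lineWeight lm w R F p) := by
  rw [freeWave_eq_of_hat (hv s), integral_mul_sourceSymbol hG hF hκ (by fun_prop)
    (fun ξ => (norm_phase _).le)]

lemma measurable_freeWave_source (hG : IsTransverse lm w R B d₀ d₁) (hF : IsSymbolOn F B)
    (hκ : IsParametrix lm w R B κ μ k₀)
    (hv : ∀ s, hat (v s) =ᵐ[volume] sourceSymbol lm w R κ μ F s) :
    Measurable fun q : ℝ × (ℝ × E3) => freeWave (v q.1) q.2 := by
  simp only [fun q : ℝ × (ℝ × E3) => freeWave_eq_of_hat (hv q.1) q.2]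
  have h1 : Measurable fun x : (ℝ × (ℝ × E3)) × E3 => sourceSymbol lm w R κ μ F x.1.1 x.2 :=
    (measurable_sourceSymbol hG hF hκ).comp
      (by fun_prop : Measurable fun x : (ℝ × (ℝ × E3)) × E3 => (x.1.1, x.2))
  have hm : StronglyMeasurable (Function.uncurry fun (q : ℝ × (ℝ × E3)) (ξ : E3) =>
      Complex.exp (Complex.I * (pair q.2 (charPt ξ) : ℂ)) * sourceSymbol lm w R κ μ F q.1 ξ) := by
    refine Measurable.stronglyMeasurable (Measurable.mul ?_ h1)
    exact (by fun_prop : Measurable fun x : (ℝ × (ℝ × E3)) × E3 =>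
      Complex.exp (Complex.I * (pair x.1.2 (charPt x.2) : ℂ)))
  exact hm.integral_prod_right.measurable.const_mul _

lemma intervalIntegral_freeWave_source (hG : IsTransverse lm w R B d₀ d₁) (hF : IsSymbolOn F B)
    (hκ : IsParametrix lm w R B κ μ k₀)
    (hv : ∀ s, hat (v s) =ᵐ[volume] sourceSymbol lm w R κ μ F s) (r : ℝ) (z : ℝ × E3) :
    ∫ s in (0 : ℝ)..r, freeWave (v s) z = (((2 * Real.pi) ^ 3 : ℝ) : ℂ)⁻¹ * (sourceConst lm *
      ∫ p : ℝ × E3, ((∫ s in (0 : ℝ)..r,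
          Complex.exp (Complex.I * ((frameNorm lm * s * p.1 : ℝ) : ℂ))) *
        (Complex.exp (Complex.I * (pair z (charPt p.2) : ℂ)) * kerMult lm κ μ p.1 p.2)) *
          lineWeight lm w R F p) := by
  simp only [freeWave_source hG hF hκ hv]
  rw [intervalIntegral.integral_const_mul, intervalIntegral.integral_const_mul]
  congr 2
  have hi : Integrable (fun p : ℝ × E3 =>
      (Complex.exp (Complex.I * (pair z (charPt p.2) : ℂ)) * kerMult lm κ μ p.1 p.2) *
          lineWeight lm w R F p) := by
    refine integrable_mul_lineWeight hG hF (Measurable.mul (by fun_prop)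
      (measurable_kerMult hκ)) (C := ∫ y, k₀ y) fun p hp _ => ?_
    rw [norm_mul, norm_phase, one_mul]
    exact norm_kerMult_le hκ hp p.1
  rw [intervalIntegral_integral_swap]
  · refine integral_congr_ae (Eventually.of_forall fun p => ?_)
    simp only [mul_assoc, intervalIntegral.integral_mul_const]
  · have : IsFiniteMeasure (volume.restrict (uIoc 0 r)) :=
      ⟨by rw [Measure.restrict_apply_univ, uIoc]; exact measure_Ioc_lt_top⟩
    have h1 := (integrable_const (μ := volume.restrict (uIoc 0 r)) (1 : ℂ)).mul_prod hi
    refine (integrable_phase_mul h1 (a := fun x : ℝ × (ℝ × E3) => frameNorm lm * x.1 * x.2.1)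
      (by fun_prop)).congr (Eventually.of_forall fun x => ?_)
    simp only [Function.uncurry]
    ring

/-- The difference of the characteristic exponentials at the spatial frequencies `ξ + hω` and `ξ`,
divided by the symbol of the equation. -/
def diffKernel (lm : ℝ) (w : E3) (κ : ℝ → E3 → ℂ) (μ : ℝ) (z p : ℝ × E3) : ℂ :=
  kerMult lm κ μ p.1 p.2 / (p.1 : ℂ) *
    (Complex.exp (Complex.I * (pair z (charPt (p.2 + p.1 • w)) : ℂ))
      - Complex.exp (Complex.I * (pair z (charPt p.2) : ℂ)))

lemma pair_charLine (lm : ℝ) (w : E3) (z p : ℝ × E3) :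
    pair z (charLine lm w p) = pair z (charPt p.2) + frameNorm lm * tTheta lm w z * p.1 := by
  have hN := (frameNorm_pos lm).ne'
  rw [tTheta_eq, mul_div_cancel₀ _ hN]
  simp only [pair, charLine, charPt, inner_add_right, inner_smul_right]
  rw [real_inner_comm w z.2]
  ring

lemma integral_exp_phase (c r : ℝ) :
    (∫ s in (0 : ℝ)..r, Complex.exp (Complex.I * ((s * c : ℝ) : ℂ))) * (Complex.I * c)
      = Complex.exp (Complex.I * ((r * c : ℝ) : ℂ)) - 1 := by
  have h1 := intervalIntegral.integral_eq_sub_of_hasDerivAt (a := 0) (b := r)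
    (fun s _ => hasDerivAt_exp_phase s c) (Continuous.intervalIntegrable (by fun_prop) 0 r)
  rw [intervalIntegral.integral_const_mul] at h1
  rw [mul_comm, h1]
  simp

/-- The solution and the superposition of the sources differ by an integral of characteristic
exponentials only. -/
lemma duhamel_sub_sources (hG : IsTransverse lm w R B d₀ d₁) (hF : IsSymbolOn F B)
    (hκ : IsParametrix lm w R B κ μ k₀)
    (hv : ∀ s, hat (v s) =ᵐ[volume] sourceSymbol lm w R κ μ F s) (z : ℝ × E3) :
    duhamel F z - ∫ s in (0 : ℝ)..tTheta lm w z, freeWave (v s) z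
      = (((2 * Real.pi) ^ 4 : ℝ) : ℂ)⁻¹ *
        ∫ p, diffKernel lm w κ μ z p * lineWeight lm w R F p := by
  have hN := frameNorm_pos lm
  set r := tTheta lm w z with hr
  rw [intervalIntegral_freeWave_source hG hF hκ hv, duhamel]
  have e1 : ∀ ζ : ℝ × E3, Complex.exp (Complex.I * (⟪z.2, ζ.2⟫ : ℂ)) *
      (expDiff z.1 ζ.1 (jap ζ.2) * F ζ) = (Complex.exp (Complex.I * (⟪z.2, ζ.2⟫ : ℂ)) *
      expDiff z.1 ζ.1 (jap ζ.2)) * F ζ := fun ζ => (mul_assoc _ _ _).symm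
  have hm1 : Measurable fun ζ : ℝ × E3 => Complex.exp (Complex.I * (⟪z.2, ζ.2⟫ : ℂ)) *
      expDiff z.1 ζ.1 (jap ζ.2) := by fun_prop
  have hb1 : ∀ ζ : ℝ × E3, ‖Complex.exp (Complex.I * (⟪z.2, ζ.2⟫ : ℂ)) *
      expDiff z.1 ζ.1 (jap ζ.2)‖ ≤ |z.1| := fun ζ => by
    rw [norm_mul, norm_phase, one_mul]
    exact norm_expDiff_le _ _ _
  simp only [e1]
  rw [integral_symbol_eq hG hF hm1 hb1]
  have e2 : (((2 * Real.pi) ^ 3 : ℝ) : ℂ)⁻¹ * sourceConst lm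
      = (((2 * Real.pi) ^ 4 : ℝ) : ℂ)⁻¹ * (-Complex.I * (frameNorm lm : ℂ)) := by
    have hpi : (Real.pi : ℂ) ≠ 0 := by exact_mod_cast Real.pi_ne_zero
    rw [sourceConst]
    push_cast
    field_simp
  rw [← mul_assoc ((((2 * Real.pi) ^ 3 : ℝ) : ℂ)⁻¹), e2, mul_assoc, ← mul_sub,
    ← integral_const_mul, ← integral_sub]
  · congr 1
    refine integral_congr_ae ?_
    have hne : ∀ᵐ p : ℝ × E3, p.1 ≠ 0 := by
      have h0 : ∀ᵐ h : ℝ, h ≠ 0 := by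
        rw [ae_iff]
        simp
      exact (Measure.quasiMeasurePreserving_fst (μ := (volume : Measure ℝ))
        (ν := (volume : Measure E3))).ae h0
    filter_upwards [hne] with p hp
    by_cases hz : lineWeight lm w R F p = 0
    · simp [hz]
    obtain ⟨hpR, hpB⟩ := lineWeight_ne_zero hF hz
    -- on the support of `F` the multiplier is `h / q`, where `-q = ⟨ξ + hω⟩ - (⟨ξ⟩ + λh)` is the
    -- denominator in Duhamel's formula
    have hker := hκ.eq p.2 hpR p.1 hpB
    rw [← mul_assoc, ← sub_mul]
    congr 1
    have hpc : (p.1 : ℂ) ≠ 0 := by exact_mod_cast hp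
    set q : ℝ := jap p.2 + lm * p.1 - jap (p.2 + p.1 • w) with hq
    have hqc : (q : ℂ) ≠ 0 := by
      intro h0
      rw [h0, mul_zero] at hker
      exact hpc hker.symm
    have hmq : kerMult lm κ μ p.1 p.2 = (p.1 : ℂ) / q := by
      rw [eq_div_iff hqc, hker]
    have hI := integral_exp_phase (frameNorm lm * p.1) r
    have e3 : (∫ s in (0 : ℝ)..r, Complex.exp (Complex.I * ((frameNorm lm * s * p.1 : ℝ) : ℂ)))
        = ∫ s in (0 : ℝ)..r, Complex.exp (Complex.I * ((s * (frameNorm lm * p.1) : ℝ) : ℂ)) := by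
      refine intervalIntegral.integral_congr fun s _ => ?_
      congr 3
      ring
    have e4 : Complex.exp (Complex.I * (⟪z.2, (charLine lm w p).2⟫ : ℂ)) *
        Complex.exp (Complex.I * ((z.1 * (charLine lm w p).1 : ℝ) : ℂ))
        = Complex.exp (Complex.I * (pair z (charPt p.2) : ℂ)) *
          Complex.exp (Complex.I * ((r * (frameNorm lm * p.1) : ℝ) : ℂ)) := by
      rw [← Complex.exp_add, ← Complex.exp_add, ← mul_add, ← mul_add, ← Complex.ofReal_add,
        ← Complex.ofReal_add]
      congr 3
      have := pair_charLine lm w z p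
      rw [pair] at this
      rw [add_comm, this]
      ring
    have e5 : Complex.exp (Complex.I * (⟪z.2, (charLine lm w p).2⟫ : ℂ)) *
        Complex.exp (Complex.I * ((z.1 * jap (charLine lm w p).2 : ℝ) : ℂ))
        = Complex.exp (Complex.I * (pair z (charPt (p.2 + p.1 • w)) : ℂ)) := by
      rw [← Complex.exp_add, ← mul_add, ← Complex.ofReal_add]
      congr 3
      simp only [pair, charPt, charLine]
      ring
    have e6 : (((jap (charLine lm w p).2 - (charLine lm w p).1 : ℝ)) : ℂ) = -(q : ℂ) := by
      rw [hq, ← Complex.ofReal_neg]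
      simp only [charLine]
      congr 1
      ring
    rw [e3, expDiff, diffKernel, hmq, e6, div_neg, mul_neg, mul_div_assoc', mul_sub, e4, e5]
    set X := ∫ s in (0 : ℝ)..r, Complex.exp (Complex.I * ((s * (frameNorm lm * p.1) : ℝ) : ℂ))
    set Y := Complex.exp (Complex.I * ((r * (frameNorm lm * p.1) : ℝ) : ℂ))
    set Z₁ := Complex.exp (Complex.I * (pair z (charPt p.2) : ℂ))
    set Z₂ := Complex.exp (Complex.I * (pair z (charPt (p.2 + p.1 • w)) : ℂ))
    have hY : Y = X * (Complex.I * ((frameNorm lm * p.1 : ℝ) : ℂ)) + 1 := by rw [hI]; ring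
    rw [hY]
    field_simp
    push_cast
    ring
  · exact integrable_mul_lineWeight hG hF (hm1.comp (continuous_charLine lm w).measurable)
      fun p _ _ => hb1 _
  · refine Integrable.const_mul ?_ _
    have hmE : Measurable fun p : ℝ × E3 => ∫ s in (0 : ℝ)..r,
        Complex.exp (Complex.I * ((frameNorm lm * s * p.1 : ℝ) : ℂ)) := by
      have hm : StronglyMeasurable (Function.uncurry fun (p : ℝ × E3) (s : ℝ) =>
          Complex.exp (Complex.I * ((frameNorm lm * s * p.1 : ℝ) : ℂ))) := by
        simp only [Function.uncurry_def]
        exact Measurable.stronglyMeasurable (by fun_prop)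
      simp only [intervalIntegral.intervalIntegral_eq_integral_uIoc]
      exact (hm.integral_prod_right (ν := volume.restrict (uIoc 0 r))).measurable.const_smul _
    refine integrable_mul_lineWeight hG hF (hmE.mul (Measurable.mul (by fun_prop)
      (measurable_kerMult hκ))) (C := (1 * |r - 0|) * ∫ y, k₀ y) fun p hp _ => ?_
    rw [norm_mul, norm_mul, norm_phase, one_mul]
    have h1 := norm_kerMult_le hκ hp p.1
    have h2 : ‖∫ s in (0 : ℝ)..r, Complex.exp (Complex.I * ((frameNorm lm * s * p.1 : ℝ) : ℂ))‖
        ≤ 1 * |r - 0| :=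
      intervalIntegral.norm_integral_le_of_norm_le_const fun s _ => (norm_phase _).le
    gcongr

end LineIntegrals

/-! ### The residual is a free wave -/

lemma exists_schwartz_synth_eq {G : E3 → ℂ} (hG : ContDiff ℝ (⊤ : ℕ∞) G)
    (hc : HasCompactSupport G) : ∃ θ : 𝓢(E3, ℂ), ∀ ξ, synth θ ξ = G ξ := by
  have h2 : HasCompactSupport fun y : E3 => G ((2 * Real.pi) • y) :=
    hc.comp_homeomorph (Homeomorph.smulOfNeZero (2 * Real.pi) (by positivity))
  obtain ⟨Γ, hΓ⟩ := exists_schwartz_of_hasCompactSupport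
    (hG.comp (contDiff_const_smul (2 * Real.pi))) h2
  refine ⟨𝓕 Γ, fun ξ => ?_⟩
  rw [synth_eq_fourierInv, ← SchwartzMap.fourierInv_coe, FourierTransform.fourierInv_fourier_eq,
    hΓ, Function.comp_apply, smul_smul, mul_inv_cancel₀ (by positivity), one_smul]

lemma contDiff_synth (θ : 𝓢(E3, ℂ)) : ContDiff ℝ (⊤ : ℕ∞) (synth θ) := by
  have h : synth θ = fun x => (𝓕⁻ θ : 𝓢(E3, ℂ)) ((2 * Real.pi)⁻¹ • x) := by
    ext x
    rw [synth_eq_fourierInv, SchwartzMap.fourierInv_coe]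
  rw [h]
  exact ((𝓕⁻ θ : 𝓢(E3, ℂ)).smooth ⊤).comp (contDiff_const_smul _)

lemma contDiff_jap : ContDiff ℝ (⊤ : ℕ∞) jap := by
  unfold jap
  exact ContDiff.sqrt (contDiff_const.add (contDiff_norm_sq ℝ)) fun x => by positivity

lemma abs_jap_sub_le (a b : E3) : |jap a - jap b| ≤ ‖a - b‖ := by
  have key : ∀ a b : E3, jap a ≤ jap b + ‖a - b‖ := by
    intro a b
    have h1 : ‖a‖ ≤ ‖b‖ + ‖a - b‖ := by
      have := norm_add_le b (a - b)
      rwa [add_sub_cancel] at this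
    have h2 : ‖b‖ ≤ jap b := Real.le_sqrt_of_sq_le (by linarith)
    have h3 := jap_sq b
    have h4 := jap_pos b
    refine Real.sqrt_le_iff.2 ⟨by positivity, ?_⟩
    nlinarith [norm_nonneg a, norm_nonneg b, norm_nonneg (a - b)]
  rw [abs_le]
  have h1 := key a b
  have h2 := key b a
  rw [norm_sub_rev] at h2
  constructor <;> linarith

section Residual

variable {lm : ℝ} {w : E3} {R : Set E3} {B : Set (ℝ × E3)} {d₀ d₁ : ℝ} {F : ℝ × E3 → ℂ}
  {κ : ℝ → E3 → ℂ} {μ : ℝ} {k₀ : ℝ → ℝ} {v : ℝ → L2}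

lemma measurable_diffKernel (hκ : IsParametrix lm w R B κ μ k₀) {X : Type*} [MeasurableSpace X]
    {a b : X → ℝ × E3} (ha : Measurable a) (hb : Measurable b) :
    Measurable fun x => diffKernel lm w κ μ (a x) (b x) := by
  have h1 : Measurable fun x => kerMult lm κ μ (b x).1 (b x).2 :=
    (measurable_kerMult hκ).comp hb
  unfold diffKernel
  exact Measurable.mul (h1.div (by fun_prop)) (by fun_prop)

lemma norm_diffKernel_le (hw : ‖w‖ = 1) (hκ : IsParametrix lm w R B κ μ k₀) (z : ℝ × E3)
    {p : ℝ × E3} (hp : p.2 ∈ R) :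
    ‖diffKernel lm w κ μ z p‖ ≤ (∫ y, k₀ y) * (|z.1| + ‖z.2‖) := by
  have hK : 0 ≤ ∫ y, k₀ y := integral_nonneg hκ.nonneg
  rcases eq_or_ne p.1 0 with h0 | h0
  · simp only [diffKernel, h0, Complex.ofReal_zero, div_zero, zero_mul, norm_zero]
    positivity
  have hpos : 0 < |p.1| := abs_pos.2 h0
  rw [diffKernel, norm_mul, norm_div, Complex.norm_real, Real.norm_eq_abs]
  have h1 : |pair z (charPt (p.2 + p.1 • w)) - pair z (charPt p.2)|
      ≤ |p.1| * (|z.1| + ‖z.2‖) := by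
    have e : pair z (charPt (p.2 + p.1 • w)) - pair z (charPt p.2)
        = z.1 * (jap (p.2 + p.1 • w) - jap p.2) + p.1 * ⟪z.2, w⟫ := by
      simp only [pair, charPt, inner_add_right, inner_smul_right]
      ring
    rw [e]
    refine (abs_add_le _ _).trans ?_
    rw [abs_mul, abs_mul, mul_add]
    have h2 : |jap (p.2 + p.1 • w) - jap p.2| ≤ |p.1| := by
      refine (abs_jap_sub_le _ _).trans (le_of_eq ?_)
      rw [add_sub_cancel_left, norm_smul, hw, mul_one, Real.norm_eq_abs]
    have h3 : |⟪z.2, w⟫| ≤ ‖z.2‖ := by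
      have := abs_real_inner_le_norm z.2 w
      rwa [hw, mul_one] at this
    rw [mul_comm |z.1|]
    gcongr
  calc _ ≤ (∫ y, k₀ y) / |p.1| * (|p.1| * (|z.1| + ‖z.2‖)) := by
        have := norm_kerMult_le hκ hp p.1
        gcongr
        exact (norm_exp_sub_exp_le _ _).trans h1
    _ = _ := by field_simp

/-- The difference between the solution and the superposition of the sources. -/
def residual (lm : ℝ) (w : E3) (R : Set E3) (κ : ℝ → E3 → ℂ) (μ : ℝ) (F : ℝ × E3 → ℂ)
    (z : ℝ × E3) : ℂ :=
  (((2 * Real.pi) ^ 4 : ℝ) : ℂ)⁻¹ * ∫ p, diffKernel lm w κ μ z p * lineWeight lm w R F p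

/-- The residual as a distribution on the Fourier side. -/
def residualFunctional (lm : ℝ) (w : E3) (R : Set E3) (κ : ℝ → E3 → ℂ) (μ : ℝ) (F : ℝ × E3 → ℂ)
    (G : E3 → ℂ) : ℂ :=
  (((2 * Real.pi) ^ 4 : ℝ) : ℂ)⁻¹ * ∫ p : ℝ × E3, kerMult lm κ μ p.1 p.2 / (p.1 : ℂ) *
    (G (p.2 + p.1 • w) - G p.2) * lineWeight lm w R F p

/-- The residual involves the test function only at the frequencies `ξ` and `ξ + hω`, which lie in
`R`. -/
lemma residualFunctional_congr (hG : IsTransverse lm w R B d₀ d₁) (hF : IsSymbolOn F B)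
    {G G' : E3 → ℂ} (h : ∀ ξ ∈ R, G ξ = G' ξ) :
    residualFunctional lm w R κ μ F G = residualFunctional lm w R κ μ F G' := by
  rw [residualFunctional, residualFunctional]
  congr 1
  refine integral_congr_ae (Eventually.of_forall fun p => ?_)
  by_cases hz : lineWeight lm w R F p = 0
  · simp [hz]
  · obtain ⟨h1, h2⟩ := lineWeight_ne_zero hF hz
    beta_reduce
    have h3 : G (p.2 + p.1 • w) = G' (p.2 + p.1 • w) := h _ (hG.freq_mem _ h2)
    rw [h _ h1, h3]

lemma measurable_residual (hG : IsTransverse lm w R B d₀ d₁) (hF : IsSymbolOn F B)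
    (hκ : IsParametrix lm w R B κ μ k₀) : Measurable (residual lm w R κ μ F) := by
  have hm : StronglyMeasurable (Function.uncurry fun z p =>
      diffKernel lm w κ μ z p * lineWeight lm w R F p) :=
    ((measurable_diffKernel hκ measurable_fst measurable_snd).mul
      ((measurable_lineWeight hG hF).comp measurable_snd)).stronglyMeasurable
  exact hm.integral_prod_right.measurable.const_mul _

lemma norm_diffKernel_mul_le (hG : IsTransverse lm w R B d₀ d₁) (hF : IsSymbolOn F B)
    (hκ : IsParametrix lm w R B κ μ k₀) (z p : ℝ × E3) :
    ‖diffKernel lm w κ μ z p * lineWeight lm w R F p‖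
      ≤ ((∫ y, k₀ y) * (|z.1| + ‖z.2‖)) * ‖lineWeight lm w R F p‖ := by
  rw [norm_mul]
  by_cases hz : lineWeight lm w R F p = 0
  · simp [hz]
  · have := norm_diffKernel_le hG.unit hκ z (lineWeight_ne_zero hF hz).1
    gcongr

lemma locallyIntegrable_residual (hG : IsTransverse lm w R B d₀ d₁) (hF : IsSymbolOn F B)
    (hκ : IsParametrix lm w R B κ μ k₀) (t : ℝ) :
    LocallyIntegrable fun x : E3 => residual lm w R κ μ F (t, x) := by
  set A : ℝ := ((2 * Real.pi) ^ 4)⁻¹ * ∫ p, ‖lineWeight lm w R F p‖ with hA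
  have hA0 : 0 ≤ A := mul_nonneg (by positivity) (integral_nonneg fun p => norm_nonneg _)
  have hK : 0 ≤ ∫ y, k₀ y := integral_nonneg hκ.nonneg
  have hc : Continuous fun x : E3 => A * ((∫ y, k₀ y) * (|t| + ‖x‖)) := by fun_prop
  refine hc.locallyIntegrable.mono ((measurable_residual hG hF hκ).comp
    measurable_prodMk_left).aestronglyMeasurable (Eventually.of_forall fun x => ?_)
  rw [Real.norm_of_nonneg (by positivity), residual, norm_mul, norm_inv, Complex.norm_real,
    Real.norm_of_nonneg (by positivity), hA, mul_assoc, mul_comm (∫ p, ‖lineWeight lm w R F p‖),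
    ← integral_const_mul]
  gcongr
  exact norm_integral_le_of_norm_le ((integrable_lineWeight hG hF).norm.const_mul _)
    (Eventually.of_forall fun p => norm_diffKernel_mul_le hG hF hκ (t, x) p)

lemma integral_charPt_schwartz (t : ℝ) (η : E3) (θ : 𝓢(E3, ℂ)) :
    ∫ x : E3, Complex.exp (Complex.I * (pair (t, x) (charPt η) : ℂ)) * θ x
      = Complex.exp (Complex.I * ((t * jap η : ℝ) : ℂ)) * synth θ η := by
  rw [synth, ← integral_const_mul]
  refine integral_congr_ae (Eventually.of_forall fun x => ?_)
  simp only [pair, charPt]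
  rw [← mul_assoc, ← Complex.exp_add, ← mul_add, ← Complex.ofReal_add, real_inner_comm]

/-- On the Fourier side the residual at time `t` is the residual at time `0` multiplied by the phase
`e^{it⟨ξ⟩}`: only characteristic exponentials enter. -/
lemma integral_residual_mul_schwartz (hG : IsTransverse lm w R B d₀ d₁) (hF : IsSymbolOn F B)
    (hκ : IsParametrix lm w R B κ μ k₀) (t : ℝ) (θ : 𝓢(E3, ℂ)) :
    ∫ x, residual lm w R κ μ F (t, x) * θ x = residualFunctional lm w R κ μ F
      fun η => Complex.exp (Complex.I * ((t * jap η : ℝ) : ℂ)) * synth θ η := by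
  have hθm : Measurable θ := θ.continuous.measurable
  have hint : Integrable (Function.uncurry fun (x : E3) (p : ℝ × E3) =>
      diffKernel lm w κ μ (t, x) p * lineWeight lm w R F p * θ x)
      ((volume : Measure E3).prod (volume : Measure (ℝ × E3))) := by
    have h1 : Integrable fun x : E3 => (∫ y, k₀ y) * (|t| + ‖x‖) * ‖θ x‖ := by
      have h2 := ((θ.integrable_pow_mul volume 0).const_mul ((∫ y, k₀ y) * |t|)).add
        ((θ.integrable_pow_mul volume 1).const_mul (∫ y, k₀ y))
      refine h2.congr (Eventually.of_forall fun x => ?_)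
      simp only [Pi.add_apply, pow_zero, pow_one]
      ring
    refine (h1.mul_prod (integrable_lineWeight hG hF).norm).mono' ?_
      (Eventually.of_forall fun q => ?_)
    · have h3 : Measurable fun q : E3 × (ℝ × E3) => diffKernel lm w κ μ (t, q.1) q.2 :=
        measurable_diffKernel hκ (by fun_prop) (by fun_prop)
      have h4 : Measurable fun q : E3 × (ℝ × E3) => lineWeight lm w R F q.2 :=
        (measurable_lineWeight hG hF).comp measurable_snd
      have h5 : Measurable fun q : E3 × (ℝ × E3) => θ q.1 := hθm.comp measurable_fst
      exact ((h3.mul h4).mul h5).aestronglyMeasurable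
    · simp only [Function.uncurry]
      rw [norm_mul]
      refine (mul_le_mul_of_nonneg_right (norm_diffKernel_mul_le hG hF hκ (t, q.1) q.2)
        (norm_nonneg _)).trans (le_of_eq ?_)
      ring
  simp only [residual, mul_assoc, ← integral_mul_const]
  rw [integral_const_mul, residualFunctional]
  congr 1
  have e1 : ∀ (x : E3), ∫ p, diffKernel lm w κ μ (t, x) p * (lineWeight lm w R F p * θ x)
      = ∫ p, diffKernel lm w κ μ (t, x) p * lineWeight lm w R F p * θ x := fun x => by
    simp only [mul_assoc]
  simp only [e1]
  rw [integral_integral_swap hint]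
  refine integral_congr_ae (Eventually.of_forall fun p => ?_)
  beta_reduce
  have hph : ∀ η, Integrable fun x : E3 =>
      Complex.exp (Complex.I * (pair (t, x) (charPt η) : ℂ)) * θ x := fun η =>
    integrable_phase_mul θ.integrable (Measurable.aestronglyMeasurable (by fun_prop))
  rw [← integral_charPt_schwartz, ← integral_charPt_schwartz, ← integral_sub (hph _) (hph _),
    ← integral_const_mul, ← integral_mul_const]
  refine integral_congr_ae (Eventually.of_forall fun x => ?_)
  simp only [diffKernel]
  ring

lemma integrable_hat_of_freqSupported {f : L2} (hR : IsCompact R) (hf : FreqSupportedIn f R) :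
    Integrable (hat f) := by
  have h1 : IntegrableOn (hat f) R := by
    have : IsFiniteMeasure (volume.restrict R) := ⟨by simpa using hR.measure_lt_top⟩
    exact ((memLp_hat f).restrict R).integrable (by norm_num)
  refine (integrableOn_iff_integrable_of_support_subset ?_).1
    (h1.congr_fun_ae (g := R.indicator (hat f)) ?_) |>.congr ?_
  · exact support_indicator_subset
  · filter_upwards [ae_restrict_mem hR.measurableSet] with ξ hξ
    rw [indicator_of_mem hξ]
  · filter_upwards [hf] with ξ h
    by_cases hξ : ξ ∈ R
    · rw [indicator_of_mem hξ]
    · rw [indicator_of_notMem hξ, h hξ]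

/-- The free evolution acts on the Fourier side by the phase `e^{it⟨ξ⟩}`. -/
lemma exists_freeWave_slice {f : L2} (hR : IsCompact R) (hf : FreqSupportedIn f R) (t : ℝ) :
    ∃ f' : L2, hat f' =ᵐ[volume]
        (fun ξ => Complex.exp (Complex.I * ((t * jap ξ : ℝ) : ℂ)) * hat f ξ) ∧
      (f' : E3 → ℂ) =ᵐ[volume] fun x => freeWave f (t, x) := by
  have h1 := integrable_phase_mul (integrable_hat_of_freqSupported hR hf)
    (a := fun ξ => t * jap ξ) (Measurable.aestronglyMeasurable (by fun_prop))
  have h2 : MemLp (fun ξ => Complex.exp (Complex.I * ((t * jap ξ : ℝ) : ℂ)) * hat f ξ) 2 := by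
    refine (memLp_hat f).mono h1.1 (Eventually.of_forall fun ξ => ?_)
    rw [norm_mul, norm_phase, one_mul]
  obtain ⟨f', h3, h4⟩ := exists_hat_eq h1 h2
  refine ⟨f', h3, ?_⟩
  filter_upwards [h4] with x hx
  rw [hx, freeWave, synth]
  congr 1
  refine integral_congr_ae (Eventually.of_forall fun ξ => ?_)
  beta_reduce
  rw [← mul_assoc, ← Complex.exp_add, ← mul_add, ← Complex.ofReal_add]

/-- The residual is the free wave with initial data its trace at time `0`. -/
lemma residual_ae_eq_freeWave (hG : IsTransverse lm w R B d₀ d₁) (hF : IsSymbolOn F B)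
    (hκ : IsParametrix lm w R B κ μ k₀) {d : L2}
    (hd : ∀ᵐ x : E3, d x = residual lm w R κ μ F (0, x)) :
    FreqSupportedIn d R ∧ residual lm w R κ μ F =ᵐ[volume] freeWave d := by
  have h0 : ∀ θ : 𝓢(E3, ℂ), (((2 * Real.pi) ^ 3 : ℝ) : ℂ)⁻¹ * ∫ ξ, hat d ξ * synth θ ξ
      = residualFunctional lm w R κ μ F (synth θ) := by
    intro θ
    rw [← integral_mul_schwartz]
    have h1 := integral_residual_mul_schwartz hG hF hκ 0 θ
    simp only [zero_mul, Complex.ofReal_zero, mul_zero, Complex.exp_zero, one_mul] at h1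
    rw [← h1]
    refine integral_congr_ae ?_
    filter_upwards [hd] with x hx
    rw [hx]
  have hc3 : ((((2 * Real.pi) ^ 3 : ℝ) : ℂ)⁻¹) ≠ 0 :=
    inv_ne_zero (by exact_mod_cast (by positivity : (2 * Real.pi) ^ 3 ≠ 0))
  have hfreq : FreqSupportedIn d R := by
    refine hG.isCompact_freq.isClosed.isOpen_compl.ae_eq_zero_of_integral_contDiff_smul_eq_zero
      (((memLp_hat d).locallyIntegrable (by norm_num)).locallyIntegrableOn _) fun g hg hgc hgs => ?_
    obtain ⟨θ, hθ⟩ := exists_schwartz_synth_eq (contDiff_ofReal_comp hg)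
      (hasCompactSupport_ofReal_comp hgc)
    have h1 := h0 θ
    rw [residualFunctional_congr hG hF (G' := fun _ => 0) (fun ξ hξ => by
      rw [hθ, image_eq_zero_of_notMem_tsupport fun h => hgs h hξ, Complex.ofReal_zero])] at h1
    have h2 : residualFunctional lm w R κ μ F (fun _ => 0) = 0 := by simp [residualFunctional]
    rw [h2, mul_eq_zero] at h1
    rw [← h1.resolve_left hc3]
    refine integral_congr_ae (Eventually.of_forall fun ξ => ?_)
    simp only [hθ, Complex.real_smul, mul_comm]
  refine ⟨hfreq, ?_⟩
  have hR := hG.isCompact_freq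
  have hmeas : Measurable (residual lm w R κ μ F) := measurable_residual hG hF hκ
  have hcont : AEStronglyMeasurable (freeWave d) volume := by
    have h1 := integrable_hat_of_freqSupported hR hfreq
    have h2 : freeWave d = fun z => (((2 * Real.pi) ^ 3 : ℝ) : ℂ)⁻¹ *
        ∫ ξ : E3, Complex.exp (Complex.I * (pair z (charPt ξ) : ℂ)) * h1.1.mk (hat d) ξ :=
      funext fun z => freeWave_eq_of_hat h1.1.ae_eq_mk z
    rw [h2]
    have hm : StronglyMeasurable (Function.uncurry fun (z : ℝ × E3) (ξ : E3) =>
        Complex.exp (Complex.I * (pair z (charPt ξ) : ℂ)) * h1.1.mk (hat d) ξ) := by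
      refine Measurable.stronglyMeasurable (Measurable.mul ?_
        (h1.1.stronglyMeasurable_mk.measurable.comp measurable_snd))
      exact (by fun_prop : Measurable fun x : (ℝ × E3) × E3 =>
        Complex.exp (Complex.I * (pair x.1 (charPt x.2) : ℂ)))
    exact (hm.integral_prod_right.measurable.const_mul _).aestronglyMeasurable
  refine ae_eq_of_ae_ae_eq hmeas.aestronglyMeasurable hcont (Eventually.of_forall fun t => ?_)
  obtain ⟨f, hf, hfx⟩ := exists_freeWave_slice hR hfreq t
  have key : ∀ᵐ x : E3, residual lm w R κ μ F (t, x) = f x := by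
    refine ae_eq_of_integral_contDiff_smul_eq (locallyIntegrable_residual hG hF hκ t)
      ((Lp.memLp f).locallyIntegrable (by norm_num)) fun g hg hgc => ?_
    obtain ⟨θ, hθ⟩ := exists_schwartz_of_hasCompactSupport (contDiff_ofReal_comp hg)
      (hasCompactSupport_ofReal_comp hgc)
    -- a cutoff equal to `1` on `R` turns the phase into a compactly supported symbol
    obtain ⟨r, hr0, hr⟩ := hR.isBounded.subset_closedBall_lt 0 0
    let ψ : ContDiffBump (0 : E3) := ⟨r, 2 * r, hr0, by linarith⟩
    obtain ⟨θt, hθt⟩ := exists_schwartz_synth_eq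
      (G := fun ξ => (ψ ξ : ℂ) * (Complex.exp (Complex.I * ((t * jap ξ : ℝ) : ℂ)) * synth θ ξ))
      ((contDiff_ofReal_comp ψ.contDiff).mul (ContDiff.mul
        (contDiff_const.mul (contDiff_ofReal_comp (contDiff_const.mul contDiff_jap))).cexp
        (contDiff_synth θ)))
      ((hasCompactSupport_ofReal_comp ψ.hasCompactSupport).mul_right)
    have hψ : ∀ ξ ∈ R, (ψ ξ : ℂ) = 1 := fun ξ hξ => by
      rw [ψ.one_of_mem_closedBall (hr hξ), Complex.ofReal_one]
    have e1 : ∫ x, g x • residual lm w R κ μ F (t, x) = ∫ x, residual lm w R κ μ F (t, x) * θ x :=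
      integral_congr_ae (Eventually.of_forall fun x => by
        simp only [hθ, Complex.real_smul, mul_comm])
    have e2 : ∫ x, g x • f x = ∫ x, f x * θ x :=
      integral_congr_ae (Eventually.of_forall fun x => by
        simp only [hθ, Complex.real_smul, mul_comm])
    rw [e1, e2, integral_residual_mul_schwartz hG hF hκ, integral_mul_schwartz,
      residualFunctional_congr hG hF (G' := synth θt) (fun ξ hξ => by
        rw [hθt, hψ ξ hξ, one_mul]), ← h0]
    congr 1
    refine integral_congr_ae ?_
    filter_upwards [hf, hfreq] with ξ h1 h2
    rw [h1, hθt]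
    by_cases hξ : ξ ∈ R
    · rw [hψ ξ hξ]
      ring
    · rw [h2 hξ]
      simp
  filter_upwards [key, hfx] with x h1 h2
  rw [h1, h2]

end Residual

/-! ### The decomposition into free waves -/

lemma freqSupportedIn_iff {R : Set E3} (hR : MeasurableSet R) (f : L2) :
    FreqSupportedIn f R ↔ fourierRestrict ((fun v : E3 => (2 * Real.pi) • v) ⁻¹' Rᶜ) f = 0 := by
  rw [fourierRestrict_eq_zero_iff (measurable_const_smul _ hR.compl)]
  constructor
  · intro h
    filter_upwards [ae_dilate h (r := 2 * Real.pi) (by positivity)] with v hv hvR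
    have := hv hvR
    rwa [hat, smul_smul, inv_mul_cancel₀ (by positivity), one_smul] at this
  · intro h
    filter_upwards [ae_dilate h (r := (2 * Real.pi)⁻¹) (by positivity)] with ξ hξ hξR
    refine hξ ?_
    rw [mem_preimage, smul_smul, mul_inv_cancel₀ (by positivity), one_smul]
    exact hξR

lemma freqSupportedIn_setIntegral {R : Set E3} (hR : MeasurableSet R) {v : ℝ → L2}
    (hv : Integrable v) (hvR : ∀ s, FreqSupportedIn (v s) R) (S : Set ℝ) :
    FreqSupportedIn (∫ s in S, v s) R := by
  rw [freqSupportedIn_iff hR, ← ContinuousLinearMap.integral_comp_comm _ hv.integrableOn]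
  simp only [(freqSupportedIn_iff hR _).1 (hvR _), integral_zero]

lemma FreqSupportedIn.sub {R : Set E3} {f g : L2} (hf : FreqSupportedIn f R)
    (hg : FreqSupportedIn g R) : FreqSupportedIn (f - g) R := by
  filter_upwards [hat_sub f g, hf, hg] with ξ h1 h2 h3 h4
  rw [h1, h2 h4, h3 h4, sub_self]

lemma memLp_freeWaveSymbol {R : Set E3} (hR : IsCompact R) (z : ℝ × E3) :
    MemLp (R.indicator fun ξ => (((2 * Real.pi) ^ 3 : ℝ) : ℂ)⁻¹ *
      Complex.exp (Complex.I * (pair z (charPt ξ) : ℂ))) 2 := by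
  refine MemLp.mono (memLp_indicator_const 2 hR.measurableSet ((((2 * Real.pi) ^ 3 : ℝ) : ℂ)⁻¹)
    (Or.inr hR.measure_lt_top.ne)) ?_ (Eventually.of_forall fun ξ => ?_)
  · exact (Measurable.indicator (by fun_prop) hR.measurableSet).aestronglyMeasurable
  · by_cases hξ : ξ ∈ R
    · rw [indicator_of_mem hξ, indicator_of_mem hξ, norm_mul, norm_phase, mul_one]
    · simp [hξ]

/-- On functions with frequencies in a fixed compact set, the evaluation of the free wave at a point
is a bounded functional. -/
lemma freeWave_eq_hatFunctional {R : Set E3} (hR : IsCompact R) (z : ℝ × E3) {f : L2}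
    (hf : FreqSupportedIn f R) :
    freeWave f z = hatFunctional _ (memLp_freeWaveSymbol hR z) f := by
  rw [freeWave_eq, hatFunctional_apply, ← integral_const_mul]
  refine integral_congr_ae ?_
  filter_upwards [hf] with ξ h
  by_cases hξ : ξ ∈ R
  · rw [indicator_of_mem hξ, mul_assoc]
  · rw [h hξ]
    simp

lemma freeWave_sub {R : Set E3} (hR : IsCompact R) (z : ℝ × E3) {f g : L2}
    (hf : FreqSupportedIn f R) (hg : FreqSupportedIn g R) :
    freeWave (f - g) z = freeWave f z - freeWave g z := by
  rw [freeWave_eq_hatFunctional hR z hf, freeWave_eq_hatFunctional hR z hg,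
    freeWave_eq_hatFunctional hR z (hf.sub hg), map_sub]

lemma integrable_freeWave {R : Set E3} (hR : IsCompact R) {v : ℝ → L2} (hv : Integrable v)
    (hvR : ∀ s, FreqSupportedIn (v s) R) (z : ℝ × E3) :
    Integrable fun s => freeWave (v s) z := by
  simp only [fun s => freeWave_eq_hatFunctional hR z (hvR s)]
  exact ContinuousLinearMap.integrable_comp _ hv

lemma freeWave_setIntegral {R : Set E3} (hR : IsCompact R) {v : ℝ → L2} (hv : Integrable v)
    (hvR : ∀ s, FreqSupportedIn (v s) R) (S : Set ℝ) (z : ℝ × E3) :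
    freeWave (∫ s in S, v s) z = ∫ s in S, freeWave (v s) z := by
  rw [freeWave_eq_hatFunctional hR z (freqSupportedIn_setIntegral hR.measurableSet hv hvR S),
    ← ContinuousLinearMap.integral_comp_comm _ hv.integrableOn]
  simp only [fun s => freeWave_eq_hatFunctional hR z (hvR s)]

lemma eLpNorm_freeWave_zero {R : Set E3} (hR : IsCompact R) {f : L2} (hf : FreqSupportedIn f R) :
    eLpNorm (fun x => freeWave f (0, x)) 2 = ‖f‖ₑ := by
  obtain ⟨f', h1, h2⟩ := exists_freeWave_slice hR hf 0
  have h3 : f' = f := by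
    refine eq_of_hat_eq (h1.trans (Eventually.of_forall fun ξ => ?_))
    simp
  rw [← eLpNorm_congr_ae h2, h3, Lp.enorm_def]

section Decomposition

variable {lm : ℝ} {w : E3} {R : Set E3} {B : Set (ℝ × E3)} {d₀ d₁ : ℝ} {F : ℝ × E3 → ℂ}
  {κ : ℝ → E3 → ℂ} {μ : ℝ} {k₀ : ℝ → ℝ} {v : ℝ → L2}

/-- Minkowski's inequality for superpositions of free waves with bounded coefficients. -/
lemma eLpNorm_superposition_le
    (hm : Measurable fun q : ℝ × (ℝ × E3) => freeWave (v q.1) q.2) {σ : ℝ → E3 → ℂ}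
    (hσ : Measurable (Function.uncurry σ)) (hσ1 : ∀ s x, ‖σ s x‖ ≤ 1) {Φ : E3 → ℝ × E3}
    (hΦ : Measurable Φ) {C : ℝ≥0∞} (hC : C ≠ ⊤)
    (h : ∀ s, eLpNorm (fun x => freeWave (v s) (Φ x)) 2 ≤ C * ‖v s‖ₑ) :
    eLpNorm (fun x => ∫ s, σ s x * freeWave (v s) (Φ x)) 2 ≤ C * ∫⁻ s, ‖v s‖ₑ := by
  have h0 : Measurable fun q : ℝ × E3 => (q.1, Φ q.2) :=
    measurable_fst.prodMk (hΦ.comp measurable_snd)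
  have h1 : Measurable fun q : ℝ × E3 => freeWave (v q.1) (Φ q.2) := by
    have := hm.comp h0
    exact this
  have h2 : StronglyMeasurable
      (Function.uncurry fun (s : ℝ) (x : E3) => σ s x * freeWave (v s) (Φ x)) :=
    (hσ.mul h1).stronglyMeasurable
  refine (eLpNorm_integral_le h2).trans ?_
  rw [← lintegral_const_mul' _ _ hC]
  refine lintegral_mono fun s => (eLpNorm_mono fun x => ?_).trans (h s)
  rw [norm_mul]
  exact mul_le_of_le_one_left (norm_nonneg _) (hσ1 s x)

/-- At time `0` the solution vanishes, so the residual is a superposition of the sources `v_s` with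
coefficients `0` and `±1`, and Minkowski's inequality applies. -/
lemma eLpNorm_residual_zero_le (hG : IsTransverse lm w R B d₀ d₁) (hF : IsSymbolOn F B)
    (hκ : IsParametrix lm w R B κ μ k₀)
    (hv : ∀ s, hat (v s) =ᵐ[volume] sourceSymbol lm w R κ μ F s) (hvi : Integrable v)
    (hvR : ∀ s, FreqSupportedIn (v s) R) :
    eLpNorm (fun x => residual lm w R κ μ F (0, x)) 2 ≤ ∫⁻ s, ‖v s‖ₑ := by
  have hR := hG.isCompact_freq
  set r : E3 → ℝ := fun x => tTheta lm w (0, x) with hr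
  have hrm : Measurable r := by
    simp only [hr, tTheta_eq]
    fun_prop
  -- the coefficient of `v_s` in the oriented integral from `tTheta (0, x)` to `0`
  set σ : ℝ → E3 → ℂ := fun s x =>
    (Ioc (r x) 0).indicator (fun _ => (1 : ℂ)) s - (Ioc 0 (r x)).indicator (fun _ => (1 : ℂ)) s
    with hσdef
  have e1 : ∀ x, residual lm w R κ μ F (0, x) = ∫ s, σ s x * freeWave (v s) (0, x) := by
    intro x
    have hi := integrable_freeWave hR hvi hvR (0, x)
    have h0 : duhamel F (0, x) = 0 := by simp [duhamel, expDiff_zero]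
    have h1 := duhamel_sub_sources hG hF hκ hv (0, x)
    rw [h0, zero_sub] at h1
    rw [residual, ← h1, intervalIntegral, neg_sub, ← integral_indicator measurableSet_Ioc,
      ← integral_indicator measurableSet_Ioc, ← integral_sub
      (hi.indicator measurableSet_Ioc) (hi.indicator measurableSet_Ioc)]
    refine integral_congr_ae (Eventually.of_forall fun s => ?_)
    simp only [hσdef, indicator, sub_mul, ite_mul, one_mul, zero_mul, hr]
  have hσm : Measurable (Function.uncurry σ) := by
    have h1 : MeasurableSet {q : ℝ × E3 | r q.2 < q.1 ∧ q.1 ≤ 0} :=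
      (measurableSet_lt (hrm.comp measurable_snd) measurable_fst).inter
        (measurableSet_le measurable_fst measurable_const)
    have h2 : MeasurableSet {q : ℝ × E3 | 0 < q.1 ∧ q.1 ≤ r q.2} :=
      (measurableSet_lt measurable_const measurable_fst).inter
        (measurableSet_le measurable_fst (hrm.comp measurable_snd))
    exact (measurable_const.indicator h1).sub (measurable_const.indicator h2)
  have hσ1 : ∀ s x, ‖σ s x‖ ≤ 1 := by
    intro s x
    simp only [hσdef, indicator, mem_Ioc]
    split_ifs with h1 h2
    · simp
    · simp
    · simp
    · simp
  have h2 := eLpNorm_superposition_le (measurable_freeWave_source hG hF hκ hv) hσm hσ1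
    (Φ := fun x => (0, x)) (by fun_prop) (C := 1) ENNReal.one_ne_top
    (fun s => by rw [eLpNorm_freeWave_zero hR (hvR s), one_mul])
  rw [one_mul] at h2
  simpa only [e1] using h2

/-- The solution is a free wave plus a superposition of free waves cut off at hyperplanes
`t_{λ,ω} = s`, and its `L²` norms on these hyperplanes are bounded accordingly. -/
lemma exists_decomposition (hG : IsTransverse lm w R B d₀ d₁) (hF : IsSymbolOn F B)
    (hκ : IsParametrix lm w R B κ μ k₀) (hfin : mixedNorm lm w (stSynth F) < ⊤) :
    ∃ (v₀ : L2) (v : ℝ → L2), Integrable v volume ∧ FreqSupportedIn v₀ R ∧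
      (∀ s, FreqSupportedIn (v s) R) ∧
      ‖v₀‖ₑ + ∫⁻ s, ‖v s‖ₑ ≤ ENNReal.ofReal (3 * (frameNorm lm * √d₁ * ∫ y, k₀ y)) *
        mixedNorm lm w (stSynth F) ∧
      (∀ z, Integrable fun s => freeWave (v s) z) ∧
      (∀ᵐ z, duhamel F z = freeWave v₀ z + ∫ s in Iio (tTheta lm w z), freeWave (v s) z) ∧
      ∀ᵐ s, eLpNorm (fun Y => duhamel F (frameMap lm w (s, Y))) 2
        ≤ ENNReal.ofReal (√(frameNorm lm / d₀)) * (‖v₀‖ₑ + ∫⁻ s, ‖v s‖ₑ) := by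
  have hR := hG.isCompact_freq
  obtain ⟨v, hvc, hv, hvb⟩ := exists_sources hG hF hκ
  have hvi : Integrable v := ⟨hvc.aestronglyMeasurable,
    hvb.trans_lt (ENNReal.mul_lt_top ENNReal.ofReal_lt_top hfin)⟩
  have hvR : ∀ s, FreqSupportedIn (v s) R := fun s => by
    filter_upwards [hv s] with ξ h1 h2
    rw [h1, sourceSymbol, indicator_of_notMem h2]
  have hres := eLpNorm_residual_zero_le hG hF hκ hv hvi hvR
  have hmem : MemLp (fun x => residual lm w R κ μ F (0, x)) 2 :=
    ⟨((measurable_residual hG hF hκ).comp measurable_prodMk_left).aestronglyMeasurable,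
      hres.trans_lt hvi.2⟩
  set d : L2 := hmem.toLp _ with hd
  obtain ⟨hdR, hdw⟩ := residual_ae_eq_freeWave hG hF hκ (d := d) hmem.coeFn_toLp
  have hdn : ‖d‖ₑ ≤ ∫⁻ s, ‖v s‖ₑ := by
    rw [Lp.enorm_def, eLpNorm_congr_ae hmem.coeFn_toLp]
    exact hres
  -- the residual uses `∫_0^{t_{λ,ω}}`; its difference to `∫_{-∞}^{t_{λ,ω}}` is again a free wave
  set V : L2 := ∫ s in Iio 0, v s with hV
  have hVR : FreqSupportedIn V R := freqSupportedIn_setIntegral hR.measurableSet hvi hvR _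
  have hVn : ‖V‖ₑ ≤ ∫⁻ s, ‖v s‖ₑ :=
    (enorm_integral_le_lintegral_enorm _).trans (setLIntegral_le_lintegral _ _)
  have hfw := integrable_freeWave hR hvi hvR
  have hdec : ∀ᵐ z, duhamel F z = freeWave (d - V) z +
      ∫ s in Iio (tTheta lm w z), freeWave (v s) z := by
    filter_upwards [hdw] with z hz
    have h1 := duhamel_sub_sources hG hF hκ hv z
    change _ = residual lm w R κ μ F z at h1
    rw [hz] at h1
    rw [freeWave_sub hR z hdR hVR, hV, freeWave_setIntegral hR hvi hvR,
      ← integral_Iic_eq_integral_Iio, ← integral_Iic_eq_integral_Iio]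
    have h2 := intervalIntegral.integral_Iic_sub_Iic (a := 0) (b := tTheta lm w z)
      (hfw z).integrableOn (hfw z).integrableOn
    rw [← h1, ← h2]
    ring
  refine ⟨d - V, v, hvi, hdR.sub hVR, hvR, ?_, hfw, hdec, ?_⟩
  · rw [ENNReal.ofReal_mul (by norm_num), mul_assoc]
    have h1 : ‖d - V‖ₑ ≤ (∫⁻ s, ‖v s‖ₑ) + ∫⁻ s, ‖v s‖ₑ := enorm_sub_le.trans (add_le_add hdn hVn)
    calc _ ≤ ((∫⁻ s, ‖v s‖ₑ) + ∫⁻ s, ‖v s‖ₑ) + ∫⁻ s, ‖v s‖ₑ := by gcongr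
      _ = ENNReal.ofReal 3 * ∫⁻ s, ‖v s‖ₑ := by
        rw [show ENNReal.ofReal 3 = 3 by simp]
        ring
      _ ≤ _ := by gcongr
  · have hslice : ∀ {f : L2}, FreqSupportedIn f R → ∀ s,
        eLpNorm (fun Y : E3 => freeWave f (frameMap lm w (s, Y))) 2
          ≤ ENNReal.ofReal (√(frameNorm lm / d₀)) * ‖f‖ₑ := fun hf s =>
      eLpNorm_freeWave_slice_le hG.unit hR hG.pos hG.lower hf s
    filter_upwards [ae_slice hG.unit hG.ne_zero hdec] with s hs
    have hΦ : Measurable fun Y : E3 => frameMap lm w (s, Y) :=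
      (continuous_frameMap lm w).measurable.comp measurable_prodMk_left
    have hm := measurable_freeWave_source hG hF hκ hv
    set σ : ℝ → E3 → ℂ := fun s' _ => (Iio s).indicator (fun _ => (1 : ℂ)) s' with hσ
    have e1 : ∀ᵐ Y : E3, duhamel F (frameMap lm w (s, Y))
        = freeWave (d - V) (frameMap lm w (s, Y)) +
          ∫ s', σ s' Y * freeWave (v s') (frameMap lm w (s, Y)) := by
      filter_upwards [hs] with Y hY
      rw [hY, tTheta_frameMap hG.unit, ← integral_indicator measurableSet_Iio]
      congr 1
      refine integral_congr_ae (Eventually.of_forall fun s' => ?_)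
      simp only [hσ, indicator, ite_mul, one_mul, zero_mul]
    have hσm : Measurable (Function.uncurry σ) :=
      (measurable_const.indicator measurableSet_Iio).comp measurable_fst
    have hσ1 : ∀ s x, ‖σ s x‖ ≤ 1 := fun s x => by
      simp only [hσ, indicator]
      split_ifs <;> simp
    have h2 := eLpNorm_superposition_le hm hσm hσ1 hΦ ENNReal.ofReal_ne_top
      (fun s' => hslice (hvR s') s)
    have hm1 : AEStronglyMeasurable
        (fun Y => ∫ s', σ s' Y * freeWave (v s') (frameMap lm w (s, Y))) volume := by
      have h0 : Measurable fun q : E3 × ℝ => (q.2, frameMap lm w (s, q.1)) :=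
        measurable_snd.prodMk (hΦ.comp measurable_fst)
      have h3 : Measurable fun q : E3 × ℝ => freeWave (v q.2) (frameMap lm w (s, q.1)) := by
        have := hm.comp h0
        exact this
      have h4 : Measurable fun q : E3 × ℝ => σ q.2 q.1 := hσm.comp measurable_swap
      have h5 : StronglyMeasurable fun q : E3 × ℝ =>
          σ q.2 q.1 * freeWave (v q.2) (frameMap lm w (s, q.1)) := (h4.mul h3).stronglyMeasurable
      exact h5.integral_prod_right'.aestronglyMeasurable
    rw [eLpNorm_congr_ae e1, mul_add]
    have hm0 : AEStronglyMeasurable (fun Y : E3 => freeWave (d - V) (frameMap lm w (s, Y)))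
        volume := by
      have h5 : AEStronglyMeasurable (fun Y : E3 => duhamel F (frameMap lm w (s, Y))) volume :=
        ((measurable_duhamel hF).comp hΦ).aestronglyMeasurable
      refine (h5.sub hm1).congr ?_
      filter_upwards [e1] with Y hY
      rw [Pi.sub_apply, hY, add_sub_cancel_right]
    exact (eLpNorm_add_le hm0 hm1 (by norm_num)).trans (add_le_add (hslice (hdR.sub hVR) s) h2)

end Decomposition

/-! ### The kernel of the parametrix -/

/-- The cutoff in the displacement variable: equal to `1` on `[-1/32, 1/32]`, supported in
`[-1/16, 1/16]`. -/
def lineBump : ContDiffBump (0 : ℝ) := ⟨1 / 32, 1 / 16, by norm_num, by norm_num⟩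

/-- A compactly supported function on the line with bounded second derivative has a Fourier
transform that decays quadratically. -/
lemma norm_fourier_le_of_hasDerivAt {m m₁ m₂ : ℝ → ℝ} (h₁ : ∀ x, HasDerivAt m (m₁ x) x)
    (h₂ : ∀ x, HasDerivAt m₁ (m₂ x) x) {r A : ℝ} (hr : 0 ≤ r)
    (hs : ∀ x, r < |x| → m x = 0 ∧ m₁ x = 0 ∧ m₂ x = 0)
    (hA : ∀ x, |m x| ≤ A) (hA₂ : ∀ x, |m₂ x| ≤ A) (y : ℝ) :
    ‖𝓕 (fun x => (m x : ℂ)) y‖ ≤ 4 * r * A * (1 + y ^ 2)⁻¹ := by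
  have hA0 : 0 ≤ A := (abs_nonneg _).trans (hA 0)
  have hsupp : ∀ {g : ℝ → ℝ}, (∀ x, r < |x| → g x = 0) → (∀ x, |g x| ≤ A) → Measurable g →
      Integrable (fun x => (g x : ℂ)) ∧ ∫ x, ‖(g x : ℂ)‖ ≤ 2 * r * A := by
    intro g hg hgA hgm
    have hb : ∀ x, ‖(g x : ℂ)‖ ≤ (Icc (-r) r).indicator (fun _ => A) x := by
      intro x
      rw [Complex.norm_real, Real.norm_eq_abs]
      by_cases hx : |x| ≤ r
      · rw [indicator_of_mem (show x ∈ Icc (-r) r from abs_le.1 hx)]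
        exact hgA x
      · rw [hg x (not_le.1 hx), abs_zero]
        exact indicator_nonneg (fun _ _ => hA0) x
    have hi : Integrable ((Icc (-r) r).indicator fun _ => A) :=
      (integrable_indicator_iff measurableSet_Icc).2 (by simp)
    have hgi : Integrable fun x => (g x : ℂ) :=
      hi.mono' (Complex.measurable_ofReal.comp hgm).aestronglyMeasurable (Eventually.of_forall hb)
    refine ⟨hgi, (integral_mono hgi.norm hi hb).trans (le_of_eq ?_)⟩
    rw [integral_indicator measurableSet_Icc, setIntegral_const]
    simp only [Real.volume_real_Icc, smul_eq_mul]
    rw [max_eq_left (by linarith)]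
    ring
  have hm : Continuous m := continuous_iff_continuousAt.2 fun x => (h₁ x).continuousAt
  have hm₁ : Continuous m₁ := continuous_iff_continuousAt.2 fun x => (h₂ x).continuousAt
  have hm₂ : Measurable m₂ := by
    have : m₂ = deriv m₁ := funext fun x => (h₂ x).deriv.symm
    rw [this]
    exact measurable_deriv _
  have hc : ∀ {g g' : ℝ → ℝ}, (∀ x, HasDerivAt g (g' x) x) →
      deriv (fun x => (g x : ℂ)) = fun x => (g' x : ℂ) := fun hg =>
    funext fun x => (hg x).ofReal_comp.deriv
  obtain ⟨i0, n0⟩ := hsupp (fun x hx => (hs x hx).1) hA hm.measurable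
  obtain ⟨i2, n2⟩ := hsupp (fun x hx => (hs x hx).2.2) hA₂ hm₂
  have i1 : Integrable fun x => (m₁ x : ℂ) := by
    refine Continuous.integrable_of_hasCompactSupport (Complex.continuous_ofReal.comp hm₁) ?_
    refine HasCompactSupport.intro (isCompact_Icc (a := -r) (b := r)) fun x hx => ?_
    have : r < |x| := not_le.1 fun h => hx (abs_le.1 h)
    simp [(hs x this).2.1]
  have e1 := Real.fourier_deriv i0 (fun x => (h₁ x).ofReal_comp.differentiableAt)
    (by rw [hc h₁]; exact i1)
  have e2 := Real.fourier_deriv i1 (fun x => (h₂ x).ofReal_comp.differentiableAt)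
    (by rw [hc h₂]; exact i2)
  rw [hc h₁] at e1
  rw [hc h₂] at e2
  have e3 := congrFun e2 y
  simp only [e1, smul_eq_mul] at e3
  have b0 : ‖𝓕 (fun x => (m x : ℂ)) y‖ ≤ 2 * r * A :=
    (VectorFourier.norm_fourierIntegral_le_integral_norm _ _ _ _ _).trans n0
  have b2 : ‖𝓕 (fun x => (m₂ x : ℂ)) y‖ ≤ 2 * r * A :=
    (VectorFourier.norm_fourierIntegral_le_integral_norm _ _ _ _ _).trans n2
  have e4 : (2 * Real.pi * y) ^ 2 * ‖𝓕 (fun x => (m x : ℂ)) y‖ ≤ 2 * r * A := by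
    refine le_of_eq_of_le ?_ b2
    have : ‖(2 * Real.pi * Complex.I * y : ℂ)‖ = |2 * Real.pi * y| := by
      rw [norm_mul, norm_mul, norm_mul, Complex.norm_I, mul_one, Complex.norm_real,
        Complex.norm_real, abs_mul, abs_mul]
      simp
    rw [e3, norm_mul, norm_mul (2 * Real.pi * Complex.I * y : ℂ), this, ← mul_assoc, ← sq, sq_abs]
  rw [← div_eq_mul_inv, le_div_iff₀ (by positivity)]
  have hpi : (1 : ℝ) ≤ 2 * Real.pi := by linarith [Real.pi_gt_three]
  have e5 : y ^ 2 ≤ (2 * Real.pi * y) ^ 2 := by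
    rw [mul_pow]
    exact le_mul_of_one_le_left (sq_nonneg y) (one_le_pow₀ hpi)
  nlinarith [norm_nonneg (𝓕 (fun x => (m x : ℂ)) y)]

/-- The rescaled bracket `⟨ξ + hω⟩ 2^{-k}` as a function of `x = h 2^{-k}`. -/
def lineSqrt (b j₀ x : ℝ) : ℝ := √(x ^ 2 + 2 * b * x + j₀ ^ 2)

/-- The localized multiplier of the parametrix in rescaled variables, without the factor
`transv⁻¹`. -/
def lineSymbol (b j₀ lm ε x : ℝ) : ℝ :=
  lineBump x * ((lineSqrt b j₀ x + j₀ + lm * x) * (2 * j₀ - ε * x)⁻¹)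

lemma lineBump_derivs : ∃ β₁ β₂ : ℝ → ℝ, ∃ A : ℝ, 0 ≤ A ∧ (∀ x, HasDerivAt lineBump (β₁ x) x) ∧
    (∀ x, HasDerivAt β₁ (β₂ x) x) ∧
    (∀ x, 1 / 16 < |x| → lineBump x = 0 ∧ β₁ x = 0 ∧ β₂ x = 0) ∧
    ∀ x, |lineBump x| ≤ A ∧ |β₁ x| ≤ A ∧ |β₂ x| ≤ A := by
  have h0 : ContDiff ℝ 2 (lineBump : ℝ → ℝ) := lineBump.contDiff
  have h1 : ContDiff ℝ 1 (deriv (lineBump : ℝ → ℝ)) :=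
    (contDiff_succ_iff_deriv (n := 1).1 h0).2.2
  have h2 : Continuous (deriv (deriv (lineBump : ℝ → ℝ))) := h1.continuous_deriv le_rfl
  have c0 : HasCompactSupport (lineBump : ℝ → ℝ) := lineBump.hasCompactSupport
  obtain ⟨A0, hA0⟩ := c0.exists_bound_of_continuous h0.continuous
  obtain ⟨A1, hA1⟩ := c0.deriv.exists_bound_of_continuous h1.continuous
  obtain ⟨A2, hA2⟩ := c0.deriv.deriv.exists_bound_of_continuous h2
  have hts : ∀ x : ℝ, 1 / 16 < |x| → x ∉ tsupport (lineBump : ℝ → ℝ) := by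
    intro x hx h
    rw [lineBump.tsupport_eq, mem_closedBall_zero_iff, Real.norm_eq_abs] at h
    exact absurd h (not_le.2 hx)
  refine ⟨deriv lineBump, deriv (deriv lineBump), |A0| + |A1| + |A2|, by positivity,
    fun x => (h0.differentiable (by norm_num) x).hasDerivAt,
    fun x => (h1.differentiable (by norm_num) x).hasDerivAt, fun x hx => ?_, fun x => ?_⟩
  · have h3 := hts x hx
    have h4 : x ∉ tsupport (deriv (lineBump : ℝ → ℝ)) := fun h =>
      h3 (closure_minimal support_deriv_subset (isClosed_tsupport _) h)
    exact ⟨image_eq_zero_of_notMem_tsupport h3, image_eq_zero_of_notMem_tsupport h4,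
      image_eq_zero_of_notMem_tsupport fun h =>
        h4 (closure_minimal support_deriv_subset (isClosed_tsupport _) h)⟩
  · have e0 := hA0 x
    have e1 := hA1 x
    have e2 := hA2 x
    rw [Real.norm_eq_abs] at e0 e1 e2
    have := le_abs_self A0
    have := le_abs_self A1
    have := le_abs_self A2
    have := abs_nonneg A0
    have := abs_nonneg A1
    have := abs_nonneg A2
    exact ⟨by linarith, by linarith, by linarith⟩

/-- The Fourier transforms of the localized multipliers decay quadratically, uniformly in the
parameters. -/
lemma exists_lineSymbol_bound : ∃ K : ℝ, 0 < K ∧ ∀ b j₀ lm ε : ℝ, |b| ≤ j₀ → 1 / 4 ≤ j₀ → j₀ ≤ 5 →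
    |lm| ≤ 1 → 0 ≤ ε → ε ≤ 1 →
    Continuous (lineSymbol b j₀ lm ε) ∧
    ∀ y, ‖𝓕 (fun x => (lineSymbol b j₀ lm ε x : ℂ)) y‖ ≤ K * (1 + y ^ 2)⁻¹ := by
  obtain ⟨β₁, β₂, A₀, hA₀, hβ₁, hβ₂, hβs, hβA⟩ := lineBump_derivs
  -- `20000` exceeds the bounds below for the derivatives of the factors, e.g. `48 ^ 2 * 8 + 8`
  set A : ℝ := A₀ + 20000 with hA
  refine ⟨4 * (1 / 16) * (9 * A ^ 3), by positivity, fun b j₀ lm ε hb hj hj5 hlm hε hε1 => ?_⟩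
  set J := lineSqrt b j₀ with hJ
  set G : ℝ → ℝ := fun x => J x + j₀ + lm * x with hG
  set G₁ : ℝ → ℝ := fun x => (x + b) / J x + lm with hG₁
  set G₂ : ℝ → ℝ := fun x => (1 * J x - (x + b) * ((x + b) / J x)) / J x ^ 2 with hG₂
  set Q : ℝ → ℝ := fun x => (2 * j₀ - ε * x)⁻¹ with hQ
  set Q₁ : ℝ → ℝ := fun x => ε * Q x ^ 2 with hQ₁
  set Q₂ : ℝ → ℝ := fun x => ε * (2 * Q x * Q₁ x) with hQ₂
  -- on `[-1/8, 1/8]`, twice the support of the cutoff, radicand and denominator stay away from `0`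
  have hrad : ∀ x, |x| ≤ 1 / 8 → (1 / 8) ^ 2 ≤ x ^ 2 + 2 * b * x + j₀ ^ 2 := by
    intro x hx
    have h1 : |b * x| ≤ j₀ * |x| := by
      rw [abs_mul]
      gcongr
    have h2 := neg_abs_le (b * x)
    have h3 : (1 / 8) ^ 2 ≤ (j₀ - |x|) ^ 2 := by
      apply pow_le_pow_left₀ (by norm_num)
      linarith
    nlinarith [sq_abs x]
  have hJpos : ∀ x, |x| ≤ 1 / 8 → 1 / 8 ≤ J x := fun x hx => Real.le_sqrt_of_sq_le (hrad x hx)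
  have hqpos : ∀ x, |x| ≤ 1 / 8 → 1 / 3 ≤ 2 * j₀ - ε * x := by
    intro x hx
    have h1 : ε * x ≤ 1 / 8 := by
      calc ε * x ≤ |ε * x| := le_abs_self _
        _ = ε * |x| := by rw [abs_mul, abs_of_nonneg hε]
        _ ≤ 1 * (1 / 8) := by gcongr
        _ = 1 / 8 := one_mul _
    linarith
  have dJ : ∀ x, |x| ≤ 1 / 8 → HasDerivAt J ((x + b) / J x) x := by
    intro x hx
    have h1 : HasDerivAt (fun x : ℝ => x ^ 2 + 2 * b * x + j₀ ^ 2) (2 * x + 2 * b) x := by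
      have := ((hasDerivAt_pow 2 x).add ((hasDerivAt_id x).const_mul (2 * b))).add_const (j₀ ^ 2)
      refine this.congr_deriv ?_
      simp
    have h2 := h1.sqrt (by have := hrad x hx; positivity)
    refine h2.congr_deriv ?_
    have h3 : √(x ^ 2 + 2 * b * x + j₀ ^ 2) = J x := rfl
    rw [h3]
    have h4 := (hJpos x hx)
    have h5 : J x ≠ 0 := by positivity
    field_simp
  have dG : ∀ x, |x| ≤ 1 / 8 → HasDerivAt G (G₁ x) x := fun x hx => by
    have := ((dJ x hx).add_const j₀).add ((hasDerivAt_id x).const_mul lm)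
    rw [mul_one] at this
    exact this
  have dG₁ : ∀ x, |x| ≤ 1 / 8 → HasDerivAt G₁ (G₂ x) x := fun x hx =>
    (((hasDerivAt_id x).add_const b).div (dJ x hx)
      (by have := hJpos x hx; positivity)).add_const lm
  have dQ : ∀ x, |x| ≤ 1 / 8 → HasDerivAt Q (Q₁ x) x := fun x hx => by
    have h1 : HasDerivAt (fun x => 2 * j₀ - ε * x) (-ε) x := by
      simpa using ((hasDerivAt_id x).const_mul ε).const_sub (2 * j₀)
    have h0 : 2 * j₀ - ε * x ≠ 0 := by have := hqpos x hx; positivity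
    refine (h1.inv h0).congr_deriv ?_
    simp only [hQ₁, hQ]
    field_simp
  have dQ₁ : ∀ x, |x| ≤ 1 / 8 → HasDerivAt Q₁ (Q₂ x) x := fun x hx => by
    have h1 := ((dQ x hx).pow 2).const_mul ε
    refine h1.congr_deriv ?_
    simp only [hQ₂]
    norm_num
  set m : ℝ → ℝ := fun x => lineBump x * (G x * Q x) with hm
  set m₁ : ℝ → ℝ := fun x => β₁ x * (G x * Q x) + lineBump x * (G₁ x * Q x + G x * Q₁ x) with hm₁
  set m₂ : ℝ → ℝ := fun x => (β₂ x * (G x * Q x) + β₁ x * (G₁ x * Q x + G x * Q₁ x)) +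
    (β₁ x * (G₁ x * Q x + G x * Q₁ x) + lineBump x * ((G₂ x * Q x + G₁ x * Q₁ x) +
      (G₁ x * Q₁ x + G x * Q₂ x))) with hm₂
  have hs : ∀ x, 1 / 16 < |x| → m x = 0 ∧ m₁ x = 0 ∧ m₂ x = 0 := fun x hx => by
    obtain ⟨e0, e1, e2⟩ := hβs x hx
    simp only [hm, hm₁, hm₂, e0, e1, e2]
    simp
  have hev : ∀ x : ℝ, ¬ |x| ≤ 1 / 8 → ∀ᶠ y in 𝓝 x, 1 / 16 < |y| := fun x hx =>
    (isOpen_lt continuous_const continuous_abs).mem_nhds (by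
      rw [not_le] at hx
      exact lt_trans (by norm_num) hx)
  have d0 : ∀ x, HasDerivAt m (m₁ x) x := by
    intro x
    by_cases hx : |x| ≤ 1 / 8
    · exact (hβ₁ x).mul ((dG x hx).mul (dQ x hx))
    · rw [(hs x (hev x hx).self_of_nhds).2.1]
      refine (hasDerivAt_const x (0 : ℝ)).congr_of_eventuallyEq ?_
      filter_upwards [hev x hx] with y hy
      exact (hs y hy).1
  have d1 : ∀ x, HasDerivAt m₁ (m₂ x) x := by
    intro x
    by_cases hx : |x| ≤ 1 / 8
    · exact ((hβ₂ x).mul ((dG x hx).mul (dQ x hx))).add ((hβ₁ x).mul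
        (((dG₁ x hx).mul (dQ x hx)).add ((dG x hx).mul (dQ₁ x hx))))
    · rw [(hs x (hev x hx).self_of_nhds).2.2]
      refine (hasDerivAt_const x (0 : ℝ)).congr_of_eventuallyEq ?_
      filter_upwards [hev x hx] with y hy
      exact (hs y hy).2.1
  have hA1 : 1 ≤ A := by linarith
  have hbd : ∀ x, |x| ≤ 1 / 16 → |m x| ≤ 9 * A ^ 3 ∧ |m₂ x| ≤ 9 * A ^ 3 := by
    intro x hx
    have hx8 : |x| ≤ 1 / 8 := hx.trans (by norm_num)
    have hJ1 := hJpos x hx8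
    have hq1 := hqpos x hx8
    have hJ0 : 0 < J x := by linarith
    have hJ6 : J x ≤ 6 := by
      refine Real.sqrt_le_iff.2 ⟨by norm_num, ?_⟩
      have h1 : b * x ≤ j₀ * |x| := (le_abs_self _).trans (by rw [abs_mul]; gcongr)
      nlinarith [sq_abs x, abs_nonneg x]
    have hxb : |x + b| ≤ 6 := (abs_add_le _ _).trans (by linarith)
    have hJinv : (J x)⁻¹ ≤ 8 := by
      rw [inv_le_comm₀ hJ0 (by norm_num)]
      linarith
    have hJinv0 : 0 ≤ (J x)⁻¹ := by positivity
    have hlx : |lm * x| ≤ 1 := by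
      rw [abs_mul]
      calc |lm| * |x| ≤ 1 * (1 / 16) := by gcongr
        _ ≤ 1 := by norm_num
    have bG : |G x| ≤ A := by
      refine (abs_add_le _ _).trans ?_
      rw [abs_of_nonneg (by linarith : 0 ≤ J x + j₀)]
      linarith
    have bxbJ : |(x + b) / J x| ≤ 48 := by
      rw [abs_div, abs_of_pos hJ0, div_eq_mul_inv]
      calc |x + b| * (J x)⁻¹ ≤ 6 * 8 := by gcongr
        _ = 48 := by norm_num
    have bG₁ : |G₁ x| ≤ A := by
      refine (abs_add_le _ _).trans ?_
      linarith
    have bG₂ : |G₂ x| ≤ A := by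
      have e : G₂ x = (J x)⁻¹ - ((x + b) / J x) ^ 2 * (J x)⁻¹ := by
        simp only [hG₂]
        field_simp
      rw [e]
      refine (abs_sub _ _).trans ?_
      rw [abs_of_nonneg hJinv0, abs_of_nonneg (by positivity), ← sq_abs]
      have : |(x + b) / J x| ^ 2 * (J x)⁻¹ ≤ 48 ^ 2 * 8 := by gcongr
      linarith
    have hQ0 : 0 ≤ Q x := inv_nonneg.2 (by linarith)
    have hQ3 : Q x ≤ 3 := by
      rw [hQ]
      refine inv_le_of_inv_le₀ (by norm_num) ?_
      linarith
    have bQ : |Q x| ≤ A := by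
      rw [abs_of_nonneg hQ0]
      linarith
    have hQ₁0 : 0 ≤ Q₁ x := by positivity
    have hQ₁9 : Q₁ x ≤ 9 := by
      calc ε * Q x ^ 2 ≤ 1 * 3 ^ 2 := by gcongr
        _ = 9 := by norm_num
    have bQ₁ : |Q₁ x| ≤ A := by
      rw [abs_of_nonneg hQ₁0]
      linarith
    have bQ₂ : |Q₂ x| ≤ A := by
      have h1 : Q₂ x ≤ 1 * (2 * 3 * 9) := by
        simp only [hQ₂]
        gcongr
      rw [abs_of_nonneg (by simp only [hQ₂]; positivity)]
      linarith
    obtain ⟨c0, c1, c2⟩ := hβA x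
    have b0 : |lineBump x| ≤ A := by linarith
    have b1 : |β₁ x| ≤ A := by linarith
    have b2 : |β₂ x| ≤ A := by linarith
    have p3 : ∀ {u v w : ℝ}, |u| ≤ A → |v| ≤ A → |w| ≤ A → |u * (v * w)| ≤ A ^ 3 := by
      intro u v w hu hv hw
      rw [abs_mul, abs_mul]
      calc |u| * (|v| * |w|) ≤ A * (A * A) := by gcongr
        _ = A ^ 3 := by ring
    have hA3 : 0 ≤ A ^ 3 := by positivity
    refine ⟨(p3 b0 bG bQ).trans (by linarith), ?_⟩
    have t1 := abs_le.1 (p3 b2 bG bQ)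
    have t2 := abs_le.1 (p3 b1 bG₁ bQ)
    have t3 := abs_le.1 (p3 b1 bG bQ₁)
    have t4 := abs_le.1 (p3 b0 bG₂ bQ)
    have t5 := abs_le.1 (p3 b0 bG₁ bQ₁)
    have t6 := abs_le.1 (p3 b0 bG bQ₂)
    simp only [hm₂, mul_add]
    rw [abs_le]
    constructor <;> linarith [t1.1, t2.1, t3.1, t4.1, t5.1, t6.1, t1.2, t2.2, t3.2, t4.2, t5.2,
      t6.2]
  have hA9 : 0 ≤ 9 * A ^ 3 := by positivity
  refine ⟨continuous_iff_continuousAt.2 fun x => (d0 x).continuousAt,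
    norm_fourier_le_of_hasDerivAt d0 d1 (by norm_num) hs (fun x => ?_) (fun x => ?_)⟩
  · rcases le_or_gt |x| (1 / 16) with hx | hx
    · exact (hbd x hx).1
    · rw [(hs x hx).1, abs_zero]
      exact hA9
  · rcases le_or_gt |x| (1 / 16) with hx | hx
    · exact (hbd x hx).2
    · rw [(hs x hx).2.2, abs_zero]
      exact hA9

/-- The kernel of the parametrix at frequency scale `q`: the Fourier transform of the localized
multiplier in the displacement variable rescaled by `q`. -/
def paramKernel (lm : ℝ) (w : E3) (q : ℝ) (y : ℝ) (ξ : E3) : ℂ :=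
  (((transv lm w ξ)⁻¹ : ℝ) : ℂ) *
    𝓕 (fun x => (lineSymbol (⟪w, ξ⟫ / q) (jap ξ / q) lm ((1 - lm ^ 2) / transv lm w ξ) x : ℂ)) y

lemma measurable_paramKernel (lm : ℝ) (w : E3) (q : ℝ) :
    Measurable (Function.uncurry (paramKernel lm w q)) := by
  have htr : Measurable (transv lm w) := (continuous_transv lm w).measurable
  have hb : Measurable (lineBump : ℝ → ℝ) := lineBump.continuous.measurable
  have hsymb : Measurable fun p : (ℝ × E3) × ℝ => lineSymbol (⟪w, p.1.2⟫ / q) (jap p.1.2 / q) lm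
      ((1 - lm ^ 2) / transv lm w p.1.2) p.2 := by
    have h1 : Measurable fun p : (ℝ × E3) × ℝ => lineBump p.2 := hb.comp measurable_snd
    have h2 : Measurable fun p : (ℝ × E3) × ℝ => transv lm w p.1.2 :=
      htr.comp (measurable_snd.comp measurable_fst)
    have h3 : Measurable fun p : (ℝ × E3) × ℝ => jap p.1.2 / q := by fun_prop
    have h4 : Measurable fun p : (ℝ × E3) × ℝ => ⟪w, p.1.2⟫ / q := by fun_prop
    unfold lineSymbol lineSqrt
    refine h1.mul ((Measurable.add (Measurable.add ?_ h3) (by fun_prop)).mul (Measurable.inv ?_))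
    · exact Real.continuous_sqrt.measurable.comp
        (((measurable_snd.pow_const 2).add ((h4.const_mul 2).mul measurable_snd)).add
          (h3.pow_const 2))
    · exact (h3.const_mul 2).sub ((measurable_const.div h2).mul measurable_snd)
  have hm : StronglyMeasurable (Function.uncurry fun (p : ℝ × E3) (x : ℝ) =>
      Complex.exp (((-2 * Real.pi * ⟪x, p.1⟫ : ℝ) : ℂ) * Complex.I) *
        (lineSymbol (⟪w, p.2⟫ / q) (jap p.2 / q) lm ((1 - lm ^ 2) / transv lm w p.2) x : ℂ)) := by
    refine (Measurable.mul ?_ (Complex.measurable_ofReal.comp hsymb)).stronglyMeasurable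
    fun_prop
  have h5 := (hm.integral_prod_right (ν := (volume : Measure ℝ))).measurable
  have h6 : Measurable fun p : ℝ × E3 => (((transv lm w p.2)⁻¹ : ℝ) : ℂ) :=
    Complex.measurable_ofReal.comp (htr.comp measurable_snd).inv
  have h7 : Function.uncurry (paramKernel lm w q) = fun p : ℝ × E3 =>
      (((transv lm w p.2)⁻¹ : ℝ) : ℂ) * ∫ x : ℝ,
        Complex.exp (((-2 * Real.pi * ⟪x, p.1⟫ : ℝ) : ℂ) * Complex.I) *
        (lineSymbol (⟪w, p.2⟫ / q) (jap p.2 / q) lm ((1 - lm ^ 2) / transv lm w p.2) x : ℂ) := by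
    funext p
    change paramKernel lm w q p.1 p.2 = _
    rw [paramKernel, Real.fourier_eq']
    rfl
  rw [h7]
  exact h6.mul h5

/-- The kernel `paramKernel` is a parametrix for a set of frequencies of size comparable to `q` on
which the transversality is at least `1 - λ²`, if `B` only involves displacements that are small
compared to `q`. In rescaled variables `x = h / q`, `j₀ = ⟨ξ⟩ / q`, `b = ω·ξ / q`,
`J(x) = ⟨ξ + hω⟩ / q` and with `D = transv λ ω ξ` this is the identity
`(j₀ + λx - J(x)) (j₀ + λx + J(x)) = x (2 j₀ D - (1 - λ²) x)`. -/
lemma exists_isParametrix : ∃ K : ℝ, 0 < K ∧ ∀ (lm : ℝ) (w : E3) (R : Set E3) (B : Set (ℝ × E3))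
    (d₀ d₁ q : ℝ), IsTransverse lm w R B d₀ d₁ → 0 < q → 0 < lm → lm ≤ 1 → 1 - lm ^ 2 ≤ d₀ →
    (∀ ξ ∈ R, 1 / 4 * q ≤ jap ξ ∧ jap ξ ≤ 5 * q) →
    (∀ ξ ∈ R, ∀ h, charLine lm w (h, ξ) ∈ B → |h| ≤ q / 32) →
    IsParametrix lm w R B (paramKernel lm w q) (2 * Real.pi / (q * frameNorm lm))
      (fun y => K / d₀ * (1 + y ^ 2)⁻¹) := by
  obtain ⟨K, hK, hKb⟩ := exists_lineSymbol_bound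
  refine ⟨K, hK, fun lm w R B d₀ d₁ q hG hq hlm hlm1 hε hR hB => ?_⟩
  have hd₀ := hG.pos
  have hpar : ∀ ξ ∈ R, Continuous (lineSymbol (⟪w, ξ⟫ / q) (jap ξ / q) lm
      ((1 - lm ^ 2) / transv lm w ξ)) ∧ ∀ y, ‖𝓕 (fun x => (lineSymbol (⟪w, ξ⟫ / q) (jap ξ / q) lm
        ((1 - lm ^ 2) / transv lm w ξ) x : ℂ)) y‖ ≤ K * (1 + y ^ 2)⁻¹ := by
    intro ξ hξ
    obtain ⟨h1, h2⟩ := hR ξ hξ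
    have hD := hG.lower ξ hξ
    have hD0 : 0 < transv lm w ξ := hd₀.trans_le hD
    have hlm2 : 0 ≤ 1 - lm ^ 2 := by nlinarith
    refine hKb _ _ _ _ ?_ ?_ ?_ ?_ (div_nonneg hlm2 hD0.le) ?_
    · rw [abs_div, abs_of_pos hq]
      gcongr
      refine (abs_real_inner_le_norm _ _).trans ?_
      rw [hG.unit, one_mul]
      exact Real.le_sqrt_of_sq_le (by linarith)
    · rwa [le_div_iff₀ hq]
    · rwa [div_le_iff₀ hq]
    · rw [abs_of_pos hlm]
      exact hlm1
    · rw [div_le_one hD0]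
      linarith
  refine ⟨measurable_paramKernel lm w q, fun ξ hξ y => ?_, fun y => by positivity,
    integrable_inv_one_add_sq.const_mul _, fun ξ hξ h hh => ?_⟩
  · have hD := hG.lower ξ hξ
    have hD0 : 0 < transv lm w ξ := hd₀.trans_le hD
    rw [paramKernel, norm_mul, Complex.norm_real, Real.norm_of_nonneg (by positivity)]
    calc (transv lm w ξ)⁻¹ * _ ≤ d₀⁻¹ * (K * (1 + y ^ 2)⁻¹) := by
          gcongr
          exact (hpar ξ hξ).2 y
      _ = _ := by ring
  · obtain ⟨hc, hb⟩ := hpar ξ hξ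
    obtain ⟨hj1, hj5⟩ := hR ξ hξ
    have hD0 : 0 < transv lm w ξ := hd₀.trans_le (hG.lower ξ hξ)
    have hx := hB ξ hξ h hh
    set D := transv lm w ξ with hDdef
    set b := ⟪w, ξ⟫ / q with hbdef
    set j₀ := jap ξ / q with hj₀
    set ε := (1 - lm ^ 2) / D with hεdef
    set m : ℝ → ℂ := fun x => (lineSymbol b j₀ lm ε x : ℂ) with hm
    have hN := frameNorm_pos lm
    have hmc : Continuous m := Complex.continuous_ofReal.comp hc
    have hms : HasCompactSupport m := by
      refine HasCompactSupport.of_support_subset_isCompact lineBump.hasCompactSupport.isCompact ?_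
      intro x hx
      refine subset_tsupport _ fun h0 => hx ?_
      simp [hm, lineSymbol, h0]
    have hmi : Integrable m := hmc.integrable_of_hasCompactSupport hms
    have hmF : Integrable (𝓕 m) := by
      refine (integrable_inv_one_add_sq.const_mul K).mono' ?_ (Eventually.of_forall hb)
      exact (VectorFourier.fourierIntegral_continuous Real.continuous_fourierChar
        (by fun_prop) hmi).aestronglyMeasurable
    have hinv := congrFun (hmc.fourierInv_fourier_eq hmi hmF) (h / q)
    have hker : kerMult lm (paramKernel lm w q) (2 * Real.pi / (q * frameNorm lm)) h ξ =
        ((D⁻¹ : ℝ) : ℂ) * m (h / q) := by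
      rw [← hinv, Real.fourierInv_eq', ← integral_const_mul]
      refine integral_congr_ae (Eventually.of_forall fun y => ?_)
      change _ * (((D⁻¹ : ℝ) : ℂ) * 𝓕 m y) = ((D⁻¹ : ℝ) : ℂ) * (_ • 𝓕 m y)
      rw [smul_eq_mul, mul_left_comm]
      congr 3
      rw [mul_comm Complex.I]
      congr 2
      simp only [RCLike.inner_apply, conj_trivial]
      field_simp
    rw [hker, hm, ← Complex.ofReal_mul, ← Complex.ofReal_mul]
    congr 1
    have hxq : |h / q| ≤ 1 / 32 := by
      rw [abs_div, abs_of_pos hq, div_le_iff₀ hq]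
      linarith
    have hbump : lineBump (h / q) = 1 := by
      apply lineBump.one_of_mem_closedBall
      rw [mem_closedBall_zero_iff, Real.norm_eq_abs]
      exact hxq
    have hjq : jap ξ = q * j₀ := by rw [hj₀]; field_simp
    have hj14 : 1 / 4 ≤ j₀ := by rwa [hj₀, le_div_iff₀ hq]
    have hD0' : D * j₀ = lm * j₀ - b := by
      have : 0 < jap ξ := jap_pos ξ
      rw [hDdef, transv, hj₀, hbdef]
      field_simp
    have hrad : 0 ≤ (h / q) ^ 2 + 2 * b * (h / q) + j₀ ^ 2 ∧
        jap (ξ + h • w) = q * lineSqrt b j₀ (h / q) := by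
      have e1 : jap (ξ + h • w) ^ 2 = q ^ 2 * ((h / q) ^ 2 + 2 * b * (h / q) + j₀ ^ 2) := by
        rw [jap_sq, norm_add_sq_real, norm_smul, hG.unit, mul_one, Real.norm_eq_abs, sq_abs,
          inner_smul_right, real_inner_comm, hj₀, hbdef]
        field_simp
        rw [jap_sq]
        ring
      have e0 : 0 ≤ (h / q) ^ 2 + 2 * b * (h / q) + j₀ ^ 2 :=
        nonneg_of_mul_nonneg_right (e1 ▸ sq_nonneg _) (by positivity)
      refine ⟨e0, ?_⟩
      rw [← Real.sqrt_sq (jap_pos (ξ + h • w)).le, e1, Real.sqrt_mul (sq_nonneg q),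
        Real.sqrt_sq hq.le, lineSqrt]
    obtain ⟨hrad, hjh⟩ := hrad
    have hJ2 : lineSqrt b j₀ (h / q) ^ 2 = (h / q) ^ 2 + 2 * b * (h / q) + j₀ ^ 2 :=
      Real.sq_sqrt hrad
    rw [lineSymbol, hbump, one_mul, hjq, hjh]
    set J := lineSqrt b j₀ (h / q)
    have hhx : h = q * (h / q) := by field_simp
    set x := h / q
    rw [hhx]
    have hε0 : 0 ≤ ε := div_nonneg (by nlinarith) hD0.le
    have hε1 : ε ≤ 1 := by
      rw [hεdef, div_le_one hD0]
      linarith [hG.lower ξ hξ]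
    have hne : 2 * j₀ - ε * x ≠ 0 := by
      have : ε * x ≤ 1 * (1 / 32) := by
        calc ε * x ≤ ε * |x| := by gcongr; exact le_abs_self x
          _ ≤ 1 * (1 / 32) := by gcongr
      linarith
    have hεD : ε * D = 1 - lm ^ 2 := by rw [hεdef]; field_simp
    have key : (J + j₀ + lm * x) * (j₀ + lm * x - J) = x * (D * (2 * j₀ - ε * x)) := by
      linear_combination -hJ2 - x * 2 * hD0' + x ^ 2 * hεD
    calc D⁻¹ * ((J + j₀ + lm * x) * (2 * j₀ - ε * x)⁻¹) * (q * j₀ + lm * (q * x) - q * J)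
        = D⁻¹ * (2 * j₀ - ε * x)⁻¹ * q * ((J + j₀ + lm * x) * (j₀ + lm * x - J)) := by ring
      _ = q * x := by
        rw [key]
        field_simp

/-! ### Transversality and the angle to the tilted direction -/

/-- The distance of the direction of `ξ` to `w`. -/
def dirDist (w ξ : E3) : ℝ := ‖w - ‖ξ‖⁻¹ • ξ‖

lemma norm_normalize {ξ : E3} (hξ : ξ ≠ 0) : ‖‖ξ‖⁻¹ • ξ‖ = 1 := by
  rw [norm_smul, norm_inv, norm_norm, inv_mul_cancel₀ (norm_ne_zero_iff.2 hξ)]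

lemma inner_eq_dirDist {w ξ : E3} (hw : ‖w‖ = 1) (hξ : ξ ≠ 0) :
    ⟪w, ξ⟫ = ‖ξ‖ * (1 - dirDist w ξ ^ 2 / 2) := by
  have h := norm_pos_iff.2 hξ
  rw [dirDist, norm_sub_sq_real, norm_normalize hξ, hw, inner_smul_right]
  field_simp
  ring

/-- The transversality is comparable to the square of the angle to `w`, as long as the frequency
is large and `λ` is close to `1` relative to that angle. -/
lemma transv_bounds {lm α : ℝ} {w ξ : E3} (hw : ‖w‖ = 1) (hα : 0 < α) (hα8 : α ≤ 8)
    (hlm : 1 - lm ≤ α ^ 2 / 2 ^ 15) (hlm1 : lm ≤ 1) (hξ : 2 ^ 10 ≤ α ^ 2 * ‖ξ‖ ^ 2)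
    (hlo : α / 4 ≤ dirDist w ξ) (hup : dirDist w ξ ≤ 22 * α) :
    α ^ 2 / 64 ≤ transv lm w ξ ∧ transv lm w ξ ≤ 256 * α ^ 2 := by
  have hξ0 : ξ ≠ 0 := by
    rintro rfl
    norm_num at hξ
  have hn := norm_pos_iff.2 hξ0
  rw [transv, inner_eq_dirDist hw hξ0]
  set u := dirDist w ξ
  have hJ2 := jap_sq ξ
  have hJ0 := jap_pos ξ
  set n := ‖ξ‖
  set J := jap ξ
  have hα2 : α ^ 2 ≤ 64 := by nlinarith
  have hn16 : 16 ≤ n ^ 2 := by nlinarith [sq_nonneg n]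
  have hJn : n ≤ J := by nlinarith
  have hJ32 : J ≤ 3 / 2 * n := by nlinarith
  have hu1 : α ^ 2 / 16 ≤ u ^ 2 := by nlinarith
  have hu2 : u ^ 2 ≤ 484 * α ^ 2 := by nlinarith
  have hJd : J - n ≤ α ^ 2 * n / 2 ^ 10 := by
    have h1 : (J - n) * n ≤ 1 := by nlinarith
    have h2 : (J - n) * n ≤ α ^ 2 * n / 2 ^ 10 * n := by linarith
    exact le_of_mul_le_mul_right h2 hn
  have e : lm - n * (1 - u ^ 2 / 2) / J = (lm * J - n + n * u ^ 2 / 2) / J := by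
    field_simp
    ring
  rw [e, le_div_iff₀ hJ0, div_le_iff₀ hJ0]
  have p1 : n * (α ^ 2 / 16) ≤ n * u ^ 2 := by gcongr
  have p2 : n * u ^ 2 ≤ n * (484 * α ^ 2) := by gcongr
  have p3 : (1 - lm) * J ≤ α ^ 2 / 2 ^ 15 * J := by gcongr
  have p4 : lm * J ≤ 1 * J := by gcongr
  have p5 : α ^ 2 * J ≤ α ^ 2 * (3 / 2 * n) := by gcongr
  have p6 : α ^ 2 * n ≤ α ^ 2 * J := by gcongr
  constructor <;> linarith

/-- A displacement by `h w` moves `ξ` along its own ray, to `(|ξ| - h) ξ / |ξ|`, up to an error of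
`h` times the distance between the direction of `ξ` and `w`. -/
lemma norm_displace_sub {w ξ : E3} (hξ : ξ ≠ 0) (h : ℝ) :
    ‖(ξ - h • w) - (‖ξ‖ - h) • ‖ξ‖⁻¹ • ξ‖ = |h| * dirDist w ξ := by
  have hn := norm_pos_iff.2 hξ
  have : (ξ - h • w) - (‖ξ‖ - h) • ‖ξ‖⁻¹ • ξ = (-h) • (w - ‖ξ‖⁻¹ • ξ) := by
    rw [sub_smul (‖ξ‖) h, smul_smul ‖ξ‖, mul_inv_cancel₀ hn.ne']
    module
  rw [this, norm_smul, norm_neg, Real.norm_eq_abs, dirDist]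

lemma norm_normalize_sub_le {x θ : E3} (hx : x ≠ 0) (hθ : ‖θ‖ = 1) {s : ℝ} (hs : 0 ≤ s) :
    ‖‖x‖⁻¹ • x - θ‖ ≤ 2 * ‖x - s • θ‖ / ‖x‖ := by
  have hn := norm_pos_iff.2 hx
  have h1 : ‖x‖⁻¹ • x - θ = ‖x‖⁻¹ • ((x - s • θ) + (s - ‖x‖) • θ) := by
    rw [show (x - s • θ) + (s - ‖x‖) • θ = x - ‖x‖ • θ by module, smul_sub, smul_smul,
      inv_mul_cancel₀ hn.ne', one_smul]
  have h2 : |s - ‖x‖| ≤ ‖x - s • θ‖ := by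
    have := abs_norm_sub_norm_le x (s • θ)
    rwa [norm_smul, hθ, mul_one, Real.norm_of_nonneg hs, abs_sub_comm] at this
  rw [h1, norm_smul, norm_inv, norm_norm, inv_mul_eq_div]
  gcongr
  refine (norm_add_le _ _).trans ?_
  rw [norm_smul, hθ, mul_one, Real.norm_eq_abs]
  linarith

/-- The chord is shorter than the arc. -/
lemma norm_normalize_sub_le_angle {e ξ : E3} (he : ‖e‖ = 1) (hξ : ξ ≠ 0) :
    ‖e - ‖ξ‖⁻¹ • ξ‖ ≤ InnerProductGeometry.angle e ξ := by
  have hn := norm_pos_iff.2 hξ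
  refine le_of_sq_le_sq ?_ (InnerProductGeometry.angle_nonneg _ _)
  have h1 := InnerProductGeometry.cos_angle e ξ
  have h2 := Real.one_sub_sq_div_two_le_cos (x := InnerProductGeometry.angle e ξ)
  rw [h1, he, one_mul] at h2
  have h3 := inner_eq_dirDist he hξ
  rw [dirDist] at h3
  rw [h3, mul_div_cancel_left₀ _ hn.ne'] at h2
  linarith

/-- The lines in direction `(λ, w)` through the points close to the characteristic surface hit that
surface: `h ↦ ⟨ξ - hw⟩ + λh` moves away from `⟨ξ⟩` at a rate comparable to the transversality. -/
lemma exists_displacement {lm d₀ q H : ℝ} {w ξ : E3} {τ : ℝ} (hw : ‖w‖ = 1) (hlm : |lm| ≤ 1)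
    (hd₀ : 0 < d₀) (hd : d₀ ≤ transv lm w ξ) (hε : 1 - lm ^ 2 ≤ d₀) (hq : 0 < q)
    (hJ : q / 2 ≤ jap ξ) (hJ' : jap ξ ≤ 3 * q) (hH : 0 < H) (hHq : H ≤ q / 32)
    (hτ : |τ - jap ξ| ≤ H * d₀ / 16) :
    ∃ h, |h| ≤ H ∧ jap (ξ - h • w) + lm * h = τ := by
  set φ : ℝ → ℝ := fun h => jap (ξ - h • w) + lm * h with hφ
  have hφc : Continuous φ := by
    have := continuous_jap
    fun_prop
  -- difference of squares, as `⟨ξ - hw⟩²` is quadratic in `h`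
  have key : ∀ h, (φ h - jap ξ) * (jap (ξ - h • w) + jap ξ - lm * h) =
      h * (2 * jap ξ * transv lm w ξ + (1 - lm ^ 2) * h) := by
    intro h
    have e1 : jap (ξ - h • w) ^ 2 = jap ξ ^ 2 - 2 * h * ⟪w, ξ⟫ + h ^ 2 := by
      rw [jap_sq, jap_sq, norm_sub_sq_real, norm_smul, hw, mul_one, Real.norm_eq_abs, sq_abs,
        inner_smul_right, real_inner_comm]
      ring
    have e2 : jap ξ * transv lm w ξ = lm * jap ξ - ⟪w, ξ⟫ := by
      have := jap_pos ξ
      rw [transv]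
      field_simp
    simp only [hφ]
    linear_combination e1 - 2 * h * e2
  have hpos : ∀ h, |h| ≤ H → 0 < jap (ξ - h • w) + jap ξ - lm * h ∧
      jap (ξ - h • w) + jap ξ - lm * h ≤ 7 * q ∧ q * d₀ / 2 ≤ 2 * jap ξ * transv lm w ξ +
        (1 - lm ^ 2) * h := by
    intro h hh
    have h1 := abs_jap_sub_le (ξ - h • w) ξ
    rw [show ξ - h • w - ξ = (-h) • w by module, norm_smul, hw, mul_one, Real.norm_eq_abs,
      abs_neg] at h1
    have h2 : |lm * h| ≤ |h| := by
      rw [abs_mul]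
      exact mul_le_of_le_one_left (abs_nonneg _) hlm
    have h3 := abs_le.1 h1
    have h4 := abs_le.1 h2
    have hlm2 : 0 ≤ 1 - lm ^ 2 := by
      rw [← sq_abs]
      nlinarith [abs_nonneg lm]
    have h5 : -(d₀ * (q / 32)) ≤ (1 - lm ^ 2) * h := by
      have : |(1 - lm ^ 2) * h| ≤ d₀ * (q / 32) := by
        rw [abs_mul, abs_of_nonneg hlm2]
        gcongr
        exact hh.trans hHq
      exact (abs_le.1 this).1
    have h6 : q / 2 * d₀ ≤ jap ξ * transv lm w ξ :=
      mul_le_mul hJ hd hd₀.le (jap_pos ξ).le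
    have := jap_pos (ξ - h • w)
    refine ⟨by linarith, by linarith, ?_⟩
    nlinarith [mul_pos hq hd₀]
  have hup : τ ≤ φ H := by
    obtain ⟨a, b, c⟩ := hpos H (by rw [abs_of_pos hH])
    have h1 : H * (q * d₀ / 2) ≤ (φ H - jap ξ) * (jap (ξ - H • w) + jap ξ - lm * H) := by
      rw [key]
      gcongr
    have h2 : 0 ≤ φ H - jap ξ :=
      nonneg_of_mul_nonneg_left ((by positivity : 0 ≤ H * (q * d₀ / 2)).trans h1) a
    have h3 : H * (q * d₀ / 2) ≤ (φ H - jap ξ) * (7 * q) := h1.trans (by gcongr)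
    have h4 : H * d₀ / 16 ≤ φ H - jap ξ := by
      refine le_of_mul_le_mul_right (a := q) ?_ hq
      nlinarith [mul_nonneg h2 hq.le, mul_pos hH hd₀, mul_pos (mul_pos hH hd₀) hq]
    linarith [(abs_le.1 hτ).2]
  have hlo : φ (-H) ≤ τ := by
    obtain ⟨a, b, c⟩ := hpos (-H) (by rw [abs_neg, abs_of_pos hH])
    have h1 : H * (q * d₀ / 2) ≤
        (jap ξ - φ (-H)) * (jap (ξ - (-H) • w) + jap ξ - lm * (-H)) := by
      have := key (-H)
      have h0 : H * (q * d₀ / 2) ≤ H * (2 * jap ξ * transv lm w ξ + (1 - lm ^ 2) * -H) := by gcongr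
      linarith
    have h2 : 0 ≤ jap ξ - φ (-H) :=
      nonneg_of_mul_nonneg_left ((by positivity : 0 ≤ H * (q * d₀ / 2)).trans h1) a
    have h3 : H * (q * d₀ / 2) ≤ (jap ξ - φ (-H)) * (7 * q) := h1.trans (by gcongr)
    have h4 : H * d₀ / 16 ≤ jap ξ - φ (-H) := by
      refine le_of_mul_le_mul_right (a := q) ?_ hq
      nlinarith [mul_nonneg h2 hq.le, mul_pos hH hd₀, mul_pos (mul_pos hH hd₀) hq]
    linarith [(abs_le.1 hτ).1]
  obtain ⟨h, hh, he⟩ := intermediate_value_Icc (by linarith : -H ≤ H) hφc.continuousOn ⟨hlo, hup⟩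
  exact ⟨h, abs_le.2 hh, he⟩

/-! ### The cutoffs -/

section Cutoffs

variable {ρ : ℝ → ℝ}

lemma IsCutoff.eq_zero (hρ : IsCutoff ρ) {s : ℝ} (hs : 2 ≤ |s|) : ρ s = 0 := by
  refine image_eq_zero_of_notMem_tsupport fun h => ?_
  have := hρ.support h
  exact absurd hs (not_le.2 (abs_lt.2 this))

lemma two_zpow_neg_mul (k : ℤ) (r : ℝ) : (2 : ℝ) ^ (-k) * r = r / 2 ^ k := by
  rw [zpow_neg, inv_mul_eq_div]

/-- `χ_k` lives at scale `2^k`. -/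
lemma IsCutoff.chi_support (hρ : IsCutoff ρ) {k : ℤ} {r : ℝ} (hr : 0 ≤ r) (h : chi ρ k r ≠ 0) :
    (2 : ℝ) ^ k / 2 ≤ r ∧ r ≤ 2 * 2 ^ k := by
  have hq : (0 : ℝ) < 2 ^ k := by positivity
  have e : (2 : ℝ) ^ (-k + 1) * r = 2 * r / 2 ^ k := by
    rw [zpow_add₀ two_ne_zero, zpow_one, zpow_neg]
    field_simp
  rw [chi, e, two_zpow_neg_mul] at h
  constructor
  · by_contra hc
    rw [not_le] at hc
    refine h ?_
    rw [hρ.one _ (by rw [abs_of_nonneg (by positivity), div_le_one hq]; linarith),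
      hρ.one _ (by rw [abs_of_nonneg (by positivity), div_le_one hq]; linarith), sub_self]
  · by_contra hc
    rw [not_le] at hc
    refine h ?_
    rw [hρ.eq_zero (by rw [abs_of_nonneg (by positivity), le_div_iff₀ hq]; linarith),
      hρ.eq_zero (by rw [abs_of_nonneg (by positivity), le_div_iff₀ hq]; linarith), sub_self]

/-- `χ̃_k` does not vanish in a neighbourhood of the support of `χ_k`, of relative size independent
of `k`. -/
lemma IsCutoff.exists_chiT_ne_zero (hρ : IsCutoff ρ) : ∃ ε > 0, ∀ (k : ℤ) (r : ℝ),
    (1 / 2 - ε) * 2 ^ k ≤ r → r ≤ (2 + ε) * 2 ^ k → chiT ρ k r ≠ 0 := by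
  have h1 : ∀ᶠ s in 𝓝 (1 : ℝ), 0 < ρ s := by
    refine hρ.smooth.continuous.continuousAt.eventually_const_lt ?_
    rw [hρ.one 1 (by simp)]
    exact one_pos
  have h2 : ∀ᶠ s in 𝓝 (2 : ℝ), ρ s = 0 := by
    have : (2 : ℝ) ∉ tsupport ρ := fun h => lt_irrefl _ (hρ.support h).2
    exact notMem_tsupport_iff_eventuallyEq.1 this
  obtain ⟨ε₁, hε₁, h1⟩ := Metric.eventually_nhds_iff.1 h1
  obtain ⟨ε₂, hε₂, h2⟩ := Metric.eventually_nhds_iff.1 h2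
  refine ⟨min (1 / 8) (min (ε₁ / 2) (ε₂ / 8)), by positivity, fun k r hr1 hr2 => ?_⟩
  have m1 : min (1 / 8 : ℝ) (min (ε₁ / 2) (ε₂ / 8)) ≤ 1 / 8 := min_le_left _ _
  have m2 : min (1 / 8 : ℝ) (min (ε₁ / 2) (ε₂ / 8)) ≤ ε₁ / 2 :=
    (min_le_right _ _).trans (min_le_left _ _)
  have m3 : min (1 / 8 : ℝ) (min (ε₁ / 2) (ε₂ / 8)) ≤ ε₂ / 8 :=
    (min_le_right _ _).trans (min_le_right _ _)
  set ε := min (1 / 8 : ℝ) (min (ε₁ / 2) (ε₂ / 8))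
  have hq : (0 : ℝ) < 2 ^ k := by positivity
  set x := r / 2 ^ k with hx
  have hx1 : 1 / 2 - ε ≤ x := by rwa [hx, le_div_iff₀ hq]
  have hx2 : x ≤ 2 + ε := by rwa [hx, div_le_iff₀ hq]
  have e : chiT ρ k r = ρ (x / 2) - ρ (4 * x) := by
    have a1 : (2 : ℝ) ^ (-(k - 1)) * r = 2 * x := by
      rw [neg_sub, sub_eq_add_neg, zpow_add₀ two_ne_zero, zpow_one, mul_assoc, two_zpow_neg_mul]
    have a2 : (2 : ℝ) ^ (-(k - 1) + 1) * r = 4 * x := by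
      rw [zpow_add₀ two_ne_zero, zpow_one, mul_right_comm, a1]; ring
    have a3 : (2 : ℝ) ^ (-k) * r = x := two_zpow_neg_mul k r
    have a4 : (2 : ℝ) ^ (-k + 1) * r = 2 * x := by
      rw [zpow_add₀ two_ne_zero, zpow_one, mul_right_comm, a3, mul_comm]
    have a6 : (2 : ℝ) ^ (-(k + 1) + 1) * r = x := by
      rw [neg_add, neg_add_cancel_right, a3]
    have a5 : (2 : ℝ) ^ (-(k + 1)) * r = x / 2 := by
      rw [zpow_add₀ two_ne_zero, zpow_one, mul_right_comm] at a6
      linarith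
    rw [chiT, chi, chi, chi, a1, a2, a3, a4, a5, a6]
    ring
  have p1 : 0 < ρ (x / 2) := by
    rcases le_or_gt (x / 2) 1 with h | h
    · rw [hρ.one _ (abs_le.2 ⟨by linarith, h⟩)]
      exact one_pos
    · refine h1 ?_
      rw [Real.dist_eq, abs_lt]
      constructor <;> linarith
  have p2 : ρ (4 * x) = 0 := by
    rcases le_or_gt 2 (4 * x) with h | h
    · exact hρ.eq_zero (h.trans (le_abs_self _))
    · refine h2 ?_
      rw [Real.dist_eq, abs_lt]
      constructor <;> linarith
  rw [e, p2, sub_zero]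
  exact p1.ne'

end Cutoffs

/-! ### Frequencies near a cap -/

section Caps

variable {ρ : ℝ → ℝ} {K : CapSystem} {k j : ℤ} {l : ℕ} {e w : E3} {α : ℝ}

lemma CapSystem.smul_mem_tsupport (he : e ∈ K.centers l) {ξ : E3} (hξ : ξ ∈ tsupport (K.η l e))
    {r : ℝ} (hr : 0 < r) : r • ξ ∈ tsupport (K.η l e) := by
  refine map_mem_closure (continuous_const_smul r) hξ fun x hx => ?_
  rw [Function.mem_support, K.η_homogeneous l e he r hr]
  exact hx

/-- The angular localization of the support of `η_κ`, as a closed condition. -/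
lemma CapSystem.norm_sub_le (he : e ∈ K.centers l) {ξ : E3} (hξ : ξ ∈ tsupport (K.η l e)) :
    ‖ξ - ‖ξ‖ • e‖ ≤ 2 ^ (-(l : ℤ)) * ‖ξ‖ := by
  have hc : IsClosed {ξ : E3 | ‖ξ - ‖ξ‖ • e‖ ≤ 2 ^ (-(l : ℤ)) * ‖ξ‖} :=
    isClosed_le (by fun_prop) (by fun_prop)
  refine closure_minimal (fun x hx => ?_) hc hξ
  rcases eq_or_ne x 0 with rfl | h0
  · simp
  have hn := norm_pos_iff.2 h0
  have h1 := (norm_normalize_sub_le_angle (K.unit l e he) h0).trans (K.η_support l e he x h0 hx).2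
  have h2 : x - ‖x‖ • e = -(‖x‖ • (e - ‖x‖⁻¹ • x)) := by
    rw [smul_sub, smul_smul, mul_inv_cancel₀ hn.ne', one_smul, neg_sub]
  change ‖x - ‖x‖ • e‖ ≤ _
  rw [h2, norm_neg, norm_smul, norm_norm, mul_comm]
  gcongr

lemma CapSystem.ηT_eq_one (he : e ∈ K.centers l) {ξ : E3} (h0 : ξ ≠ 0)
    (hξ : ξ ∈ tsupport (K.η l e)) : K.ηT l e ξ = 1 := by
  have hc : ContinuousAt (K.ηT l e) ξ :=
    (K.ηT_smooth l e he).continuousOn.continuousAt (isOpen_compl_singleton.mem_nhds h0)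
  have hf : ∃ᶠ x in 𝓝 ξ, K.ηT l e x ∈ ({1} : Set ℝ) := by
    refine ((mem_closure_iff_frequently.1 hξ).and_eventually
      (isOpen_compl_singleton.mem_nhds h0)).mono fun x hx => ?_
    exact mul_right_cancel₀ hx.1 ((K.ηT_mul l e he x hx.2).trans (one_mul _).symm)
  exact isClosed_singleton.mem_of_frequently_of_tendsto hf hc

lemma mem_freqSet (hρ : IsCutoff ρ) {ξ : E3} (hξ : ξ ∈ freqSet ρ K k l e) :
    ((2 : ℝ) ^ k / 2 ≤ ‖ξ‖ ∧ ‖ξ‖ ≤ 2 * 2 ^ k) ∧ ξ ∈ tsupport (K.η l e) := by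
  refine ⟨?_, tsupport_mul_subset_left hξ⟩
  have hc : IsClosed {ξ : E3 | (2 : ℝ) ^ k / 2 ≤ ‖ξ‖ ∧ ‖ξ‖ ≤ 2 * 2 ^ k} :=
    (isClosed_le continuous_const continuous_norm).inter
      (isClosed_le continuous_norm continuous_const)
  exact closure_minimal (fun x hx => hρ.chi_support (norm_nonneg x) (right_ne_zero_of_mul hx)) hc hξ

lemma mem_modSet (hρ : IsCutoff ρ) {c : ℕ} {ζ : ℝ × E3} (hζ : ζ ∈ modSet ρ K c k l e) :
    |ζ.1 - jap ζ.2| ≤ 2 * 2 ^ (k - 2 * l - c) ∧ ζ.2 ∈ freqSet ρ K k l e := by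
  constructor
  · have hJ := continuous_jap
    have hc : IsClosed {ζ : ℝ × E3 | |ζ.1 - jap ζ.2| ≤ 2 * (2 : ℝ) ^ (k - 2 * l - c)} :=
      isClosed_le (by fun_prop) continuous_const
    refine closure_minimal (fun x hx => ?_) hc hζ
    have h1 : chiLe ρ (k - 2 * l - c) |x.1 - jap x.2| ≠ 0 := left_ne_zero_of_mul hx
    by_contra h2
    refine h1 ?_
    rw [chiLe, two_zpow_neg_mul]
    refine hρ.eq_zero ?_
    rw [abs_of_nonneg (by positivity), le_div_iff₀ (by positivity)]
    exact (not_le.1 h2).le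
  · exact map_mem_closure continuous_snd hζ fun x hx => right_ne_zero_of_mul hx

/-- The relations between the scales, the cap and the direction `w`. -/
structure IsAdapted (K : CapSystem) (k j : ℤ) (l : ℕ) (e w : E3) (α : ℝ) : Prop where
  freq_le : (l : ℤ) ≤ k - 10
  slope_le : (l : ℤ) ≤ j - 10
  mem_centers : e ∈ K.centers l
  unit : ‖w‖ = 1
  eq_infDist : α = Metric.infDist w (cap l e)
  lower : (2 : ℝ) ^ (-3 - (l : ℤ)) ≤ α
  upper : α ≤ (2 : ℝ) ^ (3 - (l : ℤ))
  away : ∀ ξ ∈ tsupport (K.η l e), ‖ξ‖ = 1 → α / 2 ≤ dist w ξ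

namespace IsAdapted

lemma width_le (hA : IsAdapted K k j l e w α) : (2 : ℝ) ^ (-(l : ℤ)) ≤ 8 * α := by
  have h := hA.lower
  rw [sub_eq_add_neg, zpow_add₀ two_ne_zero] at h
  norm_num at h ⊢
  linarith

lemma le_width (hA : IsAdapted K k j l e w α) : α ≤ 8 * (2 : ℝ) ^ (-(l : ℤ)) := by
  have h := hA.upper
  rw [sub_eq_add_neg, zpow_add₀ two_ne_zero] at h
  norm_num at h ⊢
  linarith

lemma pos (hA : IsAdapted K k j l e w α) : 0 < α :=
  lt_of_lt_of_le (by positivity) hA.lower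

lemma le_eight (hA : IsAdapted K k j l e w α) : α ≤ 8 := by
  refine hA.le_width.trans ?_
  have : (2 : ℝ) ^ (-(l : ℤ)) ≤ 1 := zpow_le_one_of_nonpos₀ one_le_two (by simp)
  linarith

lemma slope_sq_le (hA : IsAdapted K k j l e w α) : (2 : ℝ) ^ (-2 * j) ≤ α ^ 2 / 2 ^ 14 := by
  have h1 : (2 : ℝ) ^ (-2 * j) ≤ 2 ^ ((-(l : ℤ)) * 2 + -20) :=
    zpow_le_zpow_right₀ one_le_two (by linarith [hA.slope_le])
  rw [zpow_add₀ two_ne_zero, zpow_mul _ (-(l : ℤ)), zpow_ofNat] at h1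
  have h2 : ((2 : ℝ) ^ (-(l : ℤ))) ^ 2 ≤ (8 * α) ^ 2 :=
    pow_le_pow_left₀ (by positivity) hA.width_le 2
  have h3 : (2 : ℝ) ^ (-20 : ℤ) = 1 / 2 ^ 20 := by norm_num
  rw [h3] at h1
  linarith

lemma freq_large (hA : IsAdapted K k j l e w α) : 2 ^ 14 ≤ α ^ 2 * ((2 : ℝ) ^ k) ^ 2 := by
  have h1 : (2 : ℝ) ^ (10 : ℤ) ≤ 2 ^ (-(l : ℤ) + k) :=
    zpow_le_zpow_right₀ one_le_two (by linarith [hA.freq_le])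
  rw [zpow_add₀ two_ne_zero] at h1
  have h2 : (2 : ℝ) ^ (10 : ℤ) ≤ 8 * α * 2 ^ k := by
    refine h1.trans ?_
    gcongr
    exact hA.width_le
  have h3 : (2 : ℝ) ^ 7 ≤ α * 2 ^ k := by
    have : (2 : ℝ) ^ (10 : ℤ) = 2 ^ 10 := by norm_cast
    linarith
  have h4 := pow_le_pow_left₀ (by positivity) h3 2
  rw [mul_pow] at h4
  linarith

end IsAdapted

lemma lam_bounds (j : ℤ) : 0 < lam j ∧ lam j ≤ 1 ∧ 1 - lam j ^ 2 ≤ 2 ^ (-2 * j) ∧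
    1 - lam j ≤ 2 ^ (-2 * j) / 2 := by
  have ht : (0 : ℝ) < 2 ^ (-2 * j) := by positivity
  set t : ℝ := 2 ^ (-2 * j) with htdef
  have h1 : 0 < √(1 + t) := by positivity
  have h2 : √(1 + t) ^ 2 = 1 + t := Real.sq_sqrt (by positivity)
  have h3 : 1 ≤ √(1 + t) := Real.le_sqrt_of_sq_le (by linarith)
  rw [lam, ← htdef]
  set s := √(1 + t)
  refine ⟨by positivity, (div_le_one h1).2 h3, ?_, ?_⟩
  · rw [div_pow, h2, one_pow, sub_le_iff_le_add, ← sub_le_iff_le_add', le_div_iff₀ (by positivity)]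
    nlinarith
  · rw [sub_le_iff_le_add, ← sub_le_iff_le_add', le_div_iff₀ h1]
    nlinarith [sq_nonneg (s - 1), mul_nonneg (sub_nonneg.2 h3) (sub_nonneg.2 h3)]

namespace IsAdapted

lemma slope_defect_le (hA : IsAdapted K k j l e w α) : 1 - lam j ^ 2 ≤ α ^ 2 / 64 := by
  have h1 := (lam_bounds j).2.2.1
  have h2 := hA.slope_sq_le
  have := sq_nonneg α
  linarith

/-- The directions in the support of `η_κ` have distance comparable to `α` from `w`. -/
lemma dirDist_bounds (hA : IsAdapted K k j l e w α) {ξ : E3} (h0 : ξ ≠ 0)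
    (hξ : ξ ∈ tsupport (K.η l e)) : α / 2 ≤ dirDist w ξ ∧ dirDist w ξ ≤ 21 * α := by
  have hn := norm_pos_iff.2 h0
  have hδ := hA.width_le
  set δ : ℝ := (2 : ℝ) ^ (-(l : ℤ)) with hδdef
  have hδ0 : 0 < δ := by positivity
  have he := K.unit l e hA.mem_centers
  refine ⟨?_, ?_⟩
  · have := hA.away _ (K.smul_mem_tsupport hA.mem_centers hξ (inv_pos.2 hn)) (norm_normalize h0)
    rwa [dist_eq_norm] at this
  · have h1 : ‖e - ‖ξ‖⁻¹ • ξ‖ ≤ δ := by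
      have h2 := K.norm_sub_le hA.mem_centers hξ
      have h3 : e - ‖ξ‖⁻¹ • ξ = -(‖ξ‖⁻¹ • (ξ - ‖ξ‖ • e)) := by
        rw [smul_sub, smul_smul, inv_mul_cancel₀ hn.ne', one_smul, neg_sub]
      rw [h3, norm_neg, norm_smul, norm_inv, norm_norm, inv_mul_le_iff₀ hn, mul_comm]
      exact h2
    have hcap : (cap l e).Nonempty := by
      refine ⟨e, ⟨?_, ?_⟩, by simpa using he⟩
      · rintro rfl
        simp at he
      · rw [InnerProductGeometry.angle_self (by rintro rfl; simp at he)]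
        positivity
    obtain ⟨p, hp, hwp⟩ := (Metric.infDist_lt_iff hcap).1
      (show Metric.infDist w (cap l e) < α + δ by rw [← hA.eq_infDist]; linarith)
    have hp1 : ‖p‖ = 1 := by simpa using hp.2
    have hpe : ‖e - p‖ ≤ δ / 2 := by
      have h4 := (norm_normalize_sub_le_angle he hp.1.1).trans hp.1.2
      rwa [hp1, inv_one, one_smul] at h4
    rw [dist_eq_norm] at hwp
    have h5 : w - ‖ξ‖⁻¹ • ξ = (w - p) - (e - p) + (e - ‖ξ‖⁻¹ • ξ) := by abel
    rw [dirDist, h5]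
    refine (norm_add_le _ _).trans ?_
    have := norm_sub_le (w - p) (e - p)
    linarith

end IsAdapted

/-- The frequencies of size comparable to `2^k` in the support of `η̃_κ χ̃_k` at which the
transversality is comparable to `α²`. -/
def transvSet (ρ : ℝ → ℝ) (K : CapSystem) (k j : ℤ) (l : ℕ) (e w : E3) (α : ℝ) : Set E3 :=
  {ξ | (2 ^ k / 4 ≤ ‖ξ‖ ∧ ‖ξ‖ ≤ 4 * 2 ^ k) ∧
    (α ^ 2 / 64 ≤ transv (lam j) w ξ ∧ transv (lam j) w ξ ≤ 256 * α ^ 2)} ∩ freqSetT ρ K k l e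

lemma isCompact_transvSet : IsCompact (transvSet ρ K k j l e w α) := by
  have ht := continuous_transv (lam j) w
  have hc : IsClosed (transvSet ρ K k j l e w α) := by
    refine IsClosed.inter ?_ (isClosed_tsupport _)
    exact ((isClosed_le continuous_const continuous_norm).inter
      (isClosed_le continuous_norm continuous_const)).inter
      ((isClosed_le continuous_const ht).inter (isClosed_le ht continuous_const))
  refine (isCompact_closedBall (0 : E3) (4 * 2 ^ k)).of_isClosed_subset hc fun ξ hξ => ?_
  rw [mem_closedBall_zero_iff]
  exact hξ.1.1.2

/-- A frequency in the support of `η_κ χ_k` may be moved in the direction `w` by a small fraction of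
`2^k`: the displacement is longitudinal up to a multiple of `α`, which is small compared to the
width of the cap. -/
lemma exists_displace_mem_transvSet (hρ : IsCutoff ρ) (K : CapSystem) :
    ∃ ε : ℝ, 0 < ε ∧ ε ≤ 1 / 1024 ∧
    ∀ (k j : ℤ) (l : ℕ) (e w : E3) (α : ℝ), IsAdapted K k j l e w α → ∀ ξ ∈ freqSet ρ K k l e,
      ∀ h, |h| ≤ ε * 2 ^ k → ξ - h • w ∈ transvSet ρ K k j l e w α := by
  obtain ⟨ε₁, hε₁, hchi⟩ := hρ.exists_chiT_ne_zero
  obtain ⟨C, hC⟩ := K.ηT_deriv 1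
  set ε := min (1 / 1024) (min ε₁ (1 / (4000 * (|C| + 1)))) with hε
  have hε0 : 0 < ε := by positivity
  have m1 : ε ≤ 1 / 1024 := min_le_left _ _
  have m2 : ε ≤ ε₁ := (min_le_right _ _).trans (min_le_left _ _)
  have m3 : ε * (4000 * (|C| + 1)) ≤ 1 := by
    rw [← le_div_iff₀ (by positivity)]
    exact (min_le_right _ _).trans (min_le_right _ _)
  refine ⟨ε, hε0, m1, fun k j l e w α hA ξ hξ h hh => ?_⟩
  obtain ⟨⟨hξ1, hξ2⟩, hξη⟩ := mem_freqSet hρ hξ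
  have hα := hA.pos
  have hq : (0 : ℝ) < 2 ^ k := by positivity
  have hfl := hA.freq_large
  set q : ℝ := 2 ^ k with hqdef
  have h0 : ξ ≠ 0 := by
    rintro rfl
    rw [norm_zero] at hξ1
    linarith
  have hn := norm_pos_iff.2 h0
  obtain ⟨hu1, hu2⟩ := hA.dirDist_bounds h0 hξη
  have hεq : ε * q ≤ q / 1024 := by
    calc ε * q ≤ 1 / 1024 * q := by gcongr
      _ = q / 1024 := by ring
  have hh' := abs_le.1 hh
  set x := ξ - h • w with hx
  set θ := ‖ξ‖⁻¹ • ξ with hθ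
  have hθ1 : ‖θ‖ = 1 := norm_normalize h0
  set s := ‖ξ‖ - h with hs
  have hs1 : 255 / 512 * q ≤ s := by linarith
  have hs0 : 0 < s := by linarith
  have hr : ‖x - s • θ‖ ≤ ε * q * (21 * α) := by
    rw [norm_displace_sub h0]
    gcongr
    exact norm_nonneg _
  have hr' : ‖x - s • θ‖ ≤ q / 4 := by
    refine hr.trans ?_
    calc ε * q * (21 * α) ≤ q / 1024 * (21 * 8) := by
          gcongr
          exact hA.le_eight
      _ ≤ q / 4 := by linarith
  have hhw : ‖h • w‖ ≤ ε * q := by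
    rw [norm_smul, hA.unit, mul_one, Real.norm_eq_abs]
    exact hh
  have hx1 : ‖ξ‖ - ε * q ≤ ‖x‖ := by
    have := norm_sub_norm_le ξ (h • w)
    linarith
  have hx2 : ‖x‖ ≤ ‖ξ‖ + ε * q := (norm_sub_le _ _).trans (by linarith)
  have hx0 : x ≠ 0 := by
    rw [← norm_pos_iff]
    linarith
  have hxn := norm_pos_iff.2 hx0
  have hdir : ‖‖x‖⁻¹ • x - θ‖ ≤ α / 4 := by
    refine (norm_normalize_sub_le hx0 hθ1 hs0.le).trans ?_
    rw [div_le_iff₀ hxn]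
    calc 2 * ‖x - s • θ‖ ≤ 2 * (q / 1024 * (21 * α)) := by
          gcongr
          exact hr.trans (by gcongr)
      _ ≤ α / 4 * (q / 4) := by linarith [mul_pos hα hq]
      _ ≤ α / 4 * ‖x‖ := by
          gcongr
          linarith
  have hdd : |dirDist w x - dirDist w ξ| ≤ α / 4 := by
    refine (abs_norm_sub_norm_le _ _).trans ?_
    rw [sub_sub_sub_cancel_left, norm_sub_rev]
    exact hdir
  obtain ⟨hd1, hd2⟩ := abs_le.1 hdd
  refine ⟨⟨⟨by linarith, by linarith⟩, ?_⟩, ?_⟩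
  · obtain ⟨-, hl1, -, hl2⟩ := lam_bounds j
    have hsl := hA.slope_sq_le
    refine transv_bounds hA.unit hα hA.le_eight (by linarith) hl1 ?_ (by linarith) (by linarith)
    calc (2 : ℝ) ^ 10 ≤ α ^ 2 * (q / 4) ^ 2 := by linarith
      _ ≤ α ^ 2 * ‖x‖ ^ 2 := by
          gcongr
          linarith
  · refine subset_tsupport _ (mul_ne_zero ?_ (hchi k _ ?_ ?_))
    · have hsθ : K.ηT l e (s • θ) = 1 := by
        rw [K.ηT_homogeneous l e hA.mem_centers s hs0]
        refine K.ηT_eq_one hA.mem_centers ?_ (K.smul_mem_tsupport hA.mem_centers hξη (inv_pos.2 hn))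
        rw [← norm_ne_zero_iff, hθ1]
        exact one_ne_zero
      have hball : ∀ y ∈ Metric.closedBall (s • θ) (‖x - s • θ‖), q / 8 ≤ ‖y‖ := by
        intro y hy
        rw [mem_closedBall_iff_norm] at hy
        have h1 := norm_sub_norm_le (s • θ) y
        rw [norm_smul, hθ1, mul_one, Real.norm_of_nonneg hs0.le, norm_sub_rev] at h1
        linarith
      -- mean value inequality between `s θ`, where `η̃_κ = 1`, and `x`
      have hmv := (convex_closedBall (s • θ) (‖x - s • θ‖)).norm_image_sub_le_of_norm_fderiv_le
        (𝕜 := ℝ) (f := K.ηT l e) (C := |C| * (2 ^ l / (q / 8))) (fun y hy => ?_) (fun y hy => ?_)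
        (Metric.mem_closedBall_self (norm_nonneg _)) (mem_closedBall_iff_norm.2 le_rfl)
      · intro hz
        rw [hsθ, hz, zero_sub, norm_neg, norm_one] at hmv
        have hαl : α * 2 ^ l ≤ 8 := by
          have := hA.le_width
          rw [zpow_neg, zpow_natCast, ← div_eq_mul_inv, le_div_iff₀ (by positivity)] at this
          exact this
        have : |C| * (2 ^ l / (q / 8)) * ‖x - s • θ‖ ≤ 1344 * (|C| * ε) := by
          calc |C| * (2 ^ l / (q / 8)) * ‖x - s • θ‖
              ≤ |C| * (2 ^ l / (q / 8)) * (ε * q * (21 * α)) := by gcongr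
            _ = 168 * (|C| * ε) * (α * 2 ^ l) := by
                field_simp
                ring
            _ ≤ 168 * (|C| * ε) * 8 := by gcongr
            _ = _ := by ring
        have := mul_nonneg (abs_nonneg C) hε0.le
        linarith
      · have hy0 : y ≠ 0 := by
          rw [← norm_pos_iff]
          exact lt_of_lt_of_le (by positivity) (hball y hy)
        exact ((K.ηT_smooth l e hA.mem_centers).contDiffAt
          (isOpen_compl_singleton.mem_nhds hy0)).differentiableAt (by simp)
      · have hy8 := hball y hy
        have hy0 : 0 < ‖y‖ := lt_of_lt_of_le (by positivity) hy8
        have h1 := hC l e hA.mem_centers y (norm_pos_iff.1 hy0)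
        rw [pow_one, norm_iteratedFDeriv_one] at h1
        refine h1.trans ?_
        gcongr
        exact le_abs_self C
    · have : ε * q ≤ ε₁ * q := by gcongr
      linarith
    · have : ε * q ≤ ε₁ * q := by gcongr
      linarith

end Caps

section CapTransversality

variable {ρ : ℝ → ℝ} {K : CapSystem} {k j : ℤ} {l : ℕ} {e w : E3} {α : ℝ}

lemma IsAdapted.one_le_scale (hA : IsAdapted K k j l e w α) : (1 : ℝ) ≤ 2 ^ k :=
  one_le_zpow₀ one_le_two (by have := hA.freq_le; omega)

lemma norm_le_jap (ξ : E3) : ‖ξ‖ ≤ jap ξ := Real.le_sqrt_of_sq_le (by linarith)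

lemma jap_le_one_add (ξ : E3) : jap ξ ≤ 1 + ‖ξ‖ :=
  Real.sqrt_le_iff.2 ⟨by positivity, by nlinarith [norm_nonneg ξ]⟩

lemma jap_bounds_of_mem_transvSet (hA : IsAdapted K k j l e w α) {ξ : E3}
    (hξ : ξ ∈ transvSet ρ K k j l e w α) : 1 / 4 * 2 ^ k ≤ jap ξ ∧ jap ξ ≤ 5 * 2 ^ k := by
  have h1 := norm_le_jap ξ
  have h2 := jap_le_one_add ξ
  have h3 := hA.one_le_scale
  have h4 := hξ.1.1
  constructor <;> linarith

lemma isCompact_modSet (hρ : IsCutoff ρ) (c : ℕ) : IsCompact (modSet ρ K c k l e) := by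
  set r : ℝ := 1 + 2 * 2 ^ k + 2 * 2 ^ (k - 2 * l - c) with hr
  refine (isCompact_closedBall (0 : ℝ × E3) r).of_isClosed_subset (isClosed_tsupport _)
    fun ζ hζ => ?_
  obtain ⟨h1, h2⟩ := mem_modSet hρ hζ
  have h3 := (mem_freqSet hρ h2).1.2
  have h4 := jap_le_one_add ζ.2
  have h5 := jap_pos ζ.2
  have h6 : (0 : ℝ) < 2 ^ (k - 2 * l - c) := by positivity
  rw [mem_closedBall_zero_iff, Prod.norm_def, max_le_iff, Real.norm_eq_abs, abs_le]
  rw [abs_le] at h1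
  refine ⟨⟨by linarith, by linarith⟩, by linarith⟩

/-- For a sufficiently small modulation localization, the support of the forcing is foliated by
short segments in the direction `(λ, ω)` issuing from points of the characteristic surface at
which the transversality is comparable to `α²`. -/
lemma exists_isTransverse (hρ : IsCutoff ρ) (K : CapSystem) : ∃ c₀ : ℕ, ∀ c : ℕ, c₀ ≤ c →
    ∀ (k j : ℤ) (l : ℕ) (e w : E3) (α : ℝ), IsAdapted K k j l e w α →
      IsTransverse (lam j) w (transvSet ρ K k j l e w α) (modSet ρ K c k l e) (α ^ 2 / 64)
        (256 * α ^ 2) ∧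
      freqSet ρ K k l e ⊆ transvSet ρ K k j l e w α ∧
      ∀ ξ ∈ transvSet ρ K k j l e w α, ∀ h, charLine (lam j) w (h, ξ) ∈ modSet ρ K c k l e →
        |h| ≤ 2 ^ k / 32 := by
  obtain ⟨ε, hε0, hε1, hε⟩ := exists_displace_mem_transvSet hρ K
  obtain ⟨c₀, hc₀⟩ := exists_nat_gt (131072 / ε)
  refine ⟨c₀, fun c hc k j l e w α hA => ?_⟩
  have hα := hA.pos
  have hq1 := hA.one_le_scale
  obtain ⟨hl0, hl1, -, -⟩ := lam_bounds j
  have hsub : freqSet ρ K k l e ⊆ transvSet ρ K k j l e w α := fun ξ hξ => by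
    have := hε k j l e w α hA ξ hξ 0 (by rw [abs_zero]; positivity)
    rwa [zero_smul, sub_zero] at this
  -- the choice of `c₀`: `2^{k-2l} ≈ α² 2^k`, and `c` absorbs all constants
  have hmod : 2 * (2 : ℝ) ^ (k - 2 * l - c) ≤ ε * 2 ^ k * (α ^ 2 / 64) / 16 := by
    have h1 : (2 : ℝ) ^ (k - 2 * l - c) = 2 ^ k * (2 ^ (-(l : ℤ))) ^ 2 / 2 ^ c := by
      rw [zpow_sub₀ two_ne_zero, zpow_sub₀ two_ne_zero, mul_comm (2 : ℤ), zpow_mul, zpow_neg,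
        zpow_ofNat, zpow_natCast, zpow_natCast]
      field_simp
    have h2 : 131072 ≤ ε * 2 ^ c := by
      have h3 : (c₀ : ℝ) ≤ c := by exact_mod_cast hc
      have h4 : (c : ℝ) ≤ 2 ^ c := by exact_mod_cast Nat.lt_two_pow_self.le
      rw [div_lt_iff₀ hε0] at hc₀
      nlinarith
    rw [h1, ← mul_div_assoc, div_le_iff₀ (by positivity)]
    calc 2 * (2 ^ k * (2 ^ (-(l : ℤ))) ^ 2) ≤ 2 * (2 ^ k * (8 * α) ^ 2) := by
          gcongr
          exact hA.width_le
      _ = 2 ^ k * (α ^ 2 / 1024) * 131072 := by ring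
      _ ≤ 2 ^ k * (α ^ 2 / 1024) * (ε * 2 ^ c) := by gcongr
      _ = _ := by ring
  have hex : ∀ ζ ∈ modSet ρ K c k l e, ∃ h ξ, |h| ≤ ε * 2 ^ k ∧ ξ ∈ transvSet ρ K k j l e w α ∧
      charLine (lam j) w (h, ξ) = ζ := by
    intro ζ hζ
    obtain ⟨h1, h2⟩ := mem_modSet hρ hζ
    obtain ⟨h3, -⟩ := mem_freqSet hρ h2
    have h4 := norm_le_jap ζ.2
    have h5 := jap_le_one_add ζ.2
    obtain ⟨h, hh, he⟩ := exists_displacement hA.unit (by rw [abs_of_pos hl0]; exact hl1)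
      (by positivity : 0 < α ^ 2 / 64) (hsub h2).1.2.1 hA.slope_defect_le
      (by positivity : (0 : ℝ) < 2 ^ k) (by linarith) (by linarith)
      (by positivity : 0 < ε * 2 ^ k) (by nlinarith) (h1.trans hmod)
    refine ⟨h, ζ.2 - h • w, hh, hε k j l e w α hA ζ.2 h2 h hh, ?_⟩
    rw [charLine]
    exact Prod.ext he (sub_add_cancel _ _)
  refine ⟨⟨hA.unit, hl0.ne', isCompact_transvSet, isCompact_modSet hρ c, by positivity,
    fun ξ hξ => hξ.1.2.1, fun ξ hξ => hξ.1.2.2, fun ζ hζ => hsub (mem_modSet hρ hζ).2,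
    fun ζ hζ => ?_⟩, hsub, fun ξ hξ h hh => ?_⟩
  · obtain ⟨h, ξ, -, hξ, he⟩ := hex ζ hζ
    exact ⟨(h, ξ), ⟨mem_univ _, hξ⟩, he⟩
  · obtain ⟨h', ξ', hh', hξ', he⟩ := hex _ hh
    have hinj := injOn_charLine hA.unit (R := transvSet ρ K k j l e w α) (lm := lam j)
      (fun ξ hξ => lt_of_lt_of_le (by positivity) hξ.1.2.1)
    have m' : ((h', ξ') : ℝ × E3) ∈ (univ : Set ℝ) ×ˢ transvSet ρ K k j l e w α :=
      ⟨mem_univ _, hξ'⟩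
    have m : ((h, ξ) : ℝ × E3) ∈ (univ : Set ℝ) ×ˢ transvSet ρ K k j l e w α := ⟨mem_univ _, hξ⟩
    have hhh : h' = h := congrArg Prod.fst (hinj m' m he)
    rw [← hhh]
    refine hh'.trans ?_
    have : ε * 2 ^ k ≤ 1 / 1024 * 2 ^ k := by gcongr
    linarith

end CapTransversality

/-! ### The estimates in the tilted frames -/

section Estimates

lemma normL1L2_eq (lm : ℝ) (b : OrthonormalBasis (Fin 3) ℝ E3) (g : ℝ × E3 → ℂ) :
    normL1L2 lm b g = mixedNorm lm (b 0) g :=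
  lintegral_congr fun s => sliceNorm_eq lm b g s

lemma mixedNorm_congr {lm : ℝ} {w : E3} (hw : ‖w‖ = 1) (hlm : lm ≠ 0) {g g' : ℝ × E3 → ℂ}
    (h : g =ᵐ[volume] g') : mixedNorm lm w g = mixedNorm lm w g' := by
  refine lintegral_congr_ae ?_
  filter_upwards [ae_slice hw hlm h] with s hs
  exact eLpNorm_congr_ae hs

lemma normLinfL2_le {lm : ℝ} {b : OrthonormalBasis (Fin 3) ℝ E3} {u : ℝ × E3 → ℂ} {M : ℝ≥0∞}
    (h : ∀ᵐ s : ℝ, eLpNorm (fun Y => u (frameMap lm (b 0) (s, Y))) 2 ≤ M) :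
    normLinfL2 lm b u ≤ M := by
  refine essSup_le_of_ae_le _ ?_
  filter_upwards [h] with s hs
  rwa [sliceNorm_eq]

lemma STFreqSupportedIn.congr {g g' : ℝ × E3 → ℂ} {B : Set (ℝ × E3)}
    (h : STFreqSupportedIn g B) (hg : g =ᵐ[volume] g') : STFreqSupportedIn g' B := by
  intro φ h1 h2 h3
  rw [← h φ h1 h2 h3]
  refine integral_congr_ae ?_
  filter_upwards [hg] with z hz
  rw [hz]

/-- A forcing in `L¹L²` whose Fourier transform lives on a set transversal to `(λ, ω)` is, up to a
null set, the inverse Fourier transform of a symbol on that set. -/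
lemma exists_isSymbolOn {lm d₀ d₁ : ℝ} {w : E3} {R : Set E3} {B : Set (ℝ × E3)}
    (hG : IsTransverse lm w R B d₀ d₁) {g : ℝ × E3 → ℂ} (hg : AEStronglyMeasurable g volume)
    (hgN : mixedNorm lm w g < ⊤) (hB : STFreqSupportedIn g B) :
    ∃ F, IsSymbolOn F B ∧ g =ᵐ[volume] stSynth F := by
  have hmk := hg.ae_eq_mk
  obtain ⟨F, h1, h2, h3, h4, h5⟩ := exists_forcing_eq_stSynth hG.unit hG.ne_zero
    hg.stronglyMeasurable_mk.measurable
    (by rwa [← mixedNorm_congr hG.unit hG.ne_zero hmk]) hG.isCompact_st (hB.congr hmk)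
  exact ⟨F, ⟨h1, h2, h3, h4⟩, hmk.trans h5⟩

variable {K : CapSystem} {k j : ℤ} {l : ℕ} {e w : E3} {α : ℝ}

lemma frameNorm_lam_le (j : ℤ) : frameNorm (lam j) ≤ 2 := by
  obtain ⟨h0, h1, -, -⟩ := lam_bounds j
  have h2 := frameNorm_sq (lam j)
  nlinarith [frameNorm_pos (lam j)]

lemma IsAdapted.mul_sqrt_le (hA : IsAdapted K k j l e w α) :
    α * √(frameNorm (lam j) / (α ^ 2 / 64)) ≤ 12 := by
  have hα := hA.pos
  have h : √(frameNorm (lam j) / (α ^ 2 / 64)) ≤ 12 / α := by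
    rw [Real.sqrt_le_left (by positivity), div_pow, div_le_div_iff₀ (by positivity) (by positivity)]
    nlinarith [frameNorm_lam_le j, sq_nonneg α]
  calc α * √(frameNorm (lam j) / (α ^ 2 / 64)) ≤ α * (12 / α) := by gcongr
    _ = 12 := by field_simp

/-- The parametrix has size `α⁻²` and the sources gain `√d₁ ≈ α`. -/
lemma IsAdapted.source_const_le (hA : IsAdapted K k j l e w α) {M : ℝ} (hM : 0 < M) :
    3 * (frameNorm (lam j) * √(256 * α ^ 2) * ∫ y : ℝ, M / (α ^ 2 / 64) * (1 + y ^ 2)⁻¹) ≤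
      6144 * Real.pi * M * α⁻¹ := by
  have hα := hA.pos
  rw [integral_const_mul, integral_univ_inv_one_add_sq,
    show 256 * α ^ 2 = (16 * α) ^ 2 by ring, Real.sqrt_sq (by positivity)]
  calc 3 * (frameNorm (lam j) * (16 * α) * (M / (α ^ 2 / 64) * Real.pi))
      ≤ 3 * (2 * (16 * α) * (M / (α ^ 2 / 64) * Real.pi)) := by
        gcongr
        exact frameNorm_lam_le j
    _ = 6144 * Real.pi * M * α⁻¹ := by
        field_simp
        ring

end Estimates

end TiltedFrames

end

open TiltedFrames MeasureTheory
open scoped ENNReal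
theorem mainTheorem4 (ρ : ℝ → ℝ) (hρ : IsCutoff ρ) (K : CapSystem) :
    ∃ c₀ : ℕ, ∀ c : ℕ, c₀ ≤ c → ∃ C : ℝ, 0 < C ∧
      ∀ (k j : ℤ) (l : ℕ) (e ω : E3) (b : OrthonormalBasis (Fin 3) ℝ E3) (α : ℝ),
        100 ≤ k → 100 ≤ j → (l : ℤ) ≤ min j k - 10 →
        e ∈ K.centers l → b 0 = ω →
        α = Metric.infDist ω (cap l e) →
        (2 : ℝ) ^ (-3 - (l : ℤ)) ≤ α → α ≤ (2 : ℝ) ^ (3 - (l : ℤ)) →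
        -- the frequency directions in the support of the cap cutoff stay away from `ω`
        (∀ ξ ∈ tsupport (K.η l e), ‖ξ‖ = 1 → α / 2 ≤ dist ω ξ) →
        -- free solutions
        (∀ f : L2, FreqSupportedIn f (freqSet ρ K k l e) →
          ENNReal.ofReal α * normLinfL2 (lam j) b (freeWave f) ≤ ENNReal.ofReal C * ‖f‖ₑ) ∧
        -- inhomogeneous solutions
        (∀ g : ℝ × E3 → ℂ, AEStronglyMeasurable g volume →
          normL1L2 (lam j) b g < ⊤ → STFreqSupportedIn g (modSet ρ K c k l e) →
          (∃ u : ℝ × E3 → ℂ, IsSolution g u) ∧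
          ∀ u : ℝ × E3 → ℂ, IsSolution g u →
            ENNReal.ofReal α * normLinfL2 (lam j) b u
                ≤ ENNReal.ofReal (C * α⁻¹) * normL1L2 (lam j) b g ∧
            ∃ (v₀ : L2) (v : ℝ → L2), Integrable v volume ∧
              FreqSupportedIn v₀ (freqSetT ρ K k l e) ∧
              (∀ s : ℝ, FreqSupportedIn (v s) (freqSetT ρ K k l e)) ∧
              ‖v₀‖ₑ + ∫⁻ s : ℝ, ‖v s‖ₑ ≤ ENNReal.ofReal (C * α⁻¹) * normL1L2 (lam j) b g ∧
              (∀ z : ℝ × E3, IntegrableOn (fun s : ℝ => freeWave (v s) z)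
                (Set.Iio (tTheta (lam j) ω z)) volume) ∧
              ∀ᵐ z : ℝ × E3, u z = freeWave v₀ z
                + ∫ s in Set.Iio (tTheta (lam j) ω z), freeWave (v s) z) := by
  obtain ⟨M, hM, hpar⟩ := exists_isParametrix
  obtain ⟨c₀, hc₀⟩ := exists_isTransverse hρ K
  refine ⟨c₀, fun c hc => ⟨12 * (1 + 6144 * Real.pi * M), by positivity, ?_⟩⟩
  intro k j l e ω b α hk hj hl he hb hα hα1 hα2 haway
  have hA : IsAdapted K k j l e ω α := by
    refine ⟨?_, ?_, he, ?_, hα, hα1, hα2, haway⟩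
    · exact hl.trans (sub_le_sub_right (min_le_right j k) _)
    · exact hl.trans (sub_le_sub_right (min_le_left j k) _)
    · rw [← hb]
      exact b.orthonormal.1 0
  have hα0 := hA.pos
  obtain ⟨hG, hsub, hsmall⟩ := hc₀ c hc k j l e ω α hA
  have hpm : 0 < 6144 * Real.pi * M := by positivity
  set S : ℝ≥0∞ := ENNReal.ofReal (√(frameNorm (lam j) / (α ^ 2 / 64))) with hS
  have hαS : ENNReal.ofReal α * S ≤ ENNReal.ofReal 12 := by
    rw [hS, ← ENNReal.ofReal_mul hα0.le]
    exact ENNReal.ofReal_le_ofReal hA.mul_sqrt_le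
  constructor
  · intro f hf
    have hf' : FreqSupportedIn f (transvSet ρ K k j l e ω α) := by
      filter_upwards [hf] with ξ h1 h2
      exact h1 fun h => h2 (hsub h)
    calc ENNReal.ofReal α * normLinfL2 (lam j) b (freeWave f)
        ≤ ENNReal.ofReal α * (S * ‖f‖ₑ) := by
          gcongr
          refine normLinfL2_le (Filter.Eventually.of_forall fun s => ?_)
          rw [hb]
          exact eLpNorm_freeWave_slice_le hG.unit hG.isCompact_freq hG.pos hG.lower hf' s
      _ ≤ ENNReal.ofReal (12 * (1 + 6144 * Real.pi * M)) * ‖f‖ₑ := by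
          rw [← mul_assoc]
          refine mul_le_mul_left (hαS.trans (ENNReal.ofReal_le_ofReal ?_)) _
          linarith
  · intro g hg hgN hgB
    rw [normL1L2_eq, hb] at hgN
    rw [normL1L2_eq, hb]
    obtain ⟨F, hF, hgF⟩ := exists_isSymbolOn hG hg hgN hgB
    obtain ⟨hl0, hl1, -, -⟩ := lam_bounds j
    have hκ := hpar (lam j) ω _ _ _ _ (2 ^ k) hG (by positivity) hl0 hl1 hA.slope_defect_le
      (fun ξ hξ => jap_bounds_of_mem_transvSet hA hξ) hsmall
    have hmix : mixedNorm (lam j) ω g = mixedNorm (lam j) ω (stSynth F) :=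
      mixedNorm_congr hG.unit hG.ne_zero hgF
    have hsol : IsSolution g (duhamel F) := isSolution_duhamel hF hG.isCompact_st hgF
    obtain ⟨v₀, v, hvi, hv₀, hv, hbound, hint, hrep, hslice⟩ :=
      exists_decomposition hG hF hκ (by rwa [← hmix])
    rw [← hmix] at hbound
    have hbound' : ‖v₀‖ₑ + ∫⁻ s, ‖v s‖ₑ ≤
        ENNReal.ofReal (6144 * Real.pi * M * α⁻¹) * mixedNorm (lam j) ω g :=
      hbound.trans (mul_le_mul_left (ENNReal.ofReal_le_ofReal (hA.source_const_le hM)) _)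
    refine ⟨⟨_, hsol⟩, fun u hu => ?_⟩
    have hud : u =ᵐ[volume] duhamel F := hu.ae_eq hsol
    refine ⟨?_, v₀, v, hvi, ?_, fun s => ?_, ?_, fun z => (hint z).integrableOn, ?_⟩
    · calc ENNReal.ofReal α * normLinfL2 (lam j) b u
          ≤ ENNReal.ofReal α * (S * (‖v₀‖ₑ + ∫⁻ s, ‖v s‖ₑ)) := by
            gcongr
            refine normLinfL2_le ?_
            rw [hb]
            filter_upwards [hslice, ae_slice hG.unit hG.ne_zero hud] with s h1 h2
            rw [eLpNorm_congr_ae h2]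
            exact h1
        _ ≤ ENNReal.ofReal 12 *
            (ENNReal.ofReal (6144 * Real.pi * M * α⁻¹) * mixedNorm (lam j) ω g) := by
            rw [← mul_assoc]
            gcongr
        _ ≤ _ := by
            rw [← mul_assoc, ← ENNReal.ofReal_mul (by norm_num)]
            refine mul_le_mul_left (ENNReal.ofReal_le_ofReal ?_) _
            rw [← mul_assoc]
            gcongr
            linarith
    · filter_upwards [hv₀] with ξ h1 h2
      exact h1 fun h => h2 h.2
    · filter_upwards [hv s] with ξ h1 h2
      exact h1 fun h => h2 h.2
    · refine hbound'.trans (mul_le_mul_left (ENNReal.ofReal_le_ofReal ?_) _)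
      refine mul_le_mul_of_nonneg_right ?_ (inv_nonneg.2 hα0.le)
      linarith
    · filter_upwards [hud, hrep] with z h1 h2
      rw [h1, h2]
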